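/- All functions and distributions are real-valued, $2\pi$-periodic in $x$ and of mean zero, $u=\sum_{n\neq 0}\hat u(n)e^{inx}$ with $\hat u(-n)=\overline{\hat u(n)}$; $H^s$ ($s\in\mathbb R$) is the corresponding Sobolev space, with $\|u\|_{H^s}^2=\sum_n(1+n^2)^s|\hat u(n)|^2$. Let $\mathcal H$ be the Hilbert transform, with symbol $-i\,\mathrm{sgn}(n)$, and let $\pi_N$ be the projector on the modes $|n|\le N$. Fix a normalization constant $\kappa>0$ and write $\int f=\kappa\int_0^{2\pi}f(x)\,dx$, $\|u\|_{L^2}^2=\int u^2$ and $\|u\|_{\dot H^s}^2=2\pi\kappa\sum_n|n|^{2s}|\hat u(n)|^2$. Let $\mu_1$ be the Gaussian measure given by the law of the random series $\sum_{n\ne 0}\frac{g_n}{|n|}e^{inx}$, where $g_{-n}=\overline{g_n}$ and $(g_n)_{n>0}$ are independent centered (circular) complex Gaussians with $\mathbb E|g_n|^2=\frac1{4\pi\kappa}$, so that formally $d\mu_1=Z^{-1}e^{-\|u\|_{\dot H^1}^2}du$. (For $\kappa=\frac1{4\pi}$ the $g_n$ are standard, $\mathbb E|g_n|^2=1$; for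 $\kappa=1$ the integral is the usual one.) For every $\epsilon\in(0,1)$ let $\psi_\epsilon:\mathbb R\to\mathbb R$ be a smooth even function with $\psi_\epsilon=1$ on $[0,1-\epsilon]$, $\psi_\epsilon(x)=0$ for $x>1$ and $\|\psi_\epsilon\|_{L^\infty}=1$, and let $S_N^\epsilon$ be the Fourier multiplier with symbol $\psi_\epsilon(n/N)$. Let $\Phi_N^\epsilon(t)$, $t\in\mathbb R$, be the flow of $$\partial_tu+\mathcal H\partial_x^2u+S_N^\epsilon\big(S_N^\epsilon u\cdot \partial_xS_N^\epsilon u\big)=0 .$$ Let $\chi:\mathbb R\to\mathbb R$ be smooth and compactly supported with $\chi(x)=1$ for $|x|<1$, put $\chi_R(x)=\chi(x/R)$, $\alpha_N=\sum_{n=1}^N\frac1n$, $$E_1(u)=\|u\|_{\dot H^1}^2+\tfrac34\int u^2\,\mathcal H\partial_xu+\tfrac18\int u^4$$ and $$F_{N,R}^\epsilon(u)=\chi_R\big(\|\pi_Nu\|_{L^2}\big)\,\chi_R\Big(\|\pi_Nu\|_{\dot H^{1/2}}^2-\alpha_N+\tfrac13\int(S_N^\epsilon u)^3\Big)\exp\Big(\|S_N^\epsilon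 u\|_{\dot H^1}^2-E_1(S_N^\epsilon u)\Big).$$ Proposition 6.1. Let $\sigma,R>0$ be fixed. Then for every $\delta>0$ there exist $\epsilon\in(0,1)$ and $N_0\in\mathbb N$ such that for every integer $N>N_0$, every Borel set $A\subset H^{1/2-\sigma}$ and every $t\in\mathbb R$, $$\Big|\int_AF_{N,R}^\epsilon\,d\mu_1-\int_{\Phi_N^\epsilon(t)A}F_{N,R}^\epsilon\,d\mu_1\Big|\le\delta|t| .$$ -/

import Mathlib

open MeasureTheory ProbabilityTheory Set
open scoped ContDiff ComplexConjugate

noncomputable section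

namespace BenjaminOno

/-! ### Sobolev spaces of real mean-zero distributions on the circle `ℝ / 2πℤ`

A periodic distribution is represented by the sequence of its Fourier coefficients,
`u = ∑ uₙ e^{inx}`. -/

/-- The sequence `c` is the sequence of Fourier coefficients of a real-valued distribution of mean
zero with finite `H^s` norm. -/
structure IsSobolev (s : ℝ) (c : ℤ → ℂ) : Prop where
  mean_zero : c 0 = 0
  real : ∀ n, c (-n) = conj (c n)
  summable : Summable fun n : ℤ => (1 + (n : ℝ) ^ 2) ^ s * ‖c n‖ ^ 2

/-- The space `H^s` of real-valued mean-zero distributions on the circle, for any real `s`. -/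
structure Sobolev (s : ℝ) where
  /-- The Fourier coefficients. -/
  coeff : ℤ → ℂ
  isSobolev : IsSobolev s coeff

theorem weight_pos (s : ℝ) (n : ℤ) : 0 < (1 + (n : ℝ) ^ 2) ^ (s / 2) :=
  Real.rpow_pos_of_pos (by positivity) _

/-- The isometric embedding `u ↦ ((1 + n²)^{s/2} uₙ)ₙ` of `H^s` into `ℓ²`. -/
def Sobolev.toL2 {s : ℝ} (u : Sobolev s) : lp (fun _ : ℤ => ℂ) 2 :=
  ⟨fun n => (((1 + (n : ℝ) ^ 2) ^ (s / 2) : ℝ) : ℂ) * u.coeff n, by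
    refine memℓp_gen ?_
    refine u.isSobolev.summable.congr fun n => ?_
    have h : (0 : ℝ) ≤ 1 + (n : ℝ) ^ 2 := by positivity
    simp only [ENNReal.toReal_ofNat, Real.rpow_ofNat]
    rw [norm_mul, mul_pow, Complex.norm_real, Real.norm_of_nonneg (weight_pos s n).le,
      ← Real.rpow_natCast ((1 + (n : ℝ) ^ 2) ^ (s / 2)) 2, ← Real.rpow_mul h]
    norm_num⟩

theorem Sobolev.toL2_injective (s : ℝ) : Function.Injective (Sobolev.toL2 (s := s)) := by
  rintro ⟨c, hc⟩ ⟨d, hd⟩ h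
  have h' : c = d := by
    funext n
    have hn := congrFun (congrArg Subtype.val h) n
    exact mul_left_cancel₀ (Complex.ofReal_ne_zero.mpr (weight_pos s n).ne') hn
  subst h'
  rfl

/-- The distance `‖u - v‖_{H^s} = (∑ (1 + n²)^s |uₙ - vₙ|²)^{1/2}`. -/
instance (s : ℝ) : MetricSpace (Sobolev s) :=
  MetricSpace.induced Sobolev.toL2 (Sobolev.toL2_injective s) inferInstance

/-- The Borel sets of `H^s`. -/
instance (s : ℝ) : MeasurableSpace (Sobolev s) := borel (Sobolev s)

instance (s : ℝ) : BorelSpace (Sobolev s) := ⟨rfl⟩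

theorem isSobolev_zero (s : ℝ) : IsSobolev s 0 :=
  ⟨rfl, fun _ => by simp, by simp⟩

instance (s : ℝ) : Zero (Sobolev s) := ⟨⟨0, isSobolev_zero s⟩⟩

/-! ### Fourier multipliers -/

/-- The real-valued function with Fourier coefficients `c`; only used for sequences `c` of finite
support with `c (-n) = conj (c n)`, for which the sum is finite and real. -/
def toFun (c : ℤ → ℂ) (x : ℝ) : ℝ :=
  (∑' n : ℤ, c n * Complex.exp (Complex.I * n * x)).re

/-- The `n`-th Fourier coefficient of a `2π`-periodic function. -/
def fourierCoef (f : ℝ → ℝ) (n : ℤ) : ℂ :=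
  (2 * Real.pi : ℂ)⁻¹ *
    ∫ x in (0 : ℝ)..(2 * Real.pi), (f x : ℂ) * Complex.exp (-(Complex.I * n * x))

/-- The derivative `∂ₓ`. -/
def dx (c : ℤ → ℂ) (n : ℤ) : ℂ := Complex.I * n * c n

/-- The Hilbert transform `𝓗`, with symbol `-i sgn n`, so that `𝓗 ∂ₓ = |∂ₓ|`. -/
def hilbert (c : ℤ → ℂ) (n : ℤ) : ℂ := -Complex.I * (n.sign : ℂ) * c n

/-- The sharp projector `π_N` on the modes `|n| ≤ N`. -/
def sharpProj (N : ℕ) (c : ℤ → ℂ) (n : ℤ) : ℂ := if |n| ≤ (N : ℤ) then c n else 0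

/-- The smoothed projector `S_N` with symbol `ψ (n / N)`. -/
def smoothProj (ψ : ℝ → ℝ) (N : ℕ) (c : ℤ → ℂ) (n : ℤ) : ℂ := (ψ ((n : ℝ) / N) : ℂ) * c n

/-- The conditions on the profile `ψ_ε` of the smoothed projector. As `ψ 0 = 1`, the last field
says that the sup norm of `ψ` is equal to `1`. -/
structure IsProfile (ε : ℝ) (ψ : ℝ → ℝ) : Prop where
  smooth : ContDiff ℝ ∞ ψ
  eq_one : ∀ x ∈ Icc 0 (1 - ε), ψ x = 1
  eq_zero : ∀ x, 1 < x → ψ x = 0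
  even : ∀ x, ψ x = ψ |x|
  abs_le_one : ∀ x, |ψ x| ≤ 1

/-! ### The approximate flow -/

/-- `u` is a global solution, continuous with values in `H^s`, of
`∂ₜ u + 𝓗 ∂ₓ² u + S_N (S_N u · ∂ₓ S_N u) = 0`.
The equation holds in the sense of distributions in `x`: it is tested against every `e^{inx}`. -/
structure IsSolution (ψ : ℝ → ℝ) (N : ℕ) {s : ℝ} (u : ℝ → Sobolev s) : Prop where
  continuous : Continuous u
  equation : ∀ (n : ℤ) (t : ℝ),
    HasDerivAt (fun τ => (u τ).coeff n)
      (-(hilbert (dx (dx (u t).coeff)) n)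
        - smoothProj ψ N (fourierCoef fun x =>
            toFun (smoothProj ψ N (u t).coeff) x * toFun (dx (smoothProj ψ N (u t).coeff)) x) n) t

/-- The image `Φ_N(t) A` of `A` under the flow at time `t`: the values at time `t` of the solutions
that start in `A` at time `0`. -/
def flowImage (ψ : ℝ → ℝ) (N : ℕ) {s : ℝ} (t : ℝ) (A : Set (Sobolev s)) : Set (Sobolev s) :=
  {v | ∃ u : ℝ → Sobolev s, IsSolution ψ N u ∧ u 0 ∈ A ∧ u t = v}

/-! ### Energies and densities

The number `κ > 0` fixes the normalization of the integral over the circle: `κ = 1` gives the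
Lebesgue measure on `[0, 2π]`, and `κ = 1 / (2π)` the normalized one. -/

/-- The integral over the circle, with respect to `κ dx`. -/
def torusIntegral (κ : ℝ) (f : ℝ → ℝ) : ℝ := κ * ∫ x in (0 : ℝ)..(2 * Real.pi), f x

/-- The squared norm of `Ḣ^s`, that is the integral of `||∂ₓ|^s u|²`, by Parseval; only used for
sequences of finite support. -/
def homNormSq (κ s : ℝ) (c : ℤ → ℂ) : ℝ :=
  2 * Real.pi * κ * ∑' n : ℤ, |(n : ℝ)| ^ (2 * s) * ‖c n‖ ^ 2

/-- The conserved energy `E₁(u) = ‖u‖²_{Ḣ¹} + 3/4 ∫ u² 𝓗∂ₓu + 1/8 ∫ u⁴`. -/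
def energyOne (κ : ℝ) (c : ℤ → ℂ) : ℝ :=
  homNormSq κ 1 c
    + 3 / 4 * torusIntegral κ (fun x => toFun c x ^ 2 * toFun (hilbert (dx c)) x)
    + 1 / 8 * torusIntegral κ (fun x => toFun c x ^ 4)

/-- The renormalization constant `α_N = ∑_{n=1}^N 1/n`, which is the mean of
`‖π_N u‖²_{Ḣ^{1/2}}` under the Gaussian measure `gaussianMeasure κ s` below. -/
def renorm (N : ℕ) : ℝ := ∑ n ∈ Finset.Icc 1 N, 1 / (n : ℝ)

/-- The density `F_{N,R}`, where `χ_R x = χ (x / R)`. -/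
def density (κ : ℝ) (χ ψ : ℝ → ℝ) (N : ℕ) (R : ℝ) (c : ℤ → ℂ) : ℝ :=
  χ (Real.sqrt (torusIntegral κ fun x => toFun (sharpProj N c) x ^ 2) / R)
    * χ ((homNormSq κ (1 / 2) (sharpProj N c) - renorm N
        + 1 / 3 * torusIntegral κ (fun x => toFun (smoothProj ψ N c) x ^ 3)) / R)
    * Real.exp (homNormSq κ 1 (smoothProj ψ N c) - energyOne κ (smoothProj ψ N c))

/-! ### The Gaussian measure -/

/-- The sample space: the entry `n ≥ 1` carries the real and imaginary parts of `gₙ` (the entry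
`0` is not used). -/
abbrev Sample : Type := ℕ → ℝ × ℝ

/-- The law on the sample space: the real and imaginary parts of all `gₙ`, `n ≥ 1`, are independent
centered real Gaussians of variance `1 / (8πκ)`, so that `𝔼|gₙ|² = 1 / (4πκ)`. -/
def sampleLaw (κ : ℝ) : Measure Sample :=
  Measure.infinitePi fun _ : ℕ =>
    (gaussianReal 0 (Real.toNNReal (1 / (8 * Real.pi * κ)))).prod
      (gaussianReal 0 (Real.toNNReal (1 / (8 * Real.pi * κ))))

/-- The Fourier coefficients of the random series `∑_{n ≠ 0} gₙ / |n| e^{inx}`, with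
`g_{-n} = conj gₙ`. -/
def seriesCoeff (g : Sample) (n : ℤ) : ℂ :=
  if 0 < n then (⟨(g n.natAbs).1, (g n.natAbs).2⟩ : ℂ) / (n.natAbs : ℂ)
  else if n < 0 then conj (⟨(g n.natAbs).1, (g n.natAbs).2⟩ : ℂ) / (n.natAbs : ℂ)
  else 0

open Classical in
/-- The random series as an element of `H^s`; for `s < 1/2` it lies in `H^s` almost surely. -/
def randomSeries (s : ℝ) (g : Sample) : Sobolev s :=
  if h : IsSobolev s (seriesCoeff g) then ⟨seriesCoeff g, h⟩ else 0

/-- The Gaussian measure `μ₁` on `H^s`: the law of the random series. -/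
def gaussianMeasure (κ s : ℝ) : Measure (Sobolev s) := (sampleLaw κ).map (randomSeries s)

end BenjaminOno

end

/-! On the modes `|n| ≤ N` the truncated equation is an ordinary differential equation, and each
mode above `N` only rotates, by `exp(-i n |n| t)`. The field on the low modes has divergence zero
and conserves the L² norm, whose sublevel sets are bounded there; so its flow is global and
preserves Lebesgue measure (`exists_volumePreserving_flow`). It also conserves `‖π_N u‖²_{Ḣ^{1/2}} +
1/3 ∫ (S_N u)³`, so both cutoffs in the density are constants of the motion. With `v = S_N u`, the
Gaussian weight `exp(-‖π_N u‖²_{Ḣ¹})` times the density is the product of the cutoffs and `exp(-E)`,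
where `E = ‖π_N u‖²_{Ḣ¹} + 3/4 ∫ v² |∂|v + 1/8 ∫ v⁴`. Invariance therefore fails only through
`dE/dt`.

For the exact Benjamin-Ono equation this energy is conserved. The truncation replaces `v ∂v` by
`S_N²(v ∂v)`, and the same algebra leaves (`Trig.energy_identity`) the defect `∫ ∂(1 - S_N²)(v²) ·
(3/4 v|∂|v + 1/4 v³)`, which involves only frequencies of `v²` above `(1 - ε)N`. Differentiating the
transported density in time and changing variables back at each time bounds the difference of the
two integrals, for every set `A`, by `|t|` times a constant times the Gaussian expectation of `|F|
|defect|` (`abs_setIntegral_sub_le`). It remains to show that this expectation is `O(√ε)` once `N`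
is large (`exists_integral_density_mul_defect_le`). Three estimates enter.

The density is bounded in L⁴ uniformly in `N` (`exists_trigDensity_moment_le`). The quartic term of
the energy has a good sign, so the task is an exponential moment of the cubic term on the support of
the cutoffs. The part of the cubic term at frequencies at most `M` is bounded there by `C (log M)²`,
unless the frequencies above `M` contribute more than `1` to the quantities involved.
Hypercontractivity for cubic sums and a Chernoff bound for the lower tail of the renormalized norm
make the exceptional event so unlikely, as `M` runs through powers of two, that its probability
beats `exp(C (log M)²)`.

The quartic part of the defect has L² norm `O(ε)` (`exists_integral_quartic_le`). After
symmetrization the symbol of `v|∂|v` becomes `|c| + |d| - |c + d|`, which vanishes unless `c` and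
`d` have opposite signs; this confines the output frequency to about `εN` values on each side.
Configurations with pairs of opposite frequencies cancel by parity, and the other monomials are
almost orthogonal.

The quintic part is treated by Cauchy-Schwarz. The frequencies of `v²` above `(1 - ε)N` have
expected square norm `O(ε/N)`, those of `v³` are of size `1/N` in square norm
(`exists_integral_cubeRemainder_le`), and the derivative costs `N`, which gives `N · √(ε/N) · √(1/N)
= √ε`. -/

noncomputable section

namespace BenjaminOno

/-! ### Trigonometric polynomials as Laurent polynomials -/

/-- Complex trigonometric polynomials. -/
abbrev Trig : Type := LaurentPolynomial ℂ

namespace Trig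

theorem coeff_add' (p q : Trig) (n : ℤ) : (p + q).coeff n = p.coeff n + q.coeff n := by
  simp

theorem induction_single {M : Trig → Prop} (_h0 : M 0) (hadd : ∀ p q, M p → M q → M (p + q))
    (hs : ∀ n a, M (AddMonoidAlgebra.single n a)) (p : Trig) : M p := by
  induction p using LaurentPolynomial.induction_on' with
  | add p q hp hq => exact hadd p q hp hq
  | C_mul_T n a => rw [← LaurentPolynomial.single_eq_C_mul_T]; exact hs n a

theorem coeff_single (n : ℤ) (a : ℂ) (k : ℤ) :
    (AddMonoidAlgebra.single n a : Trig).coeff k = if n = k then a else 0 := by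
  rw [AddMonoidAlgebra.coeff_single, Finsupp.single_apply]

/-- The Fourier multiplier with symbol `m`. -/
def mult (m : ℤ → ℂ) : Trig →ₗ[ℂ] Trig where
  toFun p := .ofCoeff (Finsupp.onFinset p.coeff.support (fun n => m n * p.coeff n) fun n h => by
    simp only [Finsupp.mem_support_iff]
    exact right_ne_zero_of_mul h)
  map_add' p q := by
    ext n
    simp [mul_add]
  map_smul' a p := by
    ext n
    simp [mul_left_comm]

@[simp]
theorem coeff_mult (m : ℤ → ℂ) (p : Trig) (n : ℤ) : (mult m p).coeff n = m n * p.coeff n := rfl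

/-- The mean value of a trigonometric polynomial. -/
def mean : Trig →ₗ[ℂ] ℂ where
  toFun p := p.coeff 0
  map_add' p q := by simp
  map_smul' a p := by simp

theorem mean_apply (p : Trig) : mean p = p.coeff 0 := rfl

theorem mult_single (m : ℤ → ℂ) (n : ℤ) (a : ℂ) :
    mult m (AddMonoidAlgebra.single n a) = AddMonoidAlgebra.single n (m n * a) := by
  ext k
  rw [coeff_mult, coeff_single, coeff_single]
  split_ifs with h
  · rw [h]
  · rw [mul_zero]

theorem mult_mult (m m' : ℤ → ℂ) (p : Trig) :
    mult m (mult m' p) = mult (fun n => m n * m' n) p := by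
  ext n; simp [mul_assoc]

/-- The mean of a product pairs the frequency `n` of one factor with `-n` of the other, so a
multiplier moves across with its symbol reflected. Integration by parts and the symmetry of even
multipliers are both instances. -/
theorem mean_mult_mul (m : ℤ → ℂ) (p q : Trig) :
    mean (mult m p * q) = mean (p * mult (fun n => m (-n)) q) := by
  induction p using induction_single with
  | _h0 => simp
  | hadd p p' hp hp' => simp only [map_add, add_mul, hp, hp']
  | hs n a =>
    induction q using induction_single with
    | _h0 => simp
    | hadd q q' hq hq' => simp only [map_add, mul_add, hq, hq']
    | hs k b =>
      simp only [mult_single, AddMonoidAlgebra.single_mul_single, mean_apply]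
      rw [coeff_single, coeff_single]
      split_ifs with h
      · obtain rfl : k = -n := by omega
        rw [neg_neg]; ring
      · rfl

/-- A multiplier with odd symbol is antisymmetric. -/
theorem mean_mul_mult_self_of_odd {m : ℤ → ℂ} (hm : ∀ n, m (-n) = -m n) (p : Trig) :
    mean (p * mult m p) = 0 := by
  have h := mean_mult_mul m p p
  have h' : mult (fun n => m (-n)) p = -mult m p := by
    ext n; simp [hm]
  rw [h', mul_neg, map_neg, mul_comm] at h
  linear_combination h / 2

/-- The derivative `∂ₓ`. -/
def D : Trig →ₗ[ℂ] Trig := mult fun n => Complex.I * n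

theorem D_mul (p q : Trig) : D (p * q) = D p * q + p * D q := by
  induction p using induction_single with
  | _h0 => simp
  | hadd p p' hp hp' => simp only [map_add, add_mul, hp, hp']; ring
  | hs n a =>
    induction q using induction_single with
    | _h0 => simp
    | hadd q q' hq hq' => simp only [map_add, mul_add, hq, hq']; ring
    | hs k b =>
      simp only [D, mult_single, AddMonoidAlgebra.single_mul_single]
      rw [← AddMonoidAlgebra.single_add]
      congr 1; push_cast; ring

theorem mean_D (p : Trig) : mean (D p) = 0 := by simp [mean_apply, D]

theorem mean_D_mul (p q : Trig) : mean (D p * q) = -mean (p * D q) := by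
  have := mean_D (p * q)
  rw [D_mul, map_add] at this
  linear_combination this

/-- The convolution runs over any finite set containing the support of `p`, so that one set can
serve for a whole family of polynomials. -/
theorem coeff_mul_eq_sum (p q : Trig) (s : Finset ℤ) (hs : ∀ k, k ∉ s → p.coeff k = 0) (n : ℤ) :
    (p * q).coeff n = ∑ k ∈ s, p.coeff k * q.coeff (n - k) := by
  induction q using induction_single with
  | _h0 => simp
  | hadd q q' hq hq' => simp only [mul_add, coeff_add', hq, hq', Finset.sum_add_distrib]
  | hs j b =>
    have : (p * AddMonoidAlgebra.single j b).coeff n = p.coeff (n - j) * b := by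
      have := AddMonoidAlgebra.coeff_mul_single_eq_coeff_mul (x := p) (m := j) (m₁ := n) (r := b)
        (n - j) (by intro m' _; constructor <;> intro h <;> omega)
      exact this
    rw [this]
    by_cases h : n - j ∈ s
    · rw [Finset.sum_eq_single_of_mem _ h]
      · rw [coeff_single, if_pos (by omega)]
      · intro k _ hk
        rw [coeff_single, if_neg (by omega), mul_zero]
    · rw [hs _ h, zero_mul, Finset.sum_eq_zero]
      intro k hk
      have : ¬ j = n - k := by rintro rfl; apply h; simpa using hk
      rw [coeff_single, if_neg this, mul_zero]

/-- The value of a trigonometric polynomial at a point. -/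
def evalAt (x : ℝ) : Trig →ₐ[ℂ] ℂ :=
  AddMonoidAlgebra.lift ℂ ℂ ℤ
    { toFun := fun n => Complex.exp (Complex.I * (Multiplicative.toAdd n : ℤ) * x)
      map_one' := by simp
      map_mul' := fun a b => by
        rw [← Complex.exp_add]; congr 1; push_cast [toAdd_mul]; ring }

theorem evalAt_single (x : ℝ) (n : ℤ) (a : ℂ) :
    evalAt x (AddMonoidAlgebra.single n a) = a * Complex.exp (Complex.I * n * x) := by
  rw [evalAt, AddMonoidAlgebra.lift_single]; rfl

theorem continuous_evalAt (p : Trig) : Continuous fun x => evalAt x p := by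
  induction p using induction_single with
  | _h0 => simpa using continuous_const
  | hadd p q hp hq => simp only [map_add]; exact hp.add hq
  | hs n a => simp only [evalAt_single]; fun_prop

theorem integral_evalAt (p : Trig) :
    ∫ x in (0 : ℝ)..(2 * Real.pi), evalAt x p = 2 * Real.pi * mean p := by
  induction p using induction_single with
  | _h0 => simp
  | hadd p q hp hq =>
    simp only [map_add]
    rw [intervalIntegral.integral_add, hp, hq, mul_add]
    · exact (continuous_evalAt p).intervalIntegrable _ _
    · exact (continuous_evalAt q).intervalIntegrable _ _
  | hs n a =>
    simp only [evalAt_single, mean_apply, coeff_single]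
    rw [intervalIntegral.integral_const_mul]
    rcases eq_or_ne n 0 with h | h
    · subst h; simp; ring
    · have h1 : Complex.I * (n : ℂ) ≠ 0 := mul_ne_zero Complex.I_ne_zero (by exact_mod_cast h)
      rw [integral_exp_mul_complex h1]
      have : Complex.exp (Complex.I * n * ((2 * Real.pi : ℝ) : ℂ)) = 1 := by
        rw [Complex.exp_eq_one_iff]; exact ⟨n, by push_cast; ring⟩
      rw [this]
      simp [h]

/-- The trigonometric polynomial with the Fourier coefficients `c n`, `|n| ≤ N`. -/
def ofSeq (N : ℕ) (c : ℤ → ℂ) : Trig :=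
  ∑ n ∈ Finset.Icc (-(N : ℤ)) N, AddMonoidAlgebra.single n (c n)

theorem coeff_ofSeq (N : ℕ) (c : ℤ → ℂ) (n : ℤ) :
    (ofSeq N c).coeff n = if |n| ≤ (N : ℤ) then c n else 0 := by
  have : (ofSeq N c).coeff n
      = ∑ k ∈ Finset.Icc (-(N : ℤ)) N, (AddMonoidAlgebra.single k (c k) : Trig).coeff n := by
    rw [ofSeq, AddMonoidAlgebra.coeff_sum, Finsupp.finsetSum_apply]
  rw [this]
  simp only [coeff_single, Finset.sum_ite_eq',
    Finset.mem_Icc, abs_le]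

theorem evalAt_ofSeq (N : ℕ) (c : ℤ → ℂ) (x : ℝ) :
    evalAt x (ofSeq N c)
      = ∑ n ∈ Finset.Icc (-(N : ℤ)) N, c n * Complex.exp (Complex.I * n * x) := by
  simp only [ofSeq, map_sum, evalAt_single]

/-- A trigonometric polynomial is real if its coefficients are hermitian. -/
def IsReal (p : Trig) : Prop := ∀ n, p.coeff (-n) = conj (p.coeff n)

theorem conj_evalAt {p : Trig} (hp : IsReal p) (x : ℝ) : conj (evalAt x p) = evalAt x p := by
  obtain ⟨N, hN⟩ : ∃ N : ℕ, ofSeq N p.coeff = p := by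
    refine ⟨p.coeff.support.sup Int.natAbs, ?_⟩
    ext n
    rw [coeff_ofSeq]
    split_ifs with h
    · rfl
    · by_contra h0
      have := Finset.le_sup (f := Int.natAbs) (Finsupp.mem_support_iff.mpr (Ne.symm h0))
      rw [Int.abs_eq_natAbs] at h; omega
  rw [← hN, evalAt_ofSeq, map_sum]
  refine Finset.sum_nbij' (fun n => -n) (fun n => -n) ?_ ?_ ?_ ?_ ?_
  · intro a; simp only [Finset.mem_Icc]; omega
  · intro a; simp only [Finset.mem_Icc]; omega
  · simp
  · simp
  · intro n _
    rw [hp n, map_mul, ← Complex.exp_conj]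
    simp

theorem ofReal_re_evalAt {p : Trig} (hp : IsReal p) (x : ℝ) :
    ((evalAt x p).re : ℂ) = evalAt x p :=
  Complex.conj_eq_iff_re.mp (conj_evalAt hp x)

theorem toFun_eq {N : ℕ} {c : ℤ → ℂ} (hc : ∀ n : ℤ, (N : ℤ) < |n| → c n = 0) (x : ℝ) :
    toFun c x = (evalAt x (ofSeq N c)).re := by
  rw [toFun, evalAt_ofSeq, tsum_eq_sum]
  intro n hn
  rw [hc, zero_mul]
  by_contra h
  exact hn (by rw [Finset.mem_Icc, ← abs_le]; omega)

theorem isReal_ofSeq {N : ℕ} {c : ℤ → ℂ} (hc : ∀ n, c (-n) = conj (c n)) : IsReal (ofSeq N c) := by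
  intro n
  rw [coeff_ofSeq, coeff_ofSeq, abs_neg]
  split_ifs
  · exact hc n
  · simp

theorem IsReal.mul {p q : Trig} (hp : IsReal p) (hq : IsReal q) : IsReal (p * q) := by
  intro n
  have h1 := coeff_mul_eq_sum p q p.coeff.support (fun k hk => by simpa using hk) n
  have h2 := coeff_mul_eq_sum p q (p.coeff.support.image fun k => -k) (fun k hk => by
    by_contra h
    apply hk
    rw [Finset.mem_image]
    refine ⟨-k, ?_, by simp⟩
    rw [Finsupp.mem_support_iff, hp k]
    simpa using h) (-n)
  rw [h2, h1, map_sum, Finset.sum_image (by intro a _ b _ h; simpa using h)]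
  refine Finset.sum_congr rfl fun k _ => ?_
  rw [map_mul, ← hp k, ← hq (n - k)]
  congr 2; ring

theorem IsReal.mult {p : Trig} (hp : IsReal p) {m : ℤ → ℂ} (hm : ∀ n, m (-n) = conj (m n)) :
    IsReal (mult m p) := by
  intro n; simp [hp n, hm n]

theorem IsReal.sub {p q : Trig} (hp : IsReal p) (hq : IsReal q) : IsReal (p - q) := by
  intro n; simp [hp n, hq n]

/-- Integrals of real trigonometric polynomials are their means. -/
theorem torusIntegral_eq (κ : ℝ) {f : ℝ → ℝ} {p : Trig} (h : ∀ x, f x = (evalAt x p).re) :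
    torusIntegral κ f = 2 * Real.pi * κ * (mean p).re := by
  have : ∫ x in (0 : ℝ)..(2 * Real.pi), f x = (∫ x in (0 : ℝ)..(2 * Real.pi), evalAt x p).re := by
    have h1 := Complex.reCLM.intervalIntegral_comp_comm
      ((continuous_evalAt p).intervalIntegrable (μ := volume) 0 (2 * Real.pi))
    simp only [Complex.reCLM_apply] at h1
    rw [← h1]
    simp only [h]
  rw [torusIntegral, this, integral_evalAt]
  have : (2 * (Real.pi : ℂ) * mean p).re = 2 * Real.pi * (mean p).re := by
    rw [← Complex.ofReal_ofNat, ← Complex.ofReal_mul, Complex.re_ofReal_mul]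
  rw [this]; ring

theorem evalAt_re_mul {p q : Trig} (hp : IsReal p) (x : ℝ) :
    (evalAt x (p * q)).re = (evalAt x p).re * (evalAt x q).re := by
  rw [map_mul, ← ofReal_re_evalAt hp, Complex.re_ofReal_mul, Complex.ofReal_re]

theorem evalAt_re_pow {p : Trig} (hp : IsReal p) (k : ℕ) (x : ℝ) :
    (evalAt x (p ^ k)).re = (evalAt x p).re ^ k := by
  rw [map_pow, ← ofReal_re_evalAt hp, ← Complex.ofReal_pow, Complex.ofReal_re, Complex.ofReal_re]

/-- Parseval's identity. -/
theorem mean_sq_of_isReal {p : Trig} (hp : IsReal p) (s : Finset ℤ)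
    (hs : ∀ k, k ∉ s → p.coeff k = 0) : mean (p ^ 2) = ((∑ n ∈ s, ‖p.coeff n‖ ^ 2 : ℝ) : ℂ) := by
  rw [sq, mean_apply, coeff_mul_eq_sum p p s hs 0]
  push_cast
  refine Finset.sum_congr rfl fun n _ => ?_
  rw [zero_sub, hp n, Complex.mul_conj, Complex.normSq_eq_norm_sq]
  push_cast; rfl

end Trig

end BenjaminOno

/-! ### Operators of the equation and the algebra of its conservation laws -/

namespace BenjaminOno

namespace Trig

/-- The operator `|∂ₓ|`. -/
def absD : Trig →ₗ[ℂ] Trig := mult fun n => ((|n| : ℤ) : ℂ)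

/-- The operator `𝓗 ∂ₓ² = ∂ₓ |∂ₓ|`. -/
def disp : Trig →ₗ[ℂ] Trig := mult fun n => Complex.I * n * ((|n| : ℤ) : ℂ)

theorem disp_eq (p : Trig) : disp p = D (absD p) := by
  simp only [disp, D, absD, mult_mult]

theorem mult_comm (m m' : ℤ → ℂ) (p : Trig) : mult m (mult m' p) = mult m' (mult m p) := by
  simp only [mult_mult, mul_comm]

theorem mean_mult_mul_of_even {m : ℤ → ℂ} (hm : ∀ n, m (-n) = m n) (p q : Trig) :
    mean (mult m p * q) = mean (p * mult m q) := by
  rw [mean_mult_mul]; simp only [hm]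

/-- The projection on the positive modes. -/
def pos : Trig →ₗ[ℂ] Trig := mult fun n => if 0 < n then 1 else 0

/-- The projection on the negative modes. -/
def neg : Trig →ₗ[ℂ] Trig := mult fun n => if n < 0 then 1 else 0

theorem pos_add_neg {p : Trig} (hp : p.coeff 0 = 0) : pos p + neg p = p := by
  ext n
  rw [coeff_add', pos, neg, coeff_mult, coeff_mult]
  rcases lt_trichotomy n 0 with h | h | h
  · rw [if_neg (by omega), if_pos h]; ring
  · subst h; simp [hp]
  · rw [if_neg (by omega : ¬ n < 0), if_pos h]; ring

theorem coeff_mul_of_pos {p q : Trig} (hp : ∀ n ≤ 0, p.coeff n = 0) (hq : ∀ n ≤ 0, q.coeff n = 0) :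
    ∀ n ≤ 0, (p * q).coeff n = 0 := by
  intro n hn
  rw [coeff_mul_eq_sum p q p.coeff.support (fun k hk => by simpa using hk)]
  refine Finset.sum_eq_zero fun k _ => ?_
  rcases le_or_gt k 0 with h | h
  · rw [hp k h, zero_mul]
  · rw [hq (n - k) (by omega), mul_zero]

theorem coeff_mul_of_neg {p q : Trig} (hp : ∀ n, 0 ≤ n → p.coeff n = 0)
    (hq : ∀ n, 0 ≤ n → q.coeff n = 0) : ∀ n, 0 ≤ n → (p * q).coeff n = 0 := by
  intro n hn
  rw [coeff_mul_eq_sum p q p.coeff.support (fun k hk => by simpa using hk)]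
  refine Finset.sum_eq_zero fun k _ => ?_
  rcases le_or_gt 0 k with h | h
  · rw [hp k h, zero_mul]
  · rw [hq (n - k) (by omega), mul_zero]

theorem coeff_pos_of_nonpos (p : Trig) : ∀ n ≤ 0, (pos p).coeff n = 0 := by
  intro n hn; rw [pos, coeff_mult, if_neg (by omega), zero_mul]

theorem coeff_neg_of_nonneg (p : Trig) : ∀ n, 0 ≤ n → (neg p).coeff n = 0 := by
  intro n hn; rw [neg, coeff_mult, if_neg (by omega), zero_mul]

/-- Frequencies of one sign never sum to zero, so there is no resonance inside one half of the
spectrum. This is the source of the cubic identities for the Hilbert transform. -/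
theorem mean_pos_cube (p : Trig) : mean (pos p * pos p * pos p) = 0 :=
  coeff_mul_of_pos (coeff_mul_of_pos (coeff_pos_of_nonpos p) (coeff_pos_of_nonpos p))
    (coeff_pos_of_nonpos p) 0 le_rfl

theorem mean_neg_cube (p : Trig) : mean (neg p * neg p * neg p) = 0 :=
  coeff_mul_of_neg (coeff_mul_of_neg (coeff_neg_of_nonneg p) (coeff_neg_of_nonneg p))
    (coeff_neg_of_nonneg p) 0 le_rfl

/-- On positive modes `|n|` is `-i` times the symbol `i n` of `D`, on negative modes `i` times it.
-/
theorem absD_eq (p : Trig) : absD p = -Complex.I • (pos (D p) - neg (D p)) := by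
  ext n
  have : (-Complex.I • (pos (D p) - neg (D p))).coeff n
    = -Complex.I * ((pos (D p)).coeff n - (neg (D p)).coeff n) := by simp
  rw [this]
  simp only [absD, pos, neg, D, coeff_mult]
  have hI := Complex.I_mul_I
  rcases lt_trichotomy n 0 with h | h | h
  · rw [if_neg (by omega), if_pos h, abs_of_neg h]; push_cast
    linear_combination (-(n : ℂ) * p.coeff n) * hI
  · subst h; simp
  · rw [if_neg (by omega : ¬ n < 0), if_pos h, abs_of_pos h]
    linear_combination ((n : ℂ) * p.coeff n) * hI

/-- The identity `3 ∫ f (𝓗 f)² = ∫ f³` for `f = ∂ₓ p`. -/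
theorem three_mean_D_mul_absD_sq (p : Trig) :
    3 * mean (D p * absD p * absD p) = mean (D p * D p * D p) := by
  have h0 : (D p).coeff 0 = 0 := mean_D p
  set a := pos (D p) with ha
  set b := neg (D p) with hb
  have hf : D p = a + b := (pos_add_neg h0).symm
  have h1 : absD p * absD p = -((a - b) * (a - b)) := by
    rw [absD_eq, smul_mul_smul_comm]
    simp only [← ha, ← hb, neg_mul_neg, Complex.I_mul_I, neg_one_smul]
  -- In terms of the halves `a`, `b` the two integrands are `(a + b)³` and `-(a + b)(a - b)²`. Once
  -- the pure cubes drop out, both are multiples of `a²b + ab²`, with ratio three.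
  have ha3 : mean (a * a * a) = 0 := mean_pos_cube _
  have hb3 : mean (b * b * b) = 0 := mean_neg_cube _
  have e1 : D p * absD p * absD p = -(a * a * a) - b * b * b + (a * a * b + a * b * b) := by
    rw [mul_assoc, h1, hf]; ring
  have e2 : D p * D p * D p = a * a * a + b * b * b + ((a * a * b + a * b * b)
    + (a * a * b + a * b * b) + (a * a * b + a * b * b)) := by
    rw [hf]; ring
  rw [e1, e2]
  simp only [map_add, map_sub, map_neg, ha3, hb3]
  ring

/-! ### The truncated vector field -/

variable (ψ : ℝ → ℝ) (N : ℕ)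

/-- The smoothed projector. -/
def proj : Trig →ₗ[ℂ] Trig := mult fun n => (ψ ((n : ℝ) / N) : ℂ)

/-- The multiplier `1 - S_N²`. -/
def coproj : Trig →ₗ[ℂ] Trig := mult fun n => 1 - (ψ ((n : ℝ) / N) : ℂ) ^ 2

/-- The right-hand side of the truncated equation. -/
def field (p : Trig) : Trig := -disp p - proj ψ N (proj ψ N p * D (proj ψ N p))

/-- The defect of conservation of the energy `E₁`. -/
def defect (v : Trig) : ℂ :=
  mean (D (coproj ψ N (v * v)) * ((3 / 4 : ℂ) • (v * absD v) + (1 / 4 : ℂ) • (v * v * v)))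

variable {ψ N}

theorem mul_D_self (v : Trig) : v * D v = (1 / 2 : ℂ) • D (v * v) := by
  rw [D_mul, mul_comm (D v) v, ← two_smul ℂ, smul_smul]; norm_num

theorem mean_mul_disp_self (p : Trig) : mean (p * disp p) = 0 :=
  mean_mul_mult_self_of_odd (by intro n; simp) p

theorem mean_D_mul_absD_self (p : Trig) : mean (D p * absD p) = 0 := by
  rw [mean_D_mul, ← disp_eq, mean_mul_disp_self, neg_zero]

theorem mean_mul_D_self (p : Trig) : mean (p * D p) = 0 :=
  mean_mul_mult_self_of_odd (by intro n; simp) p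

theorem proj_D (p : Trig) : proj ψ N (D p) = D (proj ψ N p) := mult_comm _ _ p

theorem proj_absD (p : Trig) : proj ψ N (absD p) = absD (proj ψ N p) := mult_comm _ _ p

theorem proj_disp (p : Trig) : proj ψ N (disp p) = disp (proj ψ N p) := mult_comm _ _ p

theorem even_symbol (hψ : ∀ x, ψ x = ψ |x|) (n : ℤ) :
    ψ (((-n : ℤ) : ℝ) / N) = ψ ((n : ℝ) / N) := by
  rw [hψ, hψ ((n : ℝ) / N)]
  congr 1
  push_cast
  rw [neg_div, abs_neg]

theorem mean_proj_mul (hψ : ∀ x, ψ x = ψ |x|) (p q : Trig) :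
    mean (proj ψ N p * q) = mean (p * proj ψ N q) :=
  mean_mult_mul_of_even (fun n => by rw [even_symbol hψ]) p q

theorem mean_absD_mul (p q : Trig) : mean (absD p * q) = mean (p * absD q) :=
  mean_mult_mul_of_even (fun n => by rw [abs_neg]) p q

/-- Conservation of the `L²` norm. -/
theorem mean_mul_field (hψ : ∀ x, ψ x = ψ |x|) (p : Trig) : mean (p * field ψ N p) = 0 := by
  have h : mean (proj ψ N p * proj ψ N p * D (proj ψ N p)) = 0 := by
    set v := proj ψ N p
    have := mean_D (v * v * v)
    have e : D (v * v * v) = v * v * D v + v * v * D v + v * v * D v := by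
      simp only [D_mul]; ring
    rw [e] at this
    simp only [map_add] at this
    linear_combination this / 3
  rw [field, mul_sub, mul_neg, map_sub, map_neg, mean_mul_disp_self, ← mean_proj_mul hψ,
    ← mul_assoc, h]
  simp

/-- Conservation of the Hamiltonian. -/
theorem hamiltonian_identity (hψ : ∀ x, ψ x = ψ |x|) (p : Trig) :
    2 * mean (absD p * field ψ N p)
      + mean (proj ψ N p * proj ψ N p * proj ψ N (field ψ N p)) = 0 := by
  set v := proj ψ N p with hv
  have h1 : mean (absD p * disp p) = 0 := by rw [disp_eq]; exact mean_mul_D_self _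
  -- The nonlinear contribution to the quadratic part is, up to sign, the dispersive contribution to
  -- the cubic part; these are the only surviving terms and they cancel.
  have h2 : mean (absD p * proj ψ N (v * D v)) = -(1 / 2) * mean (v * v * disp v) := by
    rw [← mean_proj_mul hψ, proj_absD, ← hv, mul_D_self, mul_smul_comm, map_smul, smul_eq_mul,
      mul_comm (absD v), mean_D_mul, disp_eq]
    ring
  -- Giving one projector to each factor leaves `S_N(v²)` against half of its own derivative.
  have h3 : mean (v * v * proj ψ N (proj ψ N (v * D v))) = 0 := by
    rw [← mean_proj_mul hψ, mul_D_self, map_smul, proj_D, mul_smul_comm, map_smul, mean_mul_D_self,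
      smul_zero]
  have h4 : proj ψ N (field ψ N p) = -disp v - proj ψ N (proj ψ N (v * D v)) := by
    rw [field, map_sub, map_neg, proj_disp]
  rw [h4, field, mul_sub, mul_sub, mul_neg, mul_neg, map_sub, map_sub, map_neg, map_neg, h1,
    ← hv, h2, h3]
  ring

/-- The derivative of the energy along the truncated flow. -/
theorem energy_identity (hψ : ∀ x, ψ x = ψ |x|) (p : Trig) :
    2 * mean (D p * D (field ψ N p))
      + 3 / 4 * (2 * mean (proj ψ N p * proj ψ N (field ψ N p) * absD (proj ψ N p))
        + mean (proj ψ N p * proj ψ N p * absD (proj ψ N (field ψ N p))))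
      + 1 / 2 * mean (proj ψ N p * proj ψ N p * proj ψ N p * proj ψ N (field ψ N p))
      = defect ψ N (proj ψ N p) := by
  set v := proj ψ N p with hv
  -- Since `v ∂v = 1/2 ∂(v²)`, the projected field is the exact Benjamin-Ono field at `v` plus the
  -- error `1/2 ∂(1 - S_N²)(v²)`. The terms of the exact field cancel as they do for the full
  -- equation, and the error produces the defect.
  have h4 : proj ψ N (field ψ N p)
      = -disp v - v * D v + (1 / 2 : ℂ) • D (coproj ψ N (v * v)) := by
    have : proj ψ N (proj ψ N (v * D v)) = v * D v - (1 / 2 : ℂ) • D (coproj ψ N (v * v)) := by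
      rw [mul_D_self, map_smul, map_smul, proj_D, proj_D, ← smul_sub, ← map_sub]
      congr 2
      ext n
      have : (v * v - coproj ψ N (v * v)).coeff n
        = (v * v).coeff n - (coproj ψ N (v * v)).coeff n := by simp
      rw [this]
      simp only [proj, coproj, coeff_mult]
      ring
    rw [field, map_sub, map_neg, proj_disp, this]
    abel
  set θ := coproj ψ N (v * v) with hθ
  have hS : ∀ w, 3 / 4 * (2 * mean (v * w * absD v) + mean (v * v * absD w))
      + 1 / 2 * mean (v * v * v * w)
      = 3 / 2 * mean (w * (v * absD v)) + 3 / 4 * mean (w * absD (v * v))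
        + 1 / 2 * mean (w * (v * v * v)) := by
    intro w
    have e1 : v * w * absD v = w * (v * absD v) := by ring
    have e2 : mean (v * v * absD w) = mean (w * absD (v * v)) := by
      rw [← mean_absD_mul, mul_comm]
    rw [e1, e2, mul_comm (v * v * v) w]; ring
  rw [add_assoc, hS, h4]
  have hd3 : mean (D (D v) * (v * D v)) = -(1 / 2) * mean (D v * D v * D v) := by
    have := mean_D (v * (D v * D v))
    have e : D (v * (D v * D v)) = D v * D v * D v
      + (D (D v) * (v * D v) + D (D v) * (v * D v)) := by
      simp only [D_mul]; ring
    rw [e] at this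
    simp only [map_add] at this
    linear_combination this / 2
  -- The quadratic energy is that of `p`, not of `v`; its dispersive part vanishes and the outer
  -- projector moves onto `D p`, so that only `v` remains.
  have hA : mean (D p * D (field ψ N p)) = -(1 / 2) * mean (D v * D v * D v) := by
    have e : D (field ψ N p) = -disp (D p) - proj ψ N (D (v * D v)) := by
      rw [field, map_sub, map_neg, proj_D, ← hv]
      congr 2; exact mult_comm _ _ p
    have e' : mean (D v * D (v * D v)) = 1 / 2 * mean (D v * D v * D v) := by
      rw [mul_comm, mean_D_mul, mul_comm, hd3]; ring
    rw [e, mul_sub, mul_neg, map_sub, map_neg, mean_mul_disp_self, ← mean_proj_mul hψ, proj_D,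
      ← hv, e']
    ring
  have hB1 : mean (disp v * (v * absD v)) = -(1 / 2) * mean (D v * absD v * absD v) := by
    have := mean_D (v * (absD v * absD v))
    have e : D (v * (absD v * absD v)) = D v * absD v * absD v
      + (disp v * (v * absD v) + disp v * (v * absD v)) := by
      rw [disp_eq]; simp only [D_mul]; ring
    rw [e] at this
    simp only [map_add] at this
    linear_combination this / 2
  have hB2 : mean (disp v * absD (v * v)) = -mean (D v * D v * D v) := by
    have e : absD (disp v) = -D (D (D v)) := by
      ext n
      have : (-D (D (D v))).coeff n = -(D (D (D v))).coeff n := by simp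
      rw [this]
      simp only [absD, disp, D, coeff_mult]
      have h : ((|n| : ℤ) : ℂ) * ((|n| : ℤ) : ℂ) = (n : ℂ) * n := by
        rw [← Int.cast_mul, abs_mul_abs_self, Int.cast_mul]
      linear_combination (Complex.I * n * v.coeff n) * h
        + (Complex.I * n * n * n * v.coeff n) * Complex.I_mul_I
    have e2 : D (v * v) = v * D v + v * D v := by rw [D_mul]; ring
    rw [← mean_absD_mul, e, neg_mul, map_neg, mean_D_mul, e2, mul_add, map_add, hd3]
    ring
  have hB3 : mean (disp v * (v * v * v)) = -3 * mean (D v * (v * v * absD v)) := by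
    have e : D (v * v * v) = v * v * D v + v * v * D v + v * v * D v := by
      simp only [D_mul]; ring
    have e' : absD v * (v * v * D v) = D v * (v * v * absD v) := by ring
    rw [disp_eq, mean_D_mul, e]
    simp only [mul_add, map_add, e']
    ring
  have hC1 : mean (v * D v * (v * absD v)) = mean (D v * (v * v * absD v)) := by
    congr 1; ring
  have hC2 : mean (v * D v * absD (v * v)) = 0 := by
    rw [mul_D_self, smul_mul_assoc, map_smul, mean_D_mul_absD_self, smul_zero]
  have hC3 : mean (v * D v * (v * v * v)) = 0 := by
    have := mean_D (v * v * v * v * v)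
    set w := v * D v * (v * v * v) with hw
    have e : D (v * v * v * v * v) = w + w + w + w + w := by
      rw [hw]; simp only [D_mul]; ring
    rw [e] at this
    simp only [map_add] at this
    linear_combination this / 5
  -- The form pairs `v²` with itself through a total symbol that is odd in `n`; this is why the
  -- defect has no term with `|∂|(v²)`.
  have hE2 : mean (D θ * absD (v * v)) = 0 := by
    have : mean (D θ * absD (v * v)) = mean ((v * v) * mult (fun n => -(1 - (ψ ((n : ℝ) / N) : ℂ) ^ 2)
        * (Complex.I * n) * ((|n| : ℤ) : ℂ)) (v * v)) := by
      rw [hθ, D, coproj, mult_mult, mean_mult_mul, absD, mult_mult]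
      congr 4
      funext n
      rw [even_symbol hψ]; push_cast; ring
    rw [this]
    refine mean_mul_mult_self_of_odd (fun n => ?_) _
    rw [even_symbol hψ, abs_neg]; push_cast; ring
  have h3 := three_mean_D_mul_absD_sq v
  have hdef : defect ψ N v = 3 / 4 * mean (D θ * (v * absD v)) + 1 / 4 * mean (D θ * (v * v * v)) := by
    rw [defect, mul_add, map_add, mul_smul_comm, mul_smul_comm, map_smul, map_smul]; rfl
  rw [hdef]
  simp only [add_mul, sub_mul, neg_mul, map_add, map_sub, map_neg, smul_mul_assoc, map_smul,
    smul_eq_mul, hA, hB1, hB2, hB3, hC1, hC2, hC3, hE2]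
  -- The terms cubic in `v` carry the coefficients `-1`, `3/4` and, on `∂v (|∂|v)²`, `3/4`; the last
  -- one equals `1/4` on `(∂v)³` by the identity for the Hilbert transform.
  linear_combination (1 / 4) * h3

/-! ### Derivatives of curves of trigonometric polynomials -/

/-- The curve `p` is supported in the modes `s` and its coefficients have the derivatives given by
`p'` at time `t`. -/
structure HasCoeffDeriv (s : Finset ℤ) (p : ℝ → Trig) (p' : Trig) (t : ℝ) : Prop where
  support : ∀ τ, ∀ k ∉ s, (p τ).coeff k = 0
  deriv : ∀ n, HasDerivAt (fun τ => (p τ).coeff n) (p'.coeff n) t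

theorem HasCoeffDeriv.support_deriv {s : Finset ℤ} {p : ℝ → Trig} {p' : Trig} {t : ℝ}
    (h : HasCoeffDeriv s p p' t) : ∀ k ∉ s, p'.coeff k = 0 := by
  intro k hk
  have h1 := h.deriv k
  simp only [fun τ => h.support τ k hk] at h1
  exact h1.unique (hasDerivAt_const t 0)

theorem HasCoeffDeriv.mul {s s' : Finset ℤ} {p q : ℝ → Trig} {p' q' : Trig} {t : ℝ}
    (hp : HasCoeffDeriv s p p' t) (hq : HasCoeffDeriv s' q q' t) :
    HasCoeffDeriv (Finset.image₂ (· + ·) s s') (fun τ => p τ * q τ) (p' * q t + p t * q') t := by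
  constructor
  · intro τ k hk
    rw [coeff_mul_eq_sum _ _ s (hp.support τ)]
    refine Finset.sum_eq_zero fun j hj => ?_
    rw [hq.support τ (k - j), mul_zero]
    intro h
    exact hk (Finset.mem_image₂.mpr ⟨j, hj, k - j, h, by simp⟩)
  · intro n
    simp only [fun τ => coeff_mul_eq_sum (p τ) (q τ) s (hp.support τ) n]
    rw [coeff_add', coeff_mul_eq_sum _ _ s hp.support_deriv, coeff_mul_eq_sum _ _ s (hp.support t),
      ← Finset.sum_add_distrib]
    exact HasDerivAt.fun_sum fun k _ => (hp.deriv k).mul (hq.deriv (n - k))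

theorem HasCoeffDeriv.mult {s : Finset ℤ} {p : ℝ → Trig} {p' : Trig} {t : ℝ}
    (hp : HasCoeffDeriv s p p' t) (m : ℤ → ℂ) :
    HasCoeffDeriv s (fun τ => mult m (p τ)) (mult m p') t := by
  constructor
  · intro τ k hk
    rw [coeff_mult, hp.support τ k hk, mul_zero]
  · intro n
    simp only [coeff_mult]
    exact (hp.deriv n).const_mul _

theorem HasCoeffDeriv.mean {s : Finset ℤ} {p : ℝ → Trig} {p' : Trig} {t : ℝ}
    (hp : HasCoeffDeriv s p p' t) : HasDerivAt (fun τ => mean (p τ)) (mean p') t :=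
  hp.deriv 0

variable {s : Finset ℤ} {p : ℝ → Trig} {t : ℝ}

theorem hasDerivAt_mean_sq (hψ : ∀ x, ψ x = ψ |x|)
    (hp : HasCoeffDeriv s p (field ψ N (p t)) t) :
    HasDerivAt (fun τ => Trig.mean (p τ * p τ)) 0 t := by
  have h := (hp.mul hp).mean
  rw [mul_comm (field ψ N (p t)), map_add, mean_mul_field hψ, add_zero] at h
  exact h

theorem hasDerivAt_hamiltonian (hψ : ∀ x, ψ x = ψ |x|)
    (hp : HasCoeffDeriv s p (field ψ N (p t)) t) :
    HasDerivAt (fun τ => Trig.mean (p τ * absD (p τ))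
      + 1 / 3 * Trig.mean (proj ψ N (p τ) * proj ψ N (p τ) * proj ψ N (p τ))) 0 t := by
  have hv : HasCoeffDeriv s (fun τ => proj ψ N (p τ)) (proj ψ N (field ψ N (p t))) t := hp.mult _
  have h1 := (hp.mul (hp.mult fun n => ((|n| : ℤ) : ℂ))).mean
  have h2 := (((hv.mul hv).mul hv).mean).const_mul (1 / 3 : ℂ)
  refine (h1.add h2).congr_deriv ?_
  have h := hamiltonian_identity (N := N) hψ (p t)
  set w := field ψ N (p t)
  set v := proj ψ N (p t)
  have e1 : Trig.mean (w * mult (fun n => ((|n| : ℤ) : ℂ)) (p t)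
      + p t * mult (fun n => ((|n| : ℤ) : ℂ)) w) = 2 * Trig.mean (absD (p t) * w) := by
    have : Trig.mean (p t * absD w) = Trig.mean (absD (p t) * w) := (mean_absD_mul _ _).symm
    rw [map_add, mul_comm w]
    change Trig.mean (absD (p t) * w) + Trig.mean (p t * absD w) = _
    rw [this]; ring
  have e2 : Trig.mean ((proj ψ N w * v + v * proj ψ N w) * v + v * v * proj ψ N w)
      = 3 * Trig.mean (v * v * proj ψ N w) := by
    have : (proj ψ N w * v + v * proj ψ N w) * v + v * v * proj ψ N w
      = v * v * proj ψ N w + v * v * proj ψ N w + v * v * proj ψ N w := by ring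
    rw [this]; simp only [map_add]; ring
  rw [e1, e2]
  linear_combination h

/-- The energy `‖u‖²_{Ḣ¹} + 3/4 ∫ v² 𝓗∂ₓv + 1/8 ∫ v⁴` with `v = S_N u`, up to the normalization. -/
def energy (ψ : ℝ → ℝ) (N : ℕ) (p : Trig) : ℂ :=
  mean (D p * D p) + 3 / 4 * mean (proj ψ N p * proj ψ N p * absD (proj ψ N p))
    + 1 / 8 * mean (proj ψ N p * proj ψ N p * proj ψ N p * proj ψ N p)

theorem hasDerivAt_energy (hψ : ∀ x, ψ x = ψ |x|)
    (hp : HasCoeffDeriv s p (field ψ N (p t)) t) :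
    HasDerivAt (fun τ => energy ψ N (p τ)) (defect ψ N (proj ψ N (p t))) t := by
  have hv : HasCoeffDeriv s (fun τ => proj ψ N (p τ)) (proj ψ N (field ψ N (p t))) t := hp.mult _
  have hd : HasCoeffDeriv s (fun τ => D (p τ)) (D (field ψ N (p t))) t := hp.mult _
  have ha : HasCoeffDeriv s (fun τ => absD (proj ψ N (p τ))) (absD (proj ψ N (field ψ N (p t)))) t :=
    hv.mult _
  have h1 := (hd.mul hd).mean
  have h2 := (((hv.mul hv).mul ha).mean).const_mul (3 / 4 : ℂ)
  have h3 := ((((hv.mul hv).mul hv).mul hv).mean).const_mul (1 / 8 : ℂ)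
  refine ((h1.add h2).add h3).congr_deriv ?_
  rw [← energy_identity (N := N) hψ (p t)]
  set w := field ψ N (p t)
  set v := proj ψ N (p t)
  have e1 : D w * D (p t) + D (p t) * D w = D (p t) * D w + D (p t) * D w := by ring
  have e2 : (proj ψ N w * v + v * proj ψ N w) * absD v + v * v * absD (proj ψ N w)
    = v * proj ψ N w * absD v + v * proj ψ N w * absD v + v * v * absD (proj ψ N w) := by ring
  have e3 : ((proj ψ N w * v + v * proj ψ N w) * v + v * v * proj ψ N w) * v
      + v * v * v * proj ψ N w
    = v * v * v * proj ψ N w + v * v * v * proj ψ N w + v * v * v * proj ψ N w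
      + v * v * v * proj ψ N w := by ring
  rw [e1, e2, e3]
  simp only [map_add]
  ring

end Trig

end BenjaminOno

namespace BenjaminOno

/-! ### Flows of divergence-free vector fields -/

section Flow

open scoped NNReal

variable {E : Type*} [NormedAddCommGroup E] [NormedSpace ℝ E]

/-- `Φ` is the flow of the vector field `Y`. -/
structure IsFlow (Y : E → E) (Φ : ℝ → E → E) : Prop where
  zero : ∀ x, Φ 0 x = x
  deriv : ∀ x t, HasDerivAt (fun τ => Φ τ x) (Y (Φ t x)) t

theorem curve_unique {Y : E → E} {K : ℝ≥0} (hK : LipschitzWith K Y) {f g : ℝ → E}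
    (hf : ∀ t, HasDerivAt f (Y (f t)) t) (hg : ∀ t, HasDerivAt g (Y (g t)) t) {t₀ : ℝ}
    (h : f t₀ = g t₀) : f = g :=
  ODE_solution_unique_univ (v := fun _ => Y) (s := fun _ => univ) (K := K)
    (fun _ => hK.lipschitzOnWith) (fun t => ⟨hf t, trivial⟩) (fun t => ⟨hg t, trivial⟩) h

/-- A field bounded by `L` cannot leave the ball of radius `L(n + 1)` within time `n + 1`, so
Picard-Lindelöf applies on each such interval; uniqueness glues the pieces. -/
theorem exists_curve [CompleteSpace E] {Y : E → E} {K : ℝ≥0} (hK : LipschitzWith K Y) {L : ℝ≥0}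
    (hL : ∀ x, ‖Y x‖ ≤ L) (x : E) : ∃ f : ℝ → E, f 0 = x ∧ ∀ t, HasDerivAt f (Y (f t)) t := by
  have loc : ∀ n : ℕ, ∃ f : ℝ → E, f 0 = x ∧ ∀ t ∈ Ioo (-((n : ℝ) + 1)) (n + 1),
      HasDerivAt f (Y (f t)) t := by
    intro n
    have hn : (0 : ℝ) ∈ Icc (-((n : ℝ) + 1)) (n + 1) := by 
      constructor <;> linarith [n.cast_nonneg (α := ℝ)]
    have hpl : IsPicardLindelof (fun _ => Y) (⟨0, hn⟩ : Icc (-((n : ℝ) + 1)) (n + 1)) x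
        (L * (n + 1)) 0 L K :=
      IsPicardLindelof.of_time_independent (fun y _ => hL y) hK.lipschitzOnWith (by simp)
    obtain ⟨f, h0, hf⟩ := hpl.exists_eq_forall_mem_Icc_hasDerivWithinAt₀
    exact ⟨f, h0, fun t ht => (hf t (Ioo_subset_Icc_self ht)).hasDerivAt (Icc_mem_nhds ht.1 ht.2)⟩
  choose f hf0 hf using loc
  have agree : ∀ m n : ℕ, m ≤ n → EqOn (f m) (f n) (Ioo (-((m : ℝ) + 1)) (m + 1)) := by
    intro m n hmn
    have hmn' : (m : ℝ) ≤ n := by exact_mod_cast hmn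
    refine ODE_solution_unique_of_mem_Ioo (v := fun _ => Y) (s := fun _ => univ) (K := K) (t₀ := 0)
      (fun _ _ => hK.lipschitzOnWith) ?_ (fun t ht => ⟨hf m t ht, trivial⟩)
      (fun t ht => ⟨hf n t ⟨by linarith [ht.1], by linarith [ht.2]⟩, trivial⟩) ?_
    · constructor <;> linarith [m.cast_nonneg (α := ℝ)]
    · rw [hf0, hf0]
  have mem : ∀ t : ℝ, t ∈ Ioo (-((⌈|t|⌉₊ : ℝ) + 1)) (⌈|t|⌉₊ + 1) := by
    intro t
    have := Nat.le_ceil |t|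
    constructor <;> linarith [neg_abs_le t, le_abs_self t]
  -- The `n`-th piece lives on `|t| < n + 1`, so the index `⌈|t|⌉` leaves room on both sides of `t`;
  -- near `t` every choice agrees with the next piece.
  refine ⟨fun t => f ⌈|t|⌉₊ t, by simp [hf0], fun t => ?_⟩
  set n := ⌈|t|⌉₊ with hn
  have hev : (fun τ => f ⌈|τ|⌉₊ τ) =ᶠ[nhds t] f (n + 1) := by
    have : ∀ᶠ τ in nhds t, |τ| < (n : ℝ) + 1 :=
      (continuous_abs.tendsto t).eventually_lt_const (by linarith [Nat.le_ceil |t|])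
    filter_upwards [this] with τ hτ
    refine agree _ _ ?_ (mem τ)
    exact Nat.ceil_le.mpr (by push_cast; exact hτ.le)
  have h1 := hf (n + 1) t ⟨by push_cast; linarith [(mem t).1], by push_cast; linarith [(mem t).2]⟩
  have h2 := hev.eq_of_nhds
  simp only at h2 ⊢
  rw [← h2] at h1
  exact h1.congr_of_eventuallyEq hev

theorem exists_isFlow [CompleteSpace E] {Y : E → E} {K : ℝ≥0} (hK : LipschitzWith K Y) {L : ℝ≥0}
    (hL : ∀ x, ‖Y x‖ ≤ L) : ∃ Φ, IsFlow Y Φ := by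
  choose f hf0 hf using exists_curve hK hL
  exact ⟨fun t x => f x t, hf0, hf⟩

namespace IsFlow

variable {Y : E → E} {Φ : ℝ → E → E} {K : ℝ≥0}

theorem add (hΦ : IsFlow Y Φ) (hK : LipschitzWith K Y) (s t : ℝ) (x : E) :
    Φ (s + t) x = Φ s (Φ t x) := by
  have h := curve_unique hK (f := fun s => Φ (s + t) x) (g := fun s => Φ s (Φ t x)) (t₀ := 0)
    (fun s => (hΦ.deriv x (s + t)).comp_add_const s t) (hΦ.deriv _)
    (by simp only [zero_add, hΦ.zero])
  exact congrFun h s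

theorem neg (hΦ : IsFlow Y Φ) : IsFlow (fun x => -Y x) fun t => Φ (-t) := by
  refine ⟨fun x => by simpa using hΦ.zero x, fun x t => ?_⟩
  have h := (hΦ.deriv x (-t)).scomp t (hasDerivAt_neg t)
  rw [neg_one_smul] at h
  exact h

theorem dist_le (hΦ : IsFlow Y Φ) (hK : LipschitzWith K Y) {t : ℝ} (ht : 0 ≤ t) (x y : E) :
    dist (Φ t x) (Φ t y) ≤ dist x y * Real.exp (K * t) := by
  have := dist_le_of_trajectories_ODE (v := fun _ => Y) (K := K) (f := fun t => Φ t x)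
    (g := fun t => Φ t y) (a := 0) (b := t) (δ := dist x y) (fun _ => hK)
    (fun t _ => (hΦ.deriv x t).continuousAt.continuousWithinAt)
    (fun t _ => (hΦ.deriv x t).hasDerivWithinAt)
    (fun t _ => (hΦ.deriv y t).continuousAt.continuousWithinAt)
    (fun t _ => (hΦ.deriv y t).hasDerivWithinAt) (by simp only [hΦ.zero]; rfl) t ⟨ht, le_rfl⟩
  simpa using this

theorem dist_le_abs (hΦ : IsFlow Y Φ) (hK : LipschitzWith K Y) (t : ℝ) (x y : E) :
    dist (Φ t x) (Φ t y) ≤ dist x y * Real.exp (K * |t|) := by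
  rcases le_total 0 t with h | h
  · rw [abs_of_nonneg h]; exact hΦ.dist_le hK h x y
  · rw [abs_of_nonpos h]
    have := hΦ.neg.dist_le (K := K) hK.neg (neg_nonneg.mpr h) x y
    simpa using this

theorem continuous (hΦ : IsFlow Y Φ) (hK : LipschitzWith K Y) :
    Continuous fun p : ℝ × E => Φ p.1 p.2 := by
  rw [continuous_iff_continuousAt]
  rintro ⟨t, x⟩
  rw [ContinuousAt, tendsto_iff_dist_tendsto_zero]
  have h1 : Filter.Tendsto (fun p : ℝ × E => dist p.2 x * Real.exp (K * |p.1|)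
      + dist (Φ p.1 x) (Φ t x)) (nhds (t, x)) (nhds 0) := by
    have hc : Continuous fun s => Φ s x :=
      continuous_iff_continuousAt.mpr fun s => (hΦ.deriv x s).continuousAt
    have : Continuous fun p : ℝ × E => dist p.2 x * Real.exp (K * |p.1|)
      + dist (Φ p.1 x) (Φ t x) := by fun_prop
    simpa using this.tendsto (t, x)
  refine squeeze_zero (fun _ => dist_nonneg) (fun p => ?_) h1
  exact (dist_triangle _ (Φ p.1 x) _).trans (add_le_add (hΦ.dist_le_abs hK _ _ _) le_rfl)

/-- The Euler scheme is a second-order approximation of the flow in the Lipschitz norm. -/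
theorem norm_sub_euler_le (hΦ : IsFlow Y Φ) (hK : LipschitzWith K Y) {W : E → E} {K' : ℝ≥0}
    (hY : ∀ x, HasFDerivAt Y (fderiv ℝ Y x) x) (hW : ∀ x, W x = fderiv ℝ Y x (Y x))
    (hK' : LipschitzWith K' W) {h : ℝ} (h0 : 0 ≤ h) (h1 : h ≤ 1) (x y : E) :
    ‖Φ h x - Φ h y - ((x + h • Y x) - (y + h • Y y))‖
      ≤ K' * Real.exp K * h ^ 2 * ‖x - y‖ := by
  set C := K' * Real.exp K * ‖x - y‖ with hC
  have hdW : ∀ z s, HasDerivAt (fun s => Y (Φ s z)) (W (Φ s z)) s := by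
    intro z s
    rw [hW]
    exact (hY (Φ s z)).comp_hasDerivAt s (hΦ.deriv z s)
  -- Along a trajectory `Y` has derivative `W`, which is Lipschitz, so the increments of `Y` along
  -- two trajectories differ by `O(h ‖x - y‖)`. A second integration gives the factor `h²`.
  have step1 : ∀ s ∈ Icc 0 h, ‖(Y (Φ s x) - Y (Φ s y)) - (Y x - Y y)‖ ≤ C * h := by
    intro s hs
    have := norm_image_sub_le_of_norm_deriv_le_segment' (f := fun s => Y (Φ s x) - Y (Φ s y))
      (f' := fun s => W (Φ s x) - W (Φ s y)) (a := 0) (b := h) (C := C)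
      (fun s _ => ((hdW x s).sub (hdW y s)).hasDerivWithinAt) (fun s hs => ?_) s hs
    · simp only [hΦ.zero, sub_zero] at this
      exact this.trans (mul_le_mul_of_nonneg_left hs.2 (by positivity))
    · calc ‖W (Φ s x) - W (Φ s y)‖ ≤ K' * ‖Φ s x - Φ s y‖ := hK'.norm_sub_le _ _
        _ ≤ K' * (‖x - y‖ * Real.exp K) := by
            gcongr
            have := hΦ.dist_le hK hs.1 x y
            rw [dist_eq_norm, dist_eq_norm] at this
            refine this.trans ?_
            gcongr
            nlinarith [K.2, hs.2, show (0 : ℝ) ≤ K from K.2]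
        _ = C := by rw [hC]; ring
  have := norm_image_sub_le_of_norm_deriv_le_segment'
    (f := fun s => Φ s x - Φ s y - s • (Y x - Y y))
    (f' := fun s => (Y (Φ s x) - Y (Φ s y)) - (Y x - Y y)) (a := 0) (b := h) (C := C * h)
    (fun s _ => ?_) (fun s hs => step1 s (Ico_subset_Icc_self hs)) h ⟨h0, le_rfl⟩
  · simp only [hΦ.zero, sub_zero, zero_smul] at this
    calc _ = ‖Φ h x - Φ h y - h • (Y x - Y y) - (x - y)‖ := by
          congr 1; rw [smul_sub]; abel
      _ ≤ C * h * h := this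
      _ = _ := by rw [hC]; ring
  · have h2 := ((hΦ.deriv x s).sub (hΦ.deriv y s)).sub ((hasDerivAt_id s).smul_const (Y x - Y y))
    simp only [one_smul] at h2
    exact h2.hasDerivWithinAt

end IsFlow

end Flow

/-! ### Liouville's theorem -/

section Liouville

variable {κ : Type*} [Fintype κ] [DecidableEq κ]

/-- In the Leibniz expansion the identity permutation contributes `∏ (1 + h Mᵢᵢ) ≤ exp(h tr M) = 1`.
Any other permutation moves some `i` and also its image, hence contains two off-diagonal factors of
size `h K`; the remaining factors are at most `2`. -/
theorem abs_det_one_add_smul_le {M : Matrix κ κ ℝ} {K h : ℝ} (hM : ∀ i j, |M i j| ≤ K)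
    (htr : ∑ i, M i i = 0) (h0 : 0 ≤ h) (hK : h * K ≤ 1) :
    |(1 + h • M).det| ≤ 1 + (Fintype.card κ).factorial * (2 ^ Fintype.card κ * (h * K) ^ 2) := by
  rw [Matrix.det_apply]
  have hK0 : ∀ i : κ, 0 ≤ K := fun i => (abs_nonneg _).trans (hM i i)
  have hent : ∀ i j, |h * M i j| ≤ h * K := fun i j => by
    rw [abs_mul, abs_of_nonneg h0]; exact mul_le_mul_of_nonneg_left (hM i j) h0
  have hent2 : ∀ i j, |(1 + h • M) i j| ≤ 2 := by
    intro i j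
    have : |(1 : Matrix κ κ ℝ) i j| ≤ 1 := by
      rw [Matrix.one_apply]; split_ifs <;> simp
    rw [Matrix.add_apply, Matrix.smul_apply, smul_eq_mul]
    linarith [abs_add_le ((1 : Matrix κ κ ℝ) i j) (h * M i j), hent i j]
  have hone : |∏ i, (1 + h • M) i i| ≤ 1 := by
    have hnn : ∀ i, 0 ≤ (1 + h • M) i i := fun i => by
      rw [Matrix.add_apply, Matrix.smul_apply, smul_eq_mul, Matrix.one_apply_eq]
      linarith [neg_abs_le (h * M i i), hent i i]
    rw [abs_of_nonneg (Finset.prod_nonneg fun i _ => hnn i)]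
    calc ∏ i, (1 + h • M) i i ≤ ∏ i, Real.exp (h * M i i) := by
          refine Finset.prod_le_prod (fun i _ => hnn i) fun i _ => ?_
          rw [Matrix.add_apply, Matrix.smul_apply, smul_eq_mul, Matrix.one_apply_eq]
          linarith [Real.add_one_le_exp (h * M i i)]
      _ = 1 := by rw [← Real.exp_sum, ← Finset.mul_sum, htr, mul_zero, Real.exp_zero]
  have hother : ∀ σ : Equiv.Perm κ, σ ≠ 1 →
      |∏ i, (1 + h • M) (σ i) i| ≤ 2 ^ Fintype.card κ * (h * K) ^ 2 := by
    intro σ hσ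
    obtain ⟨i, hi⟩ : ∃ i, σ i ≠ i := by
      by_contra hcon
      push Not at hcon
      exact hσ (Equiv.ext hcon)
    have hj : σ (σ i) ≠ σ i := fun e => hi (σ.injective e)
    have hoff : ∀ k, σ k ≠ k → |(1 + h • M) (σ k) k| ≤ h * K := by
      intro k hk
      rw [Matrix.add_apply, Matrix.smul_apply, smul_eq_mul, Matrix.one_apply_ne hk, zero_add]
      exact hent _ _
    rw [Finset.abs_prod, ← Finset.mul_prod_erase _ _ (Finset.mem_univ i),
      ← Finset.mul_prod_erase _ _ (Finset.mem_erase.mpr ⟨hi, Finset.mem_univ (σ i)⟩)]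
    have hrest : ∏ x ∈ (Finset.univ.erase i).erase (σ i), |(1 + h • M) (σ x) x|
        ≤ 2 ^ Fintype.card κ := by
      calc _ ≤ ∏ x ∈ (Finset.univ.erase i).erase (σ i), (2 : ℝ) :=
            Finset.prod_le_prod (fun _ _ => abs_nonneg _) fun x _ => hent2 _ _
        _ = 2 ^ ((Finset.univ.erase i).erase (σ i)).card := by simp
        _ ≤ 2 ^ Fintype.card κ := by
            refine pow_le_pow_right₀ (by norm_num) ?_
            exact Finset.card_le_univ _
    have hhK : 0 ≤ h * K := mul_nonneg h0 (hK0 i)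
    calc _ ≤ (h * K) * ((h * K) * 2 ^ Fintype.card κ) := by
          refine mul_le_mul (hoff i hi) ?_ (by positivity) hhK
          exact mul_le_mul (hoff _ hj) hrest (by positivity) hhK
      _ = _ := by ring
  rw [← Finset.add_sum_erase _ _ (Finset.mem_univ (1 : Equiv.Perm κ))]
  refine (abs_add_le _ _).trans (add_le_add ?_ ?_)
  · simpa using hone
  · refine (Finset.abs_sum_le_sum_abs _ _).trans ?_
    calc _ ≤ ∑ σ ∈ Finset.univ.erase (1 : Equiv.Perm κ), 2 ^ Fintype.card κ * (h * K) ^ 2 := by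
          refine Finset.sum_le_sum fun σ hσ => ?_
          have := hother σ (Finset.ne_of_mem_erase hσ)
          rcases Int.units_eq_one_or (Equiv.Perm.sign σ) with e | e <;> simpa [e] using this
      _ ≤ _ := by
          rw [Finset.sum_const, nsmul_eq_mul]
          refine mul_le_mul_of_nonneg_right ?_ (by positivity)
          rw [← Fintype.card_perm]
          exact_mod_cast Finset.card_le_univ _

end Liouville

end BenjaminOno

namespace BenjaminOno

section Liouville

open scoped NNReal ENNReal

variable {κ : Type*} [Fintype κ] [DecidableEq κ]

/-- The condition that the divergence of the vector field vanishes. -/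
def DivFree (Y : (κ → ℝ) → κ → ℝ) : Prop := ∀ x, ∑ k, fderiv ℝ Y x (Pi.single k 1) k = 0

theorem DivFree.neg {Y : (κ → ℝ) → κ → ℝ} (h : DivFree Y) : DivFree fun x => -Y x := by
  intro x
  have := h x
  rw [fderiv_fun_neg]
  simpa using this

theorem abs_det_euler_le {Y : (κ → ℝ) → κ → ℝ} (hdiv : DivFree Y) {K : ℝ≥0}
    (hK : LipschitzWith K Y) {h : ℝ} (h0 : 0 ≤ h) (h1 : h * K ≤ 1) (x : κ → ℝ) :
    |(ContinuousLinearMap.id ℝ (κ → ℝ) + h • fderiv ℝ Y x).det|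
      ≤ 1 + (Fintype.card κ).factorial * (2 ^ Fintype.card κ * (h * K) ^ 2) := by
  set M : Matrix κ κ ℝ := LinearMap.toMatrix' (fderiv ℝ Y x : (κ → ℝ) →ₗ[ℝ] κ → ℝ) with hM
  have hent : ∀ i j, M i j = fderiv ℝ Y x (Pi.single j 1) i := fun i j => by
    rw [hM, LinearMap.toMatrix'_apply]; rfl
  have hdet : (ContinuousLinearMap.id ℝ (κ → ℝ) + h • fderiv ℝ Y x).det = (1 + h • M).det := by
    rw [ContinuousLinearMap.det, ← LinearMap.det_toMatrix']
    congr 1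
    rw [hM, ContinuousLinearMap.toLinearMap_add, ContinuousLinearMap.toLinearMap_smul, map_add, map_smul]
    congr 1
    exact LinearMap.toMatrix'_id
  rw [hdet]
  refine abs_det_one_add_smul_le (fun i j => ?_) ?_ h0 h1
  · rw [hent, ← Real.norm_eq_abs]
    calc ‖fderiv ℝ Y x (Pi.single j 1) i‖ ≤ ‖fderiv ℝ Y x (Pi.single j 1)‖ := norm_le_pi_norm _ i
      _ ≤ ‖fderiv ℝ Y x‖ * ‖(Pi.single j 1 : κ → ℝ)‖ := ContinuousLinearMap.le_opNorm _ _
      _ ≤ K * 1 := by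
          gcongr
          · exact norm_fderiv_le_of_lipschitz ℝ hK
          · rw [Pi.norm_single]; simp
      _ = K := mul_one _
  · simp only [hent]; exact hdiv x

/-- The volume expansion in a short time is at most quadratic. -/
theorem volume_image_step [Nonempty κ] {Y W : (κ → ℝ) → κ → ℝ} {Φ : ℝ → (κ → ℝ) → κ → ℝ}
    (hΦ : IsFlow Y Φ)
    (hdiv : DivFree Y) {K K' : ℝ≥0} (hK : LipschitzWith K Y)
    (hY : ∀ x, HasFDerivAt Y (fderiv ℝ Y x) x) (hW : ∀ x, W x = fderiv ℝ Y x (Y x))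
    (hK' : LipschitzWith K' W) :
    ∃ C : ℝ, 0 ≤ C ∧ ∀ h : ℝ, 0 ≤ h → h ≤ 1 → h * K ≤ 1 / 2 → ∀ A : Set (κ → ℝ), MeasurableSet A →
      volume (Φ h '' A) ≤ ENNReal.ofReal (Real.exp (C * h ^ 2)) * volume A := by
  set d := Fintype.card κ
  set C₁ : ℝ := 2 * (K' * Real.exp K) with hC₁
  set C₂ : ℝ := d.factorial * (2 ^ d * (K : ℝ) ^ 2) with hC₂
  have hC₁0 : 0 ≤ C₁ := by positivity
  have hC₂0 : 0 ≤ C₂ := by positivity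
  refine ⟨d * C₁ + C₂, by positivity, fun h h0 h1 hhK A hA => ?_⟩
  set e : (κ → ℝ) → κ → ℝ := fun x => x + h • Y x with he
  -- For `h K ≤ 1/2` the Euler step shrinks distances by at most a factor two. It is therefore
  -- injective, and errors measured in `‖x - y‖` can be measured in `‖e x - e y‖`.
  have hlow : ∀ x y, 1 / 2 * ‖x - y‖ ≤ ‖e x - e y‖ := by
    intro x y
    have h2 : ‖h • (Y x - Y y)‖ ≤ 1 / 2 * ‖x - y‖ := by
      rw [norm_smul, Real.norm_of_nonneg h0]
      calc h * ‖Y x - Y y‖ ≤ h * (K * ‖x - y‖) :=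
            mul_le_mul_of_nonneg_left (hK.norm_sub_le _ _) h0
        _ = h * K * ‖x - y‖ := by ring
        _ ≤ _ := mul_le_mul_of_nonneg_right hhK (norm_nonneg _)
    have h3 : x - y = (e x - e y) - h • (Y x - Y y) := by
      simp only [he, smul_sub]; abel
    have h4 : ‖x - y‖ ≤ ‖e x - e y‖ + ‖h • (Y x - Y y)‖ := by
      conv_lhs => rw [h3]
      exact norm_sub_le _ _
    linarith
  have hinj : Function.Injective e := by
    intro x y hxy
    have := hlow x y
    rw [hxy, sub_self, norm_zero] at this
    exact sub_eq_zero.mp (norm_eq_zero.mp (le_antisymm (by linarith) (norm_nonneg _)))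
  have hup : ∀ x y, ‖Φ h x - Φ h y‖ ≤ (1 + C₁ * h ^ 2) * ‖e x - e y‖ := by
    intro x y
    have h2 := hΦ.norm_sub_euler_le hK hY hW hK' h0 h1 x y
    have h3 : ‖Φ h x - Φ h y‖ ≤ ‖Φ h x - Φ h y - (e x - e y)‖ + ‖e x - e y‖ := by
      simpa using norm_add_le (Φ h x - Φ h y - (e x - e y)) (e x - e y)
    have h4 := hlow x y
    have h5 : K' * Real.exp K * h ^ 2 * ‖x - y‖ ≤ C₁ * h ^ 2 * ‖e x - e y‖ := by
      have : 0 ≤ K' * Real.exp K * h ^ 2 := by positivity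
      rw [hC₁]
      nlinarith
    linarith
  have himg : Φ h '' A = (Φ h ∘ Function.invFun e) '' (e '' A) := by
    rw [← image_comp]
    refine image_congr fun x _ => ?_
    simp [Function.leftInverse_invFun hinj x]
  have hlip : LipschitzOnWith (Real.toNNReal (1 + C₁ * h ^ 2)) (Φ h ∘ Function.invFun e)
      (e '' A) := by
    refine LipschitzOnWith.of_dist_le_mul ?_
    rintro _ ⟨x, -, rfl⟩ _ ⟨y, -, rfl⟩
    simp only [Function.comp_apply, Function.leftInverse_invFun hinj x,
      Function.leftInverse_invFun hinj y, dist_eq_norm]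
    rw [Real.coe_toNNReal _ (by positivity)]
    exact hup x y
  -- The flow factors through the Euler step by a map with Lipschitz constant `1 + O(h²)`. For the
  -- sup norm on `ℝ^d` Lebesgue measure is the Hausdorff measure, so that map expands volume by at
  -- most the `d`-th power of the constant; no differentiability in the initial point is needed.
  have hv1 : volume (Φ h '' A) ≤ (Real.toNNReal (1 + C₁ * h ^ 2) : ℝ≥0∞) ^ d * volume (e '' A) := by
    have := hlip.hausdorffMeasure_image_le (d := d) (by positivity)
    rw [hausdorffMeasure_pi_real, ← himg, ENNReal.rpow_natCast] at this
    exact this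
  have hv2 : volume (e '' A) ≤ ENNReal.ofReal (1 + C₂ * h ^ 2) * volume A := by
    have hd : ∀ x ∈ A, HasFDerivWithinAt e (ContinuousLinearMap.id ℝ _ + h • fderiv ℝ Y x) A x :=
      fun x _ => ((hasFDerivAt_id x).add ((hY x).const_smul h)).hasFDerivWithinAt
    refine (addHaar_image_le_lintegral_abs_det_fderiv volume hA hd).trans ?_
    calc _ ≤ ∫⁻ x in A, ENNReal.ofReal (1 + C₂ * h ^ 2) := by
          refine lintegral_mono fun x => ENNReal.ofReal_le_ofReal ?_
          refine (abs_det_euler_le hdiv hK h0 (by linarith) x).trans (le_of_eq ?_)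
          rw [hC₂]; ring
      _ = _ := by simp
  refine (hv1.trans (mul_le_mul_right hv2 _)).trans ?_
  rw [← mul_assoc]
  refine mul_le_mul_left ?_ _
  rw [show ((Real.toNNReal (1 + C₁ * h ^ 2) : ℝ≥0) : ℝ≥0∞) = ENNReal.ofReal (1 + C₁ * h ^ 2) from rfl,
    ← ENNReal.ofReal_pow (by positivity), ← ENNReal.ofReal_mul (by positivity)]
  refine ENNReal.ofReal_le_ofReal ?_
  have e1 : 1 + C₁ * h ^ 2 ≤ Real.exp (C₁ * h ^ 2) := by linarith [Real.add_one_le_exp (C₁ * h ^ 2)]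
  have e2 : 1 + C₂ * h ^ 2 ≤ Real.exp (C₂ * h ^ 2) := by linarith [Real.add_one_le_exp (C₂ * h ^ 2)]
  calc (1 + C₁ * h ^ 2) ^ d * (1 + C₂ * h ^ 2)
      ≤ Real.exp (C₁ * h ^ 2) ^ d * Real.exp (C₂ * h ^ 2) := by gcongr
    _ = _ := by rw [← Real.exp_nat_mul, ← Real.exp_add]; congr 1; ring

/-- With `n` steps of length `t/n` the expansion factors multiply to `exp(C t²/n)`, which tends to
`1`. -/
theorem volume_image_le [Nonempty κ] {Y W : (κ → ℝ) → κ → ℝ} {Φ : ℝ → (κ → ℝ) → κ → ℝ}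
    (hΦ : IsFlow Y Φ)
    (hdiv : DivFree Y) {K K' : ℝ≥0} (hK : LipschitzWith K Y)
    (hY : ∀ x, HasFDerivAt Y (fderiv ℝ Y x) x) (hW : ∀ x, W x = fderiv ℝ Y x (Y x))
    (hK' : LipschitzWith K' W) {t : ℝ} (ht : 0 ≤ t) {A : Set (κ → ℝ)} (hA : MeasurableSet A) :
    volume (Φ t '' A) ≤ volume A := by
  obtain ⟨C, hC, hstep⟩ := volume_image_step hΦ hdiv hK hY hW hK'
  have hcont : ∀ s, Continuous (Φ s) := fun s => (hΦ.continuous hK).comp (by fun_prop : Continuous fun x : κ → ℝ => (s, x))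
  have hinj : ∀ s, Function.Injective (Φ s) := fun s x y hxy => by
    have := congrArg (Φ (-s)) hxy
    rwa [← hΦ.add hK, ← hΦ.add hK, neg_add_cancel, hΦ.zero, hΦ.zero] at this
  have hiter : ∀ h : ℝ, 0 ≤ h → h ≤ 1 → h * K ≤ 1 / 2 → ∀ n : ℕ, MeasurableSet (Φ (n * h) '' A) ∧
      volume (Φ (n * h) '' A) ≤ ENNReal.ofReal (Real.exp (n * (C * h ^ 2))) * volume A := by
    intro h h0 h1 hhK n
    refine ⟨hA.image_of_continuousOn_injOn (hcont _).continuousOn (hinj _).injOn, ?_⟩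
    induction n with
    | zero => simp [hΦ.zero]
    | succ n ih =>
      have e1 : Φ ((n + 1 : ℕ) * h) '' A = Φ h '' (Φ (n * h) '' A) := by
        rw [← image_comp]
        refine image_congr fun x _ => ?_
        rw [Function.comp_apply, ← hΦ.add hK]; congr 1; push_cast; ring
      rw [e1]
      have hm : MeasurableSet (Φ (n * h) '' A) :=
        hA.image_of_continuousOn_injOn (hcont _).continuousOn (hinj _).injOn
      refine (hstep h h0 h1 hhK _ hm).trans ((mul_le_mul_right ih _).trans (le_of_eq ?_))
      rw [← mul_assoc, ← ENNReal.ofReal_mul (Real.exp_pos _).le, ← Real.exp_add]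
      congr 3; push_cast; ring
  have hbound : ∀ᶠ n : ℕ in Filter.atTop,
      volume (Φ t '' A) ≤ ENNReal.ofReal (Real.exp (C * t ^ 2 * (1 / (n : ℝ)))) * volume A := by
    have h2 : Filter.Tendsto (fun n : ℕ => t * (1 / (n : ℝ))) Filter.atTop (nhds 0) := by
      simpa using (tendsto_one_div_atTop_nhds_zero_nat (𝕜 := ℝ)).const_mul t
    have h3 : Filter.Tendsto (fun n : ℕ => t * (1 / (n : ℝ)) * K) Filter.atTop (nhds 0) := by
      simpa using h2.mul_const (K : ℝ)
    filter_upwards [h2.eventually_le_const (by norm_num : (0 : ℝ) < 1),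
      h3.eventually_le_const (by norm_num : (0 : ℝ) < 1 / 2), Filter.eventually_gt_atTop 0]
      with n hn1 hn2 hn3
    have hn : (n : ℝ) ≠ 0 := by positivity
    have := (hiter _ (by positivity) hn1 hn2 n).2
    rw [show (n : ℝ) * (t * (1 / (n : ℝ))) = t by field_simp,
      show (n : ℝ) * (C * (t * (1 / (n : ℝ))) ^ 2) = C * t ^ 2 * (1 / (n : ℝ)) by field_simp] at this
    exact this
  have hlim : Filter.Tendsto
      (fun n : ℕ => ENNReal.ofReal (Real.exp (C * t ^ 2 * (1 / (n : ℝ)))) * volume A)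
      Filter.atTop (nhds (1 * volume A)) := by
    refine ENNReal.Tendsto.mul_const ?_ (Or.inl one_ne_zero)
    have : Filter.Tendsto (fun n : ℕ => Real.exp (C * t ^ 2 * (1 / (n : ℝ)))) Filter.atTop
        (nhds (Real.exp (C * t ^ 2 * 0))) :=
      (Real.continuous_exp.tendsto _).comp (tendsto_one_div_atTop_nhds_zero_nat.const_mul _)
    rw [mul_zero, Real.exp_zero] at this
    simpa using ENNReal.tendsto_ofReal this
  rw [one_mul] at hlim
  exact ge_of_tendsto hlim hbound

/-- Liouville's theorem for compactly supported divergence-free vector fields. -/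
theorem volume_preimage_flow [Nonempty κ] {Y : (κ → ℝ) → κ → ℝ} {Φ : ℝ → (κ → ℝ) → κ → ℝ}
    (hΦ : IsFlow Y Φ) (hdiv : DivFree Y) (hY : ContDiff ℝ ∞ Y) (hc : HasCompactSupport Y)
    {K : ℝ≥0} (hK : LipschitzWith K Y) (t : ℝ) {A : Set (κ → ℝ)} (hA : MeasurableSet A) :
    volume (Φ t ⁻¹' A) = volume A := by
  have hW : ContDiff ℝ ∞ fun x => fderiv ℝ Y x (Y x) :=
    (hY.fderiv_right (m := ∞) (by simp)).clm_apply hY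
  have hWc : HasCompactSupport fun x => fderiv ℝ Y x (Y x) := by
    refine hc.mono' ?_
    intro x hx
    by_contra h
    have : Y x = 0 := image_eq_zero_of_notMem_tsupport h
    exact hx (by simp [this])
  obtain ⟨K', hK'⟩ := hW.lipschitzWith_of_hasCompactSupport hWc (by simp)
  have hd : ∀ x, HasFDerivAt Y (fderiv ℝ Y x) x :=
    fun x => (hY.differentiable (by simp) x).hasFDerivAt
  have hdn : ∀ x, HasFDerivAt (fun x => -Y x) (fderiv ℝ (fun x => -Y x) x) x :=
    fun x => ((hY.neg).differentiable (by simp) x).hasFDerivAt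
  -- Negative times are the flow of `-Y`, which is again divergence free. Since preimages under `Φ
  -- t` are images under `Φ (-t)`, one inequality valid for all times gives equality.
  have himage : ∀ t : ℝ, ∀ A, MeasurableSet A → volume (Φ t '' A) ≤ volume A := by
    intro t A hA
    rcases le_total 0 t with h | h
    · exact volume_image_le hΦ hdiv hK hd (fun _ => rfl) hK' h hA
    · have := volume_image_le hΦ.neg hdiv.neg hK.neg hdn (W := fun x => fderiv ℝ Y x (Y x))
        (fun x => by simp [fderiv_fun_neg]) hK' (neg_nonneg.mpr h) hA
      simpa using this
  have hpre : ∀ t : ℝ, ∀ A, Φ t ⁻¹' A = Φ (-t) '' A := by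
    intro t A
    ext x
    constructor
    · intro hx
      exact ⟨Φ t x, hx, by rw [← hΦ.add hK, neg_add_cancel, hΦ.zero]⟩
    · rintro ⟨y, hy, rfl⟩
      rw [mem_preimage, ← hΦ.add hK, add_neg_cancel, hΦ.zero]
      exact hy
  have hcont : Continuous (Φ t) :=
    (hΦ.continuous hK).comp (by fun_prop : Continuous fun x : κ → ℝ => (t, x))
  refine le_antisymm ?_ ?_
  · rw [hpre]; exact himage _ _ hA
  · have : A = Φ t '' (Φ t ⁻¹' A) := by
      rw [← neg_neg t, ← hpre (-t), ← preimage_comp, neg_neg]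
      have : Φ t ∘ Φ (-t) = id := by
        funext x; rw [Function.comp_apply, ← hΦ.add hK, add_neg_cancel, hΦ.zero]; rfl
      rw [this, preimage_id]
    conv_lhs => rw [this]
    exact himage _ _ (hcont.measurable hA)

/-- A smooth divergence-free vector field with a conserved quantity whose sublevel sets are bounded
generates a global volume preserving flow. -/
theorem exists_volumePreserving_flow [Nonempty κ] {X : (κ → ℝ) → κ → ℝ} (hX : ContDiff ℝ ∞ X)
    (hdiv : DivFree X) {q : (κ → ℝ) → ℝ} (hq : ContDiff ℝ ∞ q)
    (hbdd : ∀ R : ℝ, Bornology.IsBounded {x | q x ≤ R})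
    (hqX : ∀ x, fderiv ℝ q x (X x) = 0) :
    ∃ Φ : ℝ → (κ → ℝ) → κ → ℝ, IsFlow X Φ ∧ (Continuous fun p : ℝ × (κ → ℝ) => Φ p.1 p.2) ∧
      ∀ t, MeasurePreserving (Φ t) := by
  -- The cutoff is a function of the conserved quantity, so its gradient is orthogonal to `X`: the
  -- cut-off field stays divergence free, still conserves `q`, and agrees with `X` where `q ≤ R`.
  set ρ : ℕ → (κ → ℝ) → ℝ := fun R x => Real.smoothTransition (R + 1 - q x) with hρ
  have hρs : ∀ R, ContDiff ℝ ∞ (ρ R) := fun R =>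
    Real.smoothTransition.contDiff.comp (contDiff_const.sub hq)
  have hρ1 : ∀ (R : ℕ) x, q x ≤ R → ρ R x = 1 := fun R x hx =>
    Real.smoothTransition.one_of_one_le (by linarith)
  have hρ0 : ∀ (R : ℕ) x, R + 1 ≤ q x → ρ R x = 0 := fun R x hx =>
    Real.smoothTransition.zero_of_nonpos (by linarith)
  set Y : ℕ → (κ → ℝ) → κ → ℝ := fun R x => ρ R x • X x with hY
  have hYs : ∀ R, ContDiff ℝ ∞ (Y R) := fun R => (hρs R).smul hX
  have hYc : ∀ R, HasCompactSupport (Y R) := fun R => by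
    refine HasCompactSupport.intro
      (Metric.isCompact_of_isClosed_isBounded (isClosed_le hq.continuous continuous_const)
        (hbdd (R + 1))) fun x hx => ?_
    have : R + 1 ≤ q x := (not_le.mp hx).le
    rw [hY]; simp only [hρ0 R x this, zero_smul]
  have hqY : ∀ R x, fderiv ℝ q x (Y R x) = 0 := fun R x => by
    rw [hY]; simp only [map_smul, hqX, smul_zero]
  have hYdiv : ∀ R, DivFree (Y R) := by
    intro R x
    have hdq : DifferentiableAt ℝ q x := hq.differentiable (by simp) x
    have hdρ : fderiv ℝ (ρ R) x
        = (-deriv Real.smoothTransition (R + 1 - q x)) • fderiv ℝ q x := by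
      have h1 : HasDerivAt Real.smoothTransition (deriv Real.smoothTransition (R + 1 - q x))
          (R + 1 - q x) :=
        ((Real.smoothTransition.contDiff (n := 1)).differentiable (by simp) _).hasDerivAt
      have h2 := h1.comp_hasFDerivAt x (hdq.hasFDerivAt.const_sub ((R : ℝ) + 1))
      have h3 := h2.fderiv
      rw [smul_neg, ← neg_smul] at h3
      exact h3
    have hfd : fderiv ℝ (Y R) x
        = ρ R x • fderiv ℝ X x + (fderiv ℝ (ρ R) x).smulRight (X x) :=
      fderiv_fun_smul ((hρs R).differentiable (by simp) x) (hX.differentiable (by simp) x)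
    have hsum : ∑ k, fderiv ℝ q x (Pi.single k 1) * X x k = 0 := by
      rw [← hqX x]
      conv_rhs => rw [pi_eq_sum_univ' (X x), map_sum]
      refine Finset.sum_congr rfl fun k _ => ?_
      rw [map_smul, smul_eq_mul, mul_comm]
    have : ∀ k, fderiv ℝ (Y R) x (Pi.single k 1) k = ρ R x * fderiv ℝ X x (Pi.single k 1) k
        + -deriv Real.smoothTransition (R + 1 - q x)
          * (fderiv ℝ q x (Pi.single k 1) * X x k) := fun k => by
      rw [hfd, hdρ]
      simp [mul_assoc]
    simp only [this]
    rw [Finset.sum_add_distrib, ← Finset.mul_sum, ← Finset.mul_sum, hdiv x, hsum, mul_zero,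
      mul_zero, add_zero]
  have hlip : ∀ R, ∃ K : ℝ≥0, LipschitzWith K (Y R) := fun R =>
    (hYs R).lipschitzWith_of_hasCompactSupport (hYc R) (by simp)
  choose K hK using hlip
  have hbd : ∀ R, ∃ L : ℝ≥0, ∀ x, ‖Y R x‖ ≤ L := fun R => by
    obtain ⟨L, hL⟩ := (hYc R).exists_bound_of_continuous (hYs R).continuous
    exact ⟨Real.toNNReal L, fun x => (hL x).trans (Real.le_coe_toNNReal L)⟩
  choose L hL using hbd
  choose F hF using fun R => exists_isFlow (hK R) (hL R)
  have hqc : ∀ R x t, q (F R t x) = q x := by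
    intro R x t
    have hd : ∀ s, HasDerivAt (fun s => q (F R s x)) 0 s := fun s => by
      have := (hq.differentiable (by simp) (F R s x)).hasFDerivAt.comp_hasDerivAt s ((hF R).deriv x s)
      rw [hqY] at this
      exact this
    have := is_const_of_deriv_eq_zero (fun s => (hd s).differentiableAt) (fun s => (hd s).deriv) t 0
    simpa [(hF R).zero] using this
  have hYX : ∀ (R : ℕ) x, q x ≤ R → Y R x = X x := fun R x hx => by
    rw [hY]; simp only [hρ1 R x hx, one_smul]
  have hagree : ∀ (R R' : ℕ) x, q x ≤ R → q x ≤ R' → ∀ t, F R t x = F R' t x := by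
    intro R R' x h h' t
    refine congrFun (curve_unique (hK R') (f := fun t => F R t x) (g := fun t => F R' t x) (t₀ := 0)
      (fun s => ?_) ((hF R').deriv x) (by simp only [(hF R).zero, (hF R').zero])) t
    have h1 : Y R' (F R s x) = Y R (F R s x) := by
      rw [hYX R _ (by rw [hqc]; exact h), hYX R' _ (by rw [hqc]; exact h')]
    rw [h1]; exact (hF R).deriv x s
  set Φ : ℝ → (κ → ℝ) → κ → ℝ := fun t x => F ⌈q x⌉₊ t x with hΦdef
  have hΦF : ∀ (R : ℕ) x, q x ≤ R → ∀ t, Φ t x = F R t x := fun R x hx t =>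
    hagree _ _ x (Nat.le_ceil _) hx t
  have hΦ : IsFlow X Φ := by
    refine ⟨fun x => (hF _).zero x, fun x t => ?_⟩
    have := (hF ⌈q x⌉₊).deriv x t
    rw [hYX _ _ (by rw [hqc]; exact Nat.le_ceil _)] at this
    exact this
  have hcont : Continuous fun p : ℝ × (κ → ℝ) => Φ p.1 p.2 := by
    rw [continuous_iff_continuousAt]
    rintro ⟨t, x⟩
    -- The level is raised by one so that the same cut-off flow represents `Φ` on a neighbourhood of
    -- `x`.
    have h1 := ((hF (⌈q x⌉₊ + 1)).continuous (hK _)).continuousAt (x := (t, x))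
    refine h1.congr ?_
    have : ∀ᶠ p : ℝ × (κ → ℝ) in nhds (t, x), q p.2 < (⌈q x⌉₊ + 1 : ℕ) := by
      refine ((hq.continuous.comp continuous_snd).tendsto (t, x)).eventually_lt_const ?_
      push_cast
      simp only [Function.comp_apply]
      linarith [Nat.le_ceil (q x)]
    filter_upwards [this] with p hp
    exact (hΦF _ _ hp.le _).symm
  refine ⟨Φ, hΦ, hcont, fun t => ?_⟩
  have hct : Continuous (Φ t) := hcont.comp (by fun_prop : Continuous fun x : κ → ℝ => (t, x))
  refine ⟨hct.measurable, ?_⟩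
  ext A hA
  rw [Measure.map_apply hct.measurable hA]
  set B : ℕ → Set (κ → ℝ) := fun R => {x | q x ≤ R} with hB
  have hBm : ∀ R, MeasurableSet (B R) := fun R =>
    (isClosed_le hq.continuous continuous_const).measurableSet
  have hBmono : Monotone B := fun R R' h x (hx : q x ≤ R) =>
    hx.trans (by exact_mod_cast h)
  have hBU : ∀ A : Set (κ → ℝ), A = ⋃ R, A ∩ B R := fun A => by
    rw [← inter_iUnion]
    refine (inter_eq_left.mpr fun x _ => mem_iUnion.mpr ⟨⌈q x⌉₊, show q x ≤ _ from Nat.le_ceil _⟩).symm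
  have hsup : ∀ A : Set (κ → ℝ), volume A = ⨆ R, volume (A ∩ B R) := fun A => by
    conv_lhs => rw [hBU A]
    exact Monotone.measure_iUnion fun R R' h => inter_subset_inter_right _ (hBmono h)
  rw [hsup A, hsup (Φ t ⁻¹' A)]
  congr 1
  funext R
  -- The sublevel sets of `q` are invariant, so on each of them `Φ` may be replaced by a compactly
  -- supported flow; volumes are recovered as suprema over the levels.
  have : Φ t ⁻¹' A ∩ B R = F R t ⁻¹' (A ∩ B R) := by
    ext x
    simp only [hB, mem_inter_iff, mem_preimage, mem_ofPred_eq, hqc]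
    constructor
    · rintro ⟨h1, h2⟩; exact ⟨by rwa [← hΦF R x h2], h2⟩
    · rintro ⟨h1, h2⟩; exact ⟨by rwa [hΦF R x h2], h2⟩
  rw [this]
  exact volume_preimage_flow (hF R) (hYdiv R) (hYs R) (hYc R) (hK R) t (hA.inter (hBm R))

end Liouville

end BenjaminOno

namespace BenjaminOno

/-! ### Functions with finite moments of all orders -/

section AllLp

open scoped ENNReal

variable {Ω : Type*} [MeasurableSpace Ω] {P : Measure Ω} {𝕜 : Type*} [RCLike 𝕜]

/-- All moments of `f` are finite. -/
def AllLp (P : Measure Ω) (f : Ω → 𝕜) : Prop := ∀ p : ℕ, MemLp f p P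

theorem AllLp.add {f g : Ω → 𝕜} (hf : AllLp P f) (hg : AllLp P g) :
    AllLp P fun w => f w + g w := fun p => (hf p).add (hg p)

theorem AllLp.mul {f g : Ω → 𝕜} (hf : AllLp P f) (hg : AllLp P g) :
    AllLp P fun w => f w * g w := fun p => by
  have h : ENNReal.HolderTriple ((p + p : ℕ) : ℝ≥0∞) ((p + p : ℕ) : ℝ≥0∞) (p : ℝ≥0∞) := by
    constructor
    rcases Nat.eq_zero_or_pos p with h0 | h0
    · subst h0; simp
    · push_cast
      rw [← two_mul (p : ℝ≥0∞), ENNReal.mul_inv (Or.inl (by norm_num)) (Or.inl (by norm_num)),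
        ← add_mul, ENNReal.inv_two_add_inv_two, one_mul]
  exact (hg (p + p)).mul' (hf (p + p))

theorem AllLp.const [IsFiniteMeasure P] (c : 𝕜) : AllLp P fun _ : Ω => c := fun _ => memLp_const c

theorem AllLp.const_mul {f : Ω → 𝕜} (hf : AllLp P f) (c : 𝕜) : AllLp P fun w => c * f w :=
  fun p => (hf p).const_mul c

theorem AllLp.pow [IsFiniteMeasure P] {f : Ω → 𝕜} (hf : AllLp P f) (n : ℕ) :
    AllLp P fun w => f w ^ n := by
  induction n with
  | zero => simpa using AllLp.const (P := P) (1 : 𝕜)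
  | succ n ih => simp only [pow_succ]; exact ih.mul hf

theorem AllLp.sum {ι : Type*} (s : Finset ι) {f : ι → Ω → 𝕜} (hf : ∀ i ∈ s, AllLp P (f i)) :
    AllLp P fun w => ∑ i ∈ s, f i w := fun p => memLp_finsetSum s fun i hi => hf i hi p

theorem AllLp.prod [IsFiniteMeasure P] {ι : Type*} (s : Finset ι) {f : ι → Ω → 𝕜}
    (hf : ∀ i ∈ s, AllLp P (f i)) : AllLp P fun w => ∏ i ∈ s, f i w := by
  classical
  induction s using Finset.induction_on with
  | empty => simpa using AllLp.const (P := P) (1 : 𝕜)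
  | insert i s hi ih =>
    simp only [Finset.prod_insert hi]
    exact (hf i (Finset.mem_insert_self i s)).mul
      (ih fun j hj => hf j (Finset.mem_insert_of_mem hj))

theorem AllLp.integrable {f : Ω → 𝕜} (hf : AllLp P f) : Integrable f P := by
  have := hf 1
  rw [Nat.cast_one] at this
  exact memLp_one_iff_integrable.mp this

theorem AllLp.norm {f : Ω → 𝕜} (hf : AllLp P f) : AllLp P fun w => ‖f w‖ := fun p => (hf p).norm

theorem AllLp.of_norm_le {𝕜' : Type*} [RCLike 𝕜'] {f : Ω → 𝕜} {g : Ω → 𝕜'} (hg : AllLp P g)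
    (hf : AEStronglyMeasurable f P) (h : ∀ w, ‖f w‖ ≤ ‖g w‖) : AllLp P f :=
  fun p => (hg p).mono hf (Filter.Eventually.of_forall h)

end AllLp

/-! ### Hypercontractivity -/

section Hyper

variable {Ω α : Type*} [MeasurableSpace Ω]

/-- An independent family of random variables whose moments are bounded by those of a centered
Gaussian of variance `v`. -/
structure GaussianLike (X : α → Ω → ℝ) (P : Measure Ω) (v : ℝ) : Prop where
  indep : iIndepFun X P
  measurable : ∀ i, Measurable (X i)
  allLp : ∀ i, AllLp P (X i)
  odd : ∀ i (j : ℕ), ∫ w, X i w ^ (2 * j + 1) ∂P = 0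
  even : ∀ i (j : ℕ), ∫ w, X i w ^ (2 * j) ∂P ≤ v ^ j * ((2 * j).factorial / (2 ^ j * j.factorial))

theorem pow_mul_pow_le_weighted {a b : ℝ} (ha : 0 ≤ a) (hb : 0 ≤ b) {j k : ℕ} (hk : 0 < k)
    (hj : j ≤ k) :
    a ^ j * b ^ (k - j) ≤ (j / k : ℝ) * a ^ k + ((k - j : ℕ) / k : ℝ) * b ^ k := by
  have hk' : (k : ℝ) ≠ 0 := by positivity
  have h := Real.geom_mean_le_arith_mean2_weighted (w₁ := j / k) (w₂ := (k - j : ℕ) / k)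
    (p₁ := a ^ k) (p₂ := b ^ k) (by positivity) (by positivity) (by positivity) (by positivity)
    (by rw [Nat.cast_sub hj]; field_simp; ring)
  rw [← Real.rpow_natCast a k, ← Real.rpow_natCast b k, ← Real.rpow_mul ha, ← Real.rpow_mul hb,
    mul_div_cancel₀ _ hk', mul_div_cancel₀ _ hk', Real.rpow_natCast, Real.rpow_natCast,
    Real.rpow_natCast, Real.rpow_natCast] at h
  exact h

/-- The factors are taken in consecutive pairs: `2k - 2j` is twice `k - j`, and its odd neighbour is
bounded by `2k`. -/
theorem descFactorial_two_mul_le (k j : ℕ) (hj : j ≤ k) :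
    (2 * k).descFactorial (2 * j) ≤ 2 ^ j * k.descFactorial j * (2 * k) ^ j := by
  induction j with
  | zero => simp
  | succ j ih =>
    have ih := ih (by omega)
    rw [show 2 * (j + 1) = 2 * j + 1 + 1 by ring, Nat.descFactorial_succ, Nat.descFactorial_succ,
      Nat.descFactorial_succ]
    calc (2 * k - (2 * j + 1)) * ((2 * k - 2 * j) * (2 * k).descFactorial (2 * j))
        ≤ (2 * k) * ((2 * (k - j)) * (2 ^ j * k.descFactorial j * (2 * k) ^ j)) := by
          gcongr
          · omega
          · omega
      _ = _ := by ring

/-- An even term of the binomial expansion of a `2k`-th power, weighted by a Gaussian moment,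
becomes a term of the expansion of a `k`-th power. This comparison closes the induction in
hypercontractivity. -/
theorem choose_mul_gaussian_moment_le (k j : ℕ) (hj : j ≤ k) :
    ((2 * k).choose (2 * j) : ℝ) * ((2 * j).factorial / (2 ^ j * j.factorial))
      ≤ (k.choose j) * (2 * k : ℝ) ^ j := by
  have h := descFactorial_two_mul_le k j hj
  rw [Nat.descFactorial_eq_factorial_mul_choose, Nat.descFactorial_eq_factorial_mul_choose] at h
  have h' : ((2 * j).factorial : ℝ) * (2 * k).choose (2 * j)
      ≤ 2 ^ j * (j.factorial * k.choose j) * (2 * k) ^ j := by exact_mod_cast h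
  rw [← mul_div_assoc, div_le_iff₀ (by positivity)]
  linarith

theorem sum_range_two_mul_add_one {M : Type*} [AddCommMonoid M] (f : ℕ → M) (k : ℕ)
    (hf : ∀ j, f (2 * j + 1) = 0) :
    ∑ m ∈ Finset.range (2 * k + 1), f m = ∑ j ∈ Finset.range (k + 1), f (2 * j) := by
  induction k with
  | zero => simp
  | succ k ih =>
    rw [show 2 * (k + 1) + 1 = 2 * k + 1 + 1 + 1 by ring, Finset.sum_range_succ,
      Finset.sum_range_succ, ih, Finset.sum_range_succ _ (k + 1), hf, add_zero]
    rfl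

variable {P : Measure Ω} [IsProbabilityMeasure P]

/-- This is Hölder's inequality with exponents `k/j` and `k/(k - j)`, obtained from the weighted
arithmetic-geometric inequality for `g²/A` and `h²/B`. -/
theorem integral_even_mul_even_le {g h : Ω → ℝ} (hg : AllLp P g) (hh : AllLp P h) {A B : ℝ}
    (hA : 0 < A) (hB : 0 < B) {k : ℕ} (hk : 0 < k) (hgA : ∫ w, g w ^ (2 * k) ∂P ≤ A ^ k)
    (hhB : ∫ w, h w ^ (2 * k) ∂P ≤ B ^ k) {j : ℕ} (hj : j ≤ k) :
    ∫ w, g w ^ (2 * j) * h w ^ (2 * (k - j)) ∂P ≤ A ^ j * B ^ (k - j) := by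
  have hpt : ∀ w, g w ^ (2 * j) * h w ^ (2 * (k - j)) ≤ A ^ j * B ^ (k - j)
      * ((j / k : ℝ) / A ^ k * g w ^ (2 * k) + ((k - j : ℕ) / k : ℝ) / B ^ k * h w ^ (2 * k)) := by
    intro w
    have := pow_mul_pow_le_weighted (a := g w ^ 2 / A) (b := h w ^ 2 / B) (by positivity)
      (by positivity) hk hj
    rw [div_pow, div_pow, div_pow, div_pow, ← pow_mul, ← pow_mul, ← pow_mul, ← pow_mul,
      div_mul_div_comm, div_le_iff₀ (by positivity)] at this
    refine this.trans (le_of_eq ?_)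
    ring
  have hk' : (k : ℝ) ≠ 0 := by positivity
  calc _ ≤ ∫ w, A ^ j * B ^ (k - j) * ((j / k : ℝ) / A ^ k * g w ^ (2 * k)
        + ((k - j : ℕ) / k : ℝ) / B ^ k * h w ^ (2 * k)) ∂P :=
        integral_mono ((hg.pow _).mul (hh.pow _)).integrable
          ((((hg.pow _).const_mul _).add ((hh.pow _).const_mul _)).const_mul _).integrable hpt
    _ = A ^ j * B ^ (k - j) * ((j / k : ℝ) / A ^ k * ∫ w, g w ^ (2 * k) ∂P
        + ((k - j : ℕ) / k : ℝ) / B ^ k * ∫ w, h w ^ (2 * k) ∂P) := by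
        rw [integral_const_mul, integral_add ((hg.pow _).const_mul _).integrable
          ((hh.pow _).const_mul _).integrable, integral_const_mul, integral_const_mul]
    _ ≤ A ^ j * B ^ (k - j) * ((j / k : ℝ) / A ^ k * A ^ k
        + ((k - j : ℕ) / k : ℝ) / B ^ k * B ^ k) := by gcongr
    _ = A ^ j * B ^ (k - j) := by
        rw [div_mul_cancel₀ _ (by positivity), div_mul_cancel₀ _ (by positivity), Nat.cast_sub hj,
          ← add_div, add_sub_cancel, div_self hk', mul_one]

/-- The one-variable step of hypercontractivity. -/
theorem integral_add_mul_pow_le {x g h : Ω → ℝ} (hx : AllLp P x) (hg : AllLp P g) (hh : AllLp P h)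
    (hind : ∀ m n : ℕ, ∫ w, x w ^ m * (g w ^ m * h w ^ n) ∂P
      = (∫ w, x w ^ m ∂P) * ∫ w, g w ^ m * h w ^ n ∂P) {v : ℝ} (hv : 0 ≤ v)
    (hodd : ∀ j : ℕ, ∫ w, x w ^ (2 * j + 1) ∂P = 0)
    (heven : ∀ j : ℕ, ∫ w, x w ^ (2 * j) ∂P ≤ v ^ j * ((2 * j).factorial / (2 ^ j * j.factorial)))
    {A B : ℝ} (hA : 0 ≤ A) (hB : 0 ≤ B) {k : ℕ} (hk : 0 < k)
    (hgA : ∫ w, g w ^ (2 * k) ∂P ≤ A ^ k) (hhB : ∫ w, h w ^ (2 * k) ∂P ≤ B ^ k) :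
    ∫ w, (h w + x w * g w) ^ (2 * k) ∂P ≤ (B + 2 * k * v * A) ^ k := by
  -- The normalization divides by `A` and `B`; vanishing values are reached by adding `η` to both
  -- and letting it tend to zero.
  have main : ∀ A B : ℝ, 0 < A → 0 < B → ∫ w, g w ^ (2 * k) ∂P ≤ A ^ k →
      ∫ w, h w ^ (2 * k) ∂P ≤ B ^ k →
      ∫ w, (h w + x w * g w) ^ (2 * k) ∂P ≤ (B + 2 * k * v * A) ^ k := by
    intro A B hA hB hgA hhB
    have hexp : ∀ w, (h w + x w * g w) ^ (2 * k) = ∑ m ∈ Finset.range (2 * k + 1),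
        ((2 * k).choose m : ℝ) * (x w ^ m * (g w ^ m * h w ^ (2 * k - m))) := by
      intro w
      rw [add_comm, add_pow]
      refine Finset.sum_congr rfl fun m _ => ?_
      rw [mul_pow]; ring
    simp only [hexp]
    rw [integral_finsetSum _ fun m _ =>
      (((hx.pow _).mul ((hg.pow _).mul (hh.pow _))).const_mul _).integrable]
    simp only [integral_const_mul, hind]
    -- Odd powers of `x` integrate to zero, and the even terms are matched one by one with the
    -- expansion of `(2kvA + B)^k`.
    rw [sum_range_two_mul_add_one _ k (fun j => by rw [hodd]; ring), add_comm B, add_pow]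
    refine Finset.sum_le_sum fun j hj => ?_
    have hj' : j ≤ k := by rw [Finset.mem_range] at hj; omega
    rw [show 2 * k - 2 * j = 2 * (k - j) by omega]
    have h1 := integral_even_mul_even_le hg hh hA hB hk hgA hhB hj'
    have h0 : 0 ≤ ∫ w, g w ^ (2 * j) * h w ^ (2 * (k - j)) ∂P :=
      integral_nonneg fun w => mul_nonneg ((even_two_mul j).pow_nonneg _)
        ((even_two_mul (k - j)).pow_nonneg _)
    calc ((2 * k).choose (2 * j) : ℝ) * ((∫ w, x w ^ (2 * j) ∂P)
          * ∫ w, g w ^ (2 * j) * h w ^ (2 * (k - j)) ∂P)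
        ≤ ((2 * k).choose (2 * j) : ℝ) * ((v ^ j * ((2 * j).factorial / (2 ^ j * j.factorial)))
          * (A ^ j * B ^ (k - j))) := by
          refine mul_le_mul_of_nonneg_left ?_ (by positivity)
          exact mul_le_mul (heven j) h1 h0 (by positivity)
      _ = (((2 * k).choose (2 * j) : ℝ) * ((2 * j).factorial / (2 ^ j * j.factorial)))
          * (v ^ j * (A ^ j * B ^ (k - j))) := by ring
      _ ≤ ((k.choose j) * (2 * k : ℝ) ^ j) * (v ^ j * (A ^ j * B ^ (k - j))) :=
          mul_le_mul_of_nonneg_right (choose_mul_gaussian_moment_le k j hj') (by positivity)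
      _ = _ := by rw [mul_pow, mul_pow, mul_pow]; ring
  have hlim : Filter.Tendsto (fun η : ℝ => (B + η + 2 * k * v * (A + η)) ^ k)
      (nhdsWithin 0 (Ioi 0)) (nhds ((B + 2 * k * v * A) ^ k)) := by
    have : Continuous fun η : ℝ => (B + η + 2 * k * v * (A + η)) ^ k := by fun_prop
    have h := this.tendsto 0
    simp only [add_zero] at h
    exact h.mono_left nhdsWithin_le_nhds
  refine ge_of_tendsto hlim (Filter.eventually_of_mem self_mem_nhdsWithin fun η hη => ?_)
  have hη' : (0 : ℝ) < η := hη
  refine main (A + η) (B + η) (by linarith) (by linarith) (hgA.trans ?_) (hhB.trans ?_) <;>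
  · gcongr; linarith

variable [DecidableEq α] {X : α → Ω → ℝ} {v : ℝ}

theorem GaussianLike.integral_pow_mul (hX : GaussianLike X P v) {i : α} {s : Finset α}
    (hi : i ∉ s) {F : (α → ℝ) → ℝ} (hF : Measurable F)
    (hs : ∀ x y : α → ℝ, (∀ j ∈ s, x j = y j) → F x = F y) (m : ℕ) :
    ∫ w, X i w ^ m * F (fun j => X j w) ∂P
      = (∫ w, X i w ^ m ∂P) * ∫ w, F (fun j => X j w) ∂P := by
  have hind := hX.indep.indepFun_finset {i} s (by simpa using hi) hX.measurable
  -- Independence concerns the variables in `s` alone; as `F` ignores the other coordinates they may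
  -- be filled with zeros.
  set ext : (s → ℝ) → α → ℝ := fun y j => if h : j ∈ s then y ⟨j, h⟩ else 0 with hext
  have hextm : Measurable ext := by
    refine measurable_pi_lambda _ fun j => ?_
    by_cases h : j ∈ s
    · simp only [hext, h, dif_pos]; exact measurable_pi_apply _
    · simp only [hext, h]; exact measurable_const
  have hφ : Measurable fun y : ({i} : Finset α) → ℝ => y ⟨i, by simp⟩ ^ m := by fun_prop
  have h2 := hind.comp (ψ := fun y => F (ext y)) hφ (hF.comp hextm)
  have hFe : ∀ w, F (ext fun j : s => X j w) = F (fun j => X j w) := fun w =>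
    hs _ _ fun j hj => by simp only [hext, hj, dif_pos]
  have h3 := h2.integral_fun_mul_eq_mul_integral
    (hφ.comp (measurable_pi_lambda _ fun j => hX.measurable j)).aestronglyMeasurable
    ((hF.comp hextm).comp (measurable_pi_lambda _ fun j => hX.measurable j)).aestronglyMeasurable
  simpa only [Function.comp_apply, hFe] using h3

/-- Hypercontractivity for multilinear polynomials. -/
theorem GaussianLike.integral_multilinear_pow_le (hX : GaussianLike X P v) (hv : 0 ≤ v) {k : ℕ}
    (hk : 0 < k) (s : Finset α) (a : Finset α → ℝ) :
    ∫ w, (∑ S ∈ s.powerset, a S * ∏ i ∈ S, X i w) ^ (2 * k) ∂P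
      ≤ (∑ S ∈ s.powerset, (2 * k * v) ^ S.card * a S ^ 2) ^ k := by
  induction s using Finset.induction_on generalizing a with
  | empty => simp [pow_mul]
  | insert i s hi ih =>
    have hins : ∀ S ∈ s.powerset, i ∉ S := fun S hS h => hi (Finset.mem_powerset.mp hS h)
    -- A multilinear polynomial is affine in the new variable, `h + X i · g`, with `g` and `h`
    -- depending only on the variables in `s`.
    have e1 : ∀ w, ∑ S ∈ (insert i s).powerset, a S * ∏ j ∈ S, X j w
        = (∑ S ∈ s.powerset, a S * ∏ j ∈ S, X j w)
          + X i w * ∑ S ∈ s.powerset, a (insert i S) * ∏ j ∈ S, X j w := by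
      intro w
      rw [Finset.sum_powerset_insert hi, Finset.mul_sum]
      congr 1
      refine Finset.sum_congr rfl fun S hS => ?_
      rw [Finset.prod_insert (hins S hS)]; ring
    have e2 : ∑ S ∈ (insert i s).powerset, (2 * k * v) ^ S.card * a S ^ 2
        = (∑ S ∈ s.powerset, (2 * k * v) ^ S.card * a S ^ 2)
          + 2 * k * v * ∑ S ∈ s.powerset, (2 * k * v) ^ S.card * a (insert i S) ^ 2 := by
      rw [Finset.sum_powerset_insert hi, Finset.mul_sum]
      congr 1
      refine Finset.sum_congr rfl fun S hS => ?_
      rw [Finset.card_insert_of_notMem (hins S hS)]; ring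
    simp only [e1, e2]
    have hpoly : ∀ b : Finset α → ℝ, AllLp P fun w => ∑ S ∈ s.powerset, b S * ∏ j ∈ S, X j w :=
      fun b => AllLp.sum _ fun S _ => (AllLp.prod _ fun j _ => hX.allLp j).const_mul _
    refine integral_add_mul_pow_le (hX.allLp i) (hpoly _) (hpoly _) (fun m n => ?_) hv (hX.odd i)
      (hX.even i) (Finset.sum_nonneg fun S _ => by positivity)
      (Finset.sum_nonneg fun S _ => by positivity) hk (ih _) (ih _)
    refine hX.integral_pow_mul hi (F := fun x =>
      (∑ S ∈ s.powerset, a (insert i S) * ∏ j ∈ S, x j) ^ m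
        * (∑ S ∈ s.powerset, a S * ∏ j ∈ S, x j) ^ n) (by fun_prop) (fun x y hxy => ?_) m
    have : ∀ S ∈ s.powerset, ∏ j ∈ S, x j = ∏ j ∈ S, y j := fun S hS =>
      Finset.prod_congr rfl fun j hj => hxy j (Finset.mem_powerset.mp hS hj)
    have hb : ∀ b : Finset α → ℝ, ∑ S ∈ s.powerset, b S * ∏ j ∈ S, x j
        = ∑ S ∈ s.powerset, b S * ∏ j ∈ S, y j := fun b =>
      Finset.sum_congr rfl fun S hS => by rw [this S hS]
    simp only [hb]

/-- Hypercontractivity for sums of distinct multilinear monomials. -/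
theorem GaussianLike.integral_sum_monomial_pow_le (hX : GaussianLike X P v) (hv : 0 ≤ v) {k : ℕ}
    (hk : 0 < k) {τ : Type*} (T : Finset τ) (S : τ → Finset α) (hS : Set.InjOn S T) (c : τ → ℝ) :
    ∫ w, (∑ t ∈ T, c t * ∏ i ∈ S t, X i w) ^ (2 * k) ∂P
      ≤ (∑ t ∈ T, (2 * k * v) ^ (S t).card * c t ^ 2) ^ k := by
  classical
  set s : Finset α := T.biUnion S
  have hsub : T.image S ⊆ s.powerset := by
    intro U hU
    obtain ⟨t, ht, rfl⟩ := Finset.mem_image.mp hU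
    exact Finset.mem_powerset.mpr (Finset.subset_biUnion_of_mem S ht)
  -- Injectivity of `S` on `T` reduces each of these sums to at most one coefficient, so no squares
  -- of sums appear.
  set a : Finset α → ℝ := fun U => ∑ t ∈ T with S t = U, c t with ha
  have hat : ∀ t ∈ T, a (S t) = c t := by
    intro t ht
    rw [ha]
    refine Finset.sum_eq_single_of_mem t (by simp [ht]) fun t' ht' hne => ?_
    rw [Finset.mem_filter] at ht'
    exact absurd (hS ht'.1 ht ht'.2) hne
  have ha0 : ∀ U ∉ T.image S, a U = 0 := by
    intro U hU
    refine Finset.sum_eq_zero fun t ht => ?_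
    rw [Finset.mem_filter] at ht
    exact absurd (Finset.mem_image.mpr ⟨t, ht.1, ht.2⟩) hU
  have h := hX.integral_multilinear_pow_le hv hk s a
  have e1 : ∀ w, ∑ U ∈ s.powerset, a U * ∏ i ∈ U, X i w = ∑ t ∈ T, c t * ∏ i ∈ S t, X i w := by
    intro w
    rw [← Finset.sum_subset hsub (fun U _ hU => by rw [ha0 U hU, zero_mul]),
      Finset.sum_image hS]
    exact Finset.sum_congr rfl fun t ht => by rw [hat t ht]
  have e2 : ∑ U ∈ s.powerset, (2 * k * v) ^ U.card * a U ^ 2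
      = ∑ t ∈ T, (2 * k * v) ^ (S t).card * c t ^ 2 := by
    rw [← Finset.sum_subset hsub (fun U _ hU => by rw [ha0 U hU]; ring), Finset.sum_image hS]
    exact Finset.sum_congr rfl fun t ht => by rw [hat t ht]
  simpa only [e1, e2] using h

end Hyper

/-! ### The sample space -/

section SampleSpace

open scoped NNReal

variable (κ : ℝ)

/-- The variance of the real and imaginary parts of `gₙ`. -/
def sampleVar : ℝ≥0 := Real.toNNReal (1 / (8 * Real.pi * κ))

instance : IsProbabilityMeasure (sampleLaw κ) := by
  unfold sampleLaw; infer_instance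

/-- The real and imaginary parts of `gₙ`. -/
def coord (i : ℕ × Bool) (g : Sample) : ℝ := if i.2 then (g i.1).2 else (g i.1).1

theorem measurable_coord (i : ℕ × Bool) : Measurable (coord i) := by
  rcases i with ⟨n, b⟩
  cases b
  · exact (measurable_pi_apply n).fst
  · exact (measurable_pi_apply n).snd

theorem map_eval_sampleLaw (n : ℕ) : (sampleLaw κ).map (fun g => g n)
    = (gaussianReal 0 (sampleVar κ)).prod (gaussianReal 0 (sampleVar κ)) :=
  Measure.infinitePi_map_eval _ n

theorem map_coord (i : ℕ × Bool) :
    (sampleLaw κ).map (coord i) = gaussianReal 0 (sampleVar κ) := by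
  rcases i with ⟨n, b⟩
  cases b
  · have : coord (n, false) = Prod.fst ∘ fun g : Sample => g n := rfl
    rw [this, ← Measure.map_map measurable_fst (measurable_pi_apply n), map_eval_sampleLaw,
      Measure.map_fst_prod]
    simp
  · have : coord (n, true) = Prod.snd ∘ fun g : Sample => g n := rfl
    rw [this, ← Measure.map_map measurable_snd (measurable_pi_apply n), map_eval_sampleLaw,
      Measure.map_snd_prod]
    simp

theorem indepFun_coord (n : ℕ) : IndepFun (coord (n, false)) (coord (n, true)) (sampleLaw κ) := by
  rw [indepFun_iff_map_prod_eq_prod_map_map (measurable_coord _).aemeasurable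
    (measurable_coord _).aemeasurable, map_coord, map_coord, ← map_eval_sampleLaw κ n]
  rfl

theorem iIndepFun_bool {Ω : Type*} [MeasurableSpace Ω] {P : Measure Ω} [IsProbabilityMeasure P]
    {X : Bool → Ω → ℝ} (h : IndepFun (X false) (X true) P) : iIndepFun X P := by
  classical
  rw [iIndepFun_iff_measure_inter_preimage_eq_mul]
  intro S sets hsets
  set A : Bool → Set ℝ := fun i => if i ∈ S then sets i else univ with hA
  have hAm : ∀ i, MeasurableSet (A i) := fun i => by
    simp only [hA]; split_ifs with hi
    · exact hsets i hi
    · exact MeasurableSet.univ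
  have e1 : ⋂ i ∈ S, X i ⁻¹' sets i = X false ⁻¹' A false ∩ X true ⁻¹' A true := by
    ext w
    simp only [hA, mem_iInter, mem_inter_iff, mem_preimage]
    constructor
    · intro hw
      constructor <;> split_ifs with hi <;> first | exact hw _ hi | trivial
    · rintro ⟨h1, h2⟩ i hi
      cases i
      · rwa [if_pos hi] at h1
      · rwa [if_pos hi] at h2
  have e2 : ∏ i ∈ S, P (X i ⁻¹' sets i) = ∏ i, P (X i ⁻¹' A i) := by
    rw [← Finset.prod_subset (Finset.subset_univ S)]
    · refine Finset.prod_congr rfl fun i hi => by simp only [hA, if_pos hi]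
    · intro i _ hi
      simp only [hA, if_neg hi, preimage_univ, measure_univ]
  rw [e1, e2, h.measure_inter_preimage_eq_mul _ _ (hAm _) (hAm _), Fintype.prod_bool, mul_comm]

theorem iIndepFun_coord : iIndepFun coord (sampleLaw κ) := by
  have h := iIndepFun_uncurry' (P := sampleLaw κ) (X := fun (n : ℕ) (b : Bool) => coord (n, b))
    (fun n b => measurable_coord _) ?_ fun n => iIndepFun_bool (indepFun_coord κ n)
  · exact h
  · have h1 := iIndepFun_infinitePi (P := fun _ : ℕ => (gaussianReal 0 (sampleVar κ)).prod
      (gaussianReal 0 (sampleVar κ))) (X := fun _ (z : ℝ × ℝ) (b : Bool) => if b then z.2 else z.1)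
      (fun _ => measurable_pi_lambda _ fun b => by cases b <;> simp <;> fun_prop)
    exact h1

theorem integral_coord_pow (i : ℕ × Bool) (m : ℕ) :
    ∫ g, coord i g ^ m ∂sampleLaw κ = ∫ x, x ^ m ∂gaussianReal 0 (sampleVar κ) := by
  rw [← map_coord κ i, integral_map (measurable_coord i).aemeasurable (by fun_prop)]

theorem allLp_coord (i : ℕ × Bool) : AllLp (sampleLaw κ) (coord i) := by
  intro p
  have h : MemLp id p ((sampleLaw κ).map (coord i)) := by
    rw [map_coord]; exact memLp_id_gaussianReal' _ (by simp)
  exact (memLp_map_measure_iff (by fun_prop) (measurable_coord i).aemeasurable).mp h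

theorem gaussian_moment_odd (v : ℝ≥0) (j : ℕ) : ∫ x, x ^ (2 * j + 1) ∂gaussianReal 0 v = 0 := by
  have h : (gaussianReal 0 v).map (fun x => -x) = gaussianReal 0 v := by
    rw [gaussianReal_map_neg, neg_zero]
  have h2 : ∫ x, x ^ (2 * j + 1) ∂gaussianReal 0 v = ∫ x, (-x) ^ (2 * j + 1) ∂gaussianReal 0 v := by
    conv_lhs => rw [← h]
    rw [integral_map (by fun_prop) (by fun_prop)]
  simp only [Odd.neg_pow ⟨j, rfl⟩, integral_neg] at h2
  linarith

/-- A lossy bound suffices: `x^(2j) ≤ (2j)!/t^(2j) · (exp(tx) + exp(-tx))`, with `t² = 2j/v`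
minimizing `exp(t²v/2)/t^(2j)`. The loss `2 exp(j) ≤ 6^j` is absorbed by inflating the variance to
`6v`. -/
theorem gaussian_moment_even (v : ℝ≥0) (j : ℕ) :
    ∫ x, x ^ (2 * j) ∂gaussianReal 0 v
      ≤ (6 * v) ^ j * ((2 * j).factorial / (2 ^ j * j.factorial)) := by
  rcases Nat.eq_zero_or_pos j with rfl | hj
  · simp
  rcases eq_or_ne v 0 with rfl | hv
  · simp [gaussianReal_zero_var, hj.ne']
  have hv0 : (0 : ℝ) < v := lt_of_le_of_ne v.2 (by exact_mod_cast hv.symm)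
  set t : ℝ := Real.sqrt (2 * j / v) with ht
  have hj0 : (0 : ℝ) < j := by exact_mod_cast hj
  have ht2 : t ^ 2 = 2 * j / v := Real.sq_sqrt (by positivity)
  have hpt : ∀ x : ℝ, x ^ (2 * j) ≤ (2 * j).factorial / t ^ (2 * j)
      * (Real.exp (t * x) + Real.exp ((-t) * x)) := by
    intro x
    have h1 := Real.pow_div_factorial_le_exp (x := |t * x|) (abs_nonneg _) (2 * j)
    have h2 : Real.exp |t * x| ≤ Real.exp (t * x) + Real.exp ((-t) * x) := by
      rcases abs_cases (t * x) with ⟨h, _⟩ | ⟨h, _⟩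
      · rw [h]; linarith [Real.exp_pos ((-t) * x)]
      · rw [h, ← neg_mul]; linarith [Real.exp_pos (t * x)]
    rw [Even.pow_abs (even_two_mul j), div_le_iff₀ (by positivity), mul_pow] at h1
    have htp : 0 < t ^ (2 * j) := by rw [pow_mul, ht2]; positivity
    rw [div_mul_eq_mul_div, le_div_iff₀ htp]
    nlinarith [mul_le_mul_of_nonneg_right h2 (Nat.cast_nonneg (α := ℝ) (2 * j).factorial)]
  have hmgf : ∀ s : ℝ, s ^ 2 = t ^ 2 → ∫ x, Real.exp (s * x) ∂gaussianReal 0 v = Real.exp j := by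
    intro s hs
    have := congrFun (mgf_id_gaussianReal (μ := 0) (v := v)) s
    rw [mgf] at this
    simp only [id] at this
    rw [this, hs, ht2]
    congr 1; field_simp; ring
  calc ∫ x, x ^ (2 * j) ∂gaussianReal 0 v
      ≤ ∫ x, (2 * j).factorial / t ^ (2 * j) * (Real.exp (t * x) + Real.exp ((-t) * x))
          ∂gaussianReal 0 v := by
        refine integral_mono ?_ ?_ hpt
        · exact (AllLp.pow (f := id) (fun p => memLp_id_gaussianReal' _ (by simp)) (2 * j)).integrable
        · exact ((integrable_exp_mul_gaussianReal t).add
            (integrable_exp_mul_gaussianReal (-t))).const_mul _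
    _ = (2 * j).factorial / t ^ (2 * j) * (2 * Real.exp j) := by
        rw [integral_const_mul, integral_add (integrable_exp_mul_gaussianReal t)
          (integrable_exp_mul_gaussianReal (-t)), hmgf t rfl, hmgf (-t) (by ring)]
        ring
    _ = (2 * j).factorial * ((v : ℝ) ^ j / (2 ^ j * j ^ j) * (2 * Real.exp j)) := by
        rw [pow_mul t 2 j, ht2, div_pow, mul_pow]; field_simp
    _ ≤ (2 * j).factorial * ((6 * v) ^ j / (2 ^ j * j.factorial)) := by
        refine mul_le_mul_of_nonneg_left ?_ (by positivity)
        have h1 : 2 * Real.exp j ≤ 6 ^ j := by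
          have : Real.exp j = Real.exp 1 ^ j := by rw [← Real.exp_nat_mul, mul_one]
          rw [this, show (6 : ℝ) = 2 * 3 by norm_num, mul_pow]
          have h3 : Real.exp 1 ^ j ≤ 3 ^ j := by
            gcongr; linarith [Real.exp_one_lt_d9]
          have h4 : (2 : ℝ) ≤ 2 ^ j := by
            calc (2 : ℝ) = 2 ^ 1 := by norm_num
              _ ≤ 2 ^ j := pow_le_pow_right₀ (by norm_num) hj
          exact mul_le_mul h4 h3 (by positivity) (by positivity)
        have h2 : (j.factorial : ℝ) ≤ (j : ℝ) ^ j := by exact_mod_cast Nat.factorial_le_pow j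
        calc (v : ℝ) ^ j / (2 ^ j * j ^ j) * (2 * Real.exp j)
            ≤ (v : ℝ) ^ j / (2 ^ j * j.factorial) * 6 ^ j := by gcongr
          _ = _ := by rw [mul_pow]; ring
    _ = _ := by ring

theorem gaussianLike_coord : GaussianLike coord (sampleLaw κ) (6 * sampleVar κ) where
  indep := iIndepFun_coord κ
  measurable := measurable_coord
  allLp := allLp_coord κ
  odd i j := by rw [integral_coord_pow, gaussian_moment_odd]
  even i j := by rw [integral_coord_pow]; exact gaussian_moment_even _ j

end SampleSpace

end BenjaminOno

namespace BenjaminOno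

/-! ### Rotation invariance -/

section Rotation

open scoped NNReal

/-- The rotation of angle `a` of the plane. -/
def planeRot (a : ℝ) : ℝ × ℝ →L[ℝ] ℝ × ℝ :=
  (Real.cos a • ContinuousLinearMap.fst ℝ ℝ ℝ - Real.sin a • ContinuousLinearMap.snd ℝ ℝ ℝ).prod
    (Real.sin a • ContinuousLinearMap.fst ℝ ℝ ℝ + Real.cos a • ContinuousLinearMap.snd ℝ ℝ ℝ)

theorem planeRot_apply (a : ℝ) (x : ℝ × ℝ) :
    planeRot a x = (Real.cos a * x.1 - Real.sin a * x.2, Real.sin a * x.1 + Real.cos a * x.2) := rfl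

theorem charFunDual_gaussian_prod (v : ℝ≥0) (L : StrongDual ℝ (ℝ × ℝ)) :
    charFunDual ((gaussianReal 0 v).prod (gaussianReal 0 v)) L
      = Complex.exp (-(v * ((L (1, 0) : ℝ) ^ 2 + (L (0, 1) : ℝ) ^ 2) / 2 : ℝ)) := by
  have h : ∀ M : StrongDual ℝ ℝ, charFunDual (gaussianReal 0 v) M
      = Complex.exp (-(v * (M 1 : ℝ) ^ 2 / 2 : ℝ)) := by
    intro M
    have h1 : charFunDual (gaussianReal 0 v) M = charFun (gaussianReal 0 v) (M 1) := by
      rw [charFunDual_apply, charFun_apply_real]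
      refine integral_congr_ae (Filter.Eventually.of_forall fun x => ?_)
      have : M x = M 1 * x := by
        have := M.map_smul x 1
        simp only [smul_eq_mul, mul_one] at this
        rw [this, mul_comm]
      simp only [this]
      push_cast
      ring_nf
    rw [h1, charFun_gaussianReal]
    congr 1
    push_cast
    ring
  rw [charFunDual_prod, h, h, ← Complex.exp_add]
  congr 1
  simp only [ContinuousLinearMap.comp_apply, ContinuousLinearMap.inl_apply,
    ContinuousLinearMap.inr_apply]
  push_cast
  ring

/-- The characteristic function depends only on the Euclidean length of the dual vector. The
invariance serves twice: for the orthogonality of monomials and for the linear evolution of the high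
modes. -/
theorem map_planeRot (v : ℝ≥0) (a : ℝ) :
    ((gaussianReal 0 v).prod (gaussianReal 0 v)).map (planeRot a)
      = (gaussianReal 0 v).prod (gaussianReal 0 v) := by
  haveI : IsProbabilityMeasure (((gaussianReal 0 v).prod (gaussianReal 0 v)).map (planeRot a)) :=
    Measure.isProbabilityMeasure_map (planeRot a).continuous.measurable.aemeasurable
  refine Measure.ext_of_charFunDual (funext fun L => ?_)
  rw [charFunDual_map, charFunDual_gaussian_prod, charFunDual_gaussian_prod]
  congr 3
  have h : ∀ x : ℝ × ℝ, L x = x.1 * L (1, 0) + x.2 * L (0, 1) := by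
    intro x
    rw [← smul_eq_mul, ← smul_eq_mul, ← L.map_smul, ← L.map_smul, ← L.map_add]
    congr 1
    ext <;> simp
  simp only [ContinuousLinearMap.comp_apply, planeRot_apply]
  rw [h (_, _), h (_ - _, _)]
  have := Real.sin_sq_add_cos_sq a
  simp only [mul_one, mul_zero, sub_zero, zero_sub, zero_add, add_zero]
  linear_combination (v : ℝ) / 2 * (L (1, 0) ^ 2 + L (0, 1) ^ 2) * this

/-- The rotation of `gₙ` by the angle `φ n`. -/
def sampleRot (φ : ℕ → ℝ) (g : Sample) : Sample := fun n => planeRot (φ n) (g n)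

theorem measurePreserving_sampleRot (κ : ℝ) (φ : ℕ → ℝ) :
    MeasurePreserving (sampleRot φ) (sampleLaw κ) (sampleLaw κ) := by
  refine ⟨measurable_pi_lambda _ fun n =>
    (planeRot (φ n)).continuous.measurable.comp (measurable_pi_apply n), ?_⟩
  have := Measure.infinitePi_map_pi (μ := fun _ : ℕ => (gaussianReal 0 (sampleVar κ)).prod
    (gaussianReal 0 (sampleVar κ))) (f := fun n => planeRot (φ n))
    (fun n => (planeRot (φ n)).continuous.measurable)
  simp only [map_planeRot] at this
  exact this

end Rotation

/-! ### The complex Gaussians -/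

/-- The random variable `gₙ`, with `g_{-n} = conj gₙ`. -/
def gauss (n : ℤ) (g : Sample) : ℂ :=
  if 0 < n then ⟨(g n.natAbs).1, (g n.natAbs).2⟩
  else if n < 0 then conj (⟨(g n.natAbs).1, (g n.natAbs).2⟩ : ℂ) else 0

theorem seriesCoeff_eq (g : Sample) (n : ℤ) : seriesCoeff g n = gauss n g / (n.natAbs : ℂ) := by
  unfold seriesCoeff gauss
  split_ifs <;> simp

theorem gauss_natCast {n : ℕ} (hn : 0 < n) (g : Sample) : gauss n g = ⟨(g n).1, (g n).2⟩ := by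
  simp [gauss, hn]

theorem gauss_neg (n : ℤ) (g : Sample) : gauss (-n) g = conj (gauss n g) := by
  unfold gauss
  rcases lt_trichotomy n 0 with h | h | h
  · rw [if_pos (by omega), if_neg (by omega), if_pos h, Int.natAbs_neg, Complex.conj_conj]
  · subst h; simp
  · rw [if_neg (by omega), if_pos (by omega), if_pos h, Int.natAbs_neg]

theorem normSq_gauss {n : ℤ} (hn : n ≠ 0) (g : Sample) :
    ‖gauss n g‖ ^ 2 = (g n.natAbs).1 ^ 2 + (g n.natAbs).2 ^ 2 := by
  have key : ∀ n : ℤ, 0 < n → ‖gauss n g‖ ^ 2 = (g n.natAbs).1 ^ 2 + (g n.natAbs).2 ^ 2 := by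
    intro n hn
    rw [gauss, if_pos hn, ← Complex.normSq_eq_norm_sq, Complex.normSq_mk]
    ring
  rcases lt_or_gt_of_ne hn with h | h
  · rw [← neg_neg n, gauss_neg, RCLike.norm_conj, key (-n) (by omega), Int.natAbs_neg,
      Int.natAbs_neg, Int.natAbs_neg]
  · exact key n h

theorem measurable_gauss (n : ℤ) : Measurable (gauss n) := by
  have h : Measurable fun g : Sample => (⟨(g n.natAbs).1, (g n.natAbs).2⟩ : ℂ) := by
    have : (fun g : Sample => (⟨(g n.natAbs).1, (g n.natAbs).2⟩ : ℂ))
        = Complex.measurableEquivRealProd.symm ∘ fun g : Sample => g n.natAbs := rfl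
    rw [this]
    exact Complex.measurableEquivRealProd.symm.measurable.comp (measurable_pi_apply _)
  unfold gauss
  split_ifs
  · exact h
  · exact (Complex.continuous_conj.measurable).comp h
  · exact measurable_const

theorem norm_gauss_le (n : ℤ) (g : Sample) :
    ‖gauss n g‖ ≤ ‖‖coord (n.natAbs, false) g‖ + ‖coord (n.natAbs, true) g‖‖ := by
  rw [Real.norm_of_nonneg (add_nonneg (norm_nonneg _) (norm_nonneg _))]
  rcases eq_or_ne n 0 with h | h
  · subst h
    simp only [gauss, lt_irrefl, if_false, norm_zero]
    positivity
  · refine abs_le_of_sq_le_sq' ?_ (by positivity) |>.2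
    rw [normSq_gauss h]
    have h1 : (g n.natAbs).1 = coord (n.natAbs, false) g := rfl
    have h2 : (g n.natAbs).2 = coord (n.natAbs, true) g := rfl
    rw [h1, h2, ← sq_abs (coord (n.natAbs, false) g), ← sq_abs (coord (n.natAbs, true) g),
      Real.norm_eq_abs, Real.norm_eq_abs]
    nlinarith [abs_nonneg (coord (n.natAbs, false) g), abs_nonneg (coord (n.natAbs, true) g)]

theorem allLp_gauss (κ : ℝ) (n : ℤ) : AllLp (sampleLaw κ) (gauss n) :=
  ((allLp_coord κ _).norm.add (allLp_coord κ _).norm).of_norm_le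
    (measurable_gauss n).aestronglyMeasurable (norm_gauss_le n)

theorem gauss_sampleRot (φ : ℕ → ℝ) (n : ℤ) (g : Sample) :
    gauss n (sampleRot φ g) = Complex.exp (Complex.I * (n.sign * φ n.natAbs)) * gauss n g := by
  have key : ∀ n : ℤ, 0 < n → gauss n (sampleRot φ g)
      = Complex.exp (Complex.I * (n.sign * φ n.natAbs)) * gauss n g := by
    intro n hn
    rw [gauss, gauss, if_pos hn, if_pos hn, Int.sign_eq_one_of_pos hn, Int.cast_one, one_mul,
      mul_comm Complex.I, Complex.exp_mul_I, sampleRot, planeRot_apply]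
    apply Complex.ext <;> simp [Complex.cos_ofReal_re, Complex.sin_ofReal_re] <;> ring
  rcases lt_trichotomy n 0 with h | h | h
  · obtain ⟨m, rfl⟩ : ∃ m, n = -m := ⟨-n, by ring⟩
    rw [gauss_neg, gauss_neg, key m (by omega), map_mul, ← Complex.exp_conj, Int.sign_neg,
      Int.natAbs_neg]
    simp
  · subst h; simp [gauss]
  · exact key n h

theorem integral_norm_gauss_pow_le (κ : ℝ) (m : ℕ) : ∃ C, 0 ≤ C ∧ ∀ n : ℤ,
    ∫ g, ‖gauss n g‖ ^ m ∂sampleLaw κ ≤ C := by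
  set A : ℝ := ∫ x, ‖x‖ ^ m ∂gaussianReal 0 (sampleVar κ) with hA
  have hA' : ∀ i, ∫ g, ‖coord i g‖ ^ m ∂sampleLaw κ = A := by
    intro i
    rw [hA, ← map_coord κ i, integral_map (measurable_coord i).aemeasurable (by fun_prop)]
  have hA0 : 0 ≤ A := integral_nonneg fun x => by positivity
  refine ⟨2 ^ (m - 1) * (A + A), by positivity, fun n => ?_⟩
  have hAA : A + A = ∫ g, ‖coord (n.natAbs, false) g‖ ^ m ∂sampleLaw κ
      + ∫ g, ‖coord (n.natAbs, true) g‖ ^ m ∂sampleLaw κ := by rw [hA', hA']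
  rw [hAA]
  have hi : ∀ i, Integrable (fun g => ‖coord i g‖ ^ m) (sampleLaw κ) := fun i =>
    ((allLp_coord κ i).norm.pow m).integrable
  rw [← integral_add (hi _) (hi _), ← integral_const_mul]
  refine integral_mono ((allLp_gauss κ n).norm.pow m).integrable
    (((hi _).add (hi _)).const_mul _) fun g => ?_
  have h := norm_gauss_le n g
  rw [Real.norm_of_nonneg (add_nonneg (norm_nonneg _) (norm_nonneg _))] at h
  exact (pow_le_pow_left₀ (norm_nonneg _) h m).trans
    (add_pow_le (norm_nonneg _) (norm_nonneg _) m)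

/-! ### Orthogonality of monomials -/

section Orthogonality

variable (κ : ℝ) {d : ℕ}

/-- The monomial `g_{n₁} ⋯ g_{n_d}`. -/
def monomial (n : Fin d → ℤ) (g : Sample) : ℂ := ∏ i, gauss (n i) g

theorem allLp_monomial (n : Fin d → ℤ) : AllLp (sampleLaw κ) (monomial n) :=
  AllLp.prod _ fun i _ => allLp_gauss κ (n i)

/-- The signed multiplicity of the frequency `k`. -/
def signature (n : Fin d → ℤ) (k : ℕ) : ℤ := ∑ i, if (n i).natAbs = k then (n i).sign else 0

theorem AllLp.conj {Ω : Type*} [MeasurableSpace Ω] {P : Measure Ω} {f : Ω → ℂ} (hf : AllLp P f) :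
    AllLp P fun w => conj (f w) :=
  hf.of_norm_le (Complex.continuous_conj.comp_aestronglyMeasurable (hf 0).1) fun w => by simp

theorem monomial_sampleRot (n : Fin d → ℤ) (k : ℕ) (a : ℝ) (g : Sample) :
    monomial n (sampleRot (Pi.single k a) g)
      = Complex.exp (Complex.I * (signature n k * a)) * monomial n g := by
  simp only [monomial, gauss_sampleRot, Finset.prod_mul_distrib, ← Complex.exp_sum, signature]
  congr 2
  rw [← Finset.mul_sum]
  push_cast
  rw [Finset.sum_mul]
  congr 1
  refine Finset.sum_congr rfl fun i _ => ?_
  by_cases h : (n i).natAbs = k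
  · simp [h]
  · simp [h]

/-- Rotating the `k`-th Gaussian by `π/s`, with `s` the difference of the signatures, preserves the
law and changes the sign of the integrand. -/
theorem integral_monomial_mul_conj_eq_zero {n m : Fin d → ℤ} {k : ℕ}
    (h : signature n k ≠ signature m k) :
    ∫ g, monomial n g * conj (monomial m g) ∂sampleLaw κ = 0 := by
  set s : ℤ := signature n k - signature m k with hs
  have hs0 : (s : ℂ) ≠ 0 := by exact_mod_cast sub_ne_zero.mpr h
  have hmp := measurePreserving_sampleRot κ (Pi.single k (Real.pi / s))
  have h1 : ∀ g, monomial n (sampleRot (Pi.single k (Real.pi / s)) g)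
      * conj (monomial m (sampleRot (Pi.single k (Real.pi / s)) g))
      = -(monomial n g * conj (monomial m g)) := by
    intro g
    rw [monomial_sampleRot, monomial_sampleRot, map_mul, ← Complex.exp_conj,
      mul_mul_mul_comm, ← Complex.exp_add, ← neg_one_mul, ← Complex.exp_pi_mul_I]
    congr 2
    simp only [map_mul, Complex.conj_I, Complex.conj_ofReal, map_intCast]
    push_cast
    have : (s : ℂ) = signature n k - signature m k := by rw [hs]; push_cast; ring
    field_simp
    rw [this]; ring
  have hi := ((allLp_monomial κ n).mul (allLp_monomial κ m).conj)
  have h2 := integral_map (μ := sampleLaw κ)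
    (φ := sampleRot (Pi.single k (Real.pi / s))) hmp.measurable.aemeasurable
    (f := fun g => monomial n g * conj (monomial m g)) (by rw [hmp.map_eq]; exact (hi 0).1)
  rw [hmp.map_eq] at h2
  simp only [h1, integral_neg] at h2
  exact self_eq_neg.mp h2

/-- Without opposite frequencies all occurrences of `±n i` have the sign of `n i`, so nothing
cancels in the signature. The case `i = j` of the hypothesis excludes the frequency zero. -/
theorem signature_pos {n : Fin d → ℤ} (hn : ∀ i j, n i + n j ≠ 0) (i : Fin d) :
    0 < (n i).sign * signature n (n i).natAbs := by
  rw [signature, Finset.mul_sum]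
  refine Finset.sum_pos' (fun j _ => ?_) ⟨i, Finset.mem_univ i, ?_⟩
  · split_ifs with h
    · rcases Int.natAbs_eq_natAbs_iff.mp h with h | h
      · rw [h]; exact mul_self_nonneg _
      · exact absurd (by rw [h]; ring) (hn i j)
    · simp
  · rw [if_pos rfl]
    have : n i ≠ 0 := fun h => hn i i (by rw [h]; rfl)
    exact mul_self_pos.mpr (mt Int.sign_eq_zero_iff_zero.mp this)

/-- The signature thus reveals which frequencies occur, and only boundedly many monomials can share
it. -/
theorem exists_eq_of_signature_eq {n m : Fin d → ℤ} (hn : ∀ i j, n i + n j ≠ 0)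
    (h : signature n = signature m) (i : Fin d) : ∃ j, n i = m j := by
  have h1 := signature_pos hn i
  rw [h, signature, Finset.mul_sum] at h1
  obtain ⟨j, -, hj⟩ : ∃ j ∈ Finset.univ, 0 < (n i).sign
      * (if (m j).natAbs = (n i).natAbs then (m j).sign else 0) := by
    by_contra hcon
    push Not at hcon
    exact absurd h1 (not_lt.mpr (Finset.sum_nonpos hcon))
  refine ⟨j, ?_⟩
  split_ifs at hj with hij
  · rcases Int.natAbs_eq_natAbs_iff.mp hij with h | h
    · exact h.symm
    · rw [h, Int.sign_neg] at hj
      nlinarith [mul_self_nonneg (n i).sign]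
  · simp at hj

theorem norm_integral_monomial_mul_le : ∃ C, 0 ≤ C ∧ ∀ n m : Fin d → ℤ,
    ‖∫ g, monomial n g * conj (monomial m g) ∂sampleLaw κ‖ ≤ C := by
  have hprod : ∃ C, 0 ≤ C ∧ ∀ n : Fin d → ℤ, ∫ g, ‖monomial n g‖ ^ 2 ∂sampleLaw κ ≤ C := by
    obtain ⟨C, hC, h⟩ := integral_norm_gauss_pow_le κ (2 * d)
    refine ⟨1 + d * C, by positivity, fun n => ?_⟩
    have hpt : ∀ g, ‖monomial n g‖ ^ 2 ≤ 1 + ∑ i, ‖gauss (n i) g‖ ^ (2 * d) := by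
      intro g
      rw [monomial, norm_prod]
      rcases isEmpty_or_nonempty (Fin d) with he | he
      · simp
      obtain ⟨i, hi⟩ := Finite.exists_max fun i => ‖gauss (n i) g‖
      calc (∏ i, ‖gauss (n i) g‖) ^ 2 ≤ (∏ _i : Fin d, ‖gauss (n i) g‖) ^ 2 := by
            gcongr with j
            exact hi j
        _ = ‖gauss (n i) g‖ ^ (2 * d) := by
            rw [Finset.prod_const, Finset.card_univ, Fintype.card_fin]; ring
        _ ≤ ∑ i, ‖gauss (n i) g‖ ^ (2 * d) :=
            Finset.single_le_sum (f := fun i => ‖gauss (n i) g‖ ^ (2 * d))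
              (fun i _ => by positivity) (Finset.mem_univ i)
        _ ≤ _ := by linarith
    have hI : ∀ i, Integrable (fun g => ‖gauss (n i) g‖ ^ (2 * d)) (sampleLaw κ) := fun i =>
      ((allLp_gauss κ (n i)).norm.pow _).integrable
    refine (integral_mono (g := fun g => 1 + ∑ i, ‖gauss (n i) g‖ ^ (2 * d))
      ((allLp_monomial κ n).norm.pow 2).integrable
      ((integrable_const _).add (integrable_finsetSum _ fun i _ => hI i)) hpt).trans ?_
    rw [integral_add (integrable_const _) (integrable_finsetSum _ fun i _ => hI i),
      integral_finsetSum _ fun i _ => hI i]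
    simp only [integral_const, probReal_univ, one_smul]
    gcongr
    refine (Finset.sum_le_sum fun i _ => h (n i)).trans ?_
    simp
  obtain ⟨C, hC, h⟩ := hprod
  refine ⟨C, hC, fun n m => ?_⟩
  refine (norm_integral_le_integral_norm _).trans ?_
  have hI : ∀ n : Fin d → ℤ, Integrable (fun g => ‖monomial n g‖ ^ 2) (sampleLaw κ) := fun n =>
    ((allLp_monomial κ n).norm.pow 2).integrable
  calc ∫ g, ‖monomial n g * conj (monomial m g)‖ ∂sampleLaw κ
      ≤ ∫ g, (1 / 2 * ‖monomial n g‖ ^ 2 + 1 / 2 * ‖monomial m g‖ ^ 2) ∂sampleLaw κ := by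
        refine integral_mono ((allLp_monomial κ n).mul (allLp_monomial κ m).conj).norm.integrable
          (((hI n).const_mul _).add ((hI m).const_mul _)) fun g => ?_
        simp only [norm_mul, RCLike.norm_conj]
        nlinarith [sq_nonneg (‖monomial n g‖ - ‖monomial m g‖)]
    _ ≤ C := by
        rw [integral_add ((hI n).const_mul _) ((hI m).const_mul _), integral_const_mul,
          integral_const_mul]
        linarith [h n, h m]

/-- Monomials without pairs of opposite frequencies are almost orthogonal. -/
theorem integral_norm_sum_monomial_sq_le (d : ℕ) : ∃ C, 0 ≤ C ∧ ∀ {τ : Type} (T : Finset τ)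
    (n : τ → Fin d → ℤ) (c : τ → ℂ), Set.InjOn n T → (∀ t ∈ T, ∀ i j, n t i + n t j ≠ 0) →
    ∫ g, ‖∑ t ∈ T, c t * monomial (n t) g‖ ^ 2 ∂sampleLaw κ ≤ C * ∑ t ∈ T, ‖c t‖ ^ 2 := by
  classical
  obtain ⟨C, hC, h⟩ := norm_integral_monomial_mul_le κ (d := d)
  refine ⟨C * d ^ d, by positivity, fun {τ} T n c hinj hn => ?_⟩
  set I : τ → τ → ℂ := fun s t => ∫ g, monomial (n s) g * conj (monomial (n t) g) ∂sampleLaw κ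
    with hI
  have hint : ∀ s t, Integrable (fun g => c s * conj (c t)
      * (monomial (n s) g * conj (monomial (n t) g))) (sampleLaw κ) := fun s t =>
    (((allLp_monomial κ _).mul (allLp_monomial κ _).conj).const_mul _).integrable
  have e1 : ((∫ g, ‖∑ t ∈ T, c t * monomial (n t) g‖ ^ 2 ∂sampleLaw κ : ℝ) : ℂ)
      = ∑ s ∈ T, ∑ t ∈ T, c s * conj (c t) * I s t := by
    rw [← integral_complex_ofReal]
    have : ∀ g, ((‖∑ t ∈ T, c t * monomial (n t) g‖ ^ 2 : ℝ) : ℂ)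
        = ∑ s ∈ T, ∑ t ∈ T, c s * conj (c t) * (monomial (n s) g * conj (monomial (n t) g)) := by
      intro g
      rw [Complex.ofReal_pow, ← Complex.mul_conj', map_sum, Finset.sum_mul_sum]
      refine Finset.sum_congr rfl fun s _ => Finset.sum_congr rfl fun t _ => ?_
      rw [map_mul]; ring
    simp only [this]
    rw [integral_finsetSum _ fun s _ => integrable_finsetSum _ fun t _ => hint s t]
    refine Finset.sum_congr rfl fun s _ => ?_
    rw [integral_finsetSum _ fun t _ => hint s t]
    exact Finset.sum_congr rfl fun t _ => by rw [integral_const_mul]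
  -- Monomials of equal signature take their `d` frequencies from the at most `d` values of one of
  -- them, so each row of the Gram matrix has at most `d^d` nonzero entries. Bounded entries then
  -- give the estimate by Schur's test.
  have hcard : ∀ s ∈ T, ((T.filter fun t => signature (n t) = signature (n s)).card : ℝ)
      ≤ d ^ d := by
    intro s hs
    have hsub : ((T.filter fun t => signature (n t) = signature (n s)).image n)
        ⊆ Fintype.piFinset fun _ => Finset.univ.image (n s) := by
      intro m hm
      obtain ⟨t, ht, rfl⟩ := Finset.mem_image.mp hm
      rw [Finset.mem_filter] at ht
      refine Fintype.mem_piFinset.mpr fun i => ?_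
      obtain ⟨j, hj⟩ := exists_eq_of_signature_eq (hn t ht.1) ht.2 i
      rw [hj]
      exact Finset.mem_image_of_mem _ (Finset.mem_univ j)
    have h1 := Finset.card_le_card hsub
    rw [Finset.card_image_of_injOn (hinj.mono (by intro t ht; exact (Finset.mem_filter.mp ht).1)),
      Fintype.card_piFinset, Finset.prod_const, Finset.card_univ, Fintype.card_fin] at h1
    have h2 : (Finset.univ.image (n s)).card ≤ d :=
      Finset.card_image_le.trans (by simp)
    exact_mod_cast h1.trans (Nat.pow_le_pow_left h2 d)
  have hterm : ∀ s t, ‖c s * conj (c t) * I s t‖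
      ≤ if signature (n t) = signature (n s) then C / 2 * (‖c s‖ ^ 2 + ‖c t‖ ^ 2) else 0 := by
    intro s t
    split_ifs with hst
    · rw [norm_mul, norm_mul, RCLike.norm_conj]
      have := h (n s) (n t)
      calc ‖c s‖ * ‖c t‖ * ‖I s t‖ ≤ ((‖c s‖ ^ 2 + ‖c t‖ ^ 2) / 2) * C := by
            gcongr
            nlinarith [sq_nonneg (‖c s‖ - ‖c t‖)]
        _ = _ := by ring
    · obtain ⟨k, hk⟩ := Function.ne_iff.mp hst
      have : I s t = 0 := integral_monomial_mul_conj_eq_zero κ hk.symm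
      rw [this, mul_zero, norm_zero]
  have e2 : ∫ g, ‖∑ t ∈ T, c t * monomial (n t) g‖ ^ 2 ∂sampleLaw κ
      ≤ ∑ s ∈ T, ∑ t ∈ T,
        if signature (n t) = signature (n s) then C / 2 * (‖c s‖ ^ 2 + ‖c t‖ ^ 2) else 0 := by
    have h0 : 0 ≤ ∫ g, ‖∑ t ∈ T, c t * monomial (n t) g‖ ^ 2 ∂sampleLaw κ :=
      integral_nonneg fun g => by positivity
    rw [← Real.norm_of_nonneg h0, ← Complex.norm_real, e1]
    exact (norm_sum_le _ _).trans (Finset.sum_le_sum fun s _ =>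
      (norm_sum_le _ _).trans (Finset.sum_le_sum fun t _ => hterm s t))
  refine e2.trans ?_
  have e3 : ∀ s t, (if signature (n t) = signature (n s) then C / 2 * (‖c s‖ ^ 2 + ‖c t‖ ^ 2)
      else 0) = (if signature (n t) = signature (n s) then C / 2 * ‖c s‖ ^ 2 else 0)
        + (if signature (n s) = signature (n t) then C / 2 * ‖c t‖ ^ 2 else 0) := by
    intro s t
    by_cases h : signature (n t) = signature (n s)
    · rw [if_pos h, if_pos h, if_pos h.symm]; ring
    · rw [if_neg h, if_neg h, if_neg (fun h' => h h'.symm)]; ring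
  simp only [e3, Finset.sum_add_distrib]
  rw [Finset.sum_comm (f := fun s t => if signature (n s) = signature (n t) then
    C / 2 * ‖c t‖ ^ 2 else 0), ← two_mul, Finset.mul_sum, Finset.mul_sum]
  refine Finset.sum_le_sum fun s hs => ?_
  rw [← Finset.sum_filter, Finset.sum_const, nsmul_eq_mul]
  have := mul_le_mul_of_nonneg_right (hcard s hs) (show 0 ≤ C * ‖c s‖ ^ 2 by positivity)
  linarith

end Orthogonality

end BenjaminOno

namespace BenjaminOno

/-! ### Moments of resonant cubic sums -/

/-- The real part of `z_p z_q conj z_{p+q}`. -/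
def triple (z : ℕ → ℂ) (t : ℕ × ℕ) : ℝ := (z t.1 * z t.2 * conj (z (t.1 + t.2))).re

theorem triple_swap (z : ℕ → ℂ) (t : ℕ × ℕ) : triple z t.swap = triple z t := by
  simp only [triple, Prod.fst_swap, Prod.snd_swap, mul_comm (z t.2), add_comm t.2]

theorem sum_inv_sq_le_two (n : ℕ) : ∑ i ∈ Finset.Ioo 0 n, ((i : ℝ) ^ 2)⁻¹ ≤ 2 := by
  simpa using sum_Ioo_inv_sq_le (α := ℝ) 0 n

theorem sum_inv_sq_le_div {M : ℕ} (hM : 0 < M) (n : ℕ) :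
    ∑ i ∈ Finset.Ioo (M / 2) n, ((i : ℝ) ^ 2)⁻¹ ≤ 4 / M := by
  refine (sum_Ioo_inv_sq_le (α := ℝ) (M / 2) n).trans ?_
  have h : (M : ℝ) ≤ 2 * ((M / 2 : ℕ) + 1 : ℝ) := by
    have : M ≤ 2 * (M / 2 + 1) := by omega
    exact_mod_cast this
  have hM' : (0 : ℝ) < M := by exact_mod_cast hM
  rw [div_le_div_iff₀ (by positivity) hM']
  linarith

/-- The coefficient of the real monomials of `triple`. -/
def tripleSign : Bool × Bool × Bool → ℝ
  | (false, false, false) => 1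
  | (true, true, false) => -1
  | (true, false, true) => 1
  | (false, true, true) => 1
  | _ => 0

theorem tripleSign_sq_le (b : Bool × Bool × Bool) : tripleSign b ^ 2 ≤ 1 := by
  rcases b with ⟨b1, b2, b3⟩
  cases b1 <;> cases b2 <;> cases b3 <;> simp [tripleSign]

/-- The real variables of the monomials of `triple`. -/
def tripleVars (t : (ℕ × ℕ) × (Bool × Bool × Bool)) : Finset (ℕ × Bool) :=
  {(t.1.1, t.2.1), (t.1.2, t.2.2.1), (t.1.1 + t.1.2, t.2.2.2)}

theorem prod_tripleVars {t : (ℕ × ℕ) × (Bool × Bool × Bool)} (h0 : 0 < t.1.1) (h : t.1.1 < t.1.2)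
    {M : Type*} [CommMonoid M] (f : ℕ × Bool → M) : ∏ i ∈ tripleVars t, f i
      = f (t.1.1, t.2.1) * (f (t.1.2, t.2.2.1) * f (t.1.1 + t.1.2, t.2.2.2)) := by
  rw [tripleVars, Finset.prod_insert, Finset.prod_pair]
  · intro h'; have := congrArg Prod.fst h'; simp only at this; omega
  · simp only [Finset.mem_insert, Finset.mem_singleton, Prod.mk.injEq, not_or, not_and]
    exact ⟨fun h' => by omega, fun h' => by omega⟩

theorem card_tripleVars {t : (ℕ × ℕ) × (Bool × Bool × Bool)} (h0 : 0 < t.1.1)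
    (h : t.1.1 < t.1.2) : (tripleVars t).card = 3 := by
  rw [tripleVars, Finset.card_insert_of_notMem, Finset.card_pair]
  · intro h'; have := congrArg Prod.fst h'; simp only at this; omega
  · simp only [Finset.mem_insert, Finset.mem_singleton, Prod.mk.injEq, not_or, not_and]
    exact ⟨fun h' => by omega, fun h' => by omega⟩

/-- The order `p < q < p + q` recovers the frequencies from the set of variables. Distinct data give
distinct multilinear monomials, as hypercontractivity requires; on the diagonal `p = q` this breaks
down. -/
theorem tripleVars_injOn :
    Set.InjOn tripleVars {t | 0 < t.1.1 ∧ t.1.1 < t.1.2} := by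
  rintro ⟨⟨p, q⟩, b1, b2, b3⟩ ⟨h0, h1⟩ ⟨⟨p', q'⟩, b1', b2', b3'⟩ ⟨h0', h1'⟩ h
  simp only at h0 h1 h0' h1'
  simp only [tripleVars] at h
  have m1 : (p, b1) ∈ ({(p', b1'), (q', b2'), (p' + q', b3')} : Finset (ℕ × Bool)) := by
    rw [← h]; simp
  have m2 : (q, b2) ∈ ({(p', b1'), (q', b2'), (p' + q', b3')} : Finset (ℕ × Bool)) := by
    rw [← h]; simp
  have m3 : (p + q, b3) ∈ ({(p', b1'), (q', b2'), (p' + q', b3')} : Finset (ℕ × Bool)) := by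
    rw [← h]; simp
  simp only [Finset.mem_insert, Finset.mem_singleton, Prod.mk.injEq] at m1 m2 m3
  have hp : p = p' := by omega
  have hq : q = q' := by omega
  subst hp hq
  have e1 : b1 = b1' := by
    rcases m1 with h | h | h
    · exact h.2
    · omega
    · omega
  have e2 : b2 = b2' := by
    rcases m2 with h | h | h
    · omega
    · exact h.2
    · omega
  have e3 : b3 = b3' := by
    rcases m3 with h | h | h
    · omega
    · omega
    · exact h.2
  rw [e1, e2, e3]

theorem triple_gauss {t : ℕ × ℕ} (h0 : 0 < t.1) (h : t.1 < t.2) (g : Sample) :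
    triple (fun n => gauss n g) t
      = ∑ b : Bool × Bool × Bool, tripleSign b * ∏ i ∈ tripleVars (t, b), coord i g := by
  have h2 : 0 < t.2 := h0.trans h
  simp only [Fintype.sum_prod_type, Fintype.sum_bool,
    prod_tripleVars (t := (t, _)) h0 h, tripleSign, coord]
  simp only [triple]
  rw [gauss_natCast h0, gauss_natCast h2, gauss_natCast (by omega)]
  simp
  ring

/-- The larger frequency exceeds `M/2`, so its sum contributes `O(1/M)`, while the other sum is
bounded. -/
theorem sum_pair_inv_sq_le {M : ℕ} (hM : 0 < M) (T : Finset (ℕ × ℕ))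
    (hT : ∀ t ∈ T, 0 < t.1 ∧ t.1 ≤ t.2 ∧ M < t.1 + t.2) :
    ∑ t ∈ T, (((t.1 : ℝ) * t.2) ^ 2)⁻¹ ≤ 8 / M := by
  set n : ℕ := T.sup (fun t => t.1 + t.2) + 1
  have hsub : T ⊆ Finset.Ioo 0 n ×ˢ Finset.Ioo (M / 2) n := by
    intro t ht
    have h1 := hT t ht
    have h2 : t.1 + t.2 < n := Nat.lt_succ_of_le (Finset.le_sup (f := fun t => t.1 + t.2) ht)
    simp only [Finset.mem_product, Finset.mem_Ioo]
    omega
  have hM' : (0 : ℝ) < M := by exact_mod_cast hM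
  calc _ ≤ ∑ t ∈ Finset.Ioo 0 n ×ˢ Finset.Ioo (M / 2) n, (((t.1 : ℝ) * t.2) ^ 2)⁻¹ :=
        Finset.sum_le_sum_of_subset_of_nonneg hsub fun t _ _ => by positivity
    _ = (∑ i ∈ Finset.Ioo 0 n, ((i : ℝ) ^ 2)⁻¹) * ∑ i ∈ Finset.Ioo (M / 2) n, ((i : ℝ) ^ 2)⁻¹ := by
        rw [Finset.sum_mul_sum, Finset.sum_product]
        simp only [mul_pow, mul_inv]
    _ ≤ 2 * (4 / M) := mul_le_mul (sum_inv_sq_le_two n) (sum_inv_sq_le_div hM n)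
        (Finset.sum_nonneg fun i _ => by positivity) (by norm_num)
    _ = 8 / M := by ring

section Moments

variable (κ : ℝ)

/-- Each complex cubic term splits into real multilinear monomials of degree three, indexed by eight
choices of real or imaginary parts; this gives the factor `8` and the cube of the hypercontractivity
constant. -/
theorem integral_sum_triple_pow_le_of_lt {M : ℕ} (hM : 0 < M) (T : Finset (ℕ × ℕ))
    (hT : ∀ t ∈ T, 0 < t.1 ∧ t.1 < t.2 ∧ M < t.1 + t.2) (b : ℕ × ℕ → ℝ)
    (hb : ∀ t ∈ T, |b t| ≤ ((t.1 : ℝ) * t.2)⁻¹) {k : ℕ} (hk : 0 < k) :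
    ∫ g, (∑ t ∈ T, b t * triple (fun n => gauss n g) t) ^ (2 * k) ∂sampleLaw κ
      ≤ (64 * (12 * sampleVar κ) ^ 3 * k ^ 3 / M) ^ k := by
  have h := (gaussianLike_coord κ).integral_sum_monomial_pow_le (by positivity) hk
    (T ×ˢ (Finset.univ : Finset (Bool × Bool × Bool))) tripleVars
    (tripleVars_injOn.mono fun t ht => by
      have := hT t.1 (Finset.mem_product.mp ht).1
      exact ⟨this.1, this.2.1⟩) (fun t => b t.1 * tripleSign t.2)
  have e : ∀ g, ∑ t ∈ T ×ˢ (Finset.univ : Finset (Bool × Bool × Bool)),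
      b t.1 * tripleSign t.2 * ∏ i ∈ tripleVars t, coord i g
      = ∑ t ∈ T, b t * triple (fun n => gauss n g) t := by
    intro g
    rw [Finset.sum_product]
    refine Finset.sum_congr rfl fun t ht => ?_
    rw [triple_gauss (hT t ht).1 (hT t ht).2.1, Finset.mul_sum]
    exact Finset.sum_congr rfl fun s _ => by ring
  simp only [e] at h
  refine h.trans (pow_le_pow_left₀ (Finset.sum_nonneg fun t _ => by positivity) ?_ k)
  rw [Finset.sum_product]
  have hV : (0 : ℝ) ≤ sampleVar κ := (sampleVar κ).2
  calc _ ≤ ∑ t ∈ T, ∑ s : Bool × Bool × Bool,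
        (2 * k * (6 * sampleVar κ : ℝ)) ^ 3 * (((t.1 : ℝ) * t.2) ^ 2)⁻¹ := by
        refine Finset.sum_le_sum fun t ht => Finset.sum_le_sum fun s _ => ?_
        rw [card_tripleVars (t := (t, s)) (hT t ht).1 (hT t ht).2.1]
        refine mul_le_mul_of_nonneg_left ?_ (by positivity)
        rw [mul_pow, ← sq_abs (b t), ← inv_pow]
        have h1 := pow_le_pow_left₀ (abs_nonneg _) (hb t ht) 2
        calc _ ≤ (((t.1 : ℝ) * t.2)⁻¹) ^ 2 * 1 :=
              mul_le_mul h1 (tripleSign_sq_le s) (by positivity) (by positivity)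
          _ = _ := mul_one _
    _ = 8 * (2 * k * (6 * sampleVar κ : ℝ)) ^ 3 * ∑ t ∈ T, (((t.1 : ℝ) * t.2) ^ 2)⁻¹ := by
        simp only [Finset.sum_const, Finset.card_univ, Fintype.card_prod, Fintype.card_bool,
          nsmul_eq_mul]
        rw [Finset.mul_sum]
        refine Finset.sum_congr rfl fun t _ => ?_
        push_cast; ring
    _ ≤ 8 * (2 * k * (6 * sampleVar κ : ℝ)) ^ 3 * (8 / M) := by
        refine mul_le_mul_of_nonneg_left (sum_pair_inv_sq_le hM T fun t ht => ?_) (by positivity)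
        exact ⟨(hT t ht).1, (hT t ht).2.1.le, (hT t ht).2.2⟩
    _ = _ := by ring

theorem integral_coord_even_le (i : ℕ × Bool) (j : ℕ) :
    ∫ g, coord i g ^ (2 * j) ∂sampleLaw κ ≤ (12 * sampleVar κ * j) ^ j := by
  refine ((gaussianLike_coord κ).even i j).trans ?_
  have h : ((2 * j).factorial : ℝ) ≤ (2 * j) ^ j * j.factorial := by
    have h1 := Nat.factorial_mul_descFactorial (show j ≤ 2 * j by omega)
    rw [show 2 * j - j = j by omega] at h1
    have h2 := Nat.descFactorial_le_pow (2 * j) j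
    rw [← h1]
    push_cast
    rw [mul_comm]
    gcongr
    exact_mod_cast h2
  have hV : (0 : ℝ) ≤ sampleVar κ := (sampleVar κ).2
  calc _ ≤ (6 * sampleVar κ : ℝ) ^ j * (2 * j) ^ j := by
        refine mul_le_mul_of_nonneg_left ?_ (by positivity)
        rw [div_le_iff₀ (by positivity)]
        refine h.trans ?_
        have h1 : (1 : ℝ) ≤ 2 ^ j := one_le_pow₀ (by norm_num)
        have h2 : (0 : ℝ) ≤ (2 * j) ^ j * j.factorial := by positivity
        nlinarith
    _ = _ := by rw [← mul_pow]; ring_nf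

theorem integral_norm_gauss_even_le {n : ℤ} (hn : n ≠ 0) (j : ℕ) :
    ∫ g, ‖gauss n g‖ ^ (2 * j) ∂sampleLaw κ ≤ 2 * (24 * sampleVar κ * j) ^ j := by
  have hI : ∀ i, Integrable (fun g => coord i g ^ (2 * j)) (sampleLaw κ) := fun i =>
    ((allLp_coord κ i).pow _).integrable
  have hV : (0 : ℝ) ≤ sampleVar κ := (sampleVar κ).2
  calc _ ≤ ∫ g, (2 : ℝ) ^ j * (coord (n.natAbs, false) g ^ (2 * j)
        + coord (n.natAbs, true) g ^ (2 * j)) ∂sampleLaw κ := by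
        refine integral_mono ((allLp_gauss κ n).norm.pow _).integrable
          (((hI _).add (hI _)).const_mul _) fun g => ?_
        simp only [pow_mul, normSq_gauss hn]
        refine (add_pow_le (by positivity) (by positivity) j).trans ?_
        refine mul_le_mul_of_nonneg_right (pow_le_pow_right₀ (by norm_num) (by omega)) ?_
        have : 0 ≤ (g n.natAbs).1 ^ 2 := by positivity
        positivity
    _ ≤ 2 ^ j * ((12 * sampleVar κ * j) ^ j + (12 * sampleVar κ * j) ^ j) := by
        rw [integral_const_mul, integral_add (hI _) (hI _)]
        gcongr <;> exact integral_coord_even_le κ _ j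
    _ = 2 * (2 * (12 * sampleVar κ * j)) ^ j := by rw [mul_pow 2]; ring
    _ = _ := by ring_nf

theorem allLp_triple (t : ℕ × ℕ) :
    AllLp (sampleLaw κ) fun g => triple (fun n => gauss n g) t :=
  (((allLp_gauss κ _).mul (allLp_gauss κ _)).mul (allLp_gauss κ (t.1 + t.2 : ℕ)).conj).of_norm_le
    (Complex.continuous_re.comp_aestronglyMeasurable
      (((((allLp_gauss κ _).mul (allLp_gauss κ _)).mul
        (allLp_gauss κ (t.1 + t.2 : ℕ)).conj)) 0).1) fun g => by
      simpa only [Real.norm_eq_abs, triple] using Complex.abs_re_le_norm _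

theorem integral_triple_diag_pow_le {p : ℕ} (hp : 0 < p) (k : ℕ) :
    ∫ g, triple (fun n => gauss n g) (p, p) ^ (2 * k) ∂sampleLaw κ
      ≤ 4 * (24 * sampleVar κ * (3 * k)) ^ (3 * k) := by
  have hI : ∀ n : ℤ, Integrable (fun g => ‖gauss n g‖ ^ (2 * (3 * k))) (sampleLaw κ) := fun n =>
    ((allLp_gauss κ n).norm.pow _).integrable
  calc _ ≤ ∫ g, (‖gauss p g‖ ^ (2 * (3 * k)) + ‖gauss (p + p : ℕ) g‖ ^ (2 * (3 * k)))
        ∂sampleLaw κ := by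
        refine integral_mono ((allLp_triple κ (p, p)).pow _).integrable ((hI _).add (hI _))
          fun g => ?_
        have h1 : |triple (fun n => gauss n g) (p, p)|
            ≤ ‖gauss p g‖ * ‖gauss p g‖ * ‖gauss (p + p : ℕ) g‖ := by
          refine (Complex.abs_re_le_norm _).trans ?_
          rw [norm_mul, norm_mul, RCLike.norm_conj]
        simp only
        rw [← Even.pow_abs (even_two_mul k)]
        refine (pow_le_pow_left₀ (abs_nonneg _) h1 _).trans ?_
        have key : ∀ a b : ℝ, 0 ≤ a → 0 ≤ b →
            (a * a * b) ^ (2 * k) ≤ a ^ (2 * (3 * k)) + b ^ (2 * (3 * k)) := by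
          intro a b ha hb
          have e : ∀ x : ℝ, x ^ (2 * (3 * k)) = (x * x * x) ^ (2 * k) := fun x => by
            rw [show x * x * x = x ^ 3 by ring, ← pow_mul]; ring_nf
          rw [e, e]
          rcases le_total a b with h | h
          · have : (a * a * b) ^ (2 * k) ≤ (b * b * b) ^ (2 * k) := by gcongr
            have : 0 ≤ (a * a * a) ^ (2 * k) := by positivity
            linarith
          · have : (a * a * b) ^ (2 * k) ≤ (a * a * a) ^ (2 * k) := by gcongr
            have : 0 ≤ (b * b * b) ^ (2 * k) := by positivity
            linarith
        exact key _ _ (norm_nonneg _) (norm_nonneg _)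
    _ ≤ _ := by
        rw [integral_add (hI _) (hI _)]
        have h1 := integral_norm_gauss_even_le κ (n := p) (by omega) (3 * k)
        have h2 := integral_norm_gauss_even_le κ (n := (p + p : ℕ)) (by omega) (3 * k)
        push_cast at h1 h2 ⊢
        linarith

/-- On the diagonal the term `g_p² conj g_{2p}` is not multilinear, but the coefficients `p⁻²` are
summable, with sum `W ≤ 4/M`. Convexity with the weights `w/W` then reduces to the moments of a
single term, with a power of `M` to spare. -/
theorem integral_sum_triple_pow_le_of_eq {M : ℕ} (hM : 0 < M) (T : Finset (ℕ × ℕ))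
    (hT : ∀ t ∈ T, 0 < t.1 ∧ t.1 = t.2 ∧ M < t.1 + t.2) (b : ℕ × ℕ → ℝ)
    (hb : ∀ t ∈ T, |b t| ≤ ((t.1 : ℝ) * t.2)⁻¹) {k : ℕ} (hk : 0 < k) :
    ∫ g, (∑ t ∈ T, b t * triple (fun n => gauss n g) t) ^ (2 * k) ∂sampleLaw κ
      ≤ (64 * (72 * sampleVar κ) ^ 3 * k ^ 3 / M) ^ k := by
  have hV : (0 : ℝ) ≤ sampleVar κ := (sampleVar κ).2
  have hM' : (1 : ℝ) ≤ M := by exact_mod_cast hM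
  rcases T.eq_empty_or_nonempty with rfl | hne
  · simp only [Finset.sum_empty, integral_const, probReal_univ, one_smul]
    rw [zero_pow (by omega)]
    positivity
  set w : ℕ × ℕ → ℝ := fun t => ((t.1 : ℝ) * t.2)⁻¹ with hw
  have hw0 : ∀ t ∈ T, 0 < w t := by
    intro t ht
    have h1 : (0 : ℝ) < t.1 := by exact_mod_cast (hT t ht).1
    have h2 : (0 : ℝ) < t.2 := by rw [← (hT t ht).2.1]; exact h1
    positivity
  set W : ℝ := ∑ t ∈ T, w t with hW
  have hW0 : 0 < W := Finset.sum_pos hw0 hne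
  have hWle : W ≤ 4 / M := by
    set n : ℕ := T.sup Prod.fst + 1
    have hinj : Set.InjOn Prod.fst (T : Set (ℕ × ℕ)) := by
      intro s hs t ht h
      exact Prod.ext h (by rw [← (hT s hs).2.1, ← (hT t ht).2.1, h])
    calc W = ∑ t ∈ T, ((t.1 : ℝ) ^ 2)⁻¹ := Finset.sum_congr rfl fun t ht => by
          rw [hw]; simp only; rw [← (hT t ht).2.1, sq]
      _ = ∑ i ∈ T.image Prod.fst, ((i : ℝ) ^ 2)⁻¹ := (Finset.sum_image (f := fun i : ℕ => ((i : ℝ) ^ 2)⁻¹) hinj).symm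
      _ ≤ ∑ i ∈ Finset.Ioo (M / 2) n, ((i : ℝ) ^ 2)⁻¹ := by
          refine Finset.sum_le_sum_of_subset_of_nonneg (fun i hi => ?_) fun i _ _ => by positivity
          obtain ⟨t, ht, rfl⟩ := Finset.mem_image.mp hi
          have h1 := hT t ht
          have h2 : t.1 < n := Nat.lt_succ_of_le (Finset.le_sup (f := Prod.fst) ht)
          simp only [Finset.mem_Ioo]
          omega
      _ ≤ 4 / M := sum_inv_sq_le_div hM n
  have hpt : ∀ g, (∑ t ∈ T, b t * triple (fun n => gauss n g) t) ^ (2 * k)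
      ≤ ∑ t ∈ T, W ^ (2 * k) * (w t / W) * triple (fun n => gauss n g) t ^ (2 * k) := by
    intro g
    have hJ := Real.pow_arith_mean_le_arith_mean_pow T (fun t => w t / W)
      (fun t => |triple (fun n => gauss n g) t|) (fun t ht => (div_pos (hw0 t ht) hW0).le)
      (by rw [← Finset.sum_div, div_self hW0.ne']) (fun t _ => abs_nonneg _) (2 * k)
    have h2 : |∑ t ∈ T, b t * triple (fun n => gauss n g) t|
        ≤ W * ∑ t ∈ T, w t / W * |triple (fun n => gauss n g) t| := by
      rw [Finset.mul_sum]
      refine (Finset.abs_sum_le_sum_abs _ _).trans (Finset.sum_le_sum fun t ht => ?_)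
      rw [abs_mul, ← mul_assoc, mul_div_cancel₀ _ hW0.ne']
      exact mul_le_mul_of_nonneg_right (hb t ht) (abs_nonneg _)
    calc _ = |∑ t ∈ T, b t * triple (fun n => gauss n g) t| ^ (2 * k) :=
          (Even.pow_abs (even_two_mul k) _).symm
      _ ≤ (W * ∑ t ∈ T, w t / W * |triple (fun n => gauss n g) t|) ^ (2 * k) :=
          pow_le_pow_left₀ (abs_nonneg _) h2 _
      _ ≤ W ^ (2 * k) * ∑ t ∈ T, w t / W * |triple (fun n => gauss n g) t| ^ (2 * k) := by
          rw [mul_pow]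
          exact mul_le_mul_of_nonneg_left hJ (by positivity)
      _ = _ := by
          rw [Finset.mul_sum]
          refine Finset.sum_congr rfl fun t _ => ?_
          rw [Even.pow_abs (even_two_mul k)]; ring
  have hI : ∀ t, Integrable (fun g => triple (fun n => gauss n g) t ^ (2 * k)) (sampleLaw κ) :=
    fun t => ((allLp_triple κ t).pow _).integrable
  calc _ ≤ ∫ g, ∑ t ∈ T, W ^ (2 * k) * (w t / W) * triple (fun n => gauss n g) t ^ (2 * k)
        ∂sampleLaw κ :=
        integral_mono ((AllLp.sum T fun t _ => (allLp_triple κ t).const_mul (b t)).pow _).integrable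
          (integrable_finsetSum _ fun t _ => (hI t).const_mul _) hpt
    _ = ∑ t ∈ T, W ^ (2 * k) * (w t / W)
        * ∫ g, triple (fun n => gauss n g) t ^ (2 * k) ∂sampleLaw κ := by
        rw [integral_finsetSum _ fun t _ => (hI t).const_mul _]
        simp only [integral_const_mul]
    _ ≤ ∑ t ∈ T, W ^ (2 * k) * (w t / W) * (4 * (24 * sampleVar κ * (3 * k)) ^ (3 * k)) := by
        refine Finset.sum_le_sum fun t ht => mul_le_mul_of_nonneg_left ?_ ?_
        · have : t = (t.1, t.1) := Prod.ext rfl (hT t ht).2.1.symm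
          rw [this]
          exact integral_triple_diag_pow_le κ (hT t ht).1 k
        · have := (div_pos (hw0 t ht) hW0).le
          positivity
    _ = W ^ (2 * k) * (4 * (24 * sampleVar κ * (3 * k)) ^ (3 * k)) := by
        rw [← Finset.sum_mul, ← Finset.mul_sum, ← Finset.sum_div, div_self hW0.ne', mul_one]
    _ ≤ (4 / M) ^ (2 * k) * (4 ^ k * (24 * sampleVar κ * (3 * k)) ^ (3 * k)) := by
        gcongr
        calc (4 : ℝ) = 4 ^ 1 := by norm_num
          _ ≤ 4 ^ k := pow_le_pow_right₀ (by norm_num) hk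
    _ = (64 * (72 * sampleVar κ) ^ 3 * k ^ 3 / M ^ 2) ^ k := by
        rw [pow_mul, pow_mul _ 3 k, ← mul_pow, ← mul_pow]
        congr 1
        field_simp; ring
    _ ≤ _ := by
        have : (M : ℝ) ≤ M ^ 2 := by nlinarith
        gcongr

/-- Moments of cubic sums over frequencies larger than `M`. -/
theorem integral_sum_triple_pow_le : ∃ C, 0 < C ∧ ∀ M : ℕ, 0 < M → ∀ T : Finset (ℕ × ℕ),
    (∀ t ∈ T, 0 < t.1 ∧ 0 < t.2 ∧ M < t.1 + t.2) → ∀ b : ℕ × ℕ → ℝ,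
    (∀ t ∈ T, |b t| ≤ ((t.1 : ℝ) * t.2)⁻¹) → ∀ k : ℕ, 0 < k →
    ∫ g, (∑ t ∈ T, b t * triple (fun n => gauss n g) t) ^ (2 * k) ∂sampleLaw κ
      ≤ (C * k ^ 3 / M) ^ k := by
  have hV : (0 : ℝ) ≤ sampleVar κ := (sampleVar κ).2
  set C : ℝ := 64 * (72 * sampleVar κ) ^ 3 with hC
  have hC0 : 0 ≤ C := by positivity
  -- The `2k`-th power of a sum of three terms costs `9^k`, and the three resulting moments cost `3
  -- ≤ 3^k`; the summand `1` makes the constant positive.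
  refine ⟨27 * C + 1, by positivity, fun M hM T hT b hb k hk => ?_⟩
  have hM' : (0 : ℝ) < M := by exact_mod_cast hM
  set T1 := T.filter fun t => t.1 < t.2
  set T2 := T.filter fun t => ¬ t.1 < t.2
  set T3 := T2.filter fun t => t.1 = t.2
  set T4 := T2.filter fun t => ¬ t.1 = t.2
  -- Pairs with `p > q` are exchanged into pairs with `p < q`, which leaves the cubic term
  -- unchanged.
  set T5 := T4.map (Equiv.prodComm ℕ ℕ).toEmbedding with hT5
  set A : Sample → ℝ := fun g => ∑ t ∈ T1, b t * triple (fun n => gauss n g) t with hA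
  set B : Sample → ℝ := fun g => ∑ t ∈ T3, b t * triple (fun n => gauss n g) t with hB
  set D : Sample → ℝ := fun g => ∑ t ∈ T5, b t.swap * triple (fun n => gauss n g) t with hD
  have hsum : ∀ g, ∑ t ∈ T, b t * triple (fun n => gauss n g) t = A g + (B g + D g) := by
    intro g
    rw [← Finset.sum_filter_add_sum_filter_not T (fun t => t.1 < t.2),
      ← Finset.sum_filter_add_sum_filter_not T2 (fun t => t.1 = t.2), hA, hB, hD, hT5]
    simp only [Finset.sum_map, Equiv.toEmbedding_apply, Equiv.prodComm_apply, Prod.swap_swap,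
      triple_swap]
    rfl
  have hA1 : ∫ g, A g ^ (2 * k) ∂sampleLaw κ ≤ (C * k ^ 3 / M) ^ k := by
    refine (integral_sum_triple_pow_le_of_lt κ hM T1 (fun t ht => ?_) b (fun t ht => ?_) hk).trans ?_
    · rw [Finset.mem_filter] at ht
      exact ⟨(hT t ht.1).1, ht.2, (hT t ht.1).2.2⟩
    · exact hb t (Finset.mem_filter.mp ht).1
    · rw [hC]; gcongr; norm_num
  have hB1 : ∫ g, B g ^ (2 * k) ∂sampleLaw κ ≤ (C * k ^ 3 / M) ^ k := by
    refine integral_sum_triple_pow_le_of_eq κ hM T3 (fun t ht => ?_) b (fun t ht => ?_) hk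
    · rw [Finset.mem_filter, Finset.mem_filter] at ht
      exact ⟨(hT t ht.1.1).1, ht.2, (hT t ht.1.1).2.2⟩
    · exact hb t (Finset.mem_filter.mp (Finset.mem_filter.mp ht).1).1
  have hD1 : ∫ g, D g ^ (2 * k) ∂sampleLaw κ ≤ (C * k ^ 3 / M) ^ k := by
    have hmem : ∀ t ∈ T5, t.swap ∈ T ∧ t.1 < t.2 := by
      intro t ht
      obtain ⟨s, hs, rfl⟩ := Finset.mem_map.mp ht
      rw [Finset.mem_filter, Finset.mem_filter] at hs
      simp only [Equiv.toEmbedding_apply, Equiv.prodComm_apply, Prod.swap_swap, Prod.fst_swap,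
        Prod.snd_swap]
      exact ⟨hs.1.1, by omega⟩
    refine (integral_sum_triple_pow_le_of_lt κ hM T5 (fun t ht => ?_) (fun t => b t.swap)
      (fun t ht => ?_) hk).trans ?_
    · have h1 := hT _ (hmem t ht).1
      simp only [Prod.fst_swap, Prod.snd_swap] at h1
      exact ⟨h1.2.1, (hmem t ht).2, by omega⟩
    · have := hb _ (hmem t ht).1
      simpa [mul_comm] using this
    · rw [hC]; gcongr; norm_num
  have hall : ∀ (T : Finset (ℕ × ℕ)) (b : ℕ × ℕ → ℝ), Integrable
      (fun g => (∑ t ∈ T, b t * triple (fun n => gauss n g) t) ^ (2 * k)) (sampleLaw κ) :=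
    fun T b => ((AllLp.sum T fun t _ => (allLp_triple κ t).const_mul (b t)).pow _).integrable
  have hpt : ∀ x y z : ℝ, (x + (y + z)) ^ (2 * k)
      ≤ 9 ^ k * (x ^ (2 * k) + (y ^ (2 * k) + z ^ (2 * k))) := by
    intro x y z
    have key : ∀ m x y z : ℝ, |x| ≤ m → |y| ≤ m → |z| ≤ m →
        (x + (y + z)) ^ (2 * k) ≤ 9 ^ k * m ^ (2 * k) := by
      intro m x y z hx hy hz
      have : |x + (y + z)| ≤ 3 * m := by
        linarith [abs_add_le x (y + z), abs_add_le y z]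
      calc _ = |x + (y + z)| ^ (2 * k) := (Even.pow_abs (even_two_mul k) _).symm
        _ ≤ (3 * m) ^ (2 * k) := pow_le_pow_left₀ (abs_nonneg _) this _
        _ = _ := by rw [mul_pow, pow_mul 3]; norm_num
    have h9 : (0 : ℝ) < 9 ^ k := by positivity
    have px : 0 ≤ x ^ (2 * k) := (even_two_mul k).pow_nonneg x
    have py : 0 ≤ y ^ (2 * k) := (even_two_mul k).pow_nonneg y
    have pz : 0 ≤ z ^ (2 * k) := (even_two_mul k).pow_nonneg z
    have ex := Even.pow_abs (even_two_mul k) x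
    have ey := Even.pow_abs (even_two_mul k) y
    have ez := Even.pow_abs (even_two_mul k) z
    rcases le_total |x| |y| with h1 | h1 <;> rcases le_total |y| |z| with h2 | h2 <;>
      rcases le_total |x| |z| with h3 | h3
    · refine (key |z| x y z h3 h2 le_rfl).trans ?_
      rw [ez]; gcongr; linarith
    · refine (key |z| x y z (h1.trans h2) h2 le_rfl).trans ?_
      rw [ez]; gcongr; linarith
    · refine (key |y| x y z h1 le_rfl h2).trans ?_
      rw [ey]; gcongr; linarith
    · refine (key |y| x y z h1 le_rfl h2).trans ?_
      rw [ey]; gcongr; linarith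
    · refine (key |z| x y z h3 h2 le_rfl).trans ?_
      rw [ez]; gcongr; linarith
    · refine (key |x| x y z le_rfl h1 h3).trans ?_
      rw [ex]; gcongr; linarith
    · refine (key |x| x y z le_rfl h1 (h2.trans h1)).trans ?_
      rw [ex]; gcongr; linarith
    · refine (key |x| x y z le_rfl h1 h3).trans ?_
      rw [ex]; gcongr; linarith
  simp only [hsum]
  calc ∫ g, (A g + (B g + D g)) ^ (2 * k) ∂sampleLaw κ
      ≤ ∫ g, 9 ^ k * (A g ^ (2 * k) + (B g ^ (2 * k) + D g ^ (2 * k))) ∂sampleLaw κ := by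
        refine integral_mono ?_ (((hall _ _).add ((hall _ _).add (hall _ _))).const_mul _)
          fun g => hpt _ _ _
        simp only [← hsum]
        exact hall _ _
    _ = 9 ^ k * ((∫ g, A g ^ (2 * k) ∂sampleLaw κ) + ((∫ g, B g ^ (2 * k) ∂sampleLaw κ)
        + ∫ g, D g ^ (2 * k) ∂sampleLaw κ)) := by
        have hiA : Integrable (fun g => A g ^ (2 * k)) (sampleLaw κ) := hall _ _
        have hiB : Integrable (fun g => B g ^ (2 * k)) (sampleLaw κ) := hall _ _
        have hiD : Integrable (fun g => D g ^ (2 * k)) (sampleLaw κ) := hall _ _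
        have hiBD : Integrable (fun g => B g ^ (2 * k) + D g ^ (2 * k)) (sampleLaw κ) :=
          hiB.add hiD
        rw [integral_const_mul, integral_add hiA hiBD, integral_add hiB hiD]
    _ ≤ 9 ^ k * ((C * k ^ 3 / M) ^ k + ((C * k ^ 3 / M) ^ k + (C * k ^ 3 / M) ^ k)) := by
        gcongr
    _ = 9 ^ k * (3 ^ 1 * (C * k ^ 3 / M) ^ k) := by ring
    _ ≤ 9 ^ k * (3 ^ k * (C * k ^ 3 / M) ^ k) := by
        gcongr
        · norm_num
        · exact hk
    _ = (27 * C * k ^ 3 / M) ^ k := by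
        rw [← mul_pow, ← mul_pow]; congr 1; ring
    _ ≤ _ := by
        gcongr
        linarith

end Moments

end BenjaminOno

namespace BenjaminOno

/-! ### The lower tail of the renormalized norm -/

section Excess

/-- The centered contribution of the frequency `n` to the renormalized norm. -/
def excess (κ : ℝ) (n : ℕ) (g : Sample) : ℝ := (4 * Real.pi * κ * ‖gauss n g‖ ^ 2 - 1) / n

variable {κ : ℝ}

theorem measurable_excess (κ : ℝ) (n : ℕ) : Measurable (excess κ n) := by
  unfold excess
  exact ((((measurable_gauss n).norm.pow_const 2).const_mul _).sub_const 1).div_const _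

theorem integral_norm_gauss_sq (hκ : 0 < κ) {n : ℕ} (hn : 0 < n) :
    ∫ g, 4 * Real.pi * κ * ‖gauss n g‖ ^ 2 ∂sampleLaw κ = 1 := by
  have h1 : ∀ i, ∫ g, coord i g ^ 2 ∂sampleLaw κ = 1 / (8 * Real.pi * κ) := by
    intro i
    rw [integral_coord_pow]
    have hv := variance_fun_id_gaussianReal (μ := 0) (v := sampleVar κ)
    rw [variance_of_integral_eq_zero (by fun_prop) (by simp)] at hv
    rw [hv, sampleVar, Real.coe_toNNReal _ (by positivity)]
  have hI : ∀ i, Integrable (fun g => coord i g ^ 2) (sampleLaw κ) := fun i =>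
    ((allLp_coord κ i).pow 2).integrable
  have h2 : ∀ g, ‖gauss n g‖ ^ 2 = coord (n, false) g ^ 2 + coord (n, true) g ^ 2 := fun g =>
    normSq_gauss (n := n) (by omega) g
  simp only [h2]
  rw [integral_const_mul, integral_add (hI _) (hI _), h1, h1]
  field_simp
  ring

/-- This follows from `(1 - x + x²/2)(1 + x + x²/2) = 1 + x⁴/4 ≥ 1` and the quadratic lower bound
for `exp x`. -/
theorem exp_neg_le_quadratic {x : ℝ} (hx : 0 ≤ x) : Real.exp (-x) ≤ 1 - x + x ^ 2 / 2 := by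
  have h := Real.quadratic_le_exp_of_nonneg hx
  have h2 : Real.exp (-x) * Real.exp x = 1 := by rw [← Real.exp_add]; simp
  have h3 := Real.exp_pos (-x)
  have h4 := Real.exp_pos x
  have h5 : 0 ≤ 1 - x + x ^ 2 / 2 := by nlinarith [sq_nonneg (x - 1)]
  have h6 : 1 ≤ (1 - x + x ^ 2 / 2) * Real.exp x := by
    calc (1 : ℝ) ≤ (1 - x + x ^ 2 / 2) * (1 + x + x ^ 2 / 2) := by nlinarith [sq_nonneg (x ^ 2)]
      _ ≤ _ := mul_le_mul_of_nonneg_left h h5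
  nlinarith

theorem iIndepFun_excess (κ : ℝ) : iIndepFun (fun n : ℕ => excess κ (n + 1)) (sampleLaw κ) := by
  have h : iIndepFun (fun (n : ℕ) (g : Sample) => g n) (sampleLaw κ) :=
    iIndepFun_infinitePi (P := fun _ : ℕ => (gaussianReal 0 (sampleVar κ)).prod
      (gaussianReal 0 (sampleVar κ))) (X := fun _ z => z) (fun _ => measurable_id)
  have h' := h.precomp (g := fun n : ℕ => n + 1) (add_left_injective 1)
  have h2 := h'.comp (fun n z => (4 * Real.pi * κ * (z.1 ^ 2 + z.2 ^ 2) - 1) / ((n + 1 : ℕ) : ℝ))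
    (fun n => by fun_prop)
  have e : (fun n : ℕ => excess κ (n + 1)) = fun n : ℕ => (fun z : ℝ × ℝ =>
      (4 * Real.pi * κ * (z.1 ^ 2 + z.2 ^ 2) - 1) / ((n + 1 : ℕ) : ℝ)) ∘ fun g : Sample => g (n + 1) := by
    funext n g
    simp only [excess, Function.comp_apply]
    rw [normSq_gauss (by omega)]
    rfl
  rw [e]
  exact h2

/-- The excess is bounded below by `-1/n`, so the exponential of its negative is bounded. -/
theorem integrable_exp_excess (hκ : 0 < κ) {s : ℝ} (hs : 0 ≤ s) (S : Finset ℕ) :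
    Integrable (fun g => Real.exp (-s * ∑ n ∈ S, excess κ n g)) (sampleLaw κ) := by
  have hm : Measurable fun g => Real.exp (-s * ∑ n ∈ S, excess κ n g) :=
    ((Finset.measurable_sum S fun n _ => measurable_excess κ n).const_mul _).exp
  refine Integrable.of_bound hm.aestronglyMeasurable (Real.exp (s * ∑ n ∈ S, 1 / (n : ℝ)))
    (Filter.Eventually.of_forall fun g => ?_)
  rw [Real.norm_of_nonneg (Real.exp_pos _).le, Real.exp_le_exp, neg_mul, ← mul_neg,
    ← Finset.sum_neg_distrib]
  refine mul_le_mul_of_nonneg_left (Finset.sum_le_sum fun n _ => ?_) hs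
  rw [excess, ← neg_div]
  gcongr
  have : 0 ≤ 4 * Real.pi * κ * ‖gauss n g‖ ^ 2 := by positivity
  linarith

/-- The lower tail is sub-Gaussian: by the quadratic bound for `exp(-x)`, zero mean and a bounded
fourth moment of `g_n` give `exp(C s²/n²)` for each frequency. Independence multiplies the factors,
and the sum of `n⁻²` over `n > M` is at most `1/M`. -/
theorem integral_exp_excess_le (hκ : 0 < κ) : ∃ C, 0 ≤ C ∧ ∀ M N : ℕ, 0 < M → ∀ s : ℝ, 0 ≤ s →
    ∫ g, Real.exp (-s * ∑ n ∈ Finset.Ioc M N, excess κ n g) ∂sampleLaw κ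
      ≤ Real.exp (C * s ^ 2 / M) := by
  obtain ⟨C, hC, hC4⟩ := integral_norm_gauss_pow_le κ 4
  set C' : ℝ := (4 * Real.pi * κ) ^ 2 * C / 2 with hC'
  refine ⟨C', by positivity, fun M N hM s hs => ?_⟩
  have hone : ∀ n : ℕ, 0 < n → ∫ g, Real.exp (-s * excess κ n g) ∂sampleLaw κ
      ≤ Real.exp (C' * s ^ 2 * ((n : ℝ) ^ 2)⁻¹) := by
    intro n hn
    have hn' : (0 : ℝ) < n := by exact_mod_cast hn
    have hI2 : Integrable (fun g => 4 * Real.pi * κ * ‖gauss n g‖ ^ 2) (sampleLaw κ) :=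
      (((allLp_gauss κ n).norm.pow 2).const_mul _).integrable
    have hI4 : Integrable (fun g => ‖gauss n g‖ ^ 4) (sampleLaw κ) :=
      ((allLp_gauss κ n).norm.pow 4).integrable
    have hpt : ∀ g, Real.exp (-s * excess κ n g) ≤ Real.exp (s / n)
        * ((1 - s / n * (4 * Real.pi * κ * ‖gauss n g‖ ^ 2))
          + (s / n) ^ 2 * (4 * Real.pi * κ) ^ 2 / 2 * ‖gauss n g‖ ^ 4) := by
      intro g
      have h := exp_neg_le_quadratic (x := s / n * (4 * Real.pi * κ * ‖gauss n g‖ ^ 2))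
        (by positivity)
      have e : -s * excess κ n g = s / n + -(s / n * (4 * Real.pi * κ * ‖gauss n g‖ ^ 2)) := by
        rw [excess]; field_simp; ring
      rw [e, Real.exp_add]
      refine mul_le_mul_of_nonneg_left (h.trans (le_of_eq ?_)) (Real.exp_pos _).le
      ring
    have hIa : Integrable (fun g => 1 - s / n * (4 * Real.pi * κ * ‖gauss n g‖ ^ 2))
        (sampleLaw κ) := (integrable_const _).sub (hI2.const_mul _)
    have hIb : Integrable (fun g => (s / n) ^ 2 * (4 * Real.pi * κ) ^ 2 / 2 * ‖gauss n g‖ ^ 4)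
        (sampleLaw κ) := hI4.const_mul _
    have hIexp : Integrable (fun g => Real.exp (-s * excess κ n g)) (sampleLaw κ) := by
      simpa using integrable_exp_excess hκ hs {n}
    calc _ ≤ _ := integral_mono hIexp ((hIa.add hIb).const_mul _) hpt
      _ = Real.exp (s / n) * (1 - s / n
          + (s / n) ^ 2 * (4 * Real.pi * κ) ^ 2 / 2 * ∫ g, ‖gauss n g‖ ^ 4 ∂sampleLaw κ) := by
          simp only [Pi.add_apply]
          rw [integral_const_mul, integral_add hIa hIb, integral_sub (integrable_const _)
            (hI2.const_mul _), integral_const_mul, integral_norm_gauss_sq hκ hn,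
            integral_const_mul]
          simp
      _ ≤ Real.exp (s / n) * (1 - s / n + (s / n) ^ 2 * (4 * Real.pi * κ) ^ 2 / 2 * C) := by
          gcongr
          exact hC4 n
      _ ≤ Real.exp (s / n) * Real.exp (-(s / n) + (s / n) ^ 2 * (4 * Real.pi * κ) ^ 2 / 2 * C) := by
          gcongr
          linarith [Real.add_one_le_exp (-(s / n) + (s / n) ^ 2 * (4 * Real.pi * κ) ^ 2 / 2 * C)]
      _ = _ := by
          rw [← Real.exp_add]; congr 1; rw [hC']; field_simp; ring
  have hsum : ∑ n ∈ Finset.Ioc M N, ((n : ℝ) ^ 2)⁻¹ ≤ 1 / M := by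
    rcases le_total M N with h | h
    · refine (sum_Ioc_inv_sq_le_sub hM.ne' h).trans ?_
      rw [one_div]
      have : (0 : ℝ) ≤ (N : ℝ)⁻¹ := by positivity
      linarith
    · rw [Finset.Ioc_eq_empty (by omega)]; simp
  have hmgf : ∫ g, Real.exp (-s * ∑ n ∈ Finset.Ioc M N, excess κ n g) ∂sampleLaw κ
      = ∏ n ∈ Finset.Ioc M N, ∫ g, Real.exp (-s * excess κ n g) ∂sampleLaw κ := by
    have h := (iIndepFun_excess κ).mgf_sum (t := -s) (fun n => measurable_excess κ (n + 1))
      (Finset.Ico M N)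
    have e : Finset.Ioc M N = (Finset.Ico M N).image (· + 1) := by
      ext n; simp only [Finset.mem_Ioc, Finset.mem_image, Finset.mem_Ico]
      constructor
      · intro h; exact ⟨n - 1, by omega, by omega⟩
      · rintro ⟨m, h, rfl⟩; omega
    rw [e]
    simp only [Finset.sum_image (add_left_injective 1).injOn,
      Finset.prod_image (add_left_injective 1).injOn]
    simpa [mgf] using h
  rw [hmgf]
  calc _ ≤ ∏ n ∈ Finset.Ioc M N, Real.exp (C' * s ^ 2 * ((n : ℝ) ^ 2)⁻¹) :=
        Finset.prod_le_prod (fun n _ => integral_nonneg fun g => (Real.exp_pos _).le)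
          fun n hn => hone n (by rw [Finset.mem_Ioc] at hn; omega)
    _ = Real.exp (C' * s ^ 2 * ∑ n ∈ Finset.Ioc M N, ((n : ℝ) ^ 2)⁻¹) := by
        rw [← Real.exp_sum, Finset.mul_sum]
    _ ≤ Real.exp (C' * s ^ 2 * (1 / M)) := by gcongr
    _ = _ := by rw [mul_one_div]

end Excess

/-! ### Deterministic bounds for resonant cubic sums -/

/-- The pairs of positive frequencies with `p + q ≤ M`. -/
def lowPairs (M : ℕ) : Finset (ℕ × ℕ) :=
  (Finset.Icc 1 M ×ˢ Finset.Icc 1 M).filter fun t => t.1 + t.2 ≤ M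

theorem mem_lowPairs {M : ℕ} {t : ℕ × ℕ} :
    t ∈ lowPairs M ↔ 0 < t.1 ∧ 0 < t.2 ∧ t.1 + t.2 ≤ M := by
  simp only [lowPairs, Finset.mem_filter, Finset.mem_product, Finset.mem_Icc]
  omega

theorem sum_lowPairs_swap (M : ℕ) (f : ℕ × ℕ → ℝ) :
    ∑ t ∈ lowPairs M, f t.swap = ∑ t ∈ lowPairs M, f t := by
  refine Finset.sum_equiv (Equiv.prodComm ℕ ℕ) (fun t => ?_) fun t _ => rfl
  simp only [mem_lowPairs, Equiv.prodComm_apply, Prod.fst_swap, Prod.snd_swap]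
  omega

/-- The product `d_q d_{p+q}` is bounded by half the sum of the squares; for fixed `p` both `q` and
`p + q` run injectively through `[1, M]`. -/
theorem sum_lowPairs_le {M : ℕ} {e d : ℕ → ℝ} (he : ∀ n, 0 ≤ e n) :
    ∑ t ∈ lowPairs M, e t.1 * (d t.2 * d (t.1 + t.2))
      ≤ (∑ n ∈ Finset.Icc 1 M, e n) * ∑ n ∈ Finset.Icc 1 M, d n ^ 2 := by
  have h1 : ∑ t ∈ lowPairs M, e t.1 * d t.2 ^ 2
      ≤ (∑ n ∈ Finset.Icc 1 M, e n) * ∑ n ∈ Finset.Icc 1 M, d n ^ 2 := by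
    rw [Finset.sum_mul_sum, ← Finset.sum_product']
    exact Finset.sum_le_sum_of_subset_of_nonneg (Finset.filter_subset _ _) fun t _ _ =>
      mul_nonneg (he _) (sq_nonneg _)
  have h2 : ∑ t ∈ lowPairs M, e t.1 * d (t.1 + t.2) ^ 2
      ≤ (∑ n ∈ Finset.Icc 1 M, e n) * ∑ n ∈ Finset.Icc 1 M, d n ^ 2 := by
    rw [lowPairs, Finset.sum_filter, Finset.sum_product, Finset.sum_mul]
    refine Finset.sum_le_sum fun p _ => ?_
    rw [← Finset.sum_filter]
    simp only
    rw [← Finset.mul_sum]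
    refine mul_le_mul_of_nonneg_left ?_ (he p)
    rw [← Finset.sum_image (g := fun q => p + q) (f := fun n => d n ^ 2)
      (add_right_injective p).injOn]
    refine Finset.sum_le_sum_of_subset_of_nonneg (fun n hn => ?_) fun n _ _ => sq_nonneg _
    obtain ⟨q, hq, rfl⟩ := Finset.mem_image.mp hn
    simp only [Finset.mem_filter, Finset.mem_Icc] at hq ⊢
    omega
  have h3 : ∑ t ∈ lowPairs M, e t.1 * (d t.2 * d (t.1 + t.2))
      ≤ ∑ t ∈ lowPairs M, (1 / 2 * (e t.1 * d t.2 ^ 2) + 1 / 2 * (e t.1 * d (t.1 + t.2) ^ 2)) := by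
    refine Finset.sum_le_sum fun t _ => ?_
    have := mul_nonneg (he t.1) (sq_nonneg (d t.2 - d (t.1 + t.2)))
    linarith
  refine h3.trans ?_
  rw [Finset.sum_add_distrib, ← Finset.mul_sum, ← Finset.mul_sum]
  linarith

theorem abs_triple_le (z : ℕ → ℂ) (t : ℕ × ℕ) :
    |triple z t| ≤ ‖z t.1‖ * ‖z t.2‖ * ‖z (t.1 + t.2)‖ := by
  refine (Complex.abs_re_le_norm _).trans ?_
  rw [norm_mul, norm_mul, RCLike.norm_conj]

/-- The inequality `√(p + q) ≤ √p + √q` moves half a power of one of the two frequencies onto `p +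
q`. One factor is then measured with weight `1/n` and the other two with weight `1/√n`. -/
theorem sum_lowPairs_cubic_le (M : ℕ) (z : ℕ → ℂ) (b : ℕ × ℕ → ℝ)
    (hb : ∀ t, |b t| ≤ 1) :
    |∑ t ∈ lowPairs M, b t / (t.1 * t.2) * triple z t|
      ≤ 2 * ((∑ n ∈ Finset.Icc 1 M, ‖z n‖ / n) * ∑ n ∈ Finset.Icc 1 M, ‖z n‖ ^ 2 / n) := by
  set e : ℕ → ℝ := fun n => ‖z n‖ / n with he
  set d : ℕ → ℝ := fun n => ‖z n‖ / Real.sqrt n with hd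
  have hd2 : ∀ n, d n ^ 2 = ‖z n‖ ^ 2 / n := fun n => by
    rw [hd]; simp only; rw [div_pow, Real.sq_sqrt (Nat.cast_nonneg n)]
  have hpt : ∀ t ∈ lowPairs M, |b t / (t.1 * t.2) * triple z t|
      ≤ e t.1 * (d t.2 * d (t.1 + t.2)) + e t.2 * (d t.1 * d (t.2 + t.1)) := by
    rintro ⟨p, q⟩ ht
    obtain ⟨hp, hq, -⟩ := mem_lowPairs.mp ht
    simp only at hp hq ⊢
    have hp' : (0 : ℝ) < p := by exact_mod_cast hp
    have hq' : (0 : ℝ) < q := by exact_mod_cast hq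
    have h1 := abs_triple_le z (p, q)
    simp only at h1
    have h2 : Real.sqrt (p + q : ℕ) ≤ Real.sqrt p + Real.sqrt q := by
      push_cast
      refine Real.sqrt_le_iff.mpr ⟨by positivity, ?_⟩
      nlinarith [Real.sq_sqrt hp'.le, Real.sq_sqrt hq'.le,
        mul_nonneg (Real.sqrt_nonneg (p : ℝ)) (Real.sqrt_nonneg (q : ℝ))]
    have hpq : 0 < Real.sqrt (p + q : ℕ) := Real.sqrt_pos.mpr (by positivity)
    have e1 : e p * (d q * d (p + q)) + e q * (d p * d (q + p))
        = ‖z p‖ * ‖z q‖ * ‖z (p + q)‖ / (p * q)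
          * ((Real.sqrt p + Real.sqrt q) / Real.sqrt (p + q : ℕ)) := by
      rw [he, hd]
      simp only [add_comm q p]
      have hsp : Real.sqrt p ≠ 0 := (Real.sqrt_pos.mpr hp').ne'
      have hsq : Real.sqrt q ≠ 0 := (Real.sqrt_pos.mpr hq').ne'
      have hsp2 : (p : ℝ) = Real.sqrt p * Real.sqrt p := (Real.mul_self_sqrt hp'.le).symm
      have hsq2 : (q : ℝ) = Real.sqrt q * Real.sqrt q := (Real.mul_self_sqrt hq'.le).symm
      field_simp
      linear_combination ‖z p‖ * ‖z q‖ * ‖z (p + q)‖ * (Real.sqrt p * hsq2 + Real.sqrt q * hsp2)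
    rw [e1, abs_mul, abs_div, abs_of_pos (mul_pos hp' hq')]
    calc |b (p, q)| / (p * q) * |triple z (p, q)|
        ≤ 1 / (p * q) * (‖z p‖ * ‖z q‖ * ‖z (p + q)‖) := by
          gcongr
          exact hb _
      _ = ‖z p‖ * ‖z q‖ * ‖z (p + q)‖ / (p * q) * 1 := by ring
      _ ≤ _ := by
          gcongr
          rwa [one_le_div hpq]
  calc _ ≤ ∑ t ∈ lowPairs M, |b t / (t.1 * t.2) * triple z t| := Finset.abs_sum_le_sum_abs _ _
    _ ≤ ∑ t ∈ lowPairs M, (e t.1 * (d t.2 * d (t.1 + t.2)) + e t.2 * (d t.1 * d (t.2 + t.1))) :=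
        Finset.sum_le_sum hpt
    _ = 2 * ∑ t ∈ lowPairs M, e t.1 * (d t.2 * d (t.1 + t.2)) := by
        rw [Finset.sum_add_distrib, two_mul]
        congr 1
        exact sum_lowPairs_swap M fun t => e t.1 * (d t.2 * d (t.1 + t.2))
    _ ≤ _ := by
        have := sum_lowPairs_le (M := M) (e := e) (d := d) fun n => by positivity
        simp only [hd2] at this
        linarith

theorem sum_lowPairs_smooth_cubic_le (M : ℕ) (z : ℕ → ℂ) (b : ℕ × ℕ → ℝ)
    (hb : ∀ t, |b t| ≤ 1) :
    |∑ t ∈ lowPairs M, b t / (t.1 * t.2 * (t.1 + t.2)) * triple z t|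
      ≤ (∑ n ∈ Finset.Icc 1 M, ‖z n‖ / n) * ∑ n ∈ Finset.Icc 1 M, ‖z n‖ ^ 2 / n ^ 2 := by
  have h := sum_lowPairs_le (M := M) (e := fun n => ‖z n‖ / n) (d := fun n => ‖z n‖ / n)
    fun n => by positivity
  simp only [div_pow] at h
  refine (Finset.abs_sum_le_sum_abs _ _).trans (le_trans (Finset.sum_le_sum fun t ht => ?_) h)
  obtain ⟨hp, hq, -⟩ := mem_lowPairs.mp ht
  have hp' : (0 : ℝ) < t.1 := by exact_mod_cast hp
  have hq' : (0 : ℝ) < t.2 := by exact_mod_cast hq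
  rw [abs_mul, abs_div, abs_of_pos (show (0 : ℝ) < t.1 * t.2 * (t.1 + t.2) by positivity)]
  calc _ ≤ 1 / ((t.1 : ℝ) * t.2 * (t.1 + t.2)) * (‖z t.1‖ * ‖z t.2‖ * ‖z (t.1 + t.2)‖) := by
        gcongr
        · exact hb _
        · exact abs_triple_le z t
    _ = _ := by push_cast; field_simp

theorem sq_sum_div_le (M : ℕ) (z : ℕ → ℂ) :
    (∑ n ∈ Finset.Icc 1 M, ‖z n‖ / n) ^ 2
      ≤ renorm M * ∑ n ∈ Finset.Icc 1 M, ‖z n‖ ^ 2 / n := by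
  have h := Finset.sum_mul_sq_le_sq_mul_sq (Finset.Icc 1 M) (fun n : ℕ => 1 / Real.sqrt n)
    (fun n : ℕ => ‖z n‖ / Real.sqrt n)
  have e1 : ∀ n : ℕ, 1 / Real.sqrt n * (‖z n‖ / Real.sqrt n) = ‖z n‖ / n := fun n => by
    rw [div_mul_div_comm, Real.mul_self_sqrt (Nat.cast_nonneg n), one_mul]
  simpa only [e1, div_pow, Real.sq_sqrt (Nat.cast_nonneg _), one_pow, renorm] using h

/-- On the support of the cutoffs, the low-frequency part of the cubic energy is `O(α_M²)`. -/
theorem exists_cubic_bound {κ : ℝ} (hκ : 0 < κ) (lam L K : ℝ) (hlam : 0 ≤ lam) (hL : 0 ≤ L)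
    (hK : 0 ≤ K) : ∃ C, 0 ≤ C ∧ ∀ α A Y : ℝ, 1 ≤ α → 0 ≤ A → 0 ≤ Y → A ^ 2 ≤ α * Y →
    4 * Real.pi * κ * Y ≤ α + K + lam * (A * L) → 2 * (A * Y) ≤ C * α ^ 2 := by
  -- This is half the coefficient of `Y` in the hypothesis. The cross term `lam · A · L` is absorbed
  -- by the other half through `A² ≤ α Y`, which leaves `Y = O(α)` and hence `A = O(α)`.
  set p : ℝ := 2 * Real.pi * κ with hp
  have hp0 : 0 < p := by positivity
  set C1 : ℝ := (1 + K + (lam * L) ^ 2 / (4 * p)) / p with hC1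
  have hC10 : 0 ≤ C1 := by positivity
  refine ⟨2 * ((1 + C1) * C1), by positivity, fun α A Y hα hA hY hAY hle => ?_⟩
  have hα0 : 0 < α := by linarith
  have h1 : lam * (A * L) ≤ p * Y + (lam * L) ^ 2 / (4 * p) * α := by
    have e : p * (A ^ 2 / α) ≤ p * Y := by
      gcongr
      rw [div_le_iff₀ hα0]; linarith
    have e2 : lam * (A * L) ≤ p * (A ^ 2 / α) + (lam * L) ^ 2 / (4 * p) * α := by
      have := sq_nonneg (2 * p * A - lam * L * α)
      have e3 : p * (A ^ 2 / α) + (lam * L) ^ 2 / (4 * p) * α - lam * (A * L)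
          = (2 * p * A - lam * L * α) ^ 2 / (4 * p * α) := by field_simp; ring
      have e4 : 0 ≤ (2 * p * A - lam * L * α) ^ 2 / (4 * p * α) := by positivity
      linarith
    linarith
  have h2 : Y ≤ C1 * α := by
    rw [hC1, div_mul_eq_mul_div, le_div_iff₀ hp0]
    have : K ≤ K * α := by nlinarith
    have : 4 * Real.pi * κ * Y = 2 * (p * Y) := by rw [hp]; ring
    linarith
  have h3 : A ≤ (1 + C1) * α := by
    refine le_of_sq_le_sq ?_ (by positivity)
    calc A ^ 2 ≤ α * (C1 * α) := hAY.trans (by gcongr)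
      _ ≤ ((1 + C1) * α) ^ 2 := by
        have : C1 ≤ (1 + C1) ^ 2 := by nlinarith
        nlinarith [sq_nonneg α]
  calc 2 * (A * Y) ≤ 2 * (((1 + C1) * α) * (C1 * α)) := by gcongr
    _ = _ := by ring

end BenjaminOno

namespace BenjaminOno

/-! ### Exponential integrability of the cubic energy -/

section ExpCubic

theorem renorm_two_pow_le (j : ℕ) : renorm (2 ^ j) ≤ 1 + j := by
  have h := harmonic_le_one_add_log (2 ^ j)
  have e : ((harmonic (2 ^ j) : ℚ) : ℝ) = renorm (2 ^ j) := by
    rw [harmonic_eq_sum_Icc, renorm]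
    push_cast
    exact Finset.sum_congr rfl fun n _ => by rw [one_div]
  rw [e] at h
  refine h.trans ?_
  push_cast
  rw [Real.log_pow]
  have : Real.log 2 ≤ 1 := by linarith [Real.log_two_lt_d9]
  have hj : (0 : ℝ) ≤ j := Nat.cast_nonneg j
  nlinarith

theorem renorm_mono {M N : ℕ} (h : M ≤ N) : renorm M ≤ renorm N :=
  Finset.sum_le_sum_of_subset_of_nonneg (Finset.Icc_subset_Icc_right h) fun n _ _ => by positivity

theorem one_le_renorm {M : ℕ} (h : 0 < M) : 1 ≤ renorm M := by
  have := renorm_mono (show 1 ≤ M from h)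
  simpa [renorm] using this

/-- The symbol of the cubic sums. -/
def tripleSymbol (a : ℕ → ℝ) (t : ℕ × ℕ) : ℝ := a t.1 * a t.2 * a (t.1 + t.2)

theorem abs_tripleSymbol_le {a : ℕ → ℝ} (ha : ∀ n, |a n| ≤ 1) (t : ℕ × ℕ) :
    |tripleSymbol a t| ≤ 1 := by
  rw [tripleSymbol, abs_mul, abs_mul]
  calc _ ≤ (1 : ℝ) * 1 * 1 := by gcongr <;> exact ha _
    _ = 1 := by norm_num

/-- The resonant form of the integral of `v² 𝓗∂ₓv`, truncated to frequencies at most `M`. -/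
def cubicEnergy (a : ℕ → ℝ) (M : ℕ) (g : Sample) : ℝ :=
  ∑ t ∈ lowPairs M, tripleSymbol a t / (t.1 * t.2) * triple (fun n => gauss n g) t

/-- The resonant form of the integral of `v³`, truncated to frequencies at most `M`. -/
def cubicMean (a : ℕ → ℝ) (M : ℕ) (g : Sample) : ℝ :=
  ∑ t ∈ lowPairs M, tripleSymbol a t / (t.1 * t.2 * (t.1 + t.2)) * triple (fun n => gauss n g) t

theorem measurable_triple (t : ℕ × ℕ) : Measurable fun g => triple (fun n => gauss n g) t := by
  unfold triple
  exact Complex.measurable_re.comp (((measurable_gauss _).mul (measurable_gauss _)).mul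
    (Complex.continuous_conj.measurable.comp (measurable_gauss (t.1 + t.2 : ℕ))))

theorem measurable_cubicEnergy (a : ℕ → ℝ) (M : ℕ) : Measurable (cubicEnergy a M) :=
  Finset.measurable_sum _ fun t _ => (measurable_triple t).const_mul _

theorem measurable_cubicMean (a : ℕ → ℝ) (M : ℕ) : Measurable (cubicMean a M) :=
  Finset.measurable_sum _ fun t _ => (measurable_triple t).const_mul _

/-- The event that the high frequencies make a large contribution. -/
def badSet (κ : ℝ) (a : ℕ → ℝ) (M N : ℕ) : Set Sample :=
  {g | 1 < |cubicEnergy a N g - cubicEnergy a M g|} ∪ {g | 1 < |cubicMean a N g - cubicMean a M g|}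
    ∪ {g | ∑ n ∈ Finset.Ioc M N, excess κ n g < -1}

theorem measurableSet_badSet (κ : ℝ) (a : ℕ → ℝ) (M N : ℕ) : MeasurableSet (badSet κ a M N) := by
  refine ((measurableSet_lt measurable_const ?_).union (measurableSet_lt measurable_const ?_)).union
    (measurableSet_lt ?_ measurable_const)
  · exact ((measurable_cubicEnergy a N).sub (measurable_cubicEnergy a M)).norm
  · exact ((measurable_cubicMean a N).sub (measurable_cubicMean a M)).norm
  · exact Finset.measurable_sum _ fun n _ => measurable_excess κ n

theorem sum_lowPairs_sub {M N : ℕ} (h : M ≤ N) (f : ℕ × ℕ → ℝ) :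
    ∑ t ∈ lowPairs N, f t - ∑ t ∈ lowPairs M, f t = ∑ t ∈ lowPairs N \ lowPairs M, f t := by
  rw [← Finset.sum_sdiff (s₁ := lowPairs M) (s₂ := lowPairs N) (fun t ht => by
    rw [mem_lowPairs] at ht ⊢; omega)]
  ring

variable {κ : ℝ}

/-- Chebyshev's inequality with `2k`-th moments controls the two cubic tails, and a Chernoff bound
with parameter `s` the excess. Both parameters stay free, to be adapted to `M`. -/
theorem measureReal_badSet_le (hκ : 0 < κ) : ∃ C, 0 < C ∧ ∀ a : ℕ → ℝ, (∀ n, |a n| ≤ 1) →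
    ∀ M N : ℕ, 0 < M → M ≤ N → ∀ k : ℕ, 0 < k → ∀ s : ℝ, 0 ≤ s →
    (sampleLaw κ).real (badSet κ a M N)
      ≤ 2 * (C * k ^ 3 / M) ^ k + Real.exp (C * s ^ 2 / M - s) := by
  obtain ⟨C1, hC1, h1⟩ := integral_sum_triple_pow_le κ
  obtain ⟨C2, hC2, h2⟩ := integral_exp_excess_le hκ
  refine ⟨C1 + C2, by positivity, fun a ha M N hM hMN k hk s hs => ?_⟩
  have hM' : (0 : ℝ) < M := by exact_mod_cast hM
  set X : Sample → ℝ := fun g => cubicEnergy a N g - cubicEnergy a M g with hX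
  set Y : Sample → ℝ := fun g => cubicMean a N g - cubicMean a M g with hY
  set D : Sample → ℝ := fun g => ∑ n ∈ Finset.Ioc M N, excess κ n g with hD
  have hT : ∀ t ∈ lowPairs N \ lowPairs M, 0 < t.1 ∧ 0 < t.2 ∧ M < t.1 + t.2 := by
    intro t ht
    rw [Finset.mem_sdiff, mem_lowPairs, mem_lowPairs] at ht
    omega
  have hXs : ∀ g, X g = ∑ t ∈ lowPairs N \ lowPairs M,
      tripleSymbol a t / (t.1 * t.2) * triple (fun n => gauss n g) t := fun g =>
    sum_lowPairs_sub hMN _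
  have hYs : ∀ g, Y g = ∑ t ∈ lowPairs N \ lowPairs M,
      tripleSymbol a t / (t.1 * t.2 * (t.1 + t.2)) * triple (fun n => gauss n g) t := fun g =>
    sum_lowPairs_sub hMN _
  have hmom : (C1 * k ^ 3 / M) ^ k ≤ ((C1 + C2) * k ^ 3 / M) ^ k := by
    gcongr
    linarith
  have hXm : ∫ g, X g ^ (2 * k) ∂sampleLaw κ ≤ ((C1 + C2) * k ^ 3 / M) ^ k := by
    simp only [hXs]
    refine (h1 M hM _ hT _ (fun t ht => ?_) k hk).trans hmom
    obtain ⟨hp, hq, -⟩ := hT t ht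
    have hp' : (0 : ℝ) < t.1 := by exact_mod_cast hp
    have hq' : (0 : ℝ) < t.2 := by exact_mod_cast hq
    rw [abs_div, abs_of_pos (mul_pos hp' hq'), inv_eq_one_div]
    gcongr
    exact abs_tripleSymbol_le ha t
  have hYm : ∫ g, Y g ^ (2 * k) ∂sampleLaw κ ≤ ((C1 + C2) * k ^ 3 / M) ^ k := by
    simp only [hYs]
    refine (h1 M hM _ hT _ (fun t ht => ?_) k hk).trans hmom
    obtain ⟨hp, hq, -⟩ := hT t ht
    have hp' : (1 : ℝ) ≤ t.1 := by exact_mod_cast hp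
    have hq' : (1 : ℝ) ≤ t.2 := by exact_mod_cast hq
    rw [abs_div, abs_of_pos (show (0 : ℝ) < t.1 * t.2 * (t.1 + t.2) by positivity), inv_eq_one_div]
    have : (t.1 : ℝ) * t.2 ≤ t.1 * t.2 * (t.1 + t.2) :=
      le_mul_of_one_le_right (by positivity) (by linarith)
    gcongr
    exact abs_tripleSymbol_le ha t
  have hDm : ∫ g, Real.exp (-s * D g - s) ∂sampleLaw κ ≤ Real.exp ((C1 + C2) * s ^ 2 / M - s) := by
    simp only [sub_eq_add_neg _ s, Real.exp_add]
    rw [integral_mul_const]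
    refine mul_le_mul_of_nonneg_right ((h2 M N hM s hs).trans ?_) (Real.exp_pos _).le
    rw [Real.exp_le_exp]
    gcongr
    linarith
  have hXI : Integrable (fun g => X g ^ (2 * k)) (sampleLaw κ) := by
    simp only [hXs]
    exact ((AllLp.sum _ fun t _ => (allLp_triple κ t).const_mul _).pow _).integrable
  have hYI : Integrable (fun g => Y g ^ (2 * k)) (sampleLaw κ) := by
    simp only [hYs]
    exact ((AllLp.sum _ fun t _ => (allLp_triple κ t).const_mul _).pow _).integrable
  have hDI : Integrable (fun g => Real.exp (-s * D g - s)) (sampleLaw κ) := by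
    simp only [sub_eq_add_neg _ s, Real.exp_add]
    exact (integrable_exp_excess hκ hs _).mul_const _
  have hXY : Integrable (fun g => X g ^ (2 * k) + Y g ^ (2 * k)) (sampleLaw κ) := hXI.add hYI
  have hpt : ∀ g, (badSet κ a M N).indicator (fun _ => (1 : ℝ)) g
      ≤ X g ^ (2 * k) + Y g ^ (2 * k) + Real.exp (-s * D g - s) := by
    intro g
    have p1 : 0 ≤ X g ^ (2 * k) := (even_two_mul k).pow_nonneg _
    have p2 : 0 ≤ Y g ^ (2 * k) := (even_two_mul k).pow_nonneg _
    have p3 := Real.exp_pos (-s * D g - s)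
    by_cases hg : g ∈ badSet κ a M N
    · rw [indicator_of_mem hg]
      rcases hg with (hg | hg) | hg
      · have : 1 ≤ X g ^ (2 * k) := by
          rw [← Even.pow_abs (even_two_mul k)]
          exact one_le_pow₀ (le_of_lt hg)
        linarith
      · have : 1 ≤ Y g ^ (2 * k) := by
          rw [← Even.pow_abs (even_two_mul k)]
          exact one_le_pow₀ (le_of_lt hg)
        linarith
      · have hg' : D g < -1 := hg
        have : 1 ≤ Real.exp (-s * D g - s) := by
          rw [Real.one_le_exp_iff]
          nlinarith
        linarith
    · rw [indicator_of_notMem hg]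
      positivity
  calc (sampleLaw κ).real (badSet κ a M N)
      = ∫ g, (badSet κ a M N).indicator (fun _ => (1 : ℝ)) g ∂sampleLaw κ := by
        rw [integral_indicator (measurableSet_badSet κ a M N)]
        simp
    _ ≤ ∫ g, (X g ^ (2 * k) + Y g ^ (2 * k) + Real.exp (-s * D g - s)) ∂sampleLaw κ :=
        integral_mono ((integrable_const _).indicator (measurableSet_badSet κ a M N))
          (hXY.add hDI) hpt
    _ = (∫ g, X g ^ (2 * k) ∂sampleLaw κ) + (∫ g, Y g ^ (2 * k) ∂sampleLaw κ)
        + ∫ g, Real.exp (-s * D g - s) ∂sampleLaw κ := by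
        rw [integral_add hXY hDI, integral_add hXI hYI]
    _ ≤ _ := by linarith

/-- With `M = 2^j`, `k = j²` and `s = j³`, the base `C j⁶/2^j` is eventually below any fixed
`exp(-(E + 1))`. Raised to the power `j²` it beats the weight `exp(B (j + 2)²)`; the finitely many
remaining scales use `P ≤ 1`. -/
theorem exists_summable_bound {C B : ℝ} (hC : 0 < C) (hB : 0 ≤ B) :
    ∃ S : ℝ, ∀ (N : ℕ) (P : ℕ → ℝ), (∀ j, 0 ≤ P j) → (∀ j, P j ≤ 1) →
      (∀ j : ℕ, 0 < j → ∀ k : ℕ, 0 < k → ∀ s : ℝ, 0 ≤ s →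
        P j ≤ 2 * (C * k ^ 3 / 2 ^ j) ^ k + Real.exp (C * s ^ 2 / 2 ^ j - s)) →
      ∑ j ∈ Finset.range N, P j * Real.exp (B * (j + 2) ^ 2) ≤ S := by
  -- For `j ≥ 1` one has `(j + 2)² ≤ 9 j²`.
  set E : ℝ := 9 * B with hE
  have hE0 : 0 ≤ E := by positivity
  have hlim : Filter.Tendsto (fun j : ℕ => C * ((j : ℝ) ^ 6 / 2 ^ j)) Filter.atTop (nhds 0) := by
    simpa using (tendsto_pow_const_div_const_pow_of_one_lt 6 (r := (2 : ℝ)) (by norm_num)).const_mul C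
  have hev := (hlim.eventually (gt_mem_nhds (Real.exp_pos (-(E + 1))))).and
    (Filter.eventually_ge_atTop (max 1 ⌈E + 1⌉₊))
  obtain ⟨j0, hj0⟩ := Filter.eventually_atTop.mp hev
  set β : ℕ → ℝ := fun j => (if j < j0 then Real.exp (B * (j + 2) ^ 2) else 0)
    + 5 * Real.exp (-(j : ℝ)) with hβ
  have hβs : Summable β := by
    refine Summable.add (summable_of_ne_finset_zero (s := Finset.range j0) fun j hj => ?_)
      (Real.summable_exp_neg_nat.mul_left 5)
    rw [if_neg (by simpa using hj)]
  have hβ0 : ∀ j, 0 ≤ β j := by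
    intro j
    simp only [hβ]
    split_ifs <;> positivity
  refine ⟨∑' j, β j, fun N P hP0 hP1 hP => ?_⟩
  refine (Finset.sum_le_sum fun j _ => ?_).trans (hβs.sum_le_tsum (Finset.range N) fun j _ => hβ0 j)
  by_cases hj : j < j0
  · simp only [hβ, if_pos hj]
    have := mul_le_mul_of_nonneg_right (hP1 j) (Real.exp_pos (B * (j + 2) ^ 2)).le
    linarith [Real.exp_pos (-(j : ℝ))]
  · obtain ⟨h1, h2⟩ := hj0 j (not_lt.mp hj)
    have hj1 : 1 ≤ j := (le_max_left _ _).trans h2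
    have hjE : E + 1 ≤ j := (Nat.le_ceil _).trans (by exact_mod_cast (le_max_right _ _).trans h2)
    have hj1' : (1 : ℝ) ≤ j := by exact_mod_cast hj1
    simp only [hβ, if_neg hj, zero_add]
    have hPj := hP j hj1 (j ^ 2) (by positivity) (j ^ 3) (by positivity)
    have hexp : B * ((j : ℝ) + 2) ^ 2 ≤ E * j ^ 2 := by
      have : ((j : ℝ) + 2) ^ 2 ≤ 9 * j ^ 2 := by nlinarith
      calc _ ≤ B * (9 * (j : ℝ) ^ 2) := by gcongr
        _ = _ := by rw [hE]; ring
    have hr : C * (j : ℝ) ^ 6 / 2 ^ j ≤ Real.exp (-(E + 1)) := by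
      rw [mul_div_assoc]; exact h1.le
    have ha : (C * ((j ^ 2 : ℕ) : ℝ) ^ 3 / 2 ^ j) ^ (j ^ 2) ≤ Real.exp (-((E + 1) * j ^ 2)) := by
      have e : C * ((j ^ 2 : ℕ) : ℝ) ^ 3 / 2 ^ j = C * (j : ℝ) ^ 6 / 2 ^ j := by push_cast; ring
      rw [e]
      calc _ ≤ Real.exp (-(E + 1)) ^ (j ^ 2) := by gcongr
        _ = _ := by rw [← Real.exp_nat_mul]; congr 1; push_cast; ring
    have hb : C * ((j : ℝ) ^ 3) ^ 2 / 2 ^ j - (j : ℝ) ^ 3 ≤ 1 - (E + 1) * j ^ 2 := by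
      have e : C * ((j : ℝ) ^ 3) ^ 2 / 2 ^ j = C * (j : ℝ) ^ 6 / 2 ^ j := by ring
      have : Real.exp (-(E + 1)) ≤ 1 := by rw [Real.exp_le_one_iff]; linarith
      have h3 : (E + 1) * (j : ℝ) ^ 2 ≤ j ^ 3 := by
        calc _ ≤ (j : ℝ) * j ^ 2 := by gcongr
          _ = _ := by ring
      rw [e]; linarith
    have hjj : -((E + 1) * (j : ℝ) ^ 2) + E * j ^ 2 ≤ -j := by nlinarith
    calc P j * Real.exp (B * (j + 2) ^ 2)
        ≤ (2 * Real.exp (-((E + 1) * j ^ 2)) + Real.exp (1 - (E + 1) * j ^ 2))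
          * Real.exp (E * j ^ 2) := by
          refine mul_le_mul (hPj.trans ?_) (Real.exp_le_exp.mpr hexp) (Real.exp_pos _).le
            (by positivity)
          gcongr
      _ = (2 + Real.exp 1) * Real.exp (-((E + 1) * (j : ℝ) ^ 2) + E * j ^ 2) := by
          rw [sub_eq_add_neg, Real.exp_add 1, Real.exp_add]; ring
      _ ≤ 5 * Real.exp (-(j : ℝ)) := by
          gcongr
          linarith [Real.exp_one_lt_d9]

theorem Icc_one_eq_Ioc (N : ℕ) : Finset.Icc 1 N = Finset.Ioc 0 N := by
  ext n; simp only [Finset.mem_Icc, Finset.mem_Ioc]; omega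

/-- Off the exceptional event the frequencies above `M` change the two cubic sums by at most `1` and
lower the renormalized norm by at most `1`. The cutoff thus bounds the sum of `|g_n|²/n` over `n ≤
M` by its mean plus controlled terms, and the deterministic cubic bound applies. -/
theorem abs_cubicEnergy_le_of_notMem (hκ : 0 < κ) (lam L K : ℝ) (hL : 0 ≤ L)
    (hK : 0 ≤ K) : ∃ C, 0 ≤ C ∧ ∀ a : ℕ → ℝ, (∀ n, |a n| ≤ 1) → ∀ M N : ℕ, 0 < M → M ≤ N →
    ∀ g, g ∉ badSet κ a M N → ∑ n ∈ Finset.Icc 1 N, ‖gauss n g‖ ^ 2 / n ^ 2 ≤ L →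
    |∑ n ∈ Finset.Icc 1 N, excess κ n g + lam * cubicMean a N g| ≤ K →
    |cubicEnergy a N g| ≤ C * renorm M ^ 2 + 1 := by
  obtain ⟨C, hC, h⟩ := exists_cubic_bound hκ |lam| L (K + |lam| + 1) (abs_nonneg _) hL
    (by positivity)
  refine ⟨C, hC, fun a ha M N hM hMN g hg h1 h2 => ?_⟩
  simp only [badSet, mem_union, not_or] at hg
  obtain ⟨⟨g1, g2⟩, g3⟩ := hg
  have g1 : |cubicEnergy a N g - cubicEnergy a M g| ≤ 1 := not_lt.mp g1
  have g2 : |cubicMean a N g - cubicMean a M g| ≤ 1 := not_lt.mp g2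
  have g3 : -1 ≤ ∑ n ∈ Finset.Ioc M N, excess κ n g := not_lt.mp g3
  set A : ℝ := ∑ n ∈ Finset.Icc 1 M, ‖gauss n g‖ / n with hA
  set Y : ℝ := ∑ n ∈ Finset.Icc 1 M, ‖gauss n g‖ ^ 2 / n with hY
  have hA0 : 0 ≤ A := Finset.sum_nonneg fun n _ => by positivity
  have hY0 : 0 ≤ Y := Finset.sum_nonneg fun n _ => by positivity
  have hAY := sq_sum_div_le M fun n => gauss n g
  have hQ := sum_lowPairs_cubic_le M (fun n => gauss n g) _ (abs_tripleSymbol_le ha)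
  have hT := sum_lowPairs_smooth_cubic_le M (fun n => gauss n g) _ (abs_tripleSymbol_le ha)
  have hℓ : ∑ n ∈ Finset.Icc 1 M, ‖gauss n g‖ ^ 2 / (n : ℝ) ^ 2 ≤ L :=
    (Finset.sum_le_sum_of_subset_of_nonneg (Finset.Icc_subset_Icc_right hMN)
      fun n _ _ => by positivity).trans h1
  have hT' : |cubicMean a M g| ≤ A * L := hT.trans (mul_le_mul_of_nonneg_left hℓ hA0)
  have hsplit : ∑ n ∈ Finset.Icc 1 N, excess κ n g
      = (4 * Real.pi * κ * Y - renorm M) + ∑ n ∈ Finset.Ioc M N, excess κ n g := by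
    rw [Icc_one_eq_Ioc, ← Finset.sum_Ioc_consecutive _ (Nat.zero_le M) hMN, ← Icc_one_eq_Ioc]
    congr 1
    rw [hY, renorm, Finset.mul_sum, ← Finset.sum_sub_distrib]
    refine Finset.sum_congr rfl fun n _ => ?_
    rw [excess]; ring
  have hTN : |lam * cubicMean a N g| ≤ |lam| * (A * L) + |lam| := by
    rw [abs_mul]
    have : |cubicMean a N g| ≤ A * L + 1 := by
      have := abs_sub_abs_le_abs_sub (cubicMean a N g) (cubicMean a M g)
      linarith
    nlinarith [abs_nonneg lam]
  have hle : 4 * Real.pi * κ * Y ≤ renorm M + (K + |lam| + 1) + |lam| * (A * L) := by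
    have e1 := (abs_le.mp h2).2
    have e2 := (abs_le.mp hTN).1
    rw [hsplit] at e1
    linarith
  have hfin := h (renorm M) A Y (one_le_renorm hM) hA0 hY0 hAY hle
  have hX : |cubicEnergy a M g| ≤ C * renorm M ^ 2 := hQ.trans hfin
  have := abs_sub_abs_le_abs_sub (cubicEnergy a N g) (cubicEnergy a M g)
  linarith

/-- Exponential moments of the cubic energy on the support of the cutoffs, uniformly in `N`. -/
theorem exists_dominating_exp_cubicEnergy (hκ : 0 < κ) (lam L K B : ℝ) (hL : 0 ≤ L) (hK : 0 ≤ K)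
    (hB : 0 ≤ B) : ∃ C, ∀ a : ℕ → ℝ, (∀ n, |a n| ≤ 1) → ∀ N : ℕ, 0 < N → ∃ f : Sample → ℝ,
    Integrable f (sampleLaw κ) ∧ ∫ g, f g ∂sampleLaw κ ≤ C ∧ (∀ g, 0 ≤ f g) ∧
    ∀ g, ∑ n ∈ Finset.Icc 1 N, ‖gauss n g‖ ^ 2 / n ^ 2 ≤ L →
    |∑ n ∈ Finset.Icc 1 N, excess κ n g + lam * cubicMean a N g| ≤ K →
    Real.exp (B * |cubicEnergy a N g|) ≤ f g := by
  obtain ⟨C1, hC1, h1⟩ := abs_cubicEnergy_le_of_notMem hκ lam L K hL hK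
  obtain ⟨C2, hC2, h2⟩ := measureReal_badSet_le hκ
  set B' : ℝ := B * (C1 + 1) with hB'
  obtain ⟨S, hS⟩ := exists_summable_bound (B := B') hC2 (by positivity)
  refine ⟨Real.exp B' + S, fun a ha N hN => ?_⟩
  -- Scales are capped at `N`, where nothing lies above and the exceptional event is empty; hence
  -- every sample has a good scale.
  set M : ℕ → ℕ := fun j => min (2 ^ j) N with hM
  have hM0 : ∀ j, 0 < M j := fun j => lt_min (by positivity) hN
  have hMN : ∀ j, M j ≤ N := fun j => min_le_right _ _
  have hMr : ∀ j, renorm (M j) ≤ 1 + j := fun j =>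
    (renorm_mono (min_le_left _ _)).trans (renorm_two_pow_le j)
  set f : Sample → ℝ := fun g => Real.exp B'
    + ∑ j ∈ Finset.range N, (badSet κ a (M j) N).indicator
      (fun _ => Real.exp (B' * (j + 2) ^ 2)) g with hf
  have hind : ∀ j : ℕ, Integrable ((badSet κ a (M j) N).indicator
      (fun _ => Real.exp (B' * (j + 2) ^ 2))) (sampleLaw κ) := fun j =>
    (integrable_const _).indicator (measurableSet_badSet κ a (M j) N)
  have hsumI : Integrable (fun g => ∑ j ∈ Finset.range N, (badSet κ a (M j) N).indicator
      (fun _ => Real.exp (B' * (j + 2) ^ 2)) g) (sampleLaw κ) :=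
    integrable_finsetSum _ fun j _ => hind j
  have hind0 : ∀ (j : ℕ) g, 0 ≤ (badSet κ a (M j) N).indicator
      (fun _ => Real.exp (B' * (j + 2) ^ 2)) g := fun j g =>
    indicator_nonneg (fun _ _ => (Real.exp_pos _).le) g
  have hempty : badSet κ a N N = ∅ := by
    ext g
    simp [badSet]
  refine ⟨f, (integrable_const _).add hsumI, ?_, fun g => ?_, fun g hg1 hg2 => ?_⟩
  · simp only [hf]
    rw [integral_add (integrable_const _) hsumI, integral_finsetSum _ fun j _ => hind j]
    simp only [integral_const, probReal_univ, one_smul]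
    gcongr
    have := hS N (fun j => (sampleLaw κ).real (badSet κ a (M j) N)) (fun j => measureReal_nonneg)
      (fun j => measureReal_le_one) (fun j hj k hk s hs => ?_)
    · refine (Finset.sum_le_sum fun j _ => ?_).trans this
      rw [integral_indicator (measurableSet_badSet κ a (M j) N)]
      simp
    · rcases le_total (2 ^ j) N with h | h
      · have e : M j = 2 ^ j := min_eq_left h
        have := h2 a ha (M j) N (hM0 j) (hMN j) k hk s hs
        rw [e] at this ⊢
        push_cast at this
        exact this
      · have e : M j = N := min_eq_right h
        rw [e, hempty, measureReal_empty]
        positivity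
  · exact add_nonneg (Real.exp_pos _).le (Finset.sum_nonneg fun j _ => hind0 j g)
  · have hex : ∃ j, g ∉ badSet κ a (M j) N := by
      refine ⟨N, ?_⟩
      have : M N = N := min_eq_right Nat.lt_two_pow_self.le
      rw [this, hempty]
      exact notMem_empty g
    classical
    -- At the first good scale the cubic energy is `O((1 + j)²)`.
    set j := Nat.find hex with hj
    have hgood : g ∉ badSet κ a (M j) N := Nat.find_spec hex
    have hjN : j ≤ N := by
      refine Nat.find_min' hex ?_
      have : M N = N := min_eq_right Nat.lt_two_pow_self.le
      rw [this, hempty]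
      exact notMem_empty g
    have hX := h1 a ha (M j) N (hM0 j) (hMN j) g hgood hg1 hg2
    have hX' : |cubicEnergy a N g| ≤ (C1 + 1) * (1 + j) ^ 2 := by
      refine hX.trans ?_
      have hr0 : 0 ≤ renorm (M j) := (zero_le_one.trans (one_le_renorm (hM0 j)))
      have : renorm (M j) ^ 2 ≤ (1 + j) ^ 2 := by gcongr; exact hMr j
      have h1' : (1 : ℝ) ≤ (1 + j) ^ 2 := one_le_pow₀ (by linarith [Nat.cast_nonneg (α := ℝ) j])
      nlinarith
    have hXe : Real.exp (B * |cubicEnergy a N g|) ≤ Real.exp (B' * (1 + j) ^ 2) := by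
      rw [Real.exp_le_exp, hB', mul_assoc]
      gcongr
    refine hXe.trans ?_
    rcases Nat.eq_zero_or_pos j with h0 | h0
    · rw [h0]
      simp only [Nat.cast_zero, add_zero, one_pow, mul_one, hf]
      exact le_add_of_nonneg_right (Finset.sum_nonneg fun j _ => hind0 j g)
    · have hbad : g ∈ badSet κ a (M (j - 1)) N := by
        by_contra hcon
        have := Nat.find_min' hex hcon
        omega
      have hmem : j - 1 ∈ Finset.range N := by rw [Finset.mem_range]; omega
      have e : Real.exp (B' * (1 + j) ^ 2) = (badSet κ a (M (j - 1)) N).indicator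
          (fun _ => Real.exp (B' * ((j - 1 : ℕ) + 2) ^ 2)) g := by
        rw [indicator_of_mem hbad]
        congr 3
        rw [Nat.cast_sub h0]; push_cast; ring
      rw [e]
      refine (Finset.single_le_sum (f := fun j : ℕ => (badSet κ a (M j) N).indicator
        (fun _ => Real.exp (B' * (j + 2) ^ 2)) g) (fun j _ => hind0 j g) hmem).trans ?_
      simp only [hf]
      linarith [Real.exp_pos B']

end ExpCubic

end BenjaminOno

/-! ### Cubic means as resonant sums over positive frequencies -/

namespace BenjaminOno

theorem sum_Icc_neg {M : Type*} [AddCommMonoid M] (N : ℕ) (f : ℤ → M) :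
    ∑ n ∈ Finset.Icc (-(N : ℤ)) N, f n = f 0 + ∑ n ∈ Finset.Icc 1 N, (f n + f (-n)) := by
  induction N with
  | zero => simp
  | succ N ih =>
    have e : Finset.Icc (-((N + 1 : ℕ) : ℤ)) ((N + 1 : ℕ) : ℤ)
        = insert ((N + 1 : ℕ) : ℤ) (insert (-((N + 1 : ℕ) : ℤ)) (Finset.Icc (-(N : ℤ)) N)) := by
      ext k; simp only [Finset.mem_Icc, Finset.mem_insert]; push_cast; omega
    rw [e, Finset.sum_insert, Finset.sum_insert, ih, ← Finset.insert_Icc_right_eq_Icc_add_one (by omega),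
      Finset.sum_insert]
    · rw [← add_assoc (f _) (f _)]
      exact add_left_comm _ _ _
    · simp
    · simp only [Finset.mem_Icc]; push_cast; omega
    · simp only [Finset.mem_Icc, Finset.mem_insert]; push_cast; omega

namespace Trig

theorem mean_mul_mul_eq_sum (p q r : Trig) (s s' : Finset ℤ) (hs : ∀ k, k ∉ s → p.coeff k = 0)
    (hs' : ∀ k, k ∉ s' → q.coeff k = 0) :
    mean (p * q * r) = ∑ k ∈ s, ∑ l ∈ s', p.coeff k * q.coeff l * r.coeff (-(k + l)) := by
  rw [mul_assoc, mean_apply, coeff_mul_eq_sum p (q * r) s hs]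
  refine Finset.sum_congr rfl fun k _ => ?_
  rw [coeff_mul_eq_sum q r s' hs', Finset.mul_sum]
  refine Finset.sum_congr rfl fun l _ => ?_
  rw [mul_assoc, show 0 - k - l = -(k + l) by ring]

theorem mean_mul_mult_of_isReal {p : Trig} (hp : IsReal p) (m : ℤ → ℂ) (s : Finset ℤ)
    (hs : ∀ k, k ∉ s → p.coeff k = 0) :
    mean (p * mult m p) = ∑ n ∈ s, m (-n) * ((‖p.coeff n‖ ^ 2 : ℝ) : ℂ) := by
  rw [mean_apply, coeff_mul_eq_sum _ _ s hs]
  refine Finset.sum_congr rfl fun n _ => ?_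
  rw [zero_sub, coeff_mult, hp n]
  push_cast
  rw [← Complex.mul_conj']
  ring

/-- The positive modes of a real trigonometric polynomial of degree at most `N`. -/
theorem mean_pos_pos_neg_eq_sum {N : ℕ} {p q : Trig} (hp : ∀ n : ℤ, (N : ℤ) < n → p.coeff n = 0)
    (hq : ∀ n : ℤ, n < -N → q.coeff n = 0) :
    mean (pos p * pos p * neg q)
      = ∑ t ∈ lowPairs N, p.coeff t.1 * p.coeff t.2 * q.coeff (-(t.1 + t.2)) := by
  set s : Finset ℤ := (Finset.Icc 1 N).map ⟨Nat.cast, Nat.cast_injective⟩ with hs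
  have hmem : ∀ k, k ∉ s → (pos p).coeff k = 0 := by
    intro k hk
    by_cases h0 : 0 < k
    · have : (N : ℤ) < k := by
        by_contra hcon
        refine hk (Finset.mem_map.mpr ⟨k.toNat, ?_, ?_⟩)
        · rw [Finset.mem_Icc]; omega
        · simp only [Function.Embedding.coeFn_mk]; omega
      rw [pos, coeff_mult, hp k this, mul_zero]
    · exact coeff_pos_of_nonpos p k (not_lt.mp h0)
  rw [mean_mul_mul_eq_sum _ _ _ s s hmem hmem, lowPairs, Finset.sum_filter, Finset.sum_product,
    hs, Finset.sum_map]
  refine Finset.sum_congr rfl fun k hk => ?_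
  rw [Finset.sum_map]
  refine Finset.sum_congr rfl fun l hl => ?_
  rw [Finset.mem_Icc] at hk hl
  simp only [Function.Embedding.coeFn_mk, pos, neg, coeff_mult]
  rw [if_pos (by omega), if_pos (by omega), if_pos (by omega)]
  split_ifs with h
  · ring
  · rw [hq _ (by omega)]; ring

/-- The reflection `x ↦ -x`, which is complex conjugation for the coefficients of real
polynomials. -/
theorem conj_mean_mul_mul {p q r p' q' r' : Trig} (hp : ∀ n, p'.coeff (-n) = conj (p.coeff n))
    (hq : ∀ n, q'.coeff (-n) = conj (q.coeff n)) (hr : ∀ n, r'.coeff (-n) = conj (r.coeff n)) :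
    mean (p' * q' * r') = conj (mean (p * q * r)) := by
  have h1 := mean_mul_mul_eq_sum p q r p.coeff.support q.coeff.support
    (fun k hk => by simpa using hk) (fun k hk => by simpa using hk)
  have h2 := mean_mul_mul_eq_sum p' q' r' (p.coeff.support.map ⟨fun k => -k, neg_injective⟩)
    (q.coeff.support.map ⟨fun k => -k, neg_injective⟩) (fun k hk => by
      by_contra h
      refine hk (Finset.mem_map.mpr ⟨-k, ?_, neg_neg k⟩)
      rw [Finsupp.mem_support_iff]
      intro h0
      rw [← neg_neg k, hp, h0, map_zero] at h
      exact h rfl) (fun k hk => by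
      by_contra h
      refine hk (Finset.mem_map.mpr ⟨-k, ?_, neg_neg k⟩)
      rw [Finsupp.mem_support_iff]
      intro h0
      rw [← neg_neg k, hq, h0, map_zero] at h
      exact h rfl)
  rw [h1, h2, map_sum, Finset.sum_map]
  refine Finset.sum_congr rfl fun k _ => ?_
  rw [map_sum, Finset.sum_map]
  refine Finset.sum_congr rfl fun l _ => ?_
  simp only [Function.Embedding.coeFn_mk]
  rw [hp, hq, map_mul, map_mul, ← hr]
  congr 2
  ring

theorem coeff_neg_neg_eq_conj {p : Trig} (hp : IsReal p) (n : ℤ) :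
    (neg p).coeff (-n) = conj ((pos p).coeff n) := by
  rw [neg, pos, coeff_mult, coeff_mult, hp n, map_mul]
  by_cases h : 0 < n
  · rw [if_pos (by omega), if_pos h, map_one]
  · rw [if_neg (by omega), if_neg h, map_zero]

theorem coeff_pos_neg_eq_conj {p : Trig} (hp : IsReal p) (n : ℤ) :
    (pos p).coeff (-n) = conj ((neg p).coeff n) := by
  rw [neg, pos, coeff_mult, coeff_mult, hp n, map_mul]
  by_cases h : n < 0
  · rw [if_pos (by omega), if_pos h, map_one]
  · rw [if_neg (by omega), if_neg h, map_zero]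

/-- In the expansion by halves of the spectrum the pure cubes have mean zero. The two mixed
families, each with multiplicity three, are complex conjugate. -/
theorem mean_cube_of_isReal {p : Trig} (hp : IsReal p) (h0 : p.coeff 0 = 0) :
    mean (p * p * p) = ((6 * (mean (pos p * pos p * neg p)).re : ℝ) : ℂ) := by
  have h1 := conj_mean_mul_mul (coeff_neg_neg_eq_conj hp) (coeff_neg_neg_eq_conj hp)
    (coeff_pos_neg_eq_conj hp)
  have h2 := mean_pos_cube p
  have h3 := mean_neg_cube p
  have e : mean (p * p * p) = mean (pos p * pos p * pos p) + 3 * mean (pos p * pos p * neg p)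
      + 3 * mean (neg p * neg p * pos p) + mean (neg p * neg p * neg p) := by
    nth_rewrite 1 2 3 [← pos_add_neg h0]
    have : (pos p + neg p) * (pos p + neg p) * (pos p + neg p) = pos p * pos p * pos p
        + (pos p * pos p * neg p + pos p * pos p * neg p + pos p * pos p * neg p)
        + (neg p * neg p * pos p + neg p * neg p * pos p + neg p * neg p * pos p)
        + neg p * neg p * neg p := by ring
    rw [this]
    simp only [map_add]
    ring
  rw [e, h1, h2, h3]
  have := Complex.add_conj (mean (pos p * pos p * neg p))
  push_cast at this ⊢
  linear_combination 3 * this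

/-- On each half `|∂|` is a multiple of `∂`, so integration by parts turns twice `ab|∂|a` into
`a²|∂|b`, and likewise with the halves exchanged. Each conjugate term then occurs twice, whence the
factor `4`. -/
theorem mean_sq_absD_of_isReal {p : Trig} (hp : IsReal p) (h0 : p.coeff 0 = 0) :
    mean (p * p * absD p) = ((4 * (mean (pos p * pos p * neg (absD p))).re : ℝ) : ℂ) := by
  have hq : IsReal (absD p) := hp.mult fun n => by simp
  have hq0 : (absD p).coeff 0 = 0 := by simp [absD]
  set a := pos p with ha
  set b := neg p with hb
  have hpa : p = a + b := (pos_add_neg h0).symm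
  have hqa : absD p = absD a + absD b := by rw [hpa, map_add]
  have ca : pos (absD p) = absD a := mult_comm _ _ p
  have cb : neg (absD p) = absD b := mult_comm _ _ p
  have da : absD a = -Complex.I • D a := by
    ext n
    rw [absD, D, coeff_mult, show (-Complex.I • mult (fun n : ℤ => Complex.I * n) a).coeff n
      = -Complex.I * (mult (fun n : ℤ => Complex.I * n) a).coeff n by simp, coeff_mult]
    rcases le_or_gt n 0 with h | h
    · rw [ha, coeff_pos_of_nonpos p n h]; ring
    · rw [abs_of_pos h]
      linear_combination ((n : ℂ) * a.coeff n) * Complex.I_mul_I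
  have db : absD b = Complex.I • D b := by
    ext n
    rw [absD, D, coeff_mult, show (Complex.I • mult (fun n : ℤ => Complex.I * n) b).coeff n
      = Complex.I * (mult (fun n : ℤ => Complex.I * n) b).coeff n by simp, coeff_mult]
    rcases lt_or_ge n 0 with h | h
    · rw [abs_of_neg h]
      push_cast
      linear_combination (-(n : ℂ) * b.coeff n) * Complex.I_mul_I
    · rw [hb, coeff_neg_of_nonneg p n h]; ring
  have z1 : mean (a * a * absD a) = 0 :=
    coeff_mul_of_pos (coeff_mul_of_pos (coeff_pos_of_nonpos p) (coeff_pos_of_nonpos p))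
      (by rw [← ca]; exact coeff_pos_of_nonpos _) 0 le_rfl
  have z2 : mean (b * b * absD b) = 0 :=
    coeff_mul_of_neg (coeff_mul_of_neg (coeff_neg_of_nonneg p) (coeff_neg_of_nonneg p))
      (by rw [← cb]; exact coeff_neg_of_nonneg _) 0 le_rfl
  have k1 : 2 * mean (a * b * absD a) = mean (a * a * absD b) := by
    have := mean_D_mul (a * a) b
    rw [D_mul] at this
    rw [da, db]
    have e1 : (D a * a + a * D a) * b = (2 : ℂ) • (a * b * D a) := by
      rw [two_smul]; ring
    rw [e1, map_smul, smul_eq_mul] at this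
    rw [mul_smul_comm, mul_smul_comm, map_smul, map_smul, smul_eq_mul, smul_eq_mul]
    linear_combination -Complex.I * this
  have k2 : 2 * mean (a * b * absD b) = mean (b * b * absD a) := by
    have := mean_D_mul (b * b) a
    rw [D_mul] at this
    rw [da, db]
    have e1 : (D b * b + b * D b) * a = (2 : ℂ) • (a * b * D b) := by
      rw [two_smul]; ring
    rw [e1, map_smul, smul_eq_mul] at this
    rw [mul_smul_comm, mul_smul_comm, map_smul, map_smul, smul_eq_mul, smul_eq_mul]
    linear_combination Complex.I * this
  have h1 := conj_mean_mul_mul (coeff_neg_neg_eq_conj hp) (coeff_neg_neg_eq_conj hp)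
    (coeff_pos_neg_eq_conj hq)
  rw [← ha, ← hb, ca, cb] at h1
  have e : mean (p * p * absD p) = mean (a * a * absD a) + mean (a * a * absD b)
      + 2 * mean (a * b * absD a) + 2 * mean (a * b * absD b) + mean (b * b * absD a)
      + mean (b * b * absD b) := by
    rw [hqa]
    nth_rewrite 1 2 [hpa]
    have : (a + b) * (a + b) * (absD a + absD b) = a * a * absD a + a * a * absD b
        + (2 : ℂ) • (a * b * absD a) + (2 : ℂ) • (a * b * absD b) + b * b * absD a
        + b * b * absD b := by
      simp only [two_smul]
      ring
    rw [this]
    simp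
  rw [e, z1, z2, k1, k2, h1, cb]
  have := Complex.add_conj (mean (a * a * absD b))
  push_cast at this ⊢
  linear_combination 2 * this

end Trig

/-! ### The density as a function of trigonometric polynomials -/

/-- The density `F_{N,R}` as a function of a trigonometric polynomial of degree at most `N`. -/
def trigDensity (κ : ℝ) (χ ψ : ℝ → ℝ) (N : ℕ) (R : ℝ) (p : Trig) : ℝ :=
  χ (Real.sqrt (2 * Real.pi * κ * (Trig.mean (p * p)).re) / R)
    * χ ((2 * Real.pi * κ * (Trig.mean (p * Trig.absD p) + 1 / 3 * Trig.mean
      (Trig.proj ψ N p * Trig.proj ψ N p * Trig.proj ψ N p)).re - renorm N) / R)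
    * Real.exp (-(2 * Real.pi * κ * (3 / 4 * Trig.mean
        (Trig.proj ψ N p * Trig.proj ψ N p * Trig.absD (Trig.proj ψ N p))
      + 1 / 8 * Trig.mean (Trig.proj ψ N p * Trig.proj ψ N p * Trig.proj ψ N p
        * Trig.proj ψ N p)).re))

section Density

variable {κ : ℝ} {χ ψ : ℝ → ℝ} {N : ℕ} {R : ℝ} {c : ℤ → ℂ}

theorem IsProfile.symbol_eq_zero {ε : ℝ} (h : IsProfile ε ψ) (hN : 0 < N) {n : ℤ}
    (hn : (N : ℤ) < |n|) : ψ ((n : ℝ) / N) = 0 := by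
  have hN' : (0 : ℝ) < N := by exact_mod_cast hN
  rw [h.even, h.eq_zero]
  rw [abs_div, abs_of_pos hN', one_lt_div hN']
  exact_mod_cast hn

theorem proj_ofSeq (ψ : ℝ → ℝ) (N : ℕ) (c : ℤ → ℂ) :
    Trig.proj ψ N (Trig.ofSeq N c) = Trig.ofSeq N (smoothProj ψ N c) := by
  ext n
  rw [Trig.proj, Trig.coeff_mult, Trig.coeff_ofSeq, Trig.coeff_ofSeq, smoothProj]
  split_ifs <;> simp

theorem ofSeq_hilbert_dx (N : ℕ) (c : ℤ → ℂ) :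
    Trig.ofSeq N (hilbert (dx c)) = Trig.absD (Trig.ofSeq N c) := by
  ext n
  rw [Trig.absD, Trig.coeff_mult, Trig.coeff_ofSeq, Trig.coeff_ofSeq, hilbert, dx]
  split_ifs
  · rw [← Int.sign_mul_self_eq_abs]
    push_cast
    linear_combination (-(n.sign : ℂ) * n * c n) * Complex.I_mul_I
  · simp

theorem isReal_proj {p : Trig} (hψ : ∀ x, ψ x = ψ |x|) (hp : Trig.IsReal p) :
    Trig.IsReal (Trig.proj ψ N p) :=
  hp.mult fun n => by rw [Trig.even_symbol hψ, Complex.conj_ofReal]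

theorem re_mean_mul_self {p : Trig} (hp : Trig.IsReal p) (s : Finset ℤ)
    (hs : ∀ k, k ∉ s → p.coeff k = 0) :
    Trig.mean (p * p) = ((∑ n ∈ s, ‖p.coeff n‖ ^ 2 : ℝ) : ℂ) := by
  rw [← sq, Trig.mean_sq_of_isReal hp s hs]

theorem coeff_ofSeq_eq_zero {n : ℤ} (h : n ∉ Finset.Icc (-(N : ℤ)) N) :
    (Trig.ofSeq N c).coeff n = 0 := by
  rw [Trig.coeff_ofSeq, if_neg]
  rw [abs_le]; rwa [Finset.mem_Icc] at h

/-- The `Ḣ¹` norm of `S_N u` cancels in the exponent, so only the cubic and quartic parts of the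
energy survive. As the profile vanishes beyond `1`, every function involved is a polynomial of
degree at most `N`, and integrals become means. -/
theorem density_eq {ε : ℝ} (hψ : IsProfile ε ψ) (hN : 0 < N) (hc : ∀ n, c (-n) = conj (c n)) :
    density κ χ ψ N R c = trigDensity κ χ ψ N R (Trig.ofSeq N c) := by
  set p := Trig.ofSeq N c with hp
  have hpr : Trig.IsReal p := Trig.isReal_ofSeq hc
  have hvr : Trig.IsReal (Trig.proj ψ N p) := isReal_proj hψ.even hpr
  have e3 : ∀ v : Trig, v * v * v = v ^ 3 := fun v => by ring
  have e4 : ∀ v : Trig, v * v * v * v = v ^ 4 := fun v => by ring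
  have hsharp : Trig.ofSeq N (sharpProj N c) = p := by
    ext n
    rw [hp, Trig.coeff_ofSeq, Trig.coeff_ofSeq, sharpProj]
    split_ifs <;> rfl
  have hs0 : ∀ n : ℤ, (N : ℤ) < |n| → sharpProj N c n = 0 := fun n hn => by
    rw [sharpProj, if_neg (not_le.mpr hn)]
  have hv0 : ∀ n : ℤ, (N : ℤ) < |n| → smoothProj ψ N c n = 0 := fun n hn => by
    rw [smoothProj, hψ.symbol_eq_zero hN hn]; simp
  have hh0 : ∀ n : ℤ, (N : ℤ) < |n| → hilbert (dx (smoothProj ψ N c)) n = 0 := fun n hn => by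
    rw [hilbert, dx, hv0 n hn]; simp
  have t1 : torusIntegral κ (fun x => toFun (sharpProj N c) x ^ 2)
      = 2 * Real.pi * κ * (Trig.mean (p * p)).re := by
    refine Trig.torusIntegral_eq κ fun x => ?_
    rw [Trig.toFun_eq hs0, hsharp, ← sq, Trig.evalAt_re_pow hpr]
  have t2 : torusIntegral κ (fun x => toFun (smoothProj ψ N c) x ^ 3)
      = 2 * Real.pi * κ * (Trig.mean (Trig.proj ψ N p * Trig.proj ψ N p * Trig.proj ψ N p)).re := by
    refine Trig.torusIntegral_eq κ fun x => ?_
    rw [Trig.toFun_eq hv0, ← proj_ofSeq, ← hp, ← Trig.evalAt_re_pow hvr, e3]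
  have t3 : torusIntegral κ (fun x => toFun (smoothProj ψ N c) x ^ 4)
      = 2 * Real.pi * κ * (Trig.mean (Trig.proj ψ N p * Trig.proj ψ N p * Trig.proj ψ N p
        * Trig.proj ψ N p)).re := by
    refine Trig.torusIntegral_eq κ fun x => ?_
    rw [Trig.toFun_eq hv0, ← proj_ofSeq, ← hp, ← Trig.evalAt_re_pow hvr, e4]
  have t4 : torusIntegral κ (fun x => toFun (smoothProj ψ N c) x ^ 2
        * toFun (hilbert (dx (smoothProj ψ N c))) x)
      = 2 * Real.pi * κ * (Trig.mean (Trig.proj ψ N p * Trig.proj ψ N p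
        * Trig.absD (Trig.proj ψ N p))).re := by
    refine Trig.torusIntegral_eq κ fun x => ?_
    rw [Trig.toFun_eq hv0, Trig.toFun_eq hh0, ofSeq_hilbert_dx, ← proj_ofSeq, ← hp,
      Trig.evalAt_re_mul (hvr.mul hvr), ← Trig.evalAt_re_pow hvr, sq]
  have t5 : homNormSq κ (1 / 2) (sharpProj N c)
      = 2 * Real.pi * κ * (Trig.mean (p * Trig.absD p)).re := by
    rw [Trig.absD, Trig.mean_mul_mult_of_isReal hpr _ (Finset.Icc (-(N : ℤ)) N)
      (fun k hk => coeff_ofSeq_eq_zero hk), homNormSq]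
    congr 1
    rw [tsum_eq_sum (s := Finset.Icc (-(N : ℤ)) N), Complex.re_sum]
    · refine Finset.sum_congr rfl fun n hn => ?_
      have hn' : |n| ≤ (N : ℤ) := abs_le.mpr (Finset.mem_Icc.mp hn)
      rw [sharpProj, if_pos hn', hp, Trig.coeff_ofSeq, if_pos hn', abs_neg, ← Int.cast_abs]
      norm_num
      left
      norm_cast
    · intro n hn
      rw [hs0, norm_zero]
      · ring
      · rw [Finset.mem_Icc, ← abs_le] at hn
        exact not_le.mp hn
  rw [density, trigDensity, t1, t2, t5, energyOne, t3, t4]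
  congr 2
  · congr 2
    rw [Complex.add_re, Complex.mul_re]
    norm_num
    ring
  · simp only [Complex.add_re, Complex.mul_re]
    norm_num
    ring

end Density

end BenjaminOno

namespace BenjaminOno

/-! ### Random trigonometric polynomials -/

/-- A random trigonometric polynomial of bounded degree whose coefficients have finite moments. -/
structure RandTrig {Ω : Type*} [MeasurableSpace Ω] (P : Measure Ω) (p : Ω → Trig) : Prop where
  support : ∃ s : Finset ℤ, ∀ w, ∀ k ∉ s, (p w).coeff k = 0
  measurable : ∀ n, Measurable fun w => (p w).coeff n
  allLp : ∀ n, AllLp P fun w => (p w).coeff n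

namespace RandTrig

variable {Ω : Type*} [MeasurableSpace Ω] {P : Measure Ω} {p q : Ω → Trig}

theorem mult (hp : RandTrig P p) (m : ℤ → ℂ) : RandTrig P fun w => Trig.mult m (p w) := by
  obtain ⟨s, hs⟩ := hp.support
  refine ⟨⟨s, fun w k hk => by rw [Trig.coeff_mult, hs w k hk, mul_zero]⟩, fun n => ?_, fun n => ?_⟩
  · exact (hp.measurable n).const_mul _
  · exact (hp.allLp n).const_mul _

theorem mul (hp : RandTrig P p) (hq : RandTrig P q) : RandTrig P fun w => p w * q w := by
  obtain ⟨s, hs⟩ := hp.support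
  obtain ⟨s', hs'⟩ := hq.support
  have e : ∀ n, (fun w => (p w * q w).coeff n)
      = fun w => ∑ k ∈ s, (p w).coeff k * (q w).coeff (n - k) := fun n =>
    funext fun w => Trig.coeff_mul_eq_sum _ _ s (hs w) n
  refine ⟨⟨Finset.image₂ (· + ·) s s', fun w k hk => ?_⟩, fun n => ?_, fun n => ?_⟩
  · rw [Trig.coeff_mul_eq_sum _ _ s (hs w)]
    refine Finset.sum_eq_zero fun l hl => ?_
    rw [hs' w (k - l), mul_zero]
    intro h
    exact hk (Finset.mem_image₂.mpr ⟨l, hl, k - l, h, by ring⟩)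
  · rw [e]
    exact Finset.measurable_sum _ fun k _ => (hp.measurable k).mul (hq.measurable _)
  · rw [e]
    exact AllLp.sum _ fun k _ => (hp.allLp k).mul (hq.allLp _)

theorem sub (hp : RandTrig P p) (hq : RandTrig P q) : RandTrig P fun w => p w - q w := by
  classical
  obtain ⟨s, hs⟩ := hp.support
  obtain ⟨s', hs'⟩ := hq.support
  have e : ∀ n, (fun w => (p w - q w).coeff n)
      = fun w => (p w).coeff n + (-1) * (q w).coeff n := fun n => funext fun w => by simp; ring
  refine ⟨⟨s ∪ s', fun w k hk => ?_⟩, fun n => ?_, fun n => ?_⟩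
  · rw [Finset.mem_union, not_or] at hk
    have := congrFun (e k) w
    rw [show (p w - q w).coeff k = (p w).coeff k + (-1) * (q w).coeff k from this, hs w k hk.1, hs' w k hk.2]; ring
  · rw [e]; exact (hp.measurable n).add ((hq.measurable n).const_mul _)
  · rw [e]; exact (hp.allLp n).add ((hq.allLp n).const_mul _)

theorem measurable_mean (hp : RandTrig P p) : Measurable fun w => Trig.mean (p w) :=
  hp.measurable 0

theorem allLp_mean (hp : RandTrig P p) : AllLp P fun w => Trig.mean (p w) := hp.allLp 0

end RandTrig

/-- The random series truncated at the frequency `N`. -/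
def randomTrig (N : ℕ) (g : Sample) : Trig := Trig.ofSeq N (seriesCoeff g)

theorem seriesCoeff_neg (g : Sample) (n : ℤ) : seriesCoeff g (-n) = conj (seriesCoeff g n) := by
  rw [seriesCoeff_eq, seriesCoeff_eq, gauss_neg, Int.natAbs_neg, map_div₀, map_natCast]

theorem seriesCoeff_zero (g : Sample) : seriesCoeff g 0 = 0 := by simp [seriesCoeff]

theorem isReal_randomTrig (N : ℕ) (g : Sample) : (randomTrig N g).IsReal :=
  Trig.isReal_ofSeq (seriesCoeff_neg g)

theorem coeff_randomTrig (N : ℕ) (g : Sample) (n : ℤ) : (randomTrig N g).coeff n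
    = if |n| ≤ (N : ℤ) then gauss n g / (n.natAbs : ℂ) else 0 := by
  rw [randomTrig, Trig.coeff_ofSeq, seriesCoeff_eq]

theorem randTrig_randomTrig (κ : ℝ) (N : ℕ) : RandTrig (sampleLaw κ) (randomTrig N) := by
  refine ⟨⟨Finset.Icc (-(N : ℤ)) N, fun g k hk => coeff_ofSeq_eq_zero hk⟩, fun n => ?_, fun n => ?_⟩
  · simp only [coeff_randomTrig]
    split_ifs
    · exact (measurable_gauss n).div_const _
    · exact measurable_const
  · simp only [coeff_randomTrig]
    split_ifs
    · simp only [div_eq_inv_mul]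
      exact (allLp_gauss κ n).const_mul _
    · exact AllLp.const 0

theorem RandTrig.proj {Ω : Type*} [MeasurableSpace Ω] {P : Measure Ω} {p : Ω → Trig}
    (hp : RandTrig P p) (ψ : ℝ → ℝ) (N : ℕ) : RandTrig P fun w => Trig.proj ψ N (p w) := hp.mult _

theorem norm_sq_coeff_randomTrig {N n : ℕ} (hn : n ∈ Finset.Icc 1 N) (g : Sample) :
    ‖(randomTrig N g).coeff n‖ ^ 2 = ‖gauss n g‖ ^ 2 / (n : ℝ) ^ 2 := by
  rw [Finset.mem_Icc] at hn
  rw [coeff_randomTrig, if_pos (by rw [abs_of_nonneg] <;> omega), norm_div, div_pow]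
  simp

section Identities

variable {κ : ℝ} {ψ : ℝ → ℝ} {N : ℕ}

theorem mean_mul_mult_randomTrig {m : ℤ → ℝ} (hm : ∀ n, m (-n) = m n) (N : ℕ) (g : Sample) :
    (Trig.mean (randomTrig N g * Trig.mult (fun n => (m n : ℂ)) (randomTrig N g))).re
      = 2 * ∑ n ∈ Finset.Icc 1 N, m n * (‖gauss n g‖ ^ 2 / (n : ℝ) ^ 2) := by
  rw [Trig.mean_mul_mult_of_isReal (isReal_randomTrig N g) _ (Finset.Icc (-(N : ℤ)) N)
    (fun k hk => coeff_ofSeq_eq_zero hk), sum_Icc_neg]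
  have h0 : (randomTrig N g).coeff 0 = 0 := by rw [coeff_randomTrig]; simp
  rw [h0, Complex.add_re, Complex.re_sum, Finset.mul_sum]
  simp only [norm_zero, neg_neg]
  norm_num
  refine Finset.sum_congr rfl fun n hn => ?_
  rw [(isReal_randomTrig N g) n, RCLike.norm_conj]
  have := norm_sq_coeff_randomTrig hn g
  rw [← Complex.ofReal_pow, Complex.ofReal_re, this, hm]
  ring

theorem mean_sq_randomTrig (N : ℕ) (g : Sample) :
    (Trig.mean (randomTrig N g * randomTrig N g)).re
      = 2 * ∑ n ∈ Finset.Icc 1 N, ‖gauss n g‖ ^ 2 / (n : ℝ) ^ 2 := by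
  have h := mean_mul_mult_randomTrig (m := fun _ => 1) (fun _ => rfl) N g
  have e : Trig.mult (fun _ => ((1 : ℝ) : ℂ)) (randomTrig N g) = randomTrig N g := by
    ext n; rw [Trig.coeff_mult]; simp
  rw [e] at h
  simpa only [one_mul] using h

theorem mean_absD_randomTrig (hκ : 0 < κ) (N : ℕ) (g : Sample) :
    2 * Real.pi * κ * (Trig.mean (randomTrig N g * Trig.absD (randomTrig N g))).re - renorm N
      = ∑ n ∈ Finset.Icc 1 N, excess κ n g := by
  have h := mean_mul_mult_randomTrig (m := fun n => ((|n| : ℤ) : ℝ)) (fun n => by rw [abs_neg]) N g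
  simp only [Complex.ofReal_intCast] at h
  rw [Trig.absD, h, renorm, Finset.mul_sum, Finset.mul_sum, ← Finset.sum_sub_distrib]
  refine Finset.sum_congr rfl fun n hn => ?_
  have hn' : (0 : ℝ) < n := by exact_mod_cast (Finset.mem_Icc.mp hn).1
  rw [excess, Nat.abs_cast, Int.cast_natCast]
  field_simp
  ring

/-- The symbol of the smoothed projector on the positive modes. -/
def profileSymbol (ψ : ℝ → ℝ) (N : ℕ) (n : ℕ) : ℝ := ψ ((n : ℝ) / N)

theorem coeff_proj_randomTrig {ε : ℝ} (hψ : IsProfile ε ψ) (hN : 0 < N) (g : Sample) (n : ℤ) :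
    (Trig.proj ψ N (randomTrig N g)).coeff n
      = (ψ ((n : ℝ) / N) : ℂ) * (gauss n g / (n.natAbs : ℂ)) := by
  rw [Trig.proj, Trig.coeff_mult, coeff_randomTrig]
  split_ifs with h
  · rfl
  · rw [hψ.symbol_eq_zero hN (not_le.mp h)]; simp

theorem coeff_proj_randomTrig_eq_zero {ε : ℝ} (hψ : IsProfile ε ψ) (hN : 0 < N) (g : Sample) {n : ℤ}
    (hn : (N : ℤ) < |n|) : (Trig.proj ψ N (randomTrig N g)).coeff n = 0 := by
  rw [coeff_proj_randomTrig hψ hN, hψ.symbol_eq_zero hN hn]; simp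

theorem re_triple_proj {ε : ℝ} (hψ : IsProfile ε ψ) (hN : 0 < N) (g : Sample) {t : ℕ × ℕ}
    (ht : t ∈ lowPairs N) :
    ((Trig.proj ψ N (randomTrig N g)).coeff t.1 * (Trig.proj ψ N (randomTrig N g)).coeff t.2
      * (Trig.proj ψ N (randomTrig N g)).coeff (-(t.1 + t.2))).re
      = tripleSymbol (profileSymbol ψ N) t / (t.1 * t.2 * (t.1 + t.2))
        * triple (fun n => gauss n g) t := by
  rw [(isReal_proj hψ.even (isReal_randomTrig N g)) (t.1 + t.2), coeff_proj_randomTrig hψ hN,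
    coeff_proj_randomTrig hψ hN, coeff_proj_randomTrig hψ hN, map_mul, map_div₀, Complex.conj_ofReal,
    map_natCast, triple, tripleSymbol, profileSymbol, profileSymbol, profileSymbol,
    ← Complex.re_ofReal_mul]
  congr 1
  have e : ((t.1 + t.2 : ℤ)).natAbs = t.1 + t.2 := by omega
  rw [e, Int.natAbs_natCast, Int.natAbs_natCast]
  push_cast
  simp only [mul_inv, div_eq_mul_inv]
  ring

theorem mean_cube_randomTrig {ε : ℝ} (hψ : IsProfile ε ψ) (hN : 0 < N) (g : Sample) :
    Trig.mean (Trig.proj ψ N (randomTrig N g) * Trig.proj ψ N (randomTrig N g)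
      * Trig.proj ψ N (randomTrig N g))
      = ((6 * cubicMean (profileSymbol ψ N) N g : ℝ) : ℂ) := by
  rw [Trig.mean_cube_of_isReal (isReal_proj hψ.even (isReal_randomTrig N g))
    (by rw [coeff_proj_randomTrig hψ hN]; simp),
    Trig.mean_pos_pos_neg_eq_sum
      (fun n hn => coeff_proj_randomTrig_eq_zero hψ hN g (lt_of_lt_of_le hn (le_abs_self n)))
      (fun n hn => coeff_proj_randomTrig_eq_zero hψ hN g (by rw [lt_abs]; omega)),
    Complex.re_sum, cubicMean]
  congr 2
  exact Finset.sum_congr rfl fun t ht => re_triple_proj hψ hN g ht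

theorem mean_sq_absD_randomTrig {ε : ℝ} (hψ : IsProfile ε ψ) (hN : 0 < N) (g : Sample) :
    Trig.mean (Trig.proj ψ N (randomTrig N g) * Trig.proj ψ N (randomTrig N g)
      * Trig.absD (Trig.proj ψ N (randomTrig N g)))
      = ((4 * cubicEnergy (profileSymbol ψ N) N g : ℝ) : ℂ) := by
  have hz : ∀ n : ℤ, (N : ℤ) < |n| → (Trig.proj ψ N (randomTrig N g)).coeff n = 0 := fun n hn =>
    coeff_proj_randomTrig_eq_zero hψ hN g hn
  have hm := Trig.mean_sq_absD_of_isReal (isReal_proj (N := N) hψ.even (isReal_randomTrig N g))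
    (by rw [coeff_proj_randomTrig hψ hN]; simp)
  rw [hm]
  congr 2
  set v := Trig.proj ψ N (randomTrig N g) with hv
  have h1 : Trig.mean (Trig.pos v * Trig.pos v * Trig.neg (Trig.absD v))
      = ∑ t ∈ lowPairs N, v.coeff t.1 * v.coeff t.2 * (Trig.absD v).coeff (-(t.1 + t.2)) :=
    Trig.mean_pos_pos_neg_eq_sum
      (fun n hn => hz n (lt_of_lt_of_le hn (le_abs_self n)))
      (fun n hn => by
        rw [Trig.absD, Trig.coeff_mult, hz n (by rw [lt_abs]; omega), mul_zero])
  rw [h1, Complex.re_sum, cubicEnergy]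
  refine Finset.sum_congr rfl fun t ht => ?_
  have h2 := re_triple_proj hψ hN g ht
  obtain ⟨hp, hq, -⟩ := mem_lowPairs.mp ht
  have hp' : (0 : ℝ) < t.1 := by exact_mod_cast hp
  have hq' : (0 : ℝ) < t.2 := by exact_mod_cast hq
  rw [Trig.absD, Trig.coeff_mult]
  have e : (((|(-((t.1 : ℤ) + t.2))| : ℤ)) : ℂ) = (((t.1 : ℝ) + t.2 : ℝ) : ℂ) := by
    rw [abs_neg, abs_of_nonneg (by omega)]; push_cast; rfl
  rw [e, mul_left_comm, Complex.re_ofReal_mul, h2]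
  field_simp

end Identities

/-! ### Moments of the density -/

section DensityMoment

variable {κ : ℝ} {χ : ℝ → ℝ} {R : ℝ}

theorem measurable_trigDensity {Ω : Type*} [MeasurableSpace Ω] {P : Measure Ω} {p : Ω → Trig}
    (hχ : Continuous χ) (ψ : ℝ → ℝ) (N : ℕ) (hp : RandTrig P p) :
    Measurable fun w => trigDensity κ χ ψ N R (p w) := by
  have hv := hp.proj ψ N
  have m1 := (hp.mul hp).measurable_mean
  have m2 := (hp.mul (hp.mult fun n => ((|n| : ℤ) : ℂ))).measurable_mean
  have m3 := ((hv.mul hv).mul hv).measurable_mean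
  have m4 := ((hv.mul hv).mul (hv.mult fun n => ((|n| : ℤ) : ℂ))).measurable_mean
  have m5 := (((hv.mul hv).mul hv).mul hv).measurable_mean
  have hre : ∀ {f : Ω → ℂ}, Measurable f → Measurable fun w => (f w).re :=
    fun hf => Complex.measurable_re.comp hf
  unfold trigDensity
  refine ((hχ.measurable.comp ?_).mul (hχ.measurable.comp ?_)).mul (Real.measurable_exp.comp ?_)
  · exact (((hre m1).const_mul _).sqrt).div_const _
  · exact (((hre (m2.add (m3.const_mul _))).const_mul _).sub_const _).div_const _
  · exact ((hre ((m4.const_mul _).add (m5.const_mul _))).const_mul _).neg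

theorem exists_support_bound (hχ_supp : HasCompactSupport χ) (hχ : Continuous χ) :
    ∃ r B : ℝ, 0 ≤ r ∧ 0 ≤ B ∧ (∀ x, |χ x| ≤ B) ∧ ∀ x, χ x ≠ 0 → |x| ≤ r := by
  obtain ⟨r, hr⟩ := hχ_supp.isCompact.isBounded.subset_closedBall 0
  obtain ⟨B, hB⟩ := hχ_supp.exists_bound_of_continuous hχ
  refine ⟨max r 0, B, le_max_right _ _, (norm_nonneg _).trans (hB 0), hB, fun x hx => ?_⟩
  have := hr (subset_tsupport χ (Function.mem_support.mpr hx))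
  rw [mem_closedBall_zero_iff, Real.norm_eq_abs] at this
  exact this.trans (le_max_left _ _)

/-- The density is bounded in `L⁴`, uniformly in the truncation. -/
theorem exists_trigDensity_moment_le (hκ : 0 < κ) (hχ : Continuous χ)
    (hχ_supp : HasCompactSupport χ) (hR : 0 < R) : ∃ C, 0 ≤ C ∧ ∀ (ε : ℝ) (ψ : ℝ → ℝ),
    IsProfile ε ψ → ∀ N : ℕ, 0 < N →
    Integrable (fun g => trigDensity κ χ ψ N R (randomTrig N g) ^ 4) (sampleLaw κ) ∧
    ∫ g, trigDensity κ χ ψ N R (randomTrig N g) ^ 4 ∂sampleLaw κ ≤ C := by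
  obtain ⟨r, B, hr, hB, hχB, hχr⟩ := exists_support_bound hχ_supp hχ
  -- The constants come from the mode sums. The L² norm is `4πκ Σ |g_n|²/n²`; the cubic term of the
  -- second cutoff has coefficient `2πκ · 1/3 · 6 = 4πκ`; the exponent has `2πκ · 3/4 · 4 = 6πκ`,
  -- multiplied by four for the fourth power.
  obtain ⟨C, hC⟩ := exists_dominating_exp_cubicEnergy hκ (4 * Real.pi * κ)
    ((r * R) ^ 2 / (4 * Real.pi * κ)) (r * R) (24 * Real.pi * κ) (by positivity) (by positivity)
    (by positivity)
  refine ⟨B ^ 8 * max C 0, by positivity, fun ε ψ hψ N hN => ?_⟩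
  obtain ⟨f, hfI, hfC, hf0, hf⟩ := hC (profileSymbol ψ N) (fun n => hψ.abs_le_one _) N hN
  have hpt : ∀ g, trigDensity κ χ ψ N R (randomTrig N g) ^ 4 ≤ B ^ 8 * f g := by
    intro g
    by_cases h0 : trigDensity κ χ ψ N R (randomTrig N g) = 0
    · rw [h0, zero_pow (by norm_num)]
      exact mul_nonneg (by positivity) (hf0 g)
    · set u := randomTrig N g with hu
      set v := Trig.proj ψ N u with hv
      have hvr : v.IsReal := isReal_proj hψ.even (isReal_randomTrig N g)
      rw [trigDensity, ← hv] at h0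
      have hx1 := hχr _ (left_ne_zero_of_mul (left_ne_zero_of_mul h0))
      have hx2 := hχr _ (right_ne_zero_of_mul (left_ne_zero_of_mul h0))
      rw [mean_cube_randomTrig hψ hN, Complex.add_re, mul_add, add_sub_right_comm,
        mean_absD_randomTrig hκ] at hx2
      have h2 : |∑ n ∈ Finset.Icc 1 N, excess κ n g
          + 4 * Real.pi * κ * cubicMean (profileSymbol ψ N) N g| ≤ r * R := by
        rw [abs_div, abs_of_pos hR, div_le_iff₀ hR] at hx2
        refine le_trans (le_of_eq ?_) hx2
        congr 2
        simp only [Complex.mul_re, Complex.ofReal_re, Complex.ofReal_im]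
        norm_num
        ring
      rw [mean_sq_randomTrig, abs_div, abs_of_pos hR, div_le_iff₀ hR,
        abs_of_nonneg (Real.sqrt_nonneg _), Real.sqrt_le_left (by positivity)] at hx1
      have h1 : ∑ n ∈ Finset.Icc 1 N, ‖gauss n g‖ ^ 2 / (n : ℝ) ^ 2
          ≤ (r * R) ^ 2 / (4 * Real.pi * κ) := by
        rw [le_div_iff₀ (by positivity)]
        linarith
      have hexp := hf g h1 h2
      -- The quartic energy enters the exponent with a favourable sign and is dropped.
      have hv4 : 0 ≤ (Trig.mean (v * v * v * v)).re := by
        rw [mul_assoc (v * v) v v, re_mean_mul_self (hvr.mul hvr) (v * v).coeff.support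
          (fun k hk => by simpa using hk), Complex.ofReal_re]
        positivity
      have hE : Real.exp (-(2 * Real.pi * κ * (3 / 4 * Trig.mean (v * v * Trig.absD v)
          + 1 / 8 * Trig.mean (v * v * v * v)).re)) ^ 4 ≤ f g := by
        rw [← Real.exp_nat_mul]
        refine le_trans (Real.exp_le_exp.mpr ?_) hexp
        rw [mean_sq_absD_randomTrig hψ hN, Complex.add_re, Complex.mul_re, Complex.mul_re,
          Complex.ofReal_re, Complex.ofReal_im]
        norm_num
        have := neg_abs_le (cubicEnergy (profileSymbol ψ N) N g)
        have hpk : 0 < Real.pi * κ := by positivity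
        nlinarith [mul_nonneg hpk.le hv4]
      rw [trigDensity, mul_pow, mul_pow, ← hv]
      have hx : ∀ x, χ x ^ 4 ≤ B ^ 4 := fun x => by
        rw [← Even.pow_abs (by decide : Even 4)]
        exact pow_le_pow_left₀ (abs_nonneg _) (hχB x) 4
      have hx0 : ∀ x, 0 ≤ χ x ^ 4 := fun x => by positivity
      calc _ ≤ B ^ 4 * B ^ 4 * f g := by
            refine mul_le_mul (mul_le_mul (hx _) (hx _) (hx0 _) (by positivity)) hE
              (by positivity) (by positivity)
        _ = _ := by ring
  have hint : Integrable (fun g => trigDensity κ χ ψ N R (randomTrig N g) ^ 4) (sampleLaw κ) := by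
    refine (hfI.const_mul (B ^ 8)).mono'
      ((measurable_trigDensity hχ ψ N (randTrig_randomTrig κ N)).pow_const 4).aestronglyMeasurable
      (Filter.Eventually.of_forall fun g => ?_)
    rw [Real.norm_of_nonneg (by positivity)]
    exact hpt g
  refine ⟨hint, (integral_mono hint (hfI.const_mul _) hpt).trans ?_⟩
  rw [integral_const_mul]
  gcongr
  exact hfC.trans (le_max_left _ _)

end DensityMoment

end BenjaminOno

namespace BenjaminOno

/-! ### Lattice sums -/

section LatticeSums

/-- The weight `1 / n²` restricted to the frequencies `0 < |n| ≤ N`. -/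
def weight (N : ℕ) (n : ℤ) : ℝ := if n ≠ 0 ∧ |n| ≤ (N : ℤ) then 1 / (n : ℝ) ^ 2 else 0

theorem weight_nonneg (N : ℕ) (n : ℤ) : 0 ≤ weight N n := by
  unfold weight; split_ifs <;> positivity

theorem weight_neg (N : ℕ) (n : ℤ) : weight N (-n) = weight N n := by
  simp [weight]

theorem weight_eq_zero_of_notMem {N : ℕ} {n : ℤ} (h : n ∉ Finset.Icc (-(N : ℤ)) N) :
    weight N n = 0 := by
  rw [weight, if_neg]
  rw [Finset.mem_Icc, ← abs_le] at h
  tauto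

theorem sum_weight_le (N : ℕ) : ∑ n ∈ Finset.Icc (-(N : ℤ)) N, weight N n ≤ 4 := by
  rw [sum_Icc_neg]
  have h0 : weight N 0 = 0 := by simp [weight]
  have h1 : ∀ n ∈ Finset.Icc 1 N, weight N (n : ℤ) + weight N (-(n : ℤ)) = 2 * ((n : ℝ) ^ 2)⁻¹ := by
    intro n hn
    rw [Finset.mem_Icc] at hn
    rw [weight_neg, weight, if_pos ⟨by omega, by rw [abs_of_nonneg] <;> omega⟩]
    push_cast; rw [one_div]; ring
  rw [h0, Finset.sum_congr rfl h1, ← Finset.mul_sum]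
  have h2 := sum_inv_sq_le_two (N + 1)
  have e : Finset.Icc 1 N = Finset.Ioo 0 (N + 1) := by
    ext n; simp only [Finset.mem_Icc, Finset.mem_Ioo]; omega
  rw [e]; linarith

theorem sum_abs_mul_weight (N : ℕ) :
    ∑ n ∈ Finset.Icc (-(N : ℤ)) N, ((|n| : ℤ) : ℝ) * weight N n = 2 * renorm N := by
  rw [sum_Icc_neg]
  have h1 : ∀ n ∈ Finset.Icc 1 N, ((|(n : ℤ)| : ℤ) : ℝ) * weight N (n : ℤ)
      + ((|(-(n : ℤ))| : ℤ) : ℝ) * weight N (-(n : ℤ)) = 2 * (1 / (n : ℝ)) := by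
    intro n hn
    rw [Finset.mem_Icc] at hn
    have hn' : (n : ℝ) ≠ 0 := by have := hn.1; positivity
    rw [weight_neg, abs_neg, weight, if_pos ⟨by omega, by rw [abs_of_nonneg] <;> omega⟩]
    rw [Nat.abs_cast]
    push_cast
    field_simp
    ring
  rw [Finset.sum_congr rfl h1, ← Finset.mul_sum, renorm]
  simp

theorem sum_comp_le {α β : Type*} {I : Finset β} {f : β → ℝ} (hf : ∀ n, 0 ≤ f n)
    (hI : ∀ n ∉ I, f n = 0) (s : Finset α) {e : α → β} (he : Function.Injective e) :
    ∑ x ∈ s, f (e x) ≤ ∑ n ∈ I, f n := by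
  classical
  rw [← Finset.sum_image (f := f) he.injOn]
  rw [← Finset.sum_subset (Finset.inter_subset_left (s₂ := I)) fun n hn h => hI n fun hI =>
    h (Finset.mem_inter.mpr ⟨hn, hI⟩)]
  exact Finset.sum_le_sum_of_subset_of_nonneg Finset.inter_subset_right fun n _ _ => hf n

theorem card_large_le (N K : ℕ) :
    ((Finset.Icc (-(N : ℤ)) N).filter fun b => (N : ℤ) - K < |b|).card ≤ 2 * K := by
  have hsub : ((Finset.Icc (-(N : ℤ)) N).filter fun b => (N : ℤ) - K < |b|)
      ⊆ Finset.Ioc ((N : ℤ) - K) N ∪ Finset.Ico (-(N : ℤ)) (-((N : ℤ) - K)) := by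
    intro b hb
    simp only [Finset.mem_filter, Finset.mem_Icc, Finset.mem_union, Finset.mem_Ioc,
      Finset.mem_Ico] at hb ⊢
    rcases abs_cases b with h | h <;> omega
  refine (Finset.card_le_card hsub).trans ((Finset.card_union_le _ _).trans ?_)
  rw [Int.card_Ioc, Int.card_Ico]
  omega

/-- The number of integers `b` with `N - K < |b| ≤ N`, after an injection. -/
theorem sum_large_le {α : Type*} (s : Finset α) {e : α → ℤ} (he : Function.Injective e) (N K : ℕ) :
    ∑ x ∈ s, (if (N : ℤ) - K < |e x| ∧ |e x| ≤ N then (1 : ℝ) else 0) ≤ 2 * K := by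
  refine (sum_comp_le (I := Finset.Icc (-(N : ℤ)) N)
    (f := fun b => if (N : ℤ) - K < |b| ∧ |b| ≤ N then (1 : ℝ) else 0)
    (fun n => by split_ifs <;> norm_num) (fun n hn => ?_) s he).trans ?_
  · rw [Finset.mem_Icc, ← abs_le] at hn
    rw [if_neg]; tauto
  · have := card_large_le N K
    rw [← Finset.sum_filter, Finset.sum_const, nsmul_eq_mul, mul_one]
    have h2 : ((Finset.Icc (-(N : ℤ)) N).filter fun b => (N : ℤ) - K < |b| ∧ |b| ≤ N).card
        ≤ 2 * K := by
      refine (Finset.card_le_card fun b hb => ?_).trans this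
      simp only [Finset.mem_filter] at hb ⊢
      exact ⟨hb.1, hb.2.1⟩
    exact_mod_cast h2

theorem weight_le_of_le {N : ℕ} {n : ℤ} {x : ℝ} (hx : 0 < x) (h : x ≤ ((|n| : ℤ) : ℝ)) :
    weight N n ≤ 1 / x ^ 2 := by
  unfold weight
  split_ifs
  · have : (n : ℝ) ^ 2 = (((|n| : ℤ) : ℝ)) ^ 2 := by push_cast; rw [sq_abs]
    rw [this]
    gcongr
  · positivity

/-- One of `a` and `m - a` has modulus at least `|m|/2`, so its weight is at most `4/m²`; the other
weight is summable. -/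
theorem sum_weight_mul_weight_le (N : ℕ) {m : ℤ} (hm : m ≠ 0) :
    ∑ a ∈ Finset.Icc (-(N : ℤ)) N, weight N a * weight N (m - a) ≤ 32 / (m : ℝ) ^ 2 := by
  have hm' : (0 : ℝ) < ((|m| : ℤ) : ℝ) := by exact_mod_cast abs_pos.mpr hm
  have hm2 : (m : ℝ) ^ 2 = (((|m| : ℤ) : ℝ)) ^ 2 := by push_cast; rw [sq_abs]
  have hpt : ∀ a, weight N a * weight N (m - a)
      ≤ 4 / (m : ℝ) ^ 2 * (weight N a + weight N (m - a)) := by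
    intro a
    have w1 := weight_nonneg N a
    have w2 := weight_nonneg N (m - a)
    have hc : (1 : ℝ) / (((|m| : ℤ) : ℝ) / 2) ^ 2 = 4 / (m : ℝ) ^ 2 := by
      rw [hm2]; field_simp; ring
    have hc0 : (0 : ℝ) ≤ 4 / (m : ℝ) ^ 2 := by positivity
    have htri : |m| ≤ |a| + |m - a| := by
      have := abs_add_le a (m - a); rwa [add_sub_cancel] at this
    rcases le_total |a| |m - a| with h | h
    · have h1 : weight N (m - a) ≤ 4 / (m : ℝ) ^ 2 := by
        rw [← hc]
        refine weight_le_of_le (by positivity) ?_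
        rw [div_le_iff₀ (by norm_num)]
        exact_mod_cast (by omega : |m| ≤ |m - a| * 2)
      nlinarith
    · have h1 : weight N a ≤ 4 / (m : ℝ) ^ 2 := by
        rw [← hc]
        refine weight_le_of_le (by positivity) ?_
        rw [div_le_iff₀ (by norm_num)]
        exact_mod_cast (by omega : |m| ≤ |a| * 2)
      nlinarith
  refine (Finset.sum_le_sum fun a _ => hpt a).trans ?_
  rw [← Finset.mul_sum, Finset.sum_add_distrib]
  have h1 := sum_weight_le N
  have h2 : ∑ a ∈ Finset.Icc (-(N : ℤ)) N, weight N (m - a) ≤ 4 :=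
    (sum_comp_le (weight_nonneg N) (fun n hn => weight_eq_zero_of_notMem hn) _
      (sub_right_injective (b := m))).trans h1
  have hc0 : (0 : ℝ) ≤ 4 / (m : ℝ) ^ 2 := by positivity
  calc _ ≤ 4 / (m : ℝ) ^ 2 * (4 + 4) := by gcongr
    _ = _ := by ring

variable {ε : ℝ} {N : ℕ}

/-- The set of frequencies at which the symbol of `1 - S_N²` may be nonzero. -/
def highFreq (ε : ℝ) (N : ℕ) : Finset ℤ :=
  (Finset.Icc (-(2 * N : ℤ)) (2 * N)).filter fun m => (1 - ε) * N < ((|m| : ℤ) : ℝ)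

/-- If `|a + b| > (1 - ε)N` and `|a| ≤ |b| ≤ N`, then `|b| > N/4`, and `|b|` lies within `εN + |a|`
of `N`. For given `a` there are `O(εN + |a| + 1)` such `b`, each of weight at most `16/N²`. Summing
`|a|` against its weight costs only a logarithm, absorbed by `1 + α_N ≤ εN`. -/
theorem sum_highFreq_weight_le (hε : 0 < ε) (hε' : ε ≤ 1 / 2) (hN : 0 < N)
    (hNε : 1 + renorm N ≤ ε * N) :
    ∑ m ∈ highFreq ε N, ∑ a ∈ Finset.Icc (-(N : ℤ)) N, weight N a * weight N (m - a)
      ≤ 512 * ε / N := by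
  have hN' : (0 : ℝ) < N := by exact_mod_cast hN
  set I := Finset.Icc (-(N : ℤ)) N with hI
  set K : ℤ → ℕ := fun a => ⌊ε * N⌋₊ + a.natAbs + 1 with hK
  set χ : ℤ → ℤ → ℝ := fun a b => if (N : ℤ) - K a < |b| ∧ |b| ≤ N then (1 : ℝ) else 0 with hχ
  have hχ0 : ∀ a b, 0 ≤ χ a b := fun a b => by simp only [hχ]; split_ifs <;> norm_num
  have hfloor : ε * N < (⌊ε * N⌋₊ : ℝ) + 1 := Nat.lt_floor_add_one _
  have hbd : ∀ a b : ℤ, (1 - ε) * N < ((|a + b| : ℤ) : ℝ) → |a| ≤ |b| →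
      weight N b ≤ 16 / N ^ 2 * χ a b := by
    intro a b h hab
    by_cases hb : |b| ≤ (N : ℤ)
    · have h2 : ((|a + b| : ℤ) : ℝ) ≤ ((|a| : ℤ) : ℝ) + ((|b| : ℤ) : ℝ) := by
        exact_mod_cast abs_add_le a b
      have h3 : ((|a| : ℤ) : ℝ) ≤ ((|b| : ℤ) : ℝ) := by exact_mod_cast hab
      have h4 : (N : ℤ) - K a < |b| := by
        have : (N : ℝ) - K a < ((|b| : ℤ) : ℝ) := by
          have e : ((K a : ℕ) : ℝ) = ⌊ε * N⌋₊ + ((|a| : ℤ) : ℝ) + 1 := by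
            simp only [hK]; push_cast
            rw [Nat.cast_natAbs]
            push_cast; ring
          rw [e]; nlinarith
        exact_mod_cast this
      simp only [hχ]
      rw [if_pos ⟨h4, hb⟩, mul_one]
      have h5 : (N : ℝ) / 4 ≤ ((|b| : ℤ) : ℝ) := by nlinarith
      refine (weight_le_of_le (by positivity) h5).trans (le_of_eq ?_)
      field_simp; ring
    · rw [weight, if_neg (fun h => hb h.2)]
      have := hχ0 a b
      positivity
  have hpt : ∀ a b : ℤ, (if (1 - ε) * N < ((|a + b| : ℤ) : ℝ) then weight N a * weight N b else 0)
      ≤ 16 / N ^ 2 * (weight N a * χ a b + weight N b * χ b a) := by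
    intro a b
    have w1 := weight_nonneg N a
    have w2 := weight_nonneg N b
    have c1 := hχ0 a b
    have c2 := hχ0 b a
    have hc0 : (0 : ℝ) ≤ 16 / N ^ 2 := by positivity
    split_ifs with h
    · rcases le_total |a| |b| with hab | hab
      · have := mul_le_mul_of_nonneg_left (hbd a b h hab) w1
        have : 0 ≤ 16 / (N : ℝ) ^ 2 * (weight N b * χ b a) := by positivity
        linarith
      · have := mul_le_mul_of_nonneg_left (hbd b a (by rwa [add_comm]) hab) w2
        have : 0 ≤ 16 / (N : ℝ) ^ 2 * (weight N a * χ a b) := by positivity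
        linarith
    · positivity
  calc _ = ∑ a ∈ I, ∑ m ∈ highFreq ε N, weight N a * weight N (m - a) := Finset.sum_comm
    _ ≤ ∑ a ∈ I, ∑ b ∈ I,
        (if (1 - ε) * N < ((|a + b| : ℤ) : ℝ) then weight N a * weight N b else 0) := by
        refine Finset.sum_le_sum fun a _ => ?_
        refine le_trans (Finset.sum_le_sum fun m hm => ?_) (sum_comp_le
          (f := fun b => if (1 - ε) * N < ((|a + b| : ℤ) : ℝ) then weight N a * weight N b else 0)
          (fun b => ?_) (fun b hb => ?_) (highFreq ε N) (sub_left_injective (b := a)))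
        · have : (1 - ε) * N < ((|a + (m - a)| : ℤ) : ℝ) := by
            rw [add_sub_cancel]; exact (Finset.mem_filter.mp hm).2
          rw [if_pos this]
        · split_ifs
          · exact mul_nonneg (weight_nonneg N a) (weight_nonneg N b)
          · exact le_rfl
        · rw [weight_eq_zero_of_notMem hb, mul_zero, ite_self]
    _ ≤ ∑ a ∈ I, ∑ b ∈ I, 16 / N ^ 2 * (weight N a * χ a b + weight N b * χ b a) :=
        Finset.sum_le_sum fun a _ => Finset.sum_le_sum fun b _ => hpt a b
    _ = 2 * (16 / N ^ 2 * ∑ a ∈ I, weight N a * ∑ b ∈ I, χ a b) := by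
        simp only [← Finset.mul_sum, Finset.sum_add_distrib]
        rw [Finset.sum_comm (f := fun a b => weight N b * χ b a)]
        simp only [← Finset.mul_sum]
        ring
    _ ≤ 2 * (16 / N ^ 2 * ∑ a ∈ I, weight N a * (2 * K a)) := by
        gcongr with a _
        · exact weight_nonneg N a
        · exact sum_large_le I Function.injective_id N (K a)
    _ = 2 * (16 / N ^ 2 * (2 * ((⌊ε * N⌋₊ + 1) * ∑ a ∈ I, weight N a
        + ∑ a ∈ I, ((|a| : ℤ) : ℝ) * weight N a))) := by
        congr 2
        rw [Finset.mul_sum, ← Finset.sum_add_distrib, Finset.mul_sum]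
        refine Finset.sum_congr rfl fun a _ => ?_
        simp only [hK]
        push_cast
        rw [Nat.cast_natAbs]
        push_cast
        ring
    _ ≤ 2 * (16 / N ^ 2 * (2 * ((ε * N + 1) * 4 + 2 * renorm N))) := by
        rw [sum_abs_mul_weight]
        gcongr
        · exact Finset.sum_nonneg fun a _ => weight_nonneg N a
        · exact Nat.floor_le (by positivity)
        · exact sum_weight_le N
    _ ≤ 2 * (16 / N ^ 2 * (2 * (8 * (ε * N)))) := by
        gcongr
        have : 0 ≤ renorm N := Finset.sum_nonneg fun n _ => by positivity
        linarith
    _ = _ := by field_simp; ring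

/-- For `c + d = -m` the factor `|c| + |d| - |m|` vanishes when the signs agree. When they are
opposite, the larger modulus is `|m|` plus the smaller one and the factor is twice the smaller one.
It cancels the weight of the smaller frequency, leaving `4/m²` at most, and the larger one has only
`N - |m|` possible moduli. -/
theorem sum_opposite_weight_le {m : ℤ} (hm : m ≠ 0) :
    ∑ c ∈ Finset.Icc (-(N : ℤ)) N, (((|c| + |-m - c| - |m| : ℤ)) : ℝ) ^ 2
      * (weight N c * weight N (-m - c)) ≤ 16 * (N - m.natAbs : ℕ) / (m : ℝ) ^ 2 := by
  -- The truncated subtraction gives `0` when `|m| > N`, where no admissible pair exists.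
  set K : ℕ := N - m.natAbs with hK
  have hm' : (0 : ℝ) < ((|m| : ℤ) : ℝ) := by exact_mod_cast abs_pos.mpr hm
  have hm2 : (m : ℝ) ^ 2 = (((|m| : ℤ) : ℝ)) ^ 2 := by push_cast; rw [sq_abs]
  set χ : ℤ → ℝ := fun b => if (N : ℤ) - K < |b| ∧ |b| ≤ N then (1 : ℝ) else 0 with hχ
  have hχ0 : ∀ b, 0 ≤ χ b := fun b => by simp only [hχ]; split_ifs <;> norm_num
  have key : ∀ c d : ℤ, c + d = -m → |c| ≤ |d| → (((|c| + |d| - |m| : ℤ)) : ℝ) ^ 2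
      * (weight N c * weight N d) ≤ 4 / (m : ℝ) ^ 2 * χ d := by
    intro c d hcd hle
    have hpos : 0 ≤ 4 / (m : ℝ) ^ 2 * χ d := mul_nonneg (by positivity) (hχ0 d)
    by_cases hc : c ≠ 0 ∧ |c| ≤ (N : ℤ)
    swap
    · rw [weight, if_neg hc]; simpa using hpos
    by_cases hd : d ≠ 0 ∧ |d| ≤ (N : ℤ)
    swap
    · rw [weight_eq_zero_of_notMem (n := d)]
      · simpa using hpos
      · rw [Finset.mem_Icc, ← abs_le]
        intro h
        refine hd ⟨?_, h⟩
        rintro rfl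
        have := hc.1
        rw [abs_zero] at hle
        exact this (abs_eq_zero.mp (le_antisymm hle (abs_nonneg c)))
    by_cases h0 : |c| + |d| - |m| = 0
    · rw [h0]; simpa using hpos
    · have hopp : |d| = |m| + |c| := by
        rcases abs_cases c with h1 | h1 <;> rcases abs_cases d with h2 | h2 <;>
          rcases abs_cases m with h3 | h3 <;> omega
      have hcpos : 0 < |c| := abs_pos.mpr hc.1
      have hdpos : 0 < |d| := abs_pos.mpr hd.1
      have hχd : χ d = 1 := by
        simp only [hχ]
        rw [if_pos]
        refine ⟨?_, hd.2⟩
        have : (K : ℤ) = N - |m| := by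
          have h1 := hd.2
          have h2 := Int.natCast_natAbs m
          rw [← h2] at hopp ⊢
          omega
        omega
      have e : |c| + |d| - |m| = 2 * |c| := by omega
      rw [hχd, mul_one, e, weight, if_pos hc, weight, if_pos hd]
      have hcr : (0 : ℝ) < ((|c| : ℤ) : ℝ) := by exact_mod_cast hcpos
      have hc2 : (c : ℝ) ^ 2 = (((|c| : ℤ) : ℝ)) ^ 2 := by push_cast; rw [sq_abs]
      have hd2 : (d : ℝ) ^ 2 = (((|d| : ℤ) : ℝ)) ^ 2 := by push_cast; rw [sq_abs]
      have hmd : ((|m| : ℤ) : ℝ) ≤ ((|d| : ℤ) : ℝ) := by exact_mod_cast (by omega : |m| ≤ |d|)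
      have e2 : (((2 * |c| : ℤ)) : ℝ) ^ 2 * (1 / (c : ℝ) ^ 2 * (1 / (d : ℝ) ^ 2))
          = 4 / (d : ℝ) ^ 2 := by
        rw [hc2]
        push_cast at hcr ⊢
        field_simp
        ring
      rw [e2, hm2, hd2]
      gcongr
  have hpt : ∀ c : ℤ, (((|c| + |-m - c| - |m| : ℤ)) : ℝ) ^ 2 * (weight N c * weight N (-m - c))
      ≤ 4 / (m : ℝ) ^ 2 * (χ c + χ (-m - c)) := by
    intro c
    have hc0 : (0 : ℝ) ≤ 4 / (m : ℝ) ^ 2 := by positivity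
    rcases le_total |c| |-m - c| with h | h
    · have := key c (-m - c) (by ring) h
      nlinarith [mul_nonneg hc0 (hχ0 c)]
    · have := key (-m - c) c (by ring) h
      rw [add_comm |-m - c| |c|, mul_comm (weight N (-m - c))] at this
      nlinarith [mul_nonneg hc0 (hχ0 (-m - c))]
  refine (Finset.sum_le_sum fun c _ => hpt c).trans ?_
  rw [← Finset.mul_sum, Finset.sum_add_distrib]
  have h1 := sum_large_le (Finset.Icc (-(N : ℤ)) N) Function.injective_id N K
  have h2 := sum_large_le (Finset.Icc (-(N : ℤ)) N) (sub_right_injective (b := -m)) N K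
  have hc0 : (0 : ℝ) ≤ 4 / (m : ℝ) ^ 2 := by positivity
  calc _ ≤ 4 / (m : ℝ) ^ 2 * (2 * K + 2 * K) := by
        gcongr
        exact h1
    _ = _ := by ring

/-- For each `m` the two inner sums give `m² · 32/m² · 16(N - |m|)/m²`, which is `O(ε/N)` because `N
- |m| < εN` and `|m| > N/2`. The sum effectively runs over `O(εN)` values of `m`, since it is empty
beyond `N`; together this is `O(ε²)`. -/
theorem sum_quadruple_weight_le (hε : 0 < ε) (hε' : ε ≤ 1 / 2) (hN : 0 < N) (hNε : 1 ≤ ε * N) :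
    ∑ m ∈ highFreq ε N, (m : ℝ) ^ 2
      * ((∑ a ∈ Finset.Icc (-(N : ℤ)) N, weight N a * weight N (m - a))
        * ∑ c ∈ Finset.Icc (-(N : ℤ)) N, (((|c| + |-m - c| - |m| : ℤ)) : ℝ) ^ 2
          * (weight N c * weight N (-m - c))) ≤ 8192 * ε ^ 2 := by
  have hN' : (0 : ℝ) < N := by exact_mod_cast hN
  set K : ℕ := ⌊ε * N⌋₊ + 1 with hK
  set χ : ℤ → ℝ := fun b => if (N : ℤ) - K < |b| ∧ |b| ≤ N then (1 : ℝ) else 0 with hχ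
  have hfloor : ε * N < (⌊ε * N⌋₊ : ℝ) + 1 := Nat.lt_floor_add_one _
  have hKle : (K : ℝ) ≤ 2 * (ε * N) := by
    have := Nat.floor_le (show 0 ≤ ε * N by positivity)
    rw [hK]; push_cast; linarith
  have hpt : ∀ m ∈ highFreq ε N, (m : ℝ) ^ 2
      * ((∑ a ∈ Finset.Icc (-(N : ℤ)) N, weight N a * weight N (m - a))
        * ∑ c ∈ Finset.Icc (-(N : ℤ)) N, (((|c| + |-m - c| - |m| : ℤ)) : ℝ) ^ 2
          * (weight N c * weight N (-m - c))) ≤ 2048 * ε / N * χ m := by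
    intro m hm
    have hmN := (Finset.mem_filter.mp hm).2
    have hmhalf : (N : ℝ) / 2 < ((|m| : ℤ) : ℝ) := by nlinarith
    have hm0 : m ≠ 0 := by
      rintro rfl
      simp at hmhalf
      linarith
    have hm2 : (m : ℝ) ^ 2 = (((|m| : ℤ) : ℝ)) ^ 2 := by push_cast; rw [sq_abs]
    have hmpos : (0 : ℝ) < (m : ℝ) ^ 2 := by
      rw [hm2]; have : (0 : ℝ) < ((|m| : ℤ) : ℝ) := by linarith
      positivity
    have h1 := sum_weight_mul_weight_le N hm0
    have h2 := sum_opposite_weight_le (N := N) hm0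
    have h0 : 0 ≤ ∑ c ∈ Finset.Icc (-(N : ℤ)) N, (((|c| + |-m - c| - |m| : ℤ)) : ℝ) ^ 2
          * (weight N c * weight N (-m - c)) := Finset.sum_nonneg fun c _ =>
      mul_nonneg (sq_nonneg _) (mul_nonneg (weight_nonneg _ _) (weight_nonneg _ _))
    calc _ ≤ (m : ℝ) ^ 2 * (32 / (m : ℝ) ^ 2 * (16 * (N - m.natAbs : ℕ) / (m : ℝ) ^ 2)) := by
          gcongr
      _ = 512 * (N - m.natAbs : ℕ) / (m : ℝ) ^ 2 := by field_simp; ring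
      _ ≤ 2048 * ε / N * χ m := by
          by_cases hmle : |m| ≤ (N : ℤ)
          · have hχm : χ m = 1 := by
              simp only [hχ]
              rw [if_pos]
              refine ⟨?_, hmle⟩
              have : (N : ℝ) - K < ((|m| : ℤ) : ℝ) := by
                rw [hK]; push_cast; push_cast at hmN; linarith
              exact_mod_cast this
            have hcast : ((N - m.natAbs : ℕ) : ℝ) = N - ((|m| : ℤ) : ℝ) := by
              have h2 := Int.natCast_natAbs m
              rw [← h2] at hmle
              rw [Nat.cast_sub (by omega), Nat.cast_natAbs]
            rw [hχm, hcast, mul_one, div_le_div_iff₀ hmpos hN', hm2]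
            have e1 : (N : ℝ) - ((|m| : ℤ) : ℝ) ≤ ε * N := by linarith
            have e2 : (N : ℝ) ^ 2 / 4 ≤ (((|m| : ℤ) : ℝ)) ^ 2 := by nlinarith
            calc 512 * ((N : ℝ) - ((|m| : ℤ) : ℝ)) * N ≤ 512 * (ε * N) * N := by gcongr
              _ = 2048 * ε * ((N : ℝ) ^ 2 / 4) := by ring
              _ ≤ _ := by gcongr
          · have : N - m.natAbs = 0 := by
              have h2 := Int.natCast_natAbs m
              rw [← h2] at hmle
              omega
            rw [this]
            simp only [hχ]
            rw [if_neg (fun h => hmle h.2)]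
            simp
  refine (Finset.sum_le_sum hpt).trans ?_
  rw [← Finset.mul_sum]
  have h := sum_large_le (highFreq ε N) Function.injective_id N K
  calc _ ≤ 2048 * ε / N * (2 * K) := by
        gcongr
        exact h
    _ ≤ 2048 * ε / N * (2 * (2 * (ε * N))) := by gcongr
    _ = _ := by field_simp; ring

end LatticeSums

end BenjaminOno

namespace BenjaminOno

/-! ### Gaussian trigonometric polynomials -/

/-- The random trigonometric polynomial with coefficients `wₙ gₙ`. -/
def gaussTrig (N : ℕ) (w : ℤ → ℝ) (g : Sample) : Trig :=
  Trig.ofSeq N fun n => (w n : ℂ) * gauss n g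

section GaussTrig

variable (κ : ℝ) {N : ℕ} {w : ℤ → ℝ}

theorem isReal_gaussTrig (hw : ∀ n, w (-n) = w n) (g : Sample) : (gaussTrig N w g).IsReal :=
  Trig.isReal_ofSeq fun n => by rw [hw, gauss_neg, map_mul, Complex.conj_ofReal]

theorem coeff_gaussTrig (g : Sample) (n : ℤ) : (gaussTrig N w g).coeff n
    = if |n| ≤ (N : ℤ) then (w n : ℂ) * gauss n g else 0 := by
  rw [gaussTrig, Trig.coeff_ofSeq]

theorem randTrig_gaussTrig (N : ℕ) (w : ℤ → ℝ) : RandTrig (sampleLaw κ) (gaussTrig N w) := by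
  refine ⟨⟨Finset.Icc (-(N : ℤ)) N, fun g k hk => coeff_ofSeq_eq_zero hk⟩, fun n => ?_, fun n => ?_⟩
  · simp only [coeff_gaussTrig]
    split_ifs
    · exact (measurable_gauss n).const_mul _
    · exact measurable_const
  · simp only [coeff_gaussTrig]
    split_ifs
    · exact (allLp_gauss κ n).const_mul _
    · exact AllLp.const 0

theorem evalAt_gaussTrig (hw : ∀ n, w (-n) = w n) (g : Sample) (x : ℝ) :
    (Trig.evalAt x (gaussTrig N w g)).re = ∑ t ∈ Finset.Icc 1 N ×ˢ (Finset.univ : Finset Bool),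
      (2 * w t.1 * if t.2 then -Real.sin (t.1 * x) else Real.cos (t.1 * x))
        * ∏ i ∈ ({t} : Finset (ℕ × Bool)), coord i g := by
  rw [gaussTrig, Trig.evalAt_ofSeq, sum_Icc_neg, Finset.sum_product]
  have h0 : gauss 0 g = 0 := by simp [gauss]
  rw [h0, mul_zero, zero_mul, zero_add, Complex.re_sum]
  refine Finset.sum_congr rfl fun n hn => ?_
  rw [Finset.mem_Icc] at hn
  rw [hw, gauss_neg, gauss_natCast (by omega)]
  have e : ∀ y : ℝ, Complex.exp ((y : ℂ) * Complex.I) = ⟨Real.cos y, Real.sin y⟩ := fun y =>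
    Complex.ext (Complex.exp_ofReal_mul_I_re y) (Complex.exp_ofReal_mul_I_im y)
  have e1 : Complex.exp (Complex.I * ((n : ℤ) : ℂ) * x)
      = ⟨Real.cos (n * x), Real.sin (n * x)⟩ := by
    rw [← e]; congr 1; push_cast; ring
  have e2 : Complex.exp (Complex.I * ((-(n : ℤ) : ℤ) : ℂ) * x)
      = ⟨Real.cos (n * x), -Real.sin (n * x)⟩ := by
    rw [← Real.cos_neg, ← Real.sin_neg, ← e]; congr 1; push_cast; ring
  rw [e1, e2]
  simp only [Fintype.sum_bool, Finset.prod_singleton, coord]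
  simp
  ring

/-- Moments of Gaussian trigonometric polynomials at a point. -/
theorem integral_evalAt_gaussTrig_pow_le (hw : ∀ n, w (-n) = w n) (x : ℝ) {k : ℕ} (hk : 0 < k) :
    ∫ g, (Trig.evalAt x (gaussTrig N w g)).re ^ (2 * k) ∂sampleLaw κ
      ≤ (96 * sampleVar κ * k * ∑ n ∈ Finset.Icc 1 N, w n ^ 2) ^ k := by
  have hV : (0 : ℝ) ≤ sampleVar κ := (sampleVar κ).2
  simp only [evalAt_gaussTrig hw]
  refine ((gaussianLike_coord κ).integral_sum_monomial_pow_le (by positivity) hk _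
    (fun t => {t}) (fun s _ t _ h => Finset.singleton_injective h) _).trans
    (pow_le_pow_left₀ (Finset.sum_nonneg fun t _ => by positivity) ?_ k)
  rw [Finset.sum_product, Finset.mul_sum]
  refine Finset.sum_le_sum fun n _ => ?_
  simp only [Fintype.sum_bool, Finset.card_singleton, pow_one, if_true, Bool.false_eq_true, if_false]
  have h1 : (2 * w n * -Real.sin (n * x)) ^ 2 ≤ 4 * w n ^ 2 := by
    have := Real.sin_sq_le_one (n * x)
    nlinarith [sq_nonneg (w n)]
  have h2 : (2 * w n * Real.cos (n * x)) ^ 2 ≤ 4 * w n ^ 2 := by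
    have := Real.cos_sq_le_one (n * x)
    nlinarith [sq_nonneg (w n)]
  have h3 : (0 : ℝ) ≤ 2 * k * (6 * sampleVar κ) := by positivity
  calc _ ≤ 2 * k * (6 * sampleVar κ) * (4 * w n ^ 2) + 2 * k * (6 * sampleVar κ) * (4 * w n ^ 2) := by
        gcongr
    _ = _ := by ring

end GaussTrig

section MeanBound

variable {Ω : Type*} [MeasurableSpace Ω] {P : Measure Ω} {p : Ω → Trig}

theorem RandTrig.evalAt_eq (hp : RandTrig P p) : ∃ N : ℕ, ∀ w, p w = Trig.ofSeq N (p w).coeff := by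
  obtain ⟨s, hs⟩ := hp.support
  refine ⟨s.sup Int.natAbs, fun w => ?_⟩
  ext n
  rw [Trig.coeff_ofSeq]
  split_ifs with h
  · rfl
  · refine hs w n fun hn => h ?_
    have : n.natAbs ≤ s.sup Int.natAbs := Finset.le_sup (f := Int.natAbs) hn
    rw [← Int.natCast_natAbs]
    exact_mod_cast this

theorem RandTrig.allLp_evalAt (hp : RandTrig P p) (x : ℝ) :
    AllLp P fun w => Trig.evalAt x (p w) := by
  obtain ⟨N, hN⟩ := hp.evalAt_eq
  have e : (fun w => Trig.evalAt x (p w)) = fun w => ∑ n ∈ Finset.Icc (-(N : ℤ)) N,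
      Complex.exp (Complex.I * n * x) * (p w).coeff n := by
    funext w
    rw [hN w, Trig.evalAt_ofSeq, ← hN w]
    exact Finset.sum_congr rfl fun n _ => mul_comm _ _
  rw [e]
  exact AllLp.sum _ fun n _ => (hp.allLp n).const_mul _

/-- A bound for the pointwise expectations gives a bound for the expectation of the mean. -/
theorem RandTrig.integral_mean_le (hp : RandTrig P p) {C : ℝ}
    (h : ∀ x, ∫ w, (Trig.evalAt x (p w)).re ∂P ≤ C) : ∫ w, (Trig.mean (p w)).re ∂P ≤ C := by
  obtain ⟨N, hN⟩ := hp.evalAt_eq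
  -- The expectation is taken coefficient by coefficient, so exchanging it with the integral over
  -- the circle involves finite sums only.
  set q : Trig := Trig.ofSeq N fun n => ∫ w, (p w).coeff n ∂P with hq
  have h1 : ∀ x, Trig.evalAt x q = ∫ w, Trig.evalAt x (p w) ∂P := by
    intro x
    have e : ∀ w, Trig.evalAt x (p w) = ∑ n ∈ Finset.Icc (-(N : ℤ)) N,
        Complex.exp (Complex.I * n * x) * (p w).coeff n := by
      intro w
      rw [hN w, Trig.evalAt_ofSeq, ← hN w]
      exact Finset.sum_congr rfl fun n _ => mul_comm _ _
    simp only [e]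
    rw [integral_finsetSum _ fun n _ => ((hp.allLp n).const_mul _).integrable, hq,
      Trig.evalAt_ofSeq]
    refine Finset.sum_congr rfl fun n _ => ?_
    rw [integral_const_mul, mul_comm]
  have h2 : Trig.mean q = ∫ w, Trig.mean (p w) ∂P := by
    rw [Trig.mean_apply, hq, Trig.coeff_ofSeq, if_pos (by simp)]
    rfl
  have hre : ∀ {f : Ω → ℂ}, AllLp P f → (∫ w, f w ∂P).re = ∫ w, (f w).re ∂P := fun hf =>
    (integral_re hf.integrable).symm
  have h3 : (Trig.mean q).re = ∫ w, (Trig.mean (p w)).re ∂P := by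
    rw [h2, hre hp.allLp_mean]
  have h4 := Trig.torusIntegral_eq 1 (p := q) (f := fun x => (Trig.evalAt x q).re) fun x => rfl
  rw [torusIntegral, one_mul, mul_one] at h4
  have h5 : ∫ x in (0 : ℝ)..(2 * Real.pi), (Trig.evalAt x q).re
      ≤ ∫ _x in (0 : ℝ)..(2 * Real.pi), C := by
    refine intervalIntegral.integral_mono_on (by positivity) ?_ (by simp) fun x _ => ?_
    · exact (Complex.continuous_re.comp (Trig.continuous_evalAt q)).intervalIntegrable _ _
    · rw [h1, hre (hp.allLp_evalAt x)]; exact h x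
  rw [h4, intervalIntegral.integral_const, smul_eq_mul, sub_zero, h3] at h5
  exact le_of_mul_le_mul_left h5 (by positivity)

end MeanBound

/-! ### The high frequencies of the cube -/

namespace Trig

theorem coeff_mul_eq_zero_of_degree {p q : Trig} {A B : ℤ} (hp : ∀ n : ℤ, A < |n| → p.coeff n = 0)
    (hq : ∀ n : ℤ, B < |n| → q.coeff n = 0) {n : ℤ} (hn : A + B < |n|) : (p * q).coeff n = 0 := by
  rw [coeff_mul_eq_sum p q p.coeff.support (fun k hk => by simpa using hk)]
  refine Finset.sum_eq_zero fun k _ => ?_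
  by_cases h : A < |k|
  · rw [hp k h, zero_mul]
  · rw [hq (n - k), mul_zero]
    have := abs_add_le k (n - k)
    rw [add_sub_cancel] at this
    omega

/-- The mean of `f²` is one Fourier coefficient of `f²`, hence bounded by its L² norm. -/
theorem sq_mean_mul_self_le {f : Trig} (hf : IsReal f) :
    (mean (f * f)).re ^ 2 ≤ (mean (f * f * (f * f))).re := by
  have hff := hf.mul hf
  have h := re_mean_mul_self hff (insert 0 (f * f).coeff.support)
    (fun k hk => by
      rw [Finset.mem_insert, not_or] at hk
      simpa using hk.2)
  rw [h, Complex.ofReal_re]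
  calc (mean (f * f)).re ^ 2 ≤ ‖(f * f).coeff 0‖ ^ 2 := by
        rw [← sq_abs]
        exact pow_le_pow_left₀ (abs_nonneg _) (Complex.abs_re_le_norm _) 2
    _ ≤ _ := Finset.single_le_sum (f := fun n => ‖(f * f).coeff n‖ ^ 2)
        (fun n _ => by positivity) (Finset.mem_insert_self _ _)

end Trig

section HighCube

variable (κ : ℝ)

/-- The symbol of the truncated random series. -/
def seriesSymbol (ψ : ℝ → ℝ) (N : ℕ) (n : ℤ) : ℝ := ψ ((n : ℝ) / N) / n.natAbs

variable {ε : ℝ} {ψ : ℝ → ℝ} {N : ℕ}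

theorem seriesSymbol_neg (hψ : IsProfile ε ψ) (n : ℤ) :
    seriesSymbol ψ N (-n) = seriesSymbol ψ N n := by
  rw [seriesSymbol, seriesSymbol, Trig.even_symbol hψ.even, Int.natAbs_neg]

theorem seriesSymbol_sq_le (hψ : IsProfile ε ψ) (hN : 0 < N) (n : ℤ) :
    seriesSymbol ψ N n ^ 2 ≤ weight N n := by
  rw [seriesSymbol, weight]
  split_ifs with h
  · rw [div_pow, Nat.cast_natAbs]
    have : (((|n| : ℤ) : ℝ)) ^ 2 = (n : ℝ) ^ 2 := by push_cast; rw [sq_abs]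
    rw [this]
    gcongr
    rw [← sq_abs]
    exact pow_le_one₀ (abs_nonneg _) (hψ.abs_le_one _)
  · rw [not_and_or, not_not, not_le] at h
    rcases h with h | h
    · rw [h]; simp
    · rw [hψ.symbol_eq_zero hN h]; simp

theorem proj_randomTrig_eq (hψ : IsProfile ε ψ) (hN : 0 < N) (g : Sample) :
    Trig.proj ψ N (randomTrig N g) = gaussTrig N (seriesSymbol ψ N) g := by
  ext n
  rw [coeff_proj_randomTrig hψ hN, coeff_gaussTrig]
  split_ifs with h
  · rw [seriesSymbol]; push_cast; ring
  · rw [hψ.symbol_eq_zero hN (not_le.mp h)]; simp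

/-- The part of the symbol at frequencies at most `N / 6`. -/
def lowSymbol (ψ : ℝ → ℝ) (N : ℕ) (n : ℤ) : ℝ :=
  if |n| ≤ ((N / 6 : ℕ) : ℤ) then seriesSymbol ψ N n else 0

/-- The part of the cube which contains its high frequencies. -/
def cubeRemainder (ψ : ℝ → ℝ) (N : ℕ) (g : Sample) : Trig :=
  gaussTrig N (seriesSymbol ψ N) g * gaussTrig N (seriesSymbol ψ N) g
      * gaussTrig N (seriesSymbol ψ N) g
    - gaussTrig N (lowSymbol ψ N) g * gaussTrig N (lowSymbol ψ N) g * gaussTrig N (lowSymbol ψ N) g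

theorem lowSymbol_neg (hψ : IsProfile ε ψ) (n : ℤ) : lowSymbol ψ N (-n) = lowSymbol ψ N n := by
  rw [lowSymbol, lowSymbol, abs_neg, seriesSymbol_neg hψ]

theorem randTrig_cubeRemainder (ψ : ℝ → ℝ) (N : ℕ) :
    RandTrig (sampleLaw κ) (cubeRemainder ψ N) := by
  have h1 := randTrig_gaussTrig κ N (seriesSymbol ψ N)
  have h2 := randTrig_gaussTrig κ N (lowSymbol ψ N)
  exact ((h1.mul h1).mul h1).sub ((h2.mul h2).mul h2)

theorem isReal_cubeRemainder (hψ : IsProfile ε ψ) (g : Sample) : (cubeRemainder ψ N g).IsReal := by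
  have h1 : (gaussTrig N (seriesSymbol ψ N) g).IsReal := isReal_gaussTrig (seriesSymbol_neg hψ) g
  have h2 : (gaussTrig N (lowSymbol ψ N) g).IsReal := isReal_gaussTrig (lowSymbol_neg hψ) g
  exact ((h1.mul h1).mul h1).sub ((h2.mul h2).mul h2)

/-- Three factors of degree at most `N/6` produce frequencies up to `N/2`, which lie below `(1 -
ε)N`. Subtracting the cube of the low part is therefore invisible at high frequencies, and the
difference has a factor that is small. -/
theorem coeff_cubeRemainder (hε' : ε ≤ 1 / 2) (g : Sample) {m : ℤ} (hm : m ∈ highFreq ε N) :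
    (cubeRemainder ψ N g).coeff m = (gaussTrig N (seriesSymbol ψ N) g
      * gaussTrig N (seriesSymbol ψ N) g * gaussTrig N (seriesSymbol ψ N) g).coeff m := by
  have hl : ∀ n : ℤ, ((N / 6 : ℕ) : ℤ) < |n| → (gaussTrig N (lowSymbol ψ N) g).coeff n = 0 := by
    intro n hn
    rw [coeff_gaussTrig, lowSymbol, if_neg (not_le.mpr hn)]
    simp
  have hm' : ((N / 6 : ℕ) : ℤ) + ((N / 6 : ℕ) : ℤ) + ((N / 6 : ℕ) : ℤ) < |m| := by
    have h1 := (Finset.mem_filter.mp hm).2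
    have h2 : (N : ℝ) / 2 < ((|m| : ℤ) : ℝ) := by
      have : (0 : ℝ) ≤ N := Nat.cast_nonneg N
      nlinarith
    rw [div_lt_iff₀ (by norm_num)] at h2
    have h3 : (N : ℤ) < |m| * 2 := by exact_mod_cast h2
    omega
  have h0 : (gaussTrig N (lowSymbol ψ N) g * gaussTrig N (lowSymbol ψ N) g
      * gaussTrig N (lowSymbol ψ N) g).coeff m = 0 :=
    Trig.coeff_mul_eq_zero_of_degree
      (fun n hn => Trig.coeff_mul_eq_zero_of_degree hl hl hn) hl hm'
  have e : (cubeRemainder ψ N g).coeff m = (gaussTrig N (seriesSymbol ψ N) g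
      * gaussTrig N (seriesSymbol ψ N) g * gaussTrig N (seriesSymbol ψ N) g).coeff m
      - (gaussTrig N (lowSymbol ψ N) g * gaussTrig N (lowSymbol ψ N) g
        * gaussTrig N (lowSymbol ψ N) g).coeff m := by
    rw [cubeRemainder]; simp
  rw [e, h0, sub_zero]

theorem sum_norm_cube_le (hψ : IsProfile ε ψ) (hε' : ε ≤ 1 / 2) (g : Sample) :
    ∑ m ∈ highFreq ε N, ‖(gaussTrig N (seriesSymbol ψ N) g
      * gaussTrig N (seriesSymbol ψ N) g * gaussTrig N (seriesSymbol ψ N) g).coeff m‖ ^ 2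
      ≤ (Trig.mean (cubeRemainder ψ N g * cubeRemainder ψ N g)).re := by
  classical
  rw [re_mean_mul_self (isReal_cubeRemainder hψ g)
    (highFreq ε N ∪ (cubeRemainder ψ N g).coeff.support) (fun k hk => by
      rw [Finset.mem_union, not_or] at hk
      simpa using hk.2), Complex.ofReal_re]
  rw [Finset.sum_congr rfl fun m hm => by rw [← coeff_cubeRemainder (ψ := ψ) hε' g hm]]
  exact Finset.sum_le_sum_of_subset_of_nonneg Finset.subset_union_left fun n _ _ => by positivity

/-- Here `x³ - y³ = h Q` with `Q = x² + xy + y²` bounded by a multiple of `x² + y²`. The powers of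
`N` are placed on `h`, which in the application is a Gaussian of variance `O(1/N)`, so that `N⁴ h⁸`
has bounded expectation. -/
theorem pow_four_cube_sub_le (N x y h : ℝ) (hh : h = x - y) (hN : 0 ≤ N) :
    N ^ 2 * ((x ^ 3 - y ^ 3) * (x ^ 3 - y ^ 3) * ((x ^ 3 - y ^ 3) * (x ^ 3 - y ^ 3)))
      ≤ 41 * (N ^ 4 * h ^ 8 + (x ^ 16 + y ^ 16)) := by
  set Q : ℝ := x ^ 2 + x * y + y ^ 2 with hQ
  have hQ0 : 0 ≤ Q := by nlinarith [sq_nonneg (x + y), sq_nonneg x, sq_nonneg y]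
  have hQle : Q ≤ 3 / 2 * (x ^ 2 + y ^ 2) := by nlinarith [sq_nonneg (x - y)]
  have e : (x ^ 3 - y ^ 3) * (x ^ 3 - y ^ 3) * ((x ^ 3 - y ^ 3) * (x ^ 3 - y ^ 3))
      = h ^ 4 * Q ^ 4 := by rw [hh, hQ]; ring
  have h1 : Q ^ 4 ≤ (3 / 2) ^ 4 * (2 ^ 3 * (x ^ 8 + y ^ 8)) := by
    calc Q ^ 4 ≤ (3 / 2 * (x ^ 2 + y ^ 2)) ^ 4 := pow_le_pow_left₀ hQ0 hQle 4
      _ = (3 / 2) ^ 4 * (x ^ 2 + y ^ 2) ^ 4 := by rw [mul_pow]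
      _ ≤ (3 / 2) ^ 4 * (2 ^ (4 - 1) * ((x ^ 2) ^ 4 + (y ^ 2) ^ 4)) := by
          gcongr
          exact add_pow_le (sq_nonneg x) (sq_nonneg y) 4
      _ = _ := by ring
  have h2 : N ^ 2 * h ^ 4 * (x ^ 8 + y ^ 8) ≤ 1 / 2 * (N ^ 4 * h ^ 8) + (x ^ 16 + y ^ 16) := by
    nlinarith [sq_nonneg (N ^ 2 * h ^ 4 - (x ^ 8 + y ^ 8)), sq_nonneg (x ^ 8 - y ^ 8)]
  rw [e]
  have h3 : 0 ≤ N ^ 2 * h ^ 4 := by positivity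
  have h4 : 0 ≤ N ^ 4 * h ^ 8 := by positivity
  have h5 : 0 ≤ x ^ 16 + y ^ 16 := by positivity
  calc N ^ 2 * (h ^ 4 * Q ^ 4) = N ^ 2 * h ^ 4 * Q ^ 4 := by ring
    _ ≤ N ^ 2 * h ^ 4 * ((3 / 2) ^ 4 * (2 ^ 3 * (x ^ 8 + y ^ 8))) := by gcongr
    _ = (81 / 2) * (N ^ 2 * h ^ 4 * (x ^ 8 + y ^ 8)) := by ring
    _ ≤ (81 / 2) * (1 / 2 * (N ^ 4 * h ^ 8) + (x ^ 16 + y ^ 16)) := by gcongr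
    _ ≤ 41 * (N ^ 4 * h ^ 8 + (x ^ 16 + y ^ 16)) := by linarith

end HighCube

end BenjaminOno

namespace BenjaminOno

section HighCubeMoments

variable (κ : ℝ) {ε : ℝ} {ψ : ℝ → ℝ} {N : ℕ}

theorem gaussTrig_sub (N : ℕ) (w w' : ℤ → ℝ) (g : Sample) :
    gaussTrig N (fun n => w n - w' n) g = gaussTrig N w g - gaussTrig N w' g := by
  ext n
  have e : (gaussTrig N w g - gaussTrig N w' g).coeff n
      = (gaussTrig N w g).coeff n - (gaussTrig N w' g).coeff n := by simp
  rw [e, coeff_gaussTrig, coeff_gaussTrig, coeff_gaussTrig]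
  split_ifs
  · push_cast; ring
  · simp

theorem sum_Icc_sq_le_of_le {w : ℤ → ℝ} {k : ℕ}
    (hw : ∀ n : ℤ, w n ^ 2 ≤ weight N n) (h0 : ∀ n : ℕ, n ≤ k → w n = 0) :
    ∑ n ∈ Finset.Icc 1 N, w n ^ 2 ≤ 2 / (k + 1) := by
  refine le_trans ?_ (sum_Ioo_inv_sq_le (α := ℝ) k (N + 1))
  rw [← Finset.sum_filter_add_sum_filter_not (Finset.Icc 1 N) (fun n => n ≤ k)]
  rw [Finset.sum_eq_zero (s := (Finset.Icc 1 N).filter (fun n => n ≤ k)) fun n hn => by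
    rw [h0 n (Finset.mem_filter.mp hn).2]; simp, zero_add]
  refine (Finset.sum_le_sum fun n hn => ?_).trans (Finset.sum_le_sum_of_subset_of_nonneg
    (f := fun n : ℕ => ((n : ℝ) ^ 2)⁻¹) (fun n hn => ?_) fun n _ _ => by positivity)
  · rw [Finset.mem_filter, Finset.mem_Icc] at hn
    refine (hw n).trans (le_of_eq ?_)
    rw [weight, if_pos ⟨by omega, by rw [abs_of_nonneg (by omega)]; omega⟩]
    simp
  · rw [Finset.mem_filter, Finset.mem_Icc] at hn
    rw [Finset.mem_Ioo]; omega

theorem lowSymbol_sq_le (hψ : IsProfile ε ψ) (hN : 0 < N) (n : ℤ) :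
    lowSymbol ψ N n ^ 2 ≤ weight N n := by
  rw [lowSymbol]
  split_ifs
  · exact seriesSymbol_sq_le hψ hN n
  · simpa using weight_nonneg N n

/-- The high frequencies of the cube of the truncated random series are small. -/
theorem exists_integral_cubeRemainder_le : ∃ C : ℝ, 0 ≤ C ∧ ∀ (ε : ℝ) (ψ : ℝ → ℝ),
    IsProfile ε ψ → ∀ N : ℕ, 0 < N →
      (N : ℝ) ^ 2 * ∫ g, (Trig.mean (cubeRemainder ψ N g * cubeRemainder ψ N g)).re ^ 2 ∂sampleLaw κ
        ≤ C := by
  set V : ℝ := 96 * sampleVar κ with hV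
  have hV0 : (0 : ℝ) ≤ V := mul_nonneg (by norm_num) (sampleVar κ).2
  -- The terms are the eighth moment of the high part, with variance sum `12/N` and the power of `N`
  -- taken out, and the sixteenth moments of the full and low parts, with variance sums at most `2`.
  refine ⟨41 * ((V * 4 * 12) ^ 4 + ((V * 8 * 2) ^ 8 + (V * 8 * 2) ^ 8)), by positivity,
    fun ε ψ hψ N hN => ?_⟩
  have hNR : (0 : ℝ) < N := by exact_mod_cast hN
  set p := gaussTrig N (seriesSymbol ψ N) with hp
  set q := gaussTrig N (lowSymbol ψ N) with hq
  set w : ℤ → ℝ := fun n => seriesSymbol ψ N n - lowSymbol ψ N n with hw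
  have hpr : ∀ g, (p g).IsReal := isReal_gaussTrig (seriesSymbol_neg hψ)
  have hqr : ∀ g, (q g).IsReal := isReal_gaussTrig (lowSymbol_neg hψ)
  have hwneg : ∀ n, w (-n) = w n := fun n => by
    simp only [hw, seriesSymbol_neg hψ, lowSymbol_neg hψ]
  have hhr := fun g => isReal_gaussTrig (N := N) hwneg g
  have hf := randTrig_cubeRemainder κ ψ N
  have hff := (hf.mul hf).mul (hf.mul hf)
  have hwsq : ∀ n : ℤ, w n ^ 2 ≤ weight N n := fun n => by
    simp only [hw, lowSymbol]
    split_ifs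
    · simpa using weight_nonneg N n
    · simpa using seriesSymbol_sq_le hψ hN n
  have hw0 : ∀ n : ℕ, n ≤ N / 6 → w n = 0 := fun n hn => by
    simp only [hw, lowSymbol]
    rw [if_pos (by rw [abs_of_nonneg (by omega)]; omega), sub_self]
  have s1 : ∑ n ∈ Finset.Icc 1 N, seriesSymbol ψ N n ^ 2 ≤ 2 := by
    simpa using sum_Icc_sq_le_of_le (k := 0) (seriesSymbol_sq_le hψ hN) fun n hn => by
      obtain rfl : n = 0 := by omega
      simp [seriesSymbol]
  have s2 : ∑ n ∈ Finset.Icc 1 N, lowSymbol ψ N n ^ 2 ≤ 2 := by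
    simpa using sum_Icc_sq_le_of_le (k := 0) (lowSymbol_sq_le hψ hN) fun n hn => by
      obtain rfl : n = 0 := by omega
      simp [lowSymbol, seriesSymbol]
  have s3 : ∑ n ∈ Finset.Icc 1 N, w n ^ 2 ≤ 12 / N := by
    refine (sum_Icc_sq_le_of_le hwsq hw0).trans ?_
    rw [div_le_div_iff₀ (by positivity) hNR]
    have : N ≤ 6 * (N / 6 + 1) := by omega
    have : (N : ℝ) ≤ 6 * ((N / 6 : ℕ) + 1) := by exact_mod_cast this
    linarith
  have m1 : ∀ x, ∫ g, (Trig.evalAt x (p g)).re ^ 16 ∂sampleLaw κ ≤ (V * 8 * 2) ^ 8 := fun x => by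
    refine (integral_evalAt_gaussTrig_pow_le κ (seriesSymbol_neg hψ) x (k := 8)
      (by norm_num)).trans ?_
    push_cast
    gcongr
  have m2 : ∀ x, ∫ g, (Trig.evalAt x (q g)).re ^ 16 ∂sampleLaw κ ≤ (V * 8 * 2) ^ 8 := fun x => by
    refine (integral_evalAt_gaussTrig_pow_le κ (lowSymbol_neg hψ) x (k := 8)
      (by norm_num)).trans ?_
    push_cast
    gcongr
  have m3 : ∀ x, (N : ℝ) ^ 4 * ∫ g, (Trig.evalAt x (gaussTrig N w g)).re ^ 8 ∂sampleLaw κ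
      ≤ (V * 4 * 12) ^ 4 := fun x => by
    have := integral_evalAt_gaussTrig_pow_le κ (N := N) hwneg x (k := 4) (by norm_num)
    calc _ ≤ (N : ℝ) ^ 4 * (V * 4 * (12 / N)) ^ 4 := by
          refine mul_le_mul_of_nonneg_left (this.trans ?_) (by positivity)
          push_cast
          refine pow_le_pow_left₀ (mul_nonneg (by positivity)
            (Finset.sum_nonneg fun n _ => sq_nonneg _)) ?_ 4
          exact mul_le_mul_of_nonneg_left s3 (by positivity)
      _ = _ := by field_simp
  have hre : ∀ {f : Sample → Trig}, RandTrig (sampleLaw κ) f → ∀ x,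
      AllLp (sampleLaw κ) fun g => (Trig.evalAt x (f g)).re := fun hf x =>
    (hf.allLp_evalAt x).of_norm_le
      (Complex.measurable_re.comp_aemeasurable (hf.allLp_evalAt x).integrable.aestronglyMeasurable.aemeasurable).aestronglyMeasurable
      fun g => Complex.abs_re_le_norm _
  have hP := randTrig_gaussTrig κ N (seriesSymbol ψ N)
  have hQ := randTrig_gaussTrig κ N (lowSymbol ψ N)
  have hH := randTrig_gaussTrig κ N w
  have hmean : ∀ {f : Sample → Trig}, RandTrig (sampleLaw κ) f →
      AllLp (sampleLaw κ) fun g => (Trig.mean (f g)).re := fun hf =>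
    hf.allLp_mean.of_norm_le
      (Complex.measurable_re.comp_aemeasurable hf.allLp_mean.integrable.aestronglyMeasurable.aemeasurable).aestronglyMeasurable
      fun g => Complex.abs_re_le_norm _
  have hpt : ∀ x, ∫ g, (Trig.evalAt x (cubeRemainder ψ N g * cubeRemainder ψ N g
      * (cubeRemainder ψ N g * cubeRemainder ψ N g))).re ∂sampleLaw κ
      ≤ 41 * ((V * 4 * 12) ^ 4 + ((V * 8 * 2) ^ 8 + (V * 8 * 2) ^ 8)) / N ^ 2 := by
    intro x
    rw [le_div_iff₀ (by positivity), mul_comm, ← integral_const_mul]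
    have i1 : Integrable (fun g => (Trig.evalAt x (p g)).re ^ 16) (sampleLaw κ) :=
      ((hre hP x).pow 16).integrable
    have i2 : Integrable (fun g => (Trig.evalAt x (q g)).re ^ 16) (sampleLaw κ) :=
      ((hre hQ x).pow 16).integrable
    have i3 : Integrable (fun g => (N : ℝ) ^ 4 * (Trig.evalAt x (gaussTrig N w g)).re ^ 8)
        (sampleLaw κ) := (((hre hH x).pow 8).const_mul _).integrable
    have i12 : Integrable (fun g => (Trig.evalAt x (p g)).re ^ 16 + (Trig.evalAt x (q g)).re ^ 16)
      (sampleLaw κ) := i1.add i2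
    have i123 : Integrable (fun g => (N : ℝ) ^ 4 * (Trig.evalAt x (gaussTrig N w g)).re ^ 8
      + ((Trig.evalAt x (p g)).re ^ 16 + (Trig.evalAt x (q g)).re ^ 16)) (sampleLaw κ) := i3.add i12
    have i4 : Integrable (fun g => (N : ℝ) ^ 2 * (Trig.evalAt x (cubeRemainder ψ N g
      * cubeRemainder ψ N g * (cubeRemainder ψ N g * cubeRemainder ψ N g))).re) (sampleLaw κ) :=
      ((hre hff x).const_mul _).integrable
    calc _ ≤ ∫ g, 41 * ((N : ℝ) ^ 4 * (Trig.evalAt x (gaussTrig N w g)).re ^ 8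
          + ((Trig.evalAt x (p g)).re ^ 16 + (Trig.evalAt x (q g)).re ^ 16)) ∂sampleLaw κ := by
          refine integral_mono i4 (i123.const_mul _) fun g => ?_
          have hfr := isReal_cubeRemainder (N := N) hψ g
          have ev : (Trig.evalAt x (cubeRemainder ψ N g)).re
              = (Trig.evalAt x (p g)).re ^ 3 - (Trig.evalAt x (q g)).re ^ 3 := by
            have e : cubeRemainder ψ N g = p g * p g * p g - q g * q g * q g := rfl
            rw [e, map_sub, Complex.sub_re, Trig.evalAt_re_mul ((hpr g).mul (hpr g)),
              Trig.evalAt_re_mul (hpr g), Trig.evalAt_re_mul ((hqr g).mul (hqr g)),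
              Trig.evalAt_re_mul (hqr g)]
            ring
          dsimp only
          rw [Trig.evalAt_re_mul (hfr.mul hfr), Trig.evalAt_re_mul hfr, ev]
          refine pow_four_cube_sub_le N _ _ _ ?_ hNR.le
          rw [hw, gaussTrig_sub, map_sub, Complex.sub_re]
      _ = 41 * ((N : ℝ) ^ 4 * ∫ g, (Trig.evalAt x (gaussTrig N w g)).re ^ 8 ∂sampleLaw κ
          + (∫ g, (Trig.evalAt x (p g)).re ^ 16 ∂sampleLaw κ
            + ∫ g, (Trig.evalAt x (q g)).re ^ 16 ∂sampleLaw κ)) := by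
          rw [integral_const_mul, integral_add i3 i12, integral_add i1 i2, integral_const_mul]
      _ ≤ _ := by
          have := m1 x; have := m2 x; have := m3 x
          gcongr
  have hfin := hff.integral_mean_le hpt
  rw [le_div_iff₀ (by positivity), mul_comm] at hfin
  refine le_trans (mul_le_mul_of_nonneg_left ?_ (by positivity)) hfin
  -- The square of the L² norm is controlled by the fourth power integrated over the circle, whose
  -- expectation is bounded pointwise in `x`.
  exact integral_mono ((hmean (hf.mul hf)).pow 2).integrable (hmean hff).integrable fun g =>
    Trig.sq_mean_mul_self_le (isReal_cubeRemainder hψ g)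

end HighCubeMoments

/-! ### The high frequencies of the square -/

section HighSquare

variable {ε : ℝ} {ψ : ℝ → ℝ} {N : ℕ}

theorem coeff_mul_gaussTrig (w w' : ℤ → ℝ) (g : Sample) (m : ℤ) :
    (gaussTrig N w g * gaussTrig N w' g).coeff m
      = ∑ a ∈ Finset.Icc (-(N : ℤ)) N, (w a : ℂ) * gauss a g * (gaussTrig N w' g).coeff (m - a) := by
  rw [Trig.coeff_mul_eq_sum _ _ (Finset.Icc (-(N : ℤ)) N) fun k hk => by
    rw [gaussTrig]; exact coeff_ofSeq_eq_zero hk]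
  refine Finset.sum_congr rfl fun a ha => ?_
  rw [Finset.mem_Icc] at ha
  rw [coeff_gaussTrig, if_pos (abs_le.mpr ha)]

/-- The coefficient of `monomial ![a, m - a]` in the square. -/
theorem coeff_sq_gaussTrig (hψ : IsProfile ε ψ) (hN : 0 < N) (g : Sample) (m : ℤ) :
    (gaussTrig N (seriesSymbol ψ N) g * gaussTrig N (seriesSymbol ψ N) g).coeff m
      = ∑ a ∈ Finset.Icc (-(N : ℤ)) N, ((seriesSymbol ψ N a * seriesSymbol ψ N (m - a) : ℝ) : ℂ)
        * monomial ![a, m - a] g := by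
  rw [coeff_mul_gaussTrig]
  refine Finset.sum_congr rfl fun a _ => ?_
  rw [coeff_gaussTrig, monomial, Fin.prod_univ_two]
  simp only [Matrix.cons_val_zero, Matrix.cons_val_one]
  split_ifs with h
  · push_cast; ring
  · rw [show seriesSymbol ψ N (m - a) = ψ (((m - a : ℤ) : ℝ) / N) / (m - a).natAbs from rfl,
      hψ.symbol_eq_zero hN (not_le.mp h)]; simp

/-- For `m ≠ 0` the frequencies `a` and `m - a` are never opposite, so almost orthogonality applies
to the convolution. -/
theorem exists_integral_coeff_sq_le (κ : ℝ) : ∃ C : ℝ, 0 ≤ C ∧ ∀ (ε : ℝ) (ψ : ℝ → ℝ),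
    IsProfile ε ψ → ∀ N : ℕ, 0 < N → ∀ m : ℤ, m ≠ 0 →
      ∫ g, ‖(gaussTrig N (seriesSymbol ψ N) g * gaussTrig N (seriesSymbol ψ N) g).coeff m‖ ^ 2
          ∂sampleLaw κ
        ≤ C * ∑ a ∈ Finset.Icc (-(N : ℤ)) N, weight N a * weight N (m - a) := by
  obtain ⟨C, hC, h⟩ := integral_norm_sum_monomial_sq_le κ 2
  refine ⟨C, hC, fun ε ψ hψ N hN m hm => ?_⟩
  set T := (Finset.Icc (-(N : ℤ)) N).filter fun a => a ≠ 0 ∧ m - a ≠ 0 with hT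
  have e : ∀ g, (gaussTrig N (seriesSymbol ψ N) g * gaussTrig N (seriesSymbol ψ N) g).coeff m
      = ∑ a ∈ T, ((seriesSymbol ψ N a * seriesSymbol ψ N (m - a) : ℝ) : ℂ)
        * monomial ![a, m - a] g := by
    intro g
    -- Terms containing the frequency zero disappear: the symbol there is a division by zero, with
    -- value `0`.
    rw [coeff_sq_gaussTrig hψ hN, hT, Finset.sum_filter_of_ne]
    intro a _ ha
    refine ⟨fun h0 => ha ?_, fun h0 => ha ?_⟩
    · rw [h0]; simp [seriesSymbol]
    · rw [h0]; simp [seriesSymbol]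
  simp only [e]
  refine (h T (fun a => ![a, m - a]) _ (fun a _ b _ hab => by simpa using congrFun hab 0)
    fun a ha i j => ?_).trans ?_
  · have := (Finset.mem_filter.mp ha).2
    fin_cases i <;> fin_cases j <;> simp <;> omega
  · refine mul_le_mul_of_nonneg_left ?_ hC
    refine (Finset.sum_le_sum fun a _ => ?_).trans (Finset.sum_le_sum_of_subset_of_nonneg
      (Finset.filter_subset _ _) fun a _ _ => mul_nonneg (weight_nonneg _ _) (weight_nonneg _ _))
    rw [Complex.norm_real, Real.norm_eq_abs, sq_abs, mul_pow]
    exact mul_le_mul (seriesSymbol_sq_le hψ hN a) (seriesSymbol_sq_le hψ hN _) (sq_nonneg _)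
      (weight_nonneg _ _)

end HighSquare

end BenjaminOno

namespace BenjaminOno

/-! ### The quartic part of the defect -/

section Quartic

variable {ε : ℝ} {ψ : ℝ → ℝ} {N : ℕ}

/-- The symbol of `coproj ψ N`. -/
def cosymbol (ψ : ℝ → ℝ) (N : ℕ) (m : ℤ) : ℝ := 1 - ψ ((m : ℝ) / N) ^ 2

theorem cosymbol_neg (hψ : IsProfile ε ψ) (m : ℤ) : cosymbol ψ N (-m) = cosymbol ψ N m := by
  rw [cosymbol, cosymbol, Trig.even_symbol hψ.even]

theorem abs_cosymbol_le_one (hψ : IsProfile ε ψ) (m : ℤ) : |cosymbol ψ N m| ≤ 1 := by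
  have h1 := hψ.abs_le_one ((m : ℝ) / N)
  have h2 : ψ ((m : ℝ) / N) ^ 2 ≤ 1 := by rw [← sq_abs]; exact pow_le_one₀ (abs_nonneg _) h1
  rw [cosymbol, abs_le]
  constructor <;> nlinarith [sq_nonneg (ψ ((m : ℝ) / N))]

theorem cosymbol_eq_zero (hψ : IsProfile ε ψ) (hN : 0 < N) {m : ℤ}
    (hm : ((|m| : ℤ) : ℝ) ≤ (1 - ε) * N) : cosymbol ψ N m = 0 := by
  have hNR : (0 : ℝ) < N := by exact_mod_cast hN
  rw [cosymbol, hψ.even, hψ.eq_one, one_pow, sub_self]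
  rw [abs_div, abs_of_pos hNR, mem_Icc, div_le_iff₀ hNR]
  push_cast at hm
  exact ⟨by positivity, hm⟩

/-- The symbol `1 - ψ²` vanishes for `|m| ≤ (1 - ε)N`, where the profile is `1`, and `p` has no
modes beyond `2N`. -/
theorem mean_D_coproj_mul_eq_sum (hψ : IsProfile ε ψ) (hN : 0 < N) {p : Trig}
    (hp : ∀ n : ℤ, 2 * (N : ℤ) < |n| → p.coeff n = 0) (q : Trig) :
    Trig.mean (Trig.D (Trig.coproj ψ N p) * q) = ∑ m ∈ highFreq ε N,
      Complex.I * m * (cosymbol ψ N m : ℂ) * p.coeff m * q.coeff (-m) := by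
  have hc : ∀ m, (Trig.D (Trig.coproj ψ N p)).coeff m
      = Complex.I * m * (cosymbol ψ N m : ℂ) * p.coeff m := by
    intro m
    rw [Trig.D, Trig.coeff_mult, Trig.coproj, Trig.coeff_mult, cosymbol]
    push_cast
    ring
  rw [Trig.mean_apply, Trig.coeff_mul_eq_sum _ _ (highFreq ε N) fun m hm => ?_]
  · exact Finset.sum_congr rfl fun m _ => by rw [hc, zero_sub]
  · rw [hc]
    rw [highFreq, Finset.mem_filter, not_and_or, not_lt] at hm
    rcases hm with h | h
    · rw [hp m, mul_zero]
      rw [Finset.mem_Icc, ← abs_le] at h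
      push Not at h
      convert h using 1
    · rw [cosymbol_eq_zero hψ hN h]; simp

/-- The symmetrized form of `v |D| v`. -/
theorem two_mul_mean_D_coproj_mul_absD (hψ : IsProfile ε ψ) (v : Trig) :
    2 * Trig.mean (Trig.D (Trig.coproj ψ N (v * v)) * (v * Trig.absD v))
      = Trig.mean (Trig.D (Trig.coproj ψ N (v * v))
        * (v * Trig.absD v + Trig.absD v * v - Trig.absD (v * v))) := by
  -- Subtracting `|∂|(v²)` is free, as it is paired with `v²` through an odd symbol. It turns the
  -- symbol of `v|∂|v` into `|c| + |d| - |c + d|`.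
  have h0 : Trig.mean (Trig.D (Trig.coproj ψ N (v * v)) * Trig.absD (v * v)) = 0 := by
    rw [Trig.D, Trig.coproj, Trig.absD, Trig.mult_mult, Trig.mean_mult_mul, Trig.mult_mult]
    refine Trig.mean_mul_mult_self_of_odd (fun n => ?_) _
    rw [neg_neg, abs_neg, Trig.even_symbol hψ.even]
    push_cast
    ring
  rw [mul_sub, mul_add, map_sub, map_add, h0, mul_comm (Trig.absD v) v]
  ring

/-- The frequency configurations of the quartic part. -/
def quartets (ε : ℝ) (N : ℕ) : Finset (ℤ × ℤ × ℤ) :=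
  highFreq ε N ×ˢ Finset.Icc (-(N : ℤ)) N ×ˢ Finset.Icc (-(N : ℤ)) N

/-- The coefficients of the quartic part. -/
def quarticCoeff (ψ : ℝ → ℝ) (N : ℕ) (t : ℤ × ℤ × ℤ) : ℝ :=
  t.1 * cosymbol ψ N t.1 * (seriesSymbol ψ N t.2.1 * seriesSymbol ψ N (t.1 - t.2.1))
    * ((|t.2.2| + |-t.1 - t.2.2| - |t.1| : ℤ)
      * (seriesSymbol ψ N t.2.2 * seriesSymbol ψ N (-t.1 - t.2.2)))

/-- The frequencies of the quartic part. -/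
def quarticFreq (t : ℤ × ℤ × ℤ) : Fin 4 → ℤ := ![t.2.1, t.1 - t.2.1, t.2.2, -t.1 - t.2.2]

theorem coeff_symmetrized (hψ : IsProfile ε ψ) (hN : 0 < N) (g : Sample) (m : ℤ) :
    (gaussTrig N (seriesSymbol ψ N) g * Trig.absD (gaussTrig N (seriesSymbol ψ N) g)
      + Trig.absD (gaussTrig N (seriesSymbol ψ N) g) * gaussTrig N (seriesSymbol ψ N) g
      - Trig.absD (gaussTrig N (seriesSymbol ψ N) g * gaussTrig N (seriesSymbol ψ N) g)).coeff (-m)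
    = ∑ c ∈ Finset.Icc (-(N : ℤ)) N, (((|c| + |-m - c| - |m| : ℤ)
        * (seriesSymbol ψ N c * seriesSymbol ψ N (-m - c)) : ℝ) : ℂ)
          * (gauss c g * gauss (-m - c) g) := by
  set v := gaussTrig N (seriesSymbol ψ N) g with hv
  have hs : ∀ k, k ∉ Finset.Icc (-(N : ℤ)) N → v.coeff k = 0 := fun k hk => by
    rw [hv, gaussTrig]; exact coeff_ofSeq_eq_zero hk
  have hs' : ∀ k, k ∉ Finset.Icc (-(N : ℤ)) N → (Trig.absD v).coeff k = 0 := fun k hk => by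
    rw [Trig.absD, Trig.coeff_mult, hs k hk, mul_zero]
  have hvc : ∀ k, v.coeff k = (seriesSymbol ψ N k : ℂ) * gauss k g := by
    intro k
    rw [hv, coeff_gaussTrig]
    split_ifs with h
    · rfl
    · rw [show seriesSymbol ψ N k = ψ ((k : ℝ) / N) / k.natAbs from rfl,
        hψ.symbol_eq_zero hN (not_le.mp h)]; simp
  have e : ∀ p q r : Trig, (p + q - r).coeff (-m) = p.coeff (-m) + q.coeff (-m) - r.coeff (-m) := by
    intro p q r; simp
  rw [e, Trig.absD, Trig.coeff_mult, ← Trig.absD, Trig.coeff_mul_eq_sum v _ _ hs,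
    Trig.coeff_mul_eq_sum _ v _ hs', Trig.coeff_mul_eq_sum v v _ hs, Finset.mul_sum,
    ← Finset.sum_add_distrib, ← Finset.sum_sub_distrib]
  refine Finset.sum_congr rfl fun c _ => ?_
  simp only [Trig.absD, Trig.coeff_mult, hvc, abs_neg, Complex.ofReal_mul, Complex.ofReal_intCast,
    Int.cast_add, Int.cast_sub, Complex.ofReal_add, Complex.ofReal_sub]
  ring

theorem two_mul_quartic_eq_sum (hψ : IsProfile ε ψ) (hN : 0 < N) (g : Sample) :
    2 * Trig.mean (Trig.D (Trig.coproj ψ N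
        (gaussTrig N (seriesSymbol ψ N) g * gaussTrig N (seriesSymbol ψ N) g))
        * (gaussTrig N (seriesSymbol ψ N) g * Trig.absD (gaussTrig N (seriesSymbol ψ N) g)))
      = Complex.I * ∑ t ∈ quartets ε N, (quarticCoeff ψ N t : ℂ) * monomial (quarticFreq t) g := by
  have hdeg : ∀ n : ℤ, (N : ℤ) < |n| → (gaussTrig N (seriesSymbol ψ N) g).coeff n = 0 := by
    intro n hn
    rw [coeff_gaussTrig, if_neg (not_le.mpr hn)]
  rw [two_mul_mean_D_coproj_mul_absD hψ, mean_D_coproj_mul_eq_sum hψ hN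
    (fun n hn => Trig.coeff_mul_eq_zero_of_degree hdeg hdeg (by omega)), quartets,
    Finset.sum_product, Finset.mul_sum]
  refine Finset.sum_congr rfl fun m _ => ?_
  rw [coeff_symmetrized hψ hN, coeff_sq_gaussTrig hψ hN, Finset.sum_product, mul_assoc,
    Finset.sum_mul_sum, Finset.mul_sum, Finset.mul_sum]
  refine Finset.sum_congr rfl fun a _ => ?_
  rw [Finset.mul_sum, Finset.mul_sum]
  refine Finset.sum_congr rfl fun c _ => ?_
  rw [quarticCoeff, quarticFreq, monomial, monomial, Fin.prod_univ_two, Fin.prod_univ_four]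
  simp only [Matrix.cons_val_zero, Matrix.cons_val_one, Matrix.cons_val]
  push_cast
  ring

/-- When `c = -a` or `c = a - m` the four frequencies form two opposite pairs and the monomial is
`|g_a|² |g_{m-a}|²`, which is not orthogonal to anything. It is invariant under reversal of all
frequencies, whereas the coefficient is odd through its factor `m`, so these terms cancel two by
two. -/
theorem sum_diagonal_quartets (hψ : IsProfile ε ψ) (hε : ε < 1) (g : Sample) :
    ∑ t ∈ (quartets ε N).filter (fun t => t.2.2 = -t.2.1 ∨ t.2.2 = t.2.1 - t.1),
      (quarticCoeff ψ N t : ℂ) * monomial (quarticFreq t) g = 0 := by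
  refine Finset.sum_involution (fun t _ => (-t.1, -t.2.1, -t.2.2)) ?_ ?_ ?_ ?_
  · rintro ⟨m, a, c⟩ ht
    have h := (Finset.mem_filter.mp ht).2
    have hc : quarticCoeff ψ N (-m, -a, -c) = -quarticCoeff ψ N (m, a, c) := by
      simp only [quarticCoeff]
      rw [show -m - -a = -(m - a) by ring, show - -m - -c = -(-m - c) by ring]
      simp only [seriesSymbol_neg hψ, cosymbol_neg hψ, abs_neg]
      push_cast
      ring
    have hm : monomial (quarticFreq (-m, -a, -c)) g = monomial (quarticFreq (m, a, c)) g := by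
      simp only [monomial, quarticFreq, Fin.prod_univ_four, Matrix.cons_val_zero,
        Matrix.cons_val_one, Matrix.cons_val]
      dsimp only at h
      rcases h with h | h
      · rw [h, neg_neg, show -m - -a = a - m by ring, show - -m - a = m - a by ring]; ring
      · rw [h, show -m - -a = a - m by ring, show -(a - m) = m - a by ring,
          show - -m - (m - a) = a by ring, show -m - (a - m) = -a by ring]; ring
    dsimp only
    rw [hc, hm]
    push_cast
    ring
  · rintro ⟨m, a, c⟩ _ h0 heq
    refine h0 ?_
    have : m = 0 := by
      have := congrArg Prod.fst heq
      dsimp only at this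
      omega
    simp [quarticCoeff, this]
  · rintro ⟨m, a, c⟩ ht
    simp only [Finset.mem_filter, quartets, Finset.mem_product, highFreq, Finset.mem_Icc,
      abs_neg] at ht ⊢
    refine ⟨⟨⟨by omega, ht.1.1.2⟩, by omega⟩, by omega⟩
  · rintro ⟨m, a, c⟩ _
    simp

theorem sq_quarticCoeff_le (hψ : IsProfile ε ψ) (hN : 0 < N) (m a c : ℤ) :
    quarticCoeff ψ N (m, a, c) ^ 2 ≤ (m : ℝ) ^ 2 * ((weight N a * weight N (m - a))
      * (((|c| + |-m - c| - |m| : ℤ) : ℝ) ^ 2 * (weight N c * weight N (-m - c)))) := by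
  have h1 : cosymbol ψ N m ^ 2 ≤ 1 := by
    rw [← sq_abs]; exact pow_le_one₀ (abs_nonneg _) (abs_cosymbol_le_one hψ m)
  have hw := fun n => seriesSymbol_sq_le hψ hN n
  have hw0 := fun n => weight_nonneg N n
  calc quarticCoeff ψ N (m, a, c) ^ 2 = (m : ℝ) ^ 2 * (cosymbol ψ N m ^ 2
        * (seriesSymbol ψ N a ^ 2 * seriesSymbol ψ N (m - a) ^ 2
        * (((|c| + |-m - c| - |m| : ℤ) : ℝ) ^ 2
          * (seriesSymbol ψ N c ^ 2 * seriesSymbol ψ N (-m - c) ^ 2)))) := by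
        rw [quarticCoeff]; ring
    _ ≤ (m : ℝ) ^ 2 * (1 * ((weight N a * weight N (m - a))
        * (((|c| + |-m - c| - |m| : ℤ) : ℝ) ^ 2 * (weight N c * weight N (-m - c))))) := by
        have := hw0 a; have := hw0 (m - a); have := hw0 c; have := hw0 (-m - c)
        have := hw a; have := hw (m - a); have := hw c; have := hw (-m - c)
        gcongr
    _ = _ := by rw [one_mul]

/-- Once the diagonal configurations have cancelled and the zero frequencies are dropped, no two of
the four frequencies are opposite. The second moment is then controlled by the sum of the squared
coefficients, a lattice sum of size `ε²`. -/
theorem exists_integral_quartic_le (κ : ℝ) : ∃ C : ℝ, 0 ≤ C ∧ ∀ (ε : ℝ) (ψ : ℝ → ℝ),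
    0 < ε → ε ≤ 1 / 2 → IsProfile ε ψ → ∀ N : ℕ, 0 < N → 1 ≤ ε * N →
      ∫ g, ‖Trig.mean (Trig.D (Trig.coproj ψ N
        (gaussTrig N (seriesSymbol ψ N) g * gaussTrig N (seriesSymbol ψ N) g))
        * (gaussTrig N (seriesSymbol ψ N) g * Trig.absD (gaussTrig N (seriesSymbol ψ N) g)))‖ ^ 2
          ∂sampleLaw κ ≤ C * ε ^ 2 := by
  obtain ⟨C, hC, h⟩ := integral_norm_sum_monomial_sq_le κ 4
  -- The factor `1/4` undoes the doubling in the symmetrized form, and `8192` comes from the lattice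
  -- sum.
  refine ⟨1 / 4 * (C * 8192), by positivity, fun ε ψ hε hε' hψ N hN hεN => ?_⟩
  set T := (quartets ε N).filter (fun t => (t.2.2 ≠ -t.2.1 ∧ t.2.2 ≠ t.2.1 - t.1)
    ∧ (t.2.1 ≠ 0 ∧ t.1 - t.2.1 ≠ 0 ∧ t.2.2 ≠ 0 ∧ -t.1 - t.2.2 ≠ 0)) with hT
  have e : ∀ g, ‖Trig.mean (Trig.D (Trig.coproj ψ N
        (gaussTrig N (seriesSymbol ψ N) g * gaussTrig N (seriesSymbol ψ N) g))
        * (gaussTrig N (seriesSymbol ψ N) g * Trig.absD (gaussTrig N (seriesSymbol ψ N) g)))‖ ^ 2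
      = 1 / 4 * ‖∑ t ∈ T, (quarticCoeff ψ N t : ℂ) * monomial (quarticFreq t) g‖ ^ 2 := by
    intro g
    have h2 := two_mul_quartic_eq_sum hψ hN g (ε := ε)
    rw [← Finset.sum_filter_add_sum_filter_not (quartets ε N)
      (fun t => t.2.2 = -t.2.1 ∨ t.2.2 = t.2.1 - t.1), sum_diagonal_quartets hψ (by linarith),
      zero_add] at h2
    have h3 : ∑ t ∈ (quartets ε N).filter (fun t => ¬(t.2.2 = -t.2.1 ∨ t.2.2 = t.2.1 - t.1)),
        (quarticCoeff ψ N t : ℂ) * monomial (quarticFreq t) g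
        = ∑ t ∈ T, (quarticCoeff ψ N t : ℂ) * monomial (quarticFreq t) g := by
      rw [hT, ← Finset.filter_filter]
      simp only [not_or]
      rw [Finset.sum_filter_of_ne (p := fun t : ℤ × ℤ × ℤ =>
        t.2.1 ≠ 0 ∧ t.1 - t.2.1 ≠ 0 ∧ t.2.2 ≠ 0 ∧ -t.1 - t.2.2 ≠ 0)]
      intro t _ ht
      refine ⟨fun h0 => ht ?_, fun h0 => ht ?_, fun h0 => ht ?_, fun h0 => ht ?_⟩ <;>
      · rw [quarticCoeff, h0]; simp [seriesSymbol]
    rw [h3] at h2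
    have h4 := congrArg (fun z : ℂ => ‖z‖ ^ 2) h2
    simp only [norm_mul, Complex.norm_I, one_mul, mul_pow] at h4
    rw [← h4]
    norm_num
    ring
  simp only [e]
  rw [integral_const_mul, mul_assoc]
  refine mul_le_mul_of_nonneg_left ?_ (by norm_num)
  have hm0 : ∀ t ∈ T, t.1 ≠ 0 := by
    intro t ht h0
    have h1 := (Finset.mem_filter.mp (Finset.mem_product.mp (Finset.mem_filter.mp ht).1).1).2
    rw [h0] at h1
    have : (0 : ℝ) < N := by exact_mod_cast hN
    norm_num at h1
    nlinarith
  refine (h T quarticFreq (fun t => (quarticCoeff ψ N t : ℂ)) ?_ ?_).trans ?_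
  · rintro ⟨m, a, c⟩ _ ⟨m', a', c'⟩ _ heq
    have h0 : a = a' := congrFun heq 0
    have h1 : m - a = m' - a' := congrFun heq 1
    have h2 : c = c' := congrFun heq 2
    obtain rfl : m = m' := by omega
    rw [h0, h2]
  · rintro ⟨m, a, c⟩ ht i j
    have h0 := hm0 _ ht
    have h1 := (Finset.mem_filter.mp ht).2
    dsimp only at h0 h1
    fin_cases i <;> fin_cases j <;> simp [quarticFreq] <;> omega
  · rw [mul_assoc]
    refine mul_le_mul_of_nonneg_left ?_ hC
    refine le_trans ?_ (sum_quadruple_weight_le hε hε' hN hεN)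
    refine (Finset.sum_le_sum_of_subset_of_nonneg (Finset.filter_subset _ _)
      fun t _ _ => by positivity).trans ?_
    rw [quartets, Finset.sum_product]
    refine Finset.sum_le_sum fun m _ => ?_
    rw [Finset.sum_product, Finset.sum_mul_sum, Finset.mul_sum]
    refine Finset.sum_le_sum fun a _ => ?_
    rw [Finset.mul_sum]
    refine Finset.sum_le_sum fun c _ => ?_
    rw [Complex.norm_real, Real.norm_eq_abs, sq_abs]
    refine (sq_quarticCoeff_le hψ hN m a c).trans (le_of_eq ?_)
    push_cast
    ring

end Quartic

end BenjaminOno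

namespace BenjaminOno

/-! ### The defect against the density -/

namespace Trig

variable (ψ : ℝ → ℝ) (N : ℕ)

/-- The quartic part of the defect. -/
def quarticDefect (v : Trig) : ℂ := mean (D (coproj ψ N (v * v)) * (v * absD v))

/-- The quintic part of the defect. -/
def quinticDefect (v : Trig) : ℂ := mean (D (coproj ψ N (v * v)) * (v * v * v))

theorem defect_eq (v : Trig) :
    defect ψ N v = (3 / 4 : ℂ) * quarticDefect ψ N v + (1 / 4 : ℂ) * quinticDefect ψ N v := by
  rw [defect, mul_add, map_add, mul_smul_comm, mul_smul_comm, map_smul, map_smul, smul_eq_mul,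
    smul_eq_mul, quarticDefect, quinticDefect]

theorem norm_defect_le (v : Trig) :
    ‖defect ψ N v‖ ≤ ‖quarticDefect ψ N v‖ + ‖quinticDefect ψ N v‖ := by
  rw [defect_eq]
  refine (norm_add_le _ _).trans ?_
  rw [norm_mul, norm_mul]
  have h1 : ‖(3 / 4 : ℂ)‖ ≤ 1 := by norm_num
  have h2 : ‖(1 / 4 : ℂ)‖ ≤ 1 := by norm_num
  have h3 := mul_le_mul_of_nonneg_right h1 (norm_nonneg (quarticDefect ψ N v))
  have h4 := mul_le_mul_of_nonneg_right h2 (norm_nonneg (quinticDefect ψ N v))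
  linarith

theorem IsReal.norm_coeff_neg {p : Trig} (hp : IsReal p) (n : ℤ) :
    ‖p.coeff (-n)‖ = ‖p.coeff n‖ := by rw [hp, RCLike.norm_conj]

end Trig

theorem _root_.MeasureTheory.integrable_add_integral_le {Ω : Type*} [MeasurableSpace Ω]
    {P : Measure Ω} {f g : Ω → ℝ} {a b : ℝ} (hf : Integrable f P ∧ ∫ w, f w ∂P ≤ a)
    (hg : Integrable g P ∧ ∫ w, g w ∂P ≤ b) :
    Integrable (fun w => f w + g w) P ∧ ∫ w, f w + g w ∂P ≤ a + b :=
  ⟨hf.1.add hg.1, by rw [integral_add hf.1 hg.1]; exact add_le_add hf.2 hg.2⟩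

theorem _root_.MeasureTheory.integrable_const_mul_integral_le {Ω : Type*} [MeasurableSpace Ω]
    {P : Measure Ω} {f : Ω → ℝ} {a c : ℝ} (hc : 0 ≤ c) (hf : Integrable f P ∧ ∫ w, f w ∂P ≤ a) :
    Integrable (fun w => c * f w) P ∧ ∫ w, c * f w ∂P ≤ c * a :=
  ⟨hf.1.const_mul c, by rw [integral_const_mul]; exact mul_le_mul_of_nonneg_left hf.2 hc⟩

theorem RandTrig.measurable_defect {Ω : Type*} [MeasurableSpace Ω] {P : Measure Ω} {v : Ω → Trig}
    (hv : RandTrig P v) (ψ : ℝ → ℝ) (N : ℕ) : Measurable fun w => Trig.defect ψ N (v w) := by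
  have hD : RandTrig P fun w => Trig.D (Trig.coproj ψ N (v w * v w)) :=
    ((hv.mul hv).mult _).mult _
  have h4 := (hD.mul (hv.mul (hv.mult fun n => ((|n| : ℤ) : ℂ)))).measurable_mean
  have h5 := (hD.mul ((hv.mul hv).mul hv)).measurable_mean
  simp only [Trig.defect_eq]
  exact (h4.const_mul _).add (h5.const_mul _)

section Defect

variable {κ ε : ℝ} {ψ : ℝ → ℝ} {N : ℕ}

/-- At each frequency `|m| ≤ 2N`, and the product of the coefficients of `v²` and `v³` is split by a
weighted arithmetic-geometric inequality with parameter `l`. A second one separates `F` from the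
high part of the cube. The weights make each power of `N` match the decay of the term that carries
it. -/
theorem norm_quinticDefect_le (hψ : IsProfile ε ψ) (hε' : ε ≤ 1 / 2) (hN : 0 < N) (g : Sample)
    (F : ℝ) {l : ℝ} (hl : 0 < l) :
    |F| * ‖Trig.quinticDefect ψ N (gaussTrig N (seriesSymbol ψ N) g)‖
      ≤ N / l * (∑ m ∈ highFreq ε N, ‖(gaussTrig N (seriesSymbol ψ N) g
          * gaussTrig N (seriesSymbol ψ N) g).coeff m‖ ^ 2)
        + l / 2 * (F ^ 4
          + N ^ 2 * (Trig.mean (cubeRemainder ψ N g * cubeRemainder ψ N g)).re ^ 2) := by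
  have hB := sum_norm_cube_le (N := N) hψ hε' g
  set v := gaussTrig N (seriesSymbol ψ N) g with hv
  set B := (Trig.mean (cubeRemainder ψ N g * cubeRemainder ψ N g)).re with hB'
  have hvr : v.IsReal := isReal_gaussTrig (seriesSymbol_neg hψ) g
  have hdeg : ∀ n : ℤ, (N : ℤ) < |n| → v.coeff n = 0 := by
    intro n hn
    rw [hv, coeff_gaussTrig, if_neg (not_le.mpr hn)]
  have h1 : ‖Trig.quinticDefect ψ N v‖ ≤ ∑ m ∈ highFreq ε N,
      2 * N * (‖(v * v).coeff m‖ * ‖(v * v * v).coeff m‖) := by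
    rw [Trig.quinticDefect, mean_D_coproj_mul_eq_sum hψ hN
      (fun n hn => Trig.coeff_mul_eq_zero_of_degree hdeg hdeg (by omega))]
    refine (norm_sum_le _ _).trans (Finset.sum_le_sum fun m hm => ?_)
    rw [norm_mul, norm_mul, norm_mul, norm_mul, Complex.norm_I, one_mul, Complex.norm_real,
      ((hvr.mul hvr).mul hvr).norm_coeff_neg, mul_assoc]
    have hm2 : ‖(m : ℂ)‖ ≤ 2 * N := by
      rw [highFreq, Finset.mem_filter, Finset.mem_Icc, ← abs_le] at hm
      rw [Complex.norm_intCast]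
      exact_mod_cast hm.1
    have hθ : ‖cosymbol ψ N m‖ ≤ 1 := abs_cosymbol_le_one hψ m
    calc _ ≤ 2 * (N : ℝ) * 1 * (‖(v * v).coeff m‖ * ‖(v * v * v).coeff m‖) := by gcongr
      _ = _ := by ring
  have h2 : |F| * ‖Trig.quinticDefect ψ N v‖ ≤ ∑ m ∈ highFreq ε N,
      (N / l * ‖(v * v).coeff m‖ ^ 2 + N * l * F ^ 2 * ‖(v * v * v).coeff m‖ ^ 2) := by
    refine (mul_le_mul_of_nonneg_left h1 (abs_nonneg F)).trans ?_
    rw [Finset.mul_sum]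
    refine Finset.sum_le_sum fun m _ => ?_
    set x := ‖(v * v).coeff m‖
    set y := ‖(v * v * v).coeff m‖
    have hx : N / l * x ^ 2 + N * l * F ^ 2 * y ^ 2 - |F| * (2 * N * (x * y))
        = N / l * (x - l * |F| * y) ^ 2 := by
      rw [← sq_abs F]; field_simp; ring
    have : 0 ≤ N / l * (x - l * |F| * y) ^ 2 := by positivity
    linarith
  refine h2.trans ?_
  rw [Finset.sum_add_distrib, ← Finset.mul_sum, ← Finset.mul_sum]
  refine add_le_add le_rfl ?_
  calc _ ≤ N * l * F ^ 2 * B := by gcongr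
    _ ≤ _ := by
      have : 0 ≤ l / 2 * (F ^ 2 - N * B) ^ 2 := by positivity
      nlinarith

/-- The quartic part is split as `ε/2 · F² + q²/(2ε)`, where `q²` has expectation `O(ε²)`, and
contributes `O(ε)`. For the quintic part `l = √ε` balances `N/√ε · ε/N` against `√ε` times bounded
moments, which fixes the rate `√ε`. -/
theorem exists_integral_density_mul_defect_le (hκ : 0 < κ) {χ : ℝ → ℝ} (hχ : Continuous χ)
    (hχ_supp : HasCompactSupport χ) {R : ℝ} (hR : 0 < R) : ∃ C, 0 ≤ C ∧ ∀ (ε : ℝ) (ψ : ℝ → ℝ),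
    0 < ε → ε ≤ 1 / 2 → IsProfile ε ψ → ∀ N : ℕ, 0 < N → 1 + renorm N ≤ ε * N →
    Integrable (fun g => |trigDensity κ χ ψ N R (randomTrig N g)|
      * ‖Trig.defect ψ N (Trig.proj ψ N (randomTrig N g))‖) (sampleLaw κ) ∧
    ∫ g, |trigDensity κ χ ψ N R (randomTrig N g)|
      * ‖Trig.defect ψ N (Trig.proj ψ N (randomTrig N g))‖ ∂sampleLaw κ ≤ C * √ε := by
  obtain ⟨C₁, hC₁, hF⟩ := exists_trigDensity_moment_le hκ hχ hχ_supp hR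
  obtain ⟨C₂, hC₂, hB⟩ := exists_integral_cubeRemainder_le κ
  obtain ⟨C₃, hC₃, hA⟩ := exists_integral_coeff_sq_le κ
  obtain ⟨C₄, hC₄, hQ⟩ := exists_integral_quartic_le κ
  refine ⟨(1 + C₁ + C₄) + (C₃ * 512 + (C₁ + C₂)), by positivity,
    fun ε ψ hε hε' hψ N hN hNε => ?_⟩
  have hNR : (0 : ℝ) < N := by exact_mod_cast hN
  have hNε1 : 1 ≤ ε * N := by
    have : 0 ≤ renorm N := zero_le_one.trans (one_le_renorm hN)
    linarith
  set P := sampleLaw κ with hP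
  have hsq : 0 < √ε := Real.sqrt_pos.mpr hε
  have hsq1 : √ε ≤ 1 := Real.sqrt_le_one.mpr (by linarith)
  have hss : √ε * √ε = ε := Real.mul_self_sqrt hε.le
  simp only [proj_randomTrig_eq hψ hN]
  set v := gaussTrig N (seriesSymbol ψ N) with hv
  set F := fun g => trigDensity κ χ ψ N R (randomTrig N g) with hFdef
  have hvR : RandTrig P v := randTrig_gaussTrig κ N _
  have hDv : RandTrig P fun g => Trig.D (Trig.coproj ψ N (v g * v g)) := (((hvR.mul hvR).mult _).mult _)
  have hI4 : RandTrig P fun g => Trig.D (Trig.coproj ψ N (v g * v g)) * (v g * Trig.absD (v g)) :=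
    hDv.mul (hvR.mul (hvR.mult _))
  have hFm : Measurable F := measurable_trigDensity hχ ψ N (randTrig_randomTrig κ N)
  have hdefm : Measurable fun g => Trig.defect ψ N (v g) := hvR.measurable_defect ψ N
  have b1 : Integrable (fun g => F g ^ 4) P ∧ ∫ g, F g ^ 4 ∂P ≤ C₁ := hF ε ψ hψ N hN
  have b0 : Integrable (fun _ : Sample => (1 : ℝ)) P ∧ ∫ _ : Sample, (1 : ℝ) ∂P ≤ 1 := by
    have : IsProbabilityMeasure P := by rw [hP, sampleLaw]; infer_instance
    exact ⟨integrable_const _, by simp⟩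
  have b2 : Integrable (fun g => (N : ℝ) ^ 2
        * (Trig.mean (cubeRemainder ψ N g * cubeRemainder ψ N g)).re ^ 2) P ∧
      ∫ g, (N : ℝ) ^ 2 * (Trig.mean (cubeRemainder ψ N g * cubeRemainder ψ N g)).re ^ 2 ∂P
        ≤ C₂ := by
    have hf := randTrig_cubeRemainder κ ψ N
    have hff := hf.mul hf
    refine ⟨Integrable.const_mul ?_ _, ?_⟩
    · refine ((hff.allLp_mean.norm).pow 2).integrable.mono'
        ((Complex.measurable_re.comp hff.measurable_mean).pow_const 2).aestronglyMeasurable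
        (Filter.Eventually.of_forall fun g => ?_)
      rw [Real.norm_eq_abs, abs_pow]
      exact pow_le_pow_left₀ (abs_nonneg _) (Complex.abs_re_le_norm _) 2
    · rw [integral_const_mul]; exact hB ε ψ hψ N hN
  have b3 : Integrable (fun g => ∑ m ∈ highFreq ε N, ‖(v g * v g).coeff m‖ ^ 2) P ∧
      ∫ g, ∑ m ∈ highFreq ε N, ‖(v g * v g).coeff m‖ ^ 2 ∂P ≤ C₃ * (512 * ε / N) := by
    have hi : ∀ m ∈ highFreq ε N, Integrable (fun g => ‖(v g * v g).coeff m‖ ^ 2) P :=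
      fun m _ => (((hvR.mul hvR).allLp m).norm.pow 2).integrable
    refine ⟨integrable_finsetSum _ hi, ?_⟩
    rw [integral_finsetSum _ hi]
    refine le_trans ?_ (mul_le_mul_of_nonneg_left (sum_highFreq_weight_le hε hε' hN hNε) hC₃)
    rw [Finset.mul_sum]
    refine Finset.sum_le_sum fun m hm => hA ε ψ hψ N hN m ?_
    rintro rfl
    have := (Finset.mem_filter.mp hm).2
    norm_num at this
    nlinarith
  have b4 : Integrable (fun g => ‖Trig.quarticDefect ψ N (v g)‖ ^ 2) P ∧
      ∫ g, ‖Trig.quarticDefect ψ N (v g)‖ ^ 2 ∂P ≤ C₄ * ε ^ 2 :=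
    ⟨(hI4.allLp_mean.norm.pow 2).integrable, hQ ε ψ hε hε' hψ N hN hNε1⟩
  -- The dominating function is assembled term by term together with its integrability and the bound
  -- for its integral.
  have key := integrable_add_integral_le
    (integrable_add_integral_le
      (integrable_const_mul_integral_le (c := ε / 2) (by positivity)
        (integrable_add_integral_le b0 b1))
      (integrable_const_mul_integral_le (c := 1 / (2 * ε)) (by positivity) b4))
    (integrable_add_integral_le (integrable_const_mul_integral_le (c := N / √ε) (by positivity) b3)
      (integrable_const_mul_integral_le (c := √ε / 2) (by positivity)
        (integrable_add_integral_le b1 b2)))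
  have hpt : ∀ g, |F g| * ‖Trig.defect ψ N (v g)‖ ≤ _ + _ := fun g =>
    calc |F g| * ‖Trig.defect ψ N (v g)‖
        ≤ |F g| * (‖Trig.quarticDefect ψ N (v g)‖ + ‖Trig.quinticDefect ψ N (v g)‖) :=
          mul_le_mul_of_nonneg_left (Trig.norm_defect_le ψ N (v g)) (abs_nonneg _)
      _ = |F g| * ‖Trig.quarticDefect ψ N (v g)‖ + |F g| * ‖Trig.quinticDefect ψ N (v g)‖ :=
          mul_add _ _ _
      _ ≤ (ε / 2 * (1 + F g ^ 4) + 1 / (2 * ε) * ‖Trig.quarticDefect ψ N (v g)‖ ^ 2) + _ := by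
          refine add_le_add ?_ (norm_quinticDefect_le hψ hε' hN g (F g) hsq)
          set q := ‖Trig.quarticDefect ψ N (v g)‖
          have e1 : ε / 2 * F g ^ 2 + 1 / (2 * ε) * q ^ 2 - |F g| * q
              = 1 / (2 * ε) * (ε * |F g| - q) ^ 2 := by
            rw [← sq_abs (F g)]; field_simp; ring
          have e2 : 0 ≤ 1 / (2 * ε) * (ε * |F g| - q) ^ 2 := by positivity
          have e3 : ε / 2 * F g ^ 2 ≤ ε / 2 * (1 + F g ^ 4) := by
            refine mul_le_mul_of_nonneg_left ?_ (by positivity)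
            nlinarith [sq_nonneg (F g ^ 2 - 1), sq_nonneg (F g ^ 2)]
          linarith
  have hint : Integrable (fun g => |F g| * ‖Trig.defect ψ N (v g)‖) P :=
    key.1.mono' (hFm.abs.mul hdefm.norm).aestronglyMeasurable (Filter.Eventually.of_forall fun g => by
      rw [Real.norm_of_nonneg (by positivity)]; exact hpt g)
  refine ⟨hint, (integral_mono hint key.1 hpt).trans (key.2.trans ?_)⟩
  have hεs : ε ≤ √ε := hss.symm.le.trans (mul_le_of_le_one_left hsq.le hsq1)
  have e1 : 1 / (2 * ε) * (C₄ * ε ^ 2) = C₄ / 2 * ε := by field_simp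
  have e2 : N / √ε * (C₃ * (512 * ε / N)) = C₃ * 512 * √ε := by
    have e3 : 512 * ε = 512 * (√ε * √ε) := by rw [hss]
    rw [e3]; field_simp
  rw [e1, e2]
  have h1 : ε / 2 * (1 + C₁) ≤ (1 + C₁) * √ε := by nlinarith
  have h2 : C₄ / 2 * ε ≤ C₄ * √ε := by nlinarith
  have h3 : √ε / 2 * (C₁ + C₂) ≤ (C₁ + C₂) * √ε := by nlinarith
  linarith

end Defect

theorem eventually_renorm_le {ε : ℝ} (hε : 0 < ε) :
    ∀ᶠ N : ℕ in Filter.atTop, 1 + renorm N ≤ ε * N := by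
  have h1 : Filter.Tendsto (fun N : ℕ => (2 + Real.log N) / (N : ℝ)) Filter.atTop (nhds 0) := by
    have h2 : Filter.Tendsto (fun x : ℝ => 2 / x + Real.log x / x) Filter.atTop (nhds (0 + 0)) :=
      (tendsto_const_nhds.div_atTop Filter.tendsto_id).add
        (by simpa using Real.tendsto_pow_log_div_mul_add_atTop 1 0 1 one_ne_zero)
    rw [add_zero] at h2
    refine (h2.comp tendsto_natCast_atTop_atTop).congr fun N => ?_
    simp only [Function.comp]
    ring
  filter_upwards [h1.eventually_le_const hε, Filter.eventually_gt_atTop 0] with N hN hN0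
  have hNR : (0 : ℝ) < N := by exact_mod_cast hN0
  rw [div_le_iff₀ hNR] at hN
  have h3 : renorm N ≤ 1 + Real.log N := by
    have := harmonic_le_one_add_log N
    refine le_trans (le_of_eq ?_) this
    rw [renorm, harmonic_eq_sum_Icc]
    push_cast
    simp
  linarith

end BenjaminOno

namespace BenjaminOno

/-- Uniqueness of the integral curves of a smooth vector field with a proper first integral. -/
theorem curve_unique_of_firstIntegral {E : Type*} [NormedAddCommGroup E] [NormedSpace ℝ E]
    [ProperSpace E] {X : E → E} (hX : ContDiff ℝ ∞ X) {q : E → ℝ} (hq : ContDiff ℝ ∞ q)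
    (hbdd : ∀ r, Bornology.IsBounded {x | q x ≤ r}) (hqX : ∀ x, fderiv ℝ q x (X x) = 0)
    {f g : ℝ → E} (hf : ∀ t, HasDerivAt f (X (f t)) t) (hg : ∀ t, HasDerivAt g (X (g t)) t)
    {t₀ : ℝ} (h : f t₀ = g t₀) : f = g := by
  have hc : ∀ {f : ℝ → E}, (∀ t, HasDerivAt f (X (f t)) t) → ∀ t, q (f t) = q (f t₀) := by
    intro f hf t
    have hd : ∀ s, HasDerivAt (fun s => q (f s)) 0 s := fun s => by
      have := (hq.differentiable (by simp) (f s)).hasFDerivAt.comp_hasDerivAt s (hf s)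
      rw [hqX] at this
      exact this
    exact is_const_of_deriv_eq_zero (fun s => (hd s).differentiableAt) (fun s => (hd s).deriv) t t₀
  have hX1 : LocallyLipschitz X := (hX.of_le (by simp)).locallyLipschitz
  obtain ⟨K, hK⟩ := (hX1.locallyLipschitzOn).exists_lipschitzOnWith_of_compact
    (s := {x | q x ≤ q (f t₀)}) (Metric.isCompact_of_isClosed_isBounded
      (isClosed_le hq.continuous continuous_const) (hbdd _))
  exact ODE_solution_unique_univ (v := fun _ => X) (s := fun _ => {x | q x ≤ q (f t₀)})
    (fun _ => hK) (fun t => ⟨hf t, (hc hf t).le⟩) (fun t => ⟨hg t, by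
      rw [mem_ofPred_eq, hc hg t, h]⟩) h

/-! ### The low modes -/

/-- The real and imaginary parts of the Gaussian variables of the modes `1, …, N`. -/
abbrev Low (N : ℕ) : Type := ↥(Finset.Icc 1 N) × Bool → ℝ

/-- Replaces the low modes of a sample. -/
def combine {N : ℕ} (x : Low N) (h : Sample) : Sample := fun n =>
  if hn : n ∈ Finset.Icc 1 N then (x (⟨n, hn⟩, false), x (⟨n, hn⟩, true)) else h n

/-- The low modes of a sample. -/
def lowPart (N : ℕ) (g : Sample) : Low N := fun k => coord (k.1, k.2) g

/-- The trigonometric polynomial with the given low modes. -/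
def lowTrig {N : ℕ} (x : Low N) : Trig := randomTrig N (combine x 0)

section LowModes

variable {N : ℕ}

theorem combine_apply (x : Low N) (h : Sample) (n : ↥(Finset.Icc 1 N)) :
    combine x h n = (x (n, false), x (n, true)) := by
  rw [combine, dif_pos n.2]

theorem combine_apply_of_notMem (x : Low N) (h : Sample) {n : ℕ} (hn : n ∉ Finset.Icc 1 N) :
    combine x h n = h n := by
  rw [combine, dif_neg hn]

theorem lowPart_combine (x : Low N) (h : Sample) : lowPart N (combine x h) = x := by
  funext ⟨n, b⟩
  cases b <;> simp [lowPart, coord, combine_apply]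

theorem combine_lowPart (g : Sample) : combine (lowPart N g) g = g := by
  funext n
  by_cases hn : n ∈ Finset.Icc 1 N
  · exact combine_apply (lowPart N g) g ⟨n, hn⟩
  · exact combine_apply_of_notMem _ _ hn

/-- The complex variable of a low mode. -/
def lowGauss (x : Low N) (n : ↥(Finset.Icc 1 N)) : ℂ := ⟨x (n, false), x (n, true)⟩

theorem coeff_lowTrig (x : Low N) (n : ↥(Finset.Icc 1 N)) :
    (lowTrig x).coeff (n : ℕ) = lowGauss x n / (n : ℕ) := by
  have h := Finset.mem_Icc.mp n.2
  rw [lowTrig, coeff_randomTrig, if_pos (by rw [abs_of_nonneg] <;> omega),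
    gauss_natCast (by omega), combine_apply, Int.natAbs_natCast, lowGauss]

theorem isReal_lowTrig (x : Low N) : (lowTrig x).IsReal := isReal_randomTrig N _

theorem coeff_lowTrig_zero (x : Low N) : (lowTrig x).coeff 0 = 0 := by
  simp [lowTrig, coeff_randomTrig]

theorem coeff_lowTrig_of_notMem (x : Low N) {k : ℤ} (hk : k ∉ Finset.Icc (-(N : ℤ)) N) :
    (lowTrig x).coeff k = 0 := coeff_ofSeq_eq_zero hk

/-- To prove a property of the coefficients it suffices to consider the positive modes. -/
theorem mode_cases {M : ℤ → Prop} (h0 : M 0) (hN : ∀ k, k ∉ Finset.Icc (-(N : ℤ)) N → M k)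
    (hneg : ∀ k, M k → M (-k)) (hpos : ∀ n : ↥(Finset.Icc 1 N), M (n : ℕ)) (k : ℤ) : M k := by
  have key : ∀ n : ℕ, M n := fun n => by
    by_cases hn : n ∈ Finset.Icc 1 N
    · exact hpos ⟨n, hn⟩
    · rcases Nat.eq_zero_or_pos n with h | h
      · rw [h]; exact h0
      · refine hN _ ?_
        rw [Finset.mem_Icc] at hn ⊢
        omega
  rcases Int.natAbs_eq k with h | h
  · rw [h]; exact key _
  · rw [h]; exact hneg _ (key _)

theorem contDiff_coeff_lowTrig (k : ℤ) : ContDiff ℝ ∞ fun x : Low N => (lowTrig x).coeff k := by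
  revert k
  refine mode_cases (N := N) ?_ (fun k hk => ?_) (fun k hk => ?_) fun n => ?_
  · simp only [coeff_lowTrig_zero]; exact contDiff_const
  · simp only [fun x => coeff_lowTrig_of_notMem x hk]; exact contDiff_const
  · simp only [fun x => isReal_lowTrig (N := N) x k]
    exact Complex.conjCLE.contDiff.comp hk
  · simp only [coeff_lowTrig]
    have : (fun x : Low N => lowGauss x n / ((n : ℕ) : ℂ))
        = fun x : Low N => ((x (n, false) : ℂ) + (x (n, true) : ℂ) * Complex.I) / ((n : ℕ) : ℂ) := by
      funext x; rw [lowGauss, Complex.mk_eq_add_mul_I]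
    rw [this]
    have hc : ∀ k : ↥(Finset.Icc 1 N) × Bool, ContDiff ℝ ∞ fun x : Low N => (x k : ℂ) := fun k =>
      Complex.ofRealCLM.contDiff.comp (contDiff_apply ℝ ℝ k)
    exact ((hc _).add ((hc _).mul contDiff_const)).div_const _

theorem coeff_lowTrig_add_smul (x e : Low N) (s : ℝ) (k : ℤ) :
    (lowTrig (x + s • e)).coeff k = (lowTrig x).coeff k + s * (lowTrig e).coeff k := by
  revert k
  refine mode_cases (N := N) ?_ (fun k hk => ?_) (fun k hk => ?_) fun n => ?_
  · simp only [coeff_lowTrig_zero]; ring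
  · simp only [fun x => coeff_lowTrig_of_notMem x hk]; ring
  · simp only [fun x => isReal_lowTrig (N := N) x k]
    rw [hk, map_add, map_mul, Complex.conj_ofReal]
  · simp only [coeff_lowTrig]
    have : lowGauss (x + s • e) n = lowGauss x n + s * lowGauss e n := by
      apply Complex.ext <;> simp [lowGauss]
    rw [this]; ring

theorem mean_lowTrig_sq (x : Low N) :
    (Trig.mean (lowTrig x * lowTrig x)).re
      = 2 * ∑ n : ↥(Finset.Icc 1 N), ((x (n, false)) ^ 2 + (x (n, true)) ^ 2) / (n : ℝ) ^ 2 := by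
  rw [re_mean_mul_self (isReal_lowTrig x) _ (fun k hk => coeff_lowTrig_of_notMem x hk),
    Complex.ofReal_re, sum_Icc_neg, coeff_lowTrig_zero, norm_zero, zero_pow two_ne_zero, zero_add,
    ← Finset.sum_coe_sort, Finset.mul_sum]
  refine Finset.sum_congr rfl fun n _ => ?_
  rw [(isReal_lowTrig x).norm_coeff_neg, coeff_lowTrig, norm_div, div_pow, lowGauss,
    ← Complex.normSq_eq_norm_sq, Complex.normSq_mk, Complex.norm_natCast]
  ring

/-! ### The vector field of the low modes -/

variable (ψ : ℝ → ℝ)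

/-- The truncated equation in terms of the Gaussian variables. -/
def lowField (x : Low N) : Low N := fun k =>
  ((k.1 : ℕ) : ℝ) * if k.2 then ((Trig.field ψ N (lowTrig x)).coeff (k.1 : ℕ)).im
    else ((Trig.field ψ N (lowTrig x)).coeff (k.1 : ℕ)).re

theorem coeff_field (p : Trig) (n : ℤ) : (Trig.field ψ N p).coeff n
    = -(Complex.I * n * ((|n| : ℤ) : ℂ) * p.coeff n)
      - (ψ ((n : ℝ) / N) : ℂ) * (Trig.proj ψ N p * Trig.D (Trig.proj ψ N p)).coeff n := by
  have e : ∀ p q : Trig, (-p - q).coeff n = -p.coeff n - q.coeff n := by intro p q; simp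
  rw [Trig.field, e, Trig.disp, Trig.coeff_mult, Trig.proj, Trig.coeff_mult]

variable {ψ} {ε : ℝ}

theorem isReal_D {p : Trig} (hp : p.IsReal) : (Trig.D p).IsReal :=
  hp.mult fun n => by
    rw [map_mul, Complex.conj_I, map_intCast]; push_cast; ring

theorem isReal_field (hψ : IsProfile ε ψ) {p : Trig} (hp : p.IsReal) :
    (Trig.field ψ N p).IsReal := by
  have h1 : (Trig.proj ψ N p).IsReal := isReal_proj hψ.even hp
  intro n
  rw [coeff_field, coeff_field, h1.mul (isReal_D h1) n, hp, abs_neg, Trig.even_symbol hψ.even]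
  simp only [map_sub, map_neg, map_mul, Complex.conj_I, map_intCast, Complex.conj_ofReal]
  push_cast
  ring

theorem coeff_field_zero (p : Trig) : (Trig.field ψ N p).coeff 0 = 0 := by
  have h : (Trig.proj ψ N p * Trig.D (Trig.proj ψ N p)).coeff 0 = 0 := Trig.mean_mul_D_self _
  rw [coeff_field, h]
  simp

theorem coeff_field_of_notMem (hψ : IsProfile ε ψ) (hN : 0 < N) {p : Trig} {k : ℤ}
    (hk : k ∉ Finset.Icc (-(N : ℤ)) N) (hp : p.coeff k = 0) : (Trig.field ψ N p).coeff k = 0 := by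
  rw [Finset.mem_Icc, ← abs_le, not_le] at hk
  rw [coeff_field, hp, hψ.symbol_eq_zero hN hk]
  simp

theorem contDiff_lowField (ψ : ℝ → ℝ) : ContDiff ℝ ∞ (lowField ψ : Low N → Low N) := by
  have h1 : ∀ k : ℤ, ContDiff ℝ ∞ fun x : Low N => (Trig.field ψ N (lowTrig x)).coeff k := by
    intro k
    have hp : ∀ j : ℤ, ContDiff ℝ ∞ fun x : Low N => (Trig.proj ψ N (lowTrig x)).coeff j :=
      fun j => contDiff_const.mul (contDiff_coeff_lowTrig j)
    have hD : ∀ j : ℤ, ContDiff ℝ ∞ fun x : Low N =>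
        (Trig.D (Trig.proj ψ N (lowTrig x))).coeff j := fun j => contDiff_const.mul (hp j)
    have hs : ∀ x : Low N, ∀ j ∉ Finset.Icc (-(N : ℤ)) N, (Trig.proj ψ N (lowTrig x)).coeff j = 0 :=
      fun x j hj => by rw [Trig.proj, Trig.coeff_mult, coeff_lowTrig_of_notMem x hj, mul_zero]
    simp only [coeff_field, fun x => Trig.coeff_mul_eq_sum _ (Trig.D (Trig.proj ψ N (lowTrig x)))
      _ (hs x) k]
    exact (contDiff_const.mul (contDiff_coeff_lowTrig k)).neg.sub (contDiff_const.mul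
      (ContDiff.sum fun j _ => (hp j).mul (hD (k - j))))
  refine contDiff_pi.mpr fun ⟨n, b⟩ => contDiff_const.mul ?_
  cases b
  · exact Complex.reCLM.contDiff.comp (h1 _)
  · exact Complex.imCLM.contDiff.comp (h1 _)

theorem lowGauss_lowField (x : Low N) (n : ↥(Finset.Icc 1 N)) :
    lowGauss (lowField ψ x) n = (n : ℕ) * (Trig.field ψ N (lowTrig x)).coeff (n : ℕ) := by
  apply Complex.ext <;> simp [lowGauss, lowField]

/-- The field is tangent to the space of low modes. -/
theorem lowTrig_lowField (hψ : IsProfile ε ψ) (hN : 0 < N) (x : Low N) :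
    lowTrig (lowField ψ x) = Trig.field ψ N (lowTrig x) := by
  ext k
  revert k
  refine mode_cases (N := N) ?_ (fun k hk => ?_) (fun k hk => ?_) fun n => ?_
  · rw [coeff_lowTrig_zero, coeff_field_zero]
  · rw [coeff_lowTrig_of_notMem _ hk, coeff_field_of_notMem hψ hN hk (coeff_lowTrig_of_notMem _ hk)]
  · rw [isReal_lowTrig, isReal_field hψ (isReal_lowTrig x), hk]
  · have hn : ((n : ℕ) : ℂ) ≠ 0 := by
      have := (Finset.mem_Icc.mp n.2).1
      exact_mod_cast (by omega : (n : ℕ) ≠ 0)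
    rw [coeff_lowTrig, lowGauss_lowField, mul_div_cancel_left₀ _ hn]

theorem hasCoeffDeriv_lowTrig {x : ℝ → Low N} {x' : Low N} {t : ℝ} (hx : HasDerivAt x x' t) :
    Trig.HasCoeffDeriv (Finset.Icc (-(N : ℤ)) N) (fun τ => lowTrig (x τ)) (lowTrig x') t := by
  refine ⟨fun τ k hk => coeff_lowTrig_of_notMem _ hk, fun k => ?_⟩
  have h1 := ((contDiff_coeff_lowTrig (N := N) k).differentiable (by simp) (x t)).hasFDerivAt
  have h2 : fderiv ℝ (fun x : Low N => (lowTrig x).coeff k) (x t) x' = (lowTrig x').coeff k := by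
    have h3 : HasDerivAt (fun s : ℝ => x t + s • x') x' 0 := by
      simpa using ((hasDerivAt_id (0 : ℝ)).smul_const x').const_add (x t)
    have h4 := HasFDerivAt.comp_hasDerivAt (0 : ℝ) (by simpa using h1) h3
    simp only [Function.comp_def, coeff_lowTrig_add_smul] at h4
    have h5 : HasDerivAt (fun s : ℝ => (lowTrig (x t)).coeff k + s * (lowTrig x').coeff k)
        ((lowTrig x').coeff k) 0 := by
      simpa using ((Complex.ofRealCLM.hasDerivAt (x := 0)).mul_const
        ((lowTrig x').coeff k)).const_add ((lowTrig (x t)).coeff k)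
    exact h4.unique h5
  have := h1.comp_hasDerivAt t hx
  rw [h2] at this
  exact this

end LowModes

end BenjaminOno

/-! ### Divergence, conserved norm and global flow of the low modes -/

namespace BenjaminOno

section LowFlow

variable {N : ℕ} {ψ : ℝ → ℝ} {ε : ℝ}

/-- The derivative of the vector field at a mode `n` in a direction supported in the modes `±n`. -/
theorem hasDerivAt_coeff_field (n : ℤ) {p : ℝ → Trig} {q : Trig} {t : ℝ} {s : Finset ℤ}
    (hp : Trig.HasCoeffDeriv s p q t) (hq : ∀ k, k ≠ n → k ≠ -n → q.coeff k = 0) (hn : n ≠ 0)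
    (h0 : (p t).coeff 0 = 0) :
    HasDerivAt (fun τ => (Trig.field ψ N (p τ)).coeff n)
      (-(Complex.I * n * ((|n| : ℤ) : ℂ) * q.coeff n) - (ψ ((n : ℝ) / N) : ℂ) * (Complex.I * n
        * ((Trig.proj ψ N q).coeff (-n) * (Trig.proj ψ N (p t)).coeff (2 * n)))) t := by
  have hv : Trig.HasCoeffDeriv s (fun τ => Trig.proj ψ N (p τ)) (Trig.proj ψ N q) t := hp.mult _
  have hD : Trig.HasCoeffDeriv s (fun τ => Trig.D (Trig.proj ψ N (p τ)))
    (Trig.D (Trig.proj ψ N q)) t := hv.mult _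
  simp only [coeff_field]
  refine (((hp.deriv n).const_mul _).neg.sub (((hv.mul hD).deriv n).const_mul _)).congr_deriv ?_
  congr 2
  set w := Trig.proj ψ N q with hw
  set v := Trig.proj ψ N (p t) with hvdef
  -- The linearized nonlinearity is a total derivative, so its mode `n` sees only the products `w_n
  -- v_0` and `w_{-n} v_{2n}`; the first vanishes because the mean is zero.
  have h1 : w * Trig.D v + v * Trig.D w = Trig.D (w * v) := by rw [Trig.D_mul]; ring
  have hwk : ∀ k, k ∉ ({n, -n} : Finset ℤ) → w.coeff k = 0 := fun k hk => by
    simp only [Finset.mem_insert, Finset.mem_singleton, not_or] at hk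
    rw [hw, Trig.proj, Trig.coeff_mult, hq k hk.1 hk.2, mul_zero]
  have hv0 : v.coeff 0 = 0 := by rw [hvdef, Trig.proj, Trig.coeff_mult, h0, mul_zero]
  rw [h1, Trig.D, Trig.coeff_mult, Trig.coeff_mul_eq_sum w v _ hwk, Finset.sum_pair (by omega),
    sub_self, hv0, mul_zero, zero_add, sub_neg_eq_add, two_mul]

theorem hasDerivAt_line (x e : Low N) : HasDerivAt (fun s : ℝ => x + s • e) e 0 := by
  simpa using ((hasDerivAt_id (0 : ℝ)).smul_const e).const_add x

/-- The trace already vanishes on each complex mode: the dispersive term multiplies by an imaginary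
number, which is an infinitesimal rotation, and the nonlinear term acts on the mode itself as `z ↦ λ
conj z`, a real-linear map of trace zero. -/
theorem divFree_lowField (hψ : IsProfile ε ψ) : DivFree (lowField ψ : Low N → Low N) := by
  intro x
  have hd : ∀ k, fderiv ℝ (lowField ψ) x (Pi.single k 1) k
      = deriv (fun s : ℝ => lowField ψ (x + s • Pi.single k 1) k) 0 := by
    intro k
    have h1 := ((contDiff_lowField (N := N) ψ).differentiable (by simp) x).hasFDerivAt
    have h3 : HasDerivAt (fun s : ℝ => x + s • (Pi.single k 1 : Low N)) (Pi.single k 1) 0  :=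
      hasDerivAt_line _ _
    have h4 := HasFDerivAt.comp_hasDerivAt (0 : ℝ)
      (by rw [zero_smul, add_zero]; exact h1) h3
    exact ((hasDerivAt_pi.mp h4 k).deriv).symm
  simp only [hd]
  rw [Fintype.sum_prod_type]
  refine Finset.sum_eq_zero fun n _ => ?_
  rw [Fintype.sum_bool]
  have hn1 := (Finset.mem_Icc.mp n.2).1
  have hnC : ((n : ℕ) : ℂ) ≠ 0 := by exact_mod_cast (by omega : (n : ℕ) ≠ 0)
  set v2 := (Trig.proj ψ N (lowTrig x)).coeff (2 * ((n : ℕ) : ℤ)) with hv2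
  have key : ∀ b, HasDerivAt (fun s : ℝ => (Trig.field ψ N
      (lowTrig (x + s • (Pi.single (n, b) 1 : Low N)))).coeff (n : ℕ))
      (-(Complex.I * (n : ℕ) * ((if b then Complex.I else 1)))
        - (ψ ((n : ℕ) / N) : ℂ) ^ 2 * (Complex.I * ((if b then -Complex.I else 1) * v2))) 0 := by
    intro b
    set e : Low N := Pi.single (n, b) 1 with he
    have h3 := hasDerivAt_line x e
    have hg : ∀ m : ↥(Finset.Icc 1 N), lowGauss e m
        = if m = n then (if b then Complex.I else 1) else 0 := by
      intro m
      apply Complex.ext <;> cases b <;> simp [lowGauss, he, Pi.single_apply] <;>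
        split_ifs <;> simp
    have hq : ∀ k : ℤ, k ≠ ((n : ℕ) : ℤ) → k ≠ -((n : ℕ) : ℤ) → (lowTrig e).coeff k = 0 := by
      refine mode_cases (N := N) (fun _ _ => coeff_lowTrig_zero e)
        (fun k hk _ _ => coeff_lowTrig_of_notMem e hk) (fun k hk h1 h2 => ?_) fun m h1 _ => ?_
      · rw [isReal_lowTrig, hk (by omega) (by omega), map_zero]
      · rw [coeff_lowTrig, hg, if_neg fun h => h1 (by rw [h]), zero_div]
    have h := hasDerivAt_coeff_field (ψ := ψ) (N := N) ((n : ℕ) : ℤ) (hasCoeffDeriv_lowTrig h3) hq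
      (by omega) (coeff_lowTrig_zero _)
    refine h.congr_deriv ?_
    rw [zero_smul, add_zero, ← hv2, Trig.proj, Trig.coeff_mult, isReal_lowTrig, coeff_lowTrig, hg,
      if_pos rfl, abs_of_nonneg (by omega)]
    rw [Trig.even_symbol hψ.even, map_div₀, map_natCast]
    cases b
    · simp; field_simp
    · simp; field_simp; ring
  have hre := fun b => Complex.reCLM.hasFDerivAt.comp_hasDerivAt (0 : ℝ) (key b)
  have him := fun b => Complex.imCLM.hasFDerivAt.comp_hasDerivAt (0 : ℝ) (key b)
  have ht := ((him true).const_mul ((n : ℕ) : ℝ)).deriv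
  have hf := ((hre false).const_mul ((n : ℕ) : ℝ)).deriv
  have et : deriv (fun s : ℝ => lowField ψ (x + s • (Pi.single (n, true) 1 : Low N)) (n, true)) 0 = _ := ht
  have ef : deriv (fun s : ℝ => lowField ψ (x + s • (Pi.single (n, false) 1 : Low N)) (n, false)) 0
    = _ := hf
  rw [et, ef]
  simp
  ring

/-- The conserved `L²` norm of the low modes. -/
def lowSq (x : Low N) : ℝ := (Trig.mean (lowTrig x * lowTrig x)).re

theorem contDiff_lowSq : ContDiff ℝ ∞ (lowSq : Low N → ℝ) := by
  have : (lowSq : Low N → ℝ) = fun x => _ := funext mean_lowTrig_sq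
  rw [this]
  exact contDiff_const.mul (ContDiff.sum fun n _ =>
    (((contDiff_apply ℝ ℝ _).pow 2).add ((contDiff_apply ℝ ℝ _).pow 2)).div_const _)

theorem isBounded_lowSq_le (r : ℝ) : Bornology.IsBounded {x : Low N | lowSq x ≤ r} := by
  -- Each squared coordinate is at most `N²|r|` because `n ≤ N`, and `|y| ≤ 1 + y²` avoids a square
  -- root.
  refine (Metric.isBounded_closedBall (x := (0 : Low N)) (r := 1 + N ^ 2 * |r|)).subset
    fun x hx => ?_
  rw [mem_ofPred_eq, lowSq, mean_lowTrig_sq] at hx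
  rw [mem_closedBall_zero_iff, pi_norm_le_iff_of_nonneg (by positivity)]
  rintro ⟨n, b⟩
  have hn := Finset.mem_Icc.mp n.2
  have hn0 : (0 : ℝ) < (n : ℕ) := by exact_mod_cast hn.1
  have hnN : ((n : ℕ) : ℝ) ≤ N := by exact_mod_cast hn.2
  have h1 := Finset.single_le_sum (f := fun n : ↥(Finset.Icc 1 N) =>
    ((x (n, false)) ^ 2 + (x (n, true)) ^ 2) / ((n : ℕ) : ℝ) ^ 2) (fun n _ => by positivity)
    (Finset.mem_univ n)
  have h2 : x (n, b) ^ 2 ≤ (x (n, false)) ^ 2 + (x (n, true)) ^ 2 := by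
    cases b
    · exact le_add_of_nonneg_right (sq_nonneg _)
    · exact le_add_of_nonneg_left (sq_nonneg _)
  have h3 : ((x (n, false)) ^ 2 + (x (n, true)) ^ 2) / ((n : ℕ) : ℝ) ^ 2 ≤ |r| := by
    have h0 : 0 ≤ ((x (n, false)) ^ 2 + (x (n, true)) ^ 2) / ((n : ℕ) : ℝ) ^ 2 := by positivity
    have := le_abs_self r
    linarith
  rw [div_le_iff₀ (by positivity)] at h3
  have h4 : |r| * ((n : ℕ) : ℝ) ^ 2 ≤ N ^ 2 * |r| := by
    rw [mul_comm]; gcongr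
  rw [Real.norm_eq_abs]
  nlinarith [sq_abs (x (n, b)), sq_nonneg (|x (n, b)| - 1)]

theorem fderiv_lowSq_lowField (hψ : IsProfile ε ψ) (hN : 0 < N) (x : Low N) :
    fderiv ℝ lowSq x (lowField ψ x) = 0 := by
  have h1 := ((contDiff_lowSq (N := N)).differentiable (by simp) x).hasFDerivAt
  have h3 := hasDerivAt_line x (lowField ψ x)
  have h4 := HasFDerivAt.comp_hasDerivAt (0 : ℝ) (by rw [zero_smul, add_zero]; exact h1) h3
  have h5 := hasCoeffDeriv_lowTrig h3
  rw [lowTrig_lowField hψ hN] at h5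
  have h6 := Trig.hasDerivAt_mean_sq (N := N) (ψ := ψ) hψ.even
    (p := fun s : ℝ => lowTrig (x + s • lowField ψ x)) (t := 0)
    (by rw [zero_smul, add_zero]; exact h5)
  have h7 := Complex.reCLM.hasFDerivAt.comp_hasDerivAt (0 : ℝ) h6
  rw [map_zero] at h7
  exact h4.unique h7

theorem exists_lowFlow (hψ : IsProfile ε ψ) (hN : 0 < N) : ∃ Φ : ℝ → Low N → Low N,
    IsFlow (lowField ψ) Φ ∧ Continuous (fun p : ℝ × Low N => Φ p.1 p.2) ∧
      ∀ t, MeasurePreserving (Φ t) := by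
  have : Nonempty ↥(Finset.Icc 1 N) := ⟨⟨1, by rw [Finset.mem_Icc]; omega⟩⟩
  exact exists_volumePreserving_flow (contDiff_lowField ψ) (divFree_lowField hψ)
    contDiff_lowSq isBounded_lowSq_le (fderiv_lowSq_lowField hψ hN)

theorem lowCurve_unique (hψ : IsProfile ε ψ) (hN : 0 < N) {f g : ℝ → Low N}
    (hf : ∀ t, HasDerivAt f (lowField ψ (f t)) t) (hg : ∀ t, HasDerivAt g (lowField ψ (g t)) t)
    {t₀ : ℝ} (h : f t₀ = g t₀) : f = g :=
  curve_unique_of_firstIntegral (contDiff_lowField ψ) contDiff_lowSq isBounded_lowSq_le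
    (fderiv_lowSq_lowField hψ hN) hf hg h

theorem lowFlow_add (hψ : IsProfile ε ψ) (hN : 0 < N) {Φ : ℝ → Low N → Low N}
    (hΦ : IsFlow (lowField ψ) Φ) (s t : ℝ) (x : Low N) : Φ (s + t) x = Φ s (Φ t x) := by
  have h := lowCurve_unique hψ hN (f := fun s => Φ (s + t) x) (g := fun s => Φ s (Φ t x)) (t₀ := 0)
    (fun s => (hΦ.deriv x (s + t)).comp_add_const s t) (hΦ.deriv _)
    (by simp only [zero_add, hΦ.zero])
  exact congrFun h s

end LowFlow

end BenjaminOno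

namespace BenjaminOno

/-! ### The law of the low modes -/

section LowLaw

variable {κ : ℝ} {N : ℕ}

/-- The law of the low modes. -/
def lowLaw (κ : ℝ) (N : ℕ) : Measure (Low N) := (sampleLaw κ).map (lowPart N)

theorem measurable_lowPart : Measurable (lowPart N) :=
  measurable_pi_lambda _ fun _ => measurable_coord _

instance : IsProbabilityMeasure (lowLaw κ N) :=
  Measure.isProbabilityMeasure_map measurable_lowPart.aemeasurable

/-- The energy in the density of the law of the low modes. -/
def lowEnergy (κ : ℝ) (x : Low N) : ℝ := 4 * Real.pi * κ * ∑ k, x k ^ 2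

theorem measurable_lowEnergy : Measurable (lowEnergy κ : Low N → ℝ) :=
  (Finset.measurable_sum _ fun k _ => (measurable_pi_apply k).pow_const 2).const_mul _

theorem pi_gaussianReal_eq_withDensity {ι : Type*} [Fintype ι] {v : NNReal} (hv : v ≠ 0) :
    Measure.pi (fun _ : ι => gaussianReal 0 v)
      = (volume : Measure (ι → ℝ)).withDensity
        fun x => ENNReal.ofReal (∏ k, gaussianPDFReal 0 v (x k)) := by
  refine Measure.pi_eq fun s hs => ?_
  have hi : Integrable (fun x : ι → ℝ => ∏ k, gaussianPDFReal 0 v (x k))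
      (Measure.pi fun k => (volume : Measure ℝ).restrict (s k)) :=
    Integrable.fintype_prod (f := fun _ : ι => gaussianPDFReal 0 v) fun k =>
      (integrable_gaussianPDFReal 0 v).restrict
  rw [withDensity_apply _ (MeasurableSet.univ_pi hs), volume_pi, Measure.restrict_pi_pi,
    ← ofReal_integral_eq_lintegral_ofReal hi (Filter.Eventually.of_forall fun x =>
      Finset.prod_nonneg fun k _ => gaussianPDFReal_nonneg _ _ _), integral_fintype_prod_eq_prod
      (f := fun _ : ι => gaussianPDFReal 0 v), ENNReal.ofReal_prod_of_nonneg fun k _ =>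
        integral_nonneg fun x => gaussianPDFReal_nonneg _ _ _]
  exact Finset.prod_congr rfl fun k _ => (gaussianReal_apply_eq_integral _ hv _).symm

theorem exists_lowLaw_eq (hκ : 0 < κ) (N : ℕ) : ∃ c : ℝ, 0 ≤ c ∧ lowLaw κ N
    = (volume : Measure (Low N)).withDensity
      fun x => ENNReal.ofReal (c * Real.exp (-lowEnergy κ x)) := by
  have hv : sampleVar κ ≠ 0 := by
    rw [sampleVar, ne_eq, Real.toNNReal_eq_zero, not_le]
    positivity
  have hind : iIndepFun (fun (k : ↥(Finset.Icc 1 N) × Bool) => coord ((k.1 : ℕ), k.2))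
      (sampleLaw κ) := (iIndepFun_coord κ).precomp (g := fun k : ↥(Finset.Icc 1 N) × Bool =>
        ((k.1 : ℕ), k.2)) (fun a b h => by
          rw [Prod.mk.injEq] at h
          exact Prod.ext (Subtype.ext h.1) h.2)
  have h1 := hind.map_fun_eq_pi_map fun k => (measurable_coord _).aemeasurable
  simp only [map_coord] at h1
  refine ⟨∏ _k : ↥(Finset.Icc 1 N) × Bool, (√(2 * Real.pi * sampleVar κ))⁻¹,
    Finset.prod_nonneg fun k _ => by positivity, ?_⟩
  rw [lowLaw]
  refine h1.trans ((pi_gaussianReal_eq_withDensity hv).trans ?_)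
  congr 1
  funext x
  congr 1
  simp only [gaussianPDFReal_def]
  rw [Finset.prod_mul_distrib, ← Real.exp_sum, lowEnergy, Finset.mul_sum, ← Finset.sum_neg_distrib]
  congr 2
  refine Finset.sum_congr rfl fun k _ => ?_
  rw [sub_zero, sampleVar, Real.coe_toNNReal _ (by positivity)]
  field_simp
  ring

theorem measurable_combine : Measurable fun p : Low N × Sample => combine p.1 p.2 := by
  refine measurable_pi_lambda _ fun n => ?_
  by_cases hn : n ∈ Finset.Icc 1 N
  · simp only [combine, dif_pos hn]
    exact ((measurable_pi_apply _).comp measurable_fst).prodMk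
      ((measurable_pi_apply _).comp measurable_fst)
  · simp only [combine, dif_neg hn]
    exact (measurable_pi_apply _).comp measurable_snd

/-- Resampling the low modes preserves the law. -/
theorem measurePreserving_combine (κ : ℝ) (N : ℕ) : MeasurePreserving
    (fun p : Low N × Sample => combine p.1 p.2) ((lowLaw κ N).prod (sampleLaw κ)) (sampleLaw κ) := by
  refine ⟨measurable_combine, ?_⟩
  rw [sampleLaw]
  refine Measure.eq_infinitePi _ fun s t ht => ?_
  rw [← sampleLaw, Measure.map_apply measurable_combine
    (MeasurableSet.pi s.countable_toSet fun i _ => ht i)]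
  classical
  set A : Set (Low N) := {x | ∀ n : ↥(Finset.Icc 1 N), (n : ℕ) ∈ s →
    (x (n, false), x (n, true)) ∈ t n} with hA
  have hAm : MeasurableSet A := by
    rw [hA]
    simp only [Set.ofPred_forall]
    refine MeasurableSet.iInter fun n => MeasurableSet.iInter fun _ => ?_
    exact ((measurable_pi_apply _).prodMk (measurable_pi_apply _)) (ht n)
  have e : (fun p : Low N × Sample => combine p.1 p.2) ⁻¹' Set.pi s t
      = A ×ˢ Set.pi ↑(s.filter fun n => n ∉ Finset.Icc 1 N) t := by
    ext ⟨x, h⟩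
    simp only [mem_preimage, Set.mem_pi, mem_prod, hA, mem_ofPred_eq, Finset.mem_coe,
      Finset.mem_filter]
    constructor
    · refine fun H => ⟨fun n hn => ?_, fun n hn => ?_⟩
      · have := H n hn
        rwa [combine_apply] at this
      · have := H n hn.1
        rwa [combine_apply_of_notMem _ _ hn.2] at this
    · rintro ⟨H1, H2⟩ n hn
      by_cases hn' : n ∈ Finset.Icc 1 N
      · have := H1 ⟨n, hn'⟩ hn
        rwa [← combine_apply x h] at this
      · rw [combine_apply_of_notMem _ _ hn']
        exact H2 n ⟨hn, hn'⟩
  have e2 : lowPart N ⁻¹' A = Set.pi ↑(s.filter fun n => n ∈ Finset.Icc 1 N) t := by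
    ext g
    simp only [mem_preimage, Set.mem_pi, hA, mem_ofPred_eq, Finset.mem_coe, Finset.mem_filter]
    exact ⟨fun H n hn => H ⟨n, hn.2⟩ hn.1, fun H n hn => H n ⟨hn, n.2⟩⟩
  rw [e, Measure.prod_prod, lowLaw, Measure.map_apply measurable_lowPart hAm, e2, sampleLaw,
    Measure.infinitePi_pi _ (fun i _ => ht i), Measure.infinitePi_pi _ (fun i _ => ht i)]
  exact Finset.prod_filter_mul_prod_filter_not s (fun n => n ∈ Finset.Icc 1 N) _

/-- The change of the law under volume-preserving maps of the low modes and rotations of the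
others. -/
theorem lintegral_combine_sampleRot (hκ : 0 < κ) {Θ : Low N → Low N} (hΘ : MeasurePreserving Θ)
    (φ : ℕ → ℝ) {f : Sample → ENNReal} (hf : Measurable f) :
    ∫⁻ g, ENNReal.ofReal (Real.exp (lowEnergy κ (lowPart N g) - lowEnergy κ (Θ (lowPart N g))))
      * f (combine (Θ (lowPart N g)) (sampleRot φ g)) ∂sampleLaw κ = ∫⁻ g, f g ∂sampleLaw κ := by
  obtain ⟨c, hc, hγ⟩ := exists_lowLaw_eq hκ N
  have hrot := measurePreserving_sampleRot κ φ
  have hcomb := measurePreserving_combine κ N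
  have hm1 : Measurable fun x : Low N => Real.exp (lowEnergy κ x - lowEnergy κ (Θ x)) :=
    (measurable_lowEnergy.sub (measurable_lowEnergy.comp hΘ.measurable)).exp
  have hmρ : Measurable fun x : Low N => ENNReal.ofReal (c * Real.exp (-lowEnergy κ x)) :=
    (measurable_lowEnergy.neg.exp.const_mul c).ennreal_ofReal
  have hmf : ∀ h, Measurable fun x : Low N => f (combine x h) := fun h =>
    hf.comp (measurable_combine.comp (measurable_id.prodMk measurable_const))
  have hmT : Measurable fun p : Low N × Sample =>
      ENNReal.ofReal (Real.exp (lowEnergy κ p.1 - lowEnergy κ (Θ p.1)))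
        * f (combine (Θ p.1) (sampleRot φ p.2)) :=
    (hm1.ennreal_ofReal.comp measurable_fst).mul (hf.comp (measurable_combine.comp
      ((hΘ.measurable.comp measurable_fst).prodMk (hrot.measurable.comp measurable_snd))))
  have hoverwrite : ∀ (x y : Low N) (h : Sample),
      combine x (sampleRot φ (combine y h)) = combine x (sampleRot φ h) := by
    intro x y h
    funext n
    by_cases hn : n ∈ Finset.Icc 1 N
    · simp only [combine, dif_pos hn]
    · simp only [combine, dif_neg hn, sampleRot]
  -- For fixed high modes the law of the low modes has density proportional to `exp(-lowEnergy)`.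
  -- The exponential factor replaces its value at `x` by the value at `Θ x`, after which Lebesgue
  -- invariance of `Θ` applies.
  have hinner : ∀ h, ∫⁻ x, ENNReal.ofReal (Real.exp (lowEnergy κ x - lowEnergy κ (Θ x)))
      * f (combine (Θ x) h) ∂lowLaw κ N = ∫⁻ x, f (combine x h) ∂lowLaw κ N := by
    intro h
    have hm2 : Measurable fun x : Low N => ENNReal.ofReal
        (Real.exp (lowEnergy κ x - lowEnergy κ (Θ x))) * f (combine (Θ x) h) :=
      hm1.ennreal_ofReal.mul ((hmf h).comp hΘ.measurable)
    rw [hγ, lintegral_withDensity_eq_lintegral_mul _ hmρ hm2,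
      lintegral_withDensity_eq_lintegral_mul _ hmρ (hmf h),
      ← hΘ.lintegral_comp (hmρ.mul (hmf h))]
    refine lintegral_congr fun x => ?_
    simp only [Pi.mul_apply]
    rw [← mul_assoc, ← ENNReal.ofReal_mul (by positivity), mul_assoc, ← Real.exp_add]
    congr 4
    ring
  have hmap : Measurable fun g => ENNReal.ofReal
      (Real.exp (lowEnergy κ (lowPart N g) - lowEnergy κ (Θ (lowPart N g))))
        * f (combine (Θ (lowPart N g)) (sampleRot φ g)) :=
    (hm1.comp measurable_lowPart).ennreal_ofReal.mul (hf.comp (measurable_combine.comp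
      ((hΘ.measurable.comp measurable_lowPart).prodMk hrot.measurable)))
  have hfc : Measurable fun p : Low N × Sample => f (combine p.1 p.2) := hf.comp measurable_combine
  have c1 : ∫⁻ h, ∫⁻ x, f (combine x h) ∂lowLaw κ N ∂sampleLaw κ = ∫⁻ g, f g ∂sampleLaw κ := by
    rw [← hcomb.lintegral_comp hf]
    exact (lintegral_prod_symm _ hfc.aemeasurable).symm
  -- Resampling the low modes independently turns the law into a product, so that the rotation of
  -- the high modes and the map of the low modes are treated one after the other.
  rw [← c1, ← hrot.lintegral_comp (f := fun h => ∫⁻ x, f (combine x h) ∂lowLaw κ N)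
    hfc.lintegral_prod_left', ← hcomb.lintegral_comp hmap]
  simp only [lowPart_combine, hoverwrite]
  rw [lintegral_prod_symm _ hmT.aemeasurable]
  exact lintegral_congr fun h => hinner (sampleRot φ h)

end LowLaw

end BenjaminOno

namespace BenjaminOno

/-! ### The density along the flow -/

section DensityFlow

variable {κ ε R : ℝ} {χ ψ : ℝ → ℝ} {N : ℕ}

theorem randomTrig_combine (x : Low N) (h : Sample) : randomTrig N (combine x h) = lowTrig x := by
  ext k
  revert k
  refine mode_cases (N := N) ?_ (fun k hk => ?_) (fun k hk => ?_) fun n => ?_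
  · simp [lowTrig, coeff_randomTrig]
  · rw [coeff_lowTrig_of_notMem x hk, randomTrig, coeff_ofSeq_eq_zero hk]
  · rw [isReal_lowTrig, isReal_randomTrig, hk]
  · have hn := Finset.mem_Icc.mp n.2
    rw [coeff_lowTrig, coeff_randomTrig, if_pos (by rw [abs_of_nonneg] <;> omega),
      gauss_natCast (by omega), combine_apply, Int.natAbs_natCast, lowGauss]

theorem lowTrig_lowPart (g : Sample) : lowTrig (lowPart N g) = randomTrig N g := by
  rw [← randomTrig_combine _ g, combine_lowPart]

/-- The quadratic form in the Gaussian weight is the `Ḣ¹` part of the energy; this is what lets the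
law and the density combine into the cutoffs times `exp(-E)`. -/
theorem mean_D_lowTrig_sq (κ : ℝ) (x : Low N) :
    2 * Real.pi * κ * (Trig.mean (Trig.D (lowTrig x) * Trig.D (lowTrig x))).re
      = lowEnergy κ x := by
  have hD := isReal_D (isReal_lowTrig x)
  have hc : ∀ k, (Trig.D (lowTrig x)).coeff k = Complex.I * k * (lowTrig x).coeff k := fun k => rfl
  rw [re_mean_mul_self hD (Finset.Icc (-(N : ℤ)) N)
    (fun k hk => by rw [hc, coeff_lowTrig_of_notMem x hk, mul_zero]),
    Complex.ofReal_re, sum_Icc_neg, hc, coeff_lowTrig_zero, mul_zero, norm_zero,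
    zero_pow two_ne_zero, zero_add, ← Finset.sum_coe_sort, lowEnergy, Fintype.sum_prod_type,
    Finset.mul_sum, Finset.mul_sum]
  refine Finset.sum_congr rfl fun n _ => ?_
  have hn : ((n : ℕ) : ℝ) ≠ 0 := by
    have := (Finset.mem_Icc.mp n.2).1
    exact_mod_cast (by omega : (n : ℕ) ≠ 0)
  rw [hD.norm_coeff_neg, hc, coeff_lowTrig, norm_mul, norm_mul, norm_div, Complex.norm_I, one_mul,
    Complex.norm_intCast, Complex.norm_natCast, Int.cast_natCast, Nat.abs_cast,
    mul_div_cancel₀ _ hn, lowGauss, ← Complex.normSq_eq_norm_sq, Complex.normSq_mk,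
    Fintype.sum_bool]
  ring

/-- Only measurability is wanted here; with the zero measure the moment conditions are void. -/
theorem randTrig_lowTrig : RandTrig (0 : Measure (Low N)) (lowTrig : Low N → Trig) :=
  ⟨⟨_, fun x _ hk => coeff_lowTrig_of_notMem x hk⟩,
    fun n => (contDiff_coeff_lowTrig n).continuous.measurable, fun n p => by simp⟩

/-- The density of the low modes, transported by a map. -/
def transported (κ : ℝ) (χ ψ : ℝ → ℝ) (N : ℕ) (R : ℝ) (x y : Low N) : ℝ :=
  Real.exp (lowEnergy κ x - lowEnergy κ y) * trigDensity κ χ ψ N R (lowTrig y)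

/-- The density of the low modes against the derivative of the energy. -/
def production (κ : ℝ) (χ ψ : ℝ → ℝ) (N : ℕ) (R : ℝ) (y : Low N) : ℝ :=
  2 * Real.pi * κ * (|trigDensity κ χ ψ N R (lowTrig y)|
    * ‖Trig.defect ψ N (Trig.proj ψ N (lowTrig y))‖)

theorem measurable_production (hχ : Continuous χ) :
    Measurable (production κ χ ψ N R : Low N → ℝ) :=
  ((measurable_trigDensity hχ ψ N randTrig_lowTrig).abs.mul
    ((randTrig_lowTrig.proj ψ N).measurable_defect ψ N).norm).const_mul _

/-- The cutoffs depend only on the two conserved quantities and stay frozen, so the derivative is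
that of `exp(-E)` along the flow, and the derivative of the energy is the defect. -/
theorem hasDerivAt_transported (hψ : IsProfile ε ψ) (hN : 0 < N) {Φ : ℝ → Low N → Low N}
    (hΦ : IsFlow (lowField ψ) Φ) (x : Low N) (t : ℝ) :
    HasDerivAt (fun s => transported κ χ ψ N R x (Φ s x))
      (-(2 * Real.pi * κ * (Trig.defect ψ N (Trig.proj ψ N (lowTrig (Φ t x)))).re)
        * transported κ χ ψ N R x (Φ t x)) t := by
  have hc : ∀ s, Trig.HasCoeffDeriv (Finset.Icc (-(N : ℤ)) N) (fun τ => lowTrig (Φ τ x))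
      (Trig.field ψ N (lowTrig (Φ s x))) s := fun s => by
    have := hasCoeffDeriv_lowTrig (hΦ.deriv x s)
    rwa [lowTrig_lowField hψ hN] at this
  have conserved : ∀ {f : Trig → ℂ}, (∀ s, HasDerivAt (fun τ => f (lowTrig (Φ τ x))) 0 s) →
      ∀ s, f (lowTrig (Φ s x)) = f (lowTrig x) := fun {f} h s => by
    have := is_const_of_deriv_eq_zero (fun s => (h s).differentiableAt) (fun s => (h s).deriv) s 0
    rwa [hΦ.zero] at this
  have h1 := conserved (f := fun p => Trig.mean (p * p))
    fun s => Trig.hasDerivAt_mean_sq hψ.even (hc s)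
  have h2 := conserved (f := fun p => Trig.mean (p * Trig.absD p) + 1 / 3 * Trig.mean
    (Trig.proj ψ N p * Trig.proj ψ N p * Trig.proj ψ N p))
    fun s => Trig.hasDerivAt_hamiltonian hψ.even (hc s)
  set a := χ (Real.sqrt (2 * Real.pi * κ * (Trig.mean (lowTrig x * lowTrig x)).re) / R)
    * χ ((2 * Real.pi * κ * (Trig.mean (lowTrig x * Trig.absD (lowTrig x)) + 1 / 3 * Trig.mean
      (Trig.proj ψ N (lowTrig x) * Trig.proj ψ N (lowTrig x)
        * Trig.proj ψ N (lowTrig x))).re - renorm N) / R) with ha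
  have e : ∀ s, transported κ χ ψ N R x (Φ s x) = a * Real.exp (lowEnergy κ x
      - 2 * Real.pi * κ * (Trig.energy ψ N (lowTrig (Φ s x))).re) := by
    intro s
    rw [transported, trigDensity, h1, h2, ← ha, ← mean_D_lowTrig_sq κ (Φ s x), mul_left_comm,
      ← Real.exp_add, Trig.energy]
    simp only [Complex.add_re]
    congr 2
    ring
  have h3 := Complex.reCLM.hasFDerivAt.comp_hasDerivAt t
    (Trig.hasDerivAt_energy (N := N) hψ.even (hc t))
  have h4 := (((h3.const_mul (2 * Real.pi * κ)).const_sub (lowEnergy κ x)).exp).const_mul a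
  rw [e t]
  have e' : (fun s => transported κ χ ψ N R x (Φ s x)) = fun s => _ := funext e
  rw [e']
  refine h4.congr_deriv ?_
  simp only [Function.comp_apply, Complex.reCLM_apply]
  ring

theorem continuous_defect_flow {Φ : ℝ → Low N → Low N} (hΦ : IsFlow (lowField ψ) Φ) (x : Low N) :
    Continuous fun s => Trig.defect ψ N (Trig.proj ψ N (lowTrig (Φ s x))) := by
  rw [continuous_iff_continuousAt]
  intro s
  have hv := (hasCoeffDeriv_lowTrig (hΦ.deriv x s)).mult fun n => (ψ ((n : ℝ) / N) : ℂ)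
  have hD := ((hv.mul hv).mult fun n => 1 - (ψ ((n : ℝ) / N) : ℂ) ^ 2).mult
    fun n => Complex.I * n
  have h4 := (hD.mul (hv.mul (hv.mult fun n => ((|n| : ℤ) : ℂ)))).mean
  have h5 := (hD.mul ((hv.mul hv).mul hv)).mean
  simp only [Trig.defect_eq]
  exact ((h4.const_mul _).add (h5.const_mul _)).continuousAt

/-- This is the fundamental theorem of calculus, in a form with nonnegative integrals so that the
order of integration can afterwards be exchanged without integrability conditions. -/
theorem ofReal_abs_transported_sub_le (hκ : 0 < κ) (hψ : IsProfile ε ψ) (hN : 0 < N)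
    {Φ : ℝ → Low N → Low N} (hΦ : IsFlow (lowField ψ) Φ) (x : Low N) (t : ℝ) :
    ENNReal.ofReal |transported κ χ ψ N R x (Φ t x) - trigDensity κ χ ψ N R (lowTrig x)|
      ≤ ∫⁻ s in uIoc 0 t, ENNReal.ofReal (Real.exp (lowEnergy κ x - lowEnergy κ (Φ s x)))
        * ENNReal.ofReal (production κ χ ψ N R (Φ s x)) := by
  have hd := fun s => hasDerivAt_transported (κ := κ) (χ := χ) (R := R) hψ hN hΦ x s
  have hcont : Continuous fun s =>
      -(2 * Real.pi * κ * (Trig.defect ψ N (Trig.proj ψ N (lowTrig (Φ s x)))).re)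
        * transported κ χ ψ N R x (Φ s x) :=
    ((Complex.continuous_re.comp (continuous_defect_flow hΦ x)).const_mul _).neg.mul
      (continuous_iff_continuousAt.mpr fun s => (hd s).continuousAt)
  have h0 : transported κ χ ψ N R x (Φ 0 x) = trigDensity κ χ ψ N R (lowTrig x) := by
    rw [hΦ.zero, transported, sub_self, Real.exp_zero, one_mul]
  rw [← h0, ← intervalIntegral.integral_eq_sub_of_hasDerivAt (fun s _ => hd s)
    (hcont.intervalIntegrable 0 t)]
  rw [← Real.norm_eq_abs, intervalIntegral.norm_integral_eq_norm_integral_uIoc,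
    ofReal_norm]
  refine (enorm_integral_le_lintegral_enorm _).trans (lintegral_mono fun s => ?_)
  rw [← ofReal_norm, ← ENNReal.ofReal_mul (Real.exp_pos _).le]
  refine ENNReal.ofReal_le_ofReal ?_
  rw [production, transported, norm_mul, norm_neg, norm_mul (2 * Real.pi * κ),
    norm_mul (Real.exp _), Real.norm_of_nonneg (by positivity : (0 : ℝ) ≤ 2 * Real.pi * κ),
    Real.norm_of_nonneg (Real.exp_pos _).le, Real.norm_eq_abs, Real.norm_eq_abs]
  have h1 := Complex.abs_re_le_norm (Trig.defect ψ N (Trig.proj ψ N (lowTrig (Φ s x))))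
  calc _ ≤ 2 * Real.pi * κ * ‖Trig.defect ψ N (Trig.proj ψ N (lowTrig (Φ s x)))‖
        * (Real.exp (lowEnergy κ x - lowEnergy κ (Φ s x))
          * |trigDensity κ χ ψ N R (lowTrig (Φ s x))|) := by gcongr
    _ = _ := by ring

/-- After Tonelli the change of variables at time `s` removes the Jacobian factor and the flow
together, so the integrand in `s` is constant and the bound is linear in `|t|`. -/
theorem lintegral_transported_sub_le (hκ : 0 < κ) (hχ : Continuous χ) (hψ : IsProfile ε ψ)
    (hN : 0 < N) {Φ : ℝ → Low N → Low N} (hΦ : IsFlow (lowField ψ) Φ)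
    (hΦc : Continuous fun p : ℝ × Low N => Φ p.1 p.2) (hΦv : ∀ t, MeasurePreserving (Φ t)) (t : ℝ) :
    ∫⁻ g, ENNReal.ofReal |transported κ χ ψ N R (lowPart N g) (Φ t (lowPart N g))
        - trigDensity κ χ ψ N R (lowTrig (lowPart N g))| ∂sampleLaw κ
      ≤ ENNReal.ofReal |t|
        * ∫⁻ g, ENNReal.ofReal (production κ χ ψ N R (lowPart N g)) ∂sampleLaw κ := by
  have hH : Measurable (production κ χ ψ N R : Low N → ℝ) := measurable_production hχ
  have hE : Measurable (lowEnergy κ : Low N → ℝ) := measurable_lowEnergy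
  have hm : Measurable fun p : ℝ × Low N =>
      ENNReal.ofReal (Real.exp (lowEnergy κ p.2 - lowEnergy κ (Φ p.1 p.2)))
        * ENNReal.ofReal (production κ χ ψ N R (Φ p.1 p.2)) :=
    ((hE.comp measurable_snd).sub (hE.comp hΦc.measurable)).exp.ennreal_ofReal.mul
      (hH.comp hΦc.measurable).ennreal_ofReal
  have hm2 : Measurable fun p : Sample × ℝ => (p.2, lowPart N p.1) :=
    measurable_snd.prodMk (measurable_lowPart.comp measurable_fst)
  calc _ ≤ ∫⁻ g, (∫⁻ s in uIoc 0 t, ENNReal.ofReal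
          (Real.exp (lowEnergy κ (lowPart N g) - lowEnergy κ (Φ s (lowPart N g))))
        * ENNReal.ofReal (production κ χ ψ N R (Φ s (lowPart N g)))) ∂sampleLaw κ :=
        lintegral_mono fun g => ofReal_abs_transported_sub_le hκ hψ hN hΦ _ t
    _ = ∫⁻ s in uIoc 0 t, ∫⁻ g, ENNReal.ofReal
          (Real.exp (lowEnergy κ (lowPart N g) - lowEnergy κ (Φ s (lowPart N g))))
        * ENNReal.ofReal (production κ χ ψ N R (Φ s (lowPart N g))) ∂sampleLaw κ :=
        lintegral_lintegral_swap (hm.comp hm2).aemeasurable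
    _ = ∫⁻ _s in uIoc 0 t, ∫⁻ g, ENNReal.ofReal (production κ χ ψ N R (lowPart N g)) ∂sampleLaw κ := by
        refine lintegral_congr fun s => ?_
        have := lintegral_combine_sampleRot hκ (hΦv s) (fun _ => 0)
          (f := fun g => ENNReal.ofReal (production κ χ ψ N R (lowPart N g)))
          (hH.comp measurable_lowPart).ennreal_ofReal
        simp only [lowPart_combine] at this
        exact this
    _ = _ := by
        rw [lintegral_const, Measure.restrict_apply_univ, mul_comm, uIoc, Real.volume_Ioc,
          max_sub_min_eq_abs, sub_zero]

end DensityFlow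

/-! ### The flow on the sample space -/

section SampleFlow

variable {κ ε R : ℝ} {χ ψ : ℝ → ℝ} {N : ℕ}

/-- The flow on the sample space: the modes above `N` rotate. -/
def sampleFlow {N : ℕ} (Φ : ℝ → Low N → Low N) (t : ℝ) (g : Sample) : Sample :=
  combine (Φ t (lowPart N g)) (sampleRot (fun n => -(n ^ 2 * t)) g)

theorem sampleFlow_neg (hψ : IsProfile ε ψ) (hN : 0 < N) {Φ : ℝ → Low N → Low N}
    (hΦ : IsFlow (lowField ψ) Φ) (t : ℝ) (g : Sample) :
    sampleFlow Φ (-t) (sampleFlow Φ t g) = g := by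
  rw [sampleFlow, sampleFlow, lowPart_combine, ← lowFlow_add hψ hN hΦ, neg_add_cancel, hΦ.zero]
  funext n
  by_cases hn : n ∈ Finset.Icc 1 N
  · exact combine_apply (lowPart N g) _ ⟨n, hn⟩
  · rw [combine_apply_of_notMem _ _ hn, sampleRot, combine_apply_of_notMem _ _ hn, sampleRot,
      planeRot_apply, planeRot_apply, mul_neg, neg_neg, Real.cos_neg, Real.sin_neg]
    have h := Real.sin_sq_add_cos_sq ((n : ℝ) ^ 2 * t)
    ext
    · dsimp only; linear_combination (g n).1 * h
    · dsimp only; linear_combination (g n).2 * h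

theorem measurable_sampleFlow {Φ : ℝ → Low N → Low N} {t : ℝ} (hΦ : Measurable (Φ t)) :
    Measurable (sampleFlow Φ t) :=
  measurable_combine.comp ((hΦ.comp measurable_lowPart).prodMk
    (measurePreserving_sampleRot 1 _).measurable)

theorem integral_comp_sampleFlow (hκ : 0 < κ) {Φ : ℝ → Low N → Low N} {t : ℝ}
    (hΦ : MeasurePreserving (Φ t)) {f : Sample → ℝ} (hf : Measurable f) :
    ∫ g, Real.exp (lowEnergy κ (lowPart N g) - lowEnergy κ (Φ t (lowPart N g)))
      * f (sampleFlow Φ t g) ∂sampleLaw κ = ∫ g, f g ∂sampleLaw κ := by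
  have hT := measurable_sampleFlow hΦ.measurable
  have hJ : Measurable fun g : Sample => ENNReal.ofReal
      (Real.exp (lowEnergy κ (lowPart N g) - lowEnergy κ (Φ t (lowPart N g)))) :=
    (((measurable_lowEnergy.comp measurable_lowPart).sub (measurable_lowEnergy.comp
      (hΦ.measurable.comp measurable_lowPart))).exp).ennreal_ofReal
  have hmap : ((sampleLaw κ).withDensity fun g => ENNReal.ofReal
      (Real.exp (lowEnergy κ (lowPart N g) - lowEnergy κ (Φ t (lowPart N g))))).map
        (sampleFlow Φ t) = sampleLaw κ := by
    refine Measure.ext_of_lintegral _ fun F hF => ?_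
    have hFT : Measurable fun g => F (sampleFlow Φ t g) := hF.comp hT
    rw [lintegral_map hF hT, lintegral_withDensity_eq_lintegral_mul _ hJ hFT]
    exact lintegral_combine_sampleRot hκ hΦ _ hF
  conv_rhs => rw [← hmap]
  rw [integral_map hT.aemeasurable hf.aestronglyMeasurable,
    integral_withDensity_eq_integral_toReal_smul hJ (Filter.Eventually.of_forall fun g =>
      ENNReal.ofReal_lt_top)]
  refine integral_congr_ae (Filter.Eventually.of_forall fun g => ?_)
  simp only [smul_eq_mul]
  rw [ENNReal.toReal_ofReal (Real.exp_pos _).le]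

/-- The change of variables brings the integral over the image back to `B`, with the transported
density in place of the density. The difference is at most their L¹ distance over the whole space,
which explains the uniformity in `B`. -/
theorem abs_setIntegral_sub_le (hκ : 0 < κ) (hχ : Continuous χ) (hψ : IsProfile ε ψ)
    (hN : 0 < N) {Φ : ℝ → Low N → Low N} (hΦ : IsFlow (lowField ψ) Φ)
    (hΦc : Continuous fun p : ℝ × Low N => Φ p.1 p.2) (hΦv : ∀ t, MeasurePreserving (Φ t))
    (hF : Integrable (fun g => trigDensity κ χ ψ N R (randomTrig N g)) (sampleLaw κ))
    (hH : Integrable (fun g => |trigDensity κ χ ψ N R (randomTrig N g)|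
      * ‖Trig.defect ψ N (Trig.proj ψ N (randomTrig N g))‖) (sampleLaw κ))
    {B : Set Sample} (hB : MeasurableSet B) (t : ℝ) :
    |∫ g in B, trigDensity κ χ ψ N R (randomTrig N g) ∂sampleLaw κ
      - ∫ g in sampleFlow Φ (-t) ⁻¹' B, trigDensity κ χ ψ N R (randomTrig N g) ∂sampleLaw κ|
    ≤ |t| * (2 * Real.pi * κ * ∫ g, |trigDensity κ χ ψ N R (randomTrig N g)|
      * ‖Trig.defect ψ N (Trig.proj ψ N (randomTrig N g))‖ ∂sampleLaw κ) := by
  set F : Sample → ℝ := fun g => trigDensity κ χ ψ N R (randomTrig N g) with hFdef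
  set f : Sample → ℝ := fun g => transported κ χ ψ N R (lowPart N g) (Φ t (lowPart N g)) with hf
  have hFm : Measurable F := measurable_trigDensity hχ ψ N (randTrig_randomTrig κ N)
  have hTm := measurable_sampleFlow (hΦv (-t)).measurable
  have hlow : Measurable fun x : Low N => trigDensity κ χ ψ N R (lowTrig x) :=
    measurable_trigDensity hχ ψ N randTrig_lowTrig
  have hfm : Measurable f :=
    (((measurable_lowEnergy.comp measurable_lowPart).sub (measurable_lowEnergy.comp
      ((hΦv t).measurable.comp measurable_lowPart))).exp).mul
      (hlow.comp ((hΦv t).measurable.comp measurable_lowPart))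
  have hprod : ∀ g : Sample, production κ χ ψ N R (lowPart N g) = 2 * Real.pi * κ * (|F g|
      * ‖Trig.defect ψ N (Trig.proj ψ N (randomTrig N g))‖) := fun g => by
    rw [production, lowTrig_lowPart]
  have hle := lintegral_transported_sub_le (R := R) hκ hχ hψ hN hΦ hΦc hΦv t
  simp only [lowTrig_lowPart, hprod] at hle
  rw [← ofReal_integral_eq_lintegral_ofReal (hH.const_mul _) (Filter.Eventually.of_forall
    fun g => by positivity), integral_const_mul, ← ENNReal.ofReal_mul (abs_nonneg t)] at hle
  have hsub : Integrable (fun g => f g - F g) (sampleLaw κ) := by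
    refine ⟨(hfm.sub hFm).aestronglyMeasurable, ?_⟩
    rw [hasFiniteIntegral_iff_norm]
    exact hle.trans_lt ENNReal.ofReal_lt_top
  have hfi : Integrable f (sampleLaw κ) := by
    refine (hsub.add hF).congr (Filter.Eventually.of_forall fun g => ?_)
    simp
  have hchange : ∫ g in sampleFlow Φ (-t) ⁻¹' B, F g ∂sampleLaw κ = ∫ g in B, f g ∂sampleLaw κ := by
    rw [← integral_indicator (hTm hB), ← integral_indicator hB,
      ← integral_comp_sampleFlow hκ (hΦv t) (hFm.indicator (hTm hB))]
    refine integral_congr_ae (Filter.Eventually.of_forall fun g => ?_)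
    dsimp only
    have hmem : sampleFlow Φ t g ∈ sampleFlow Φ (-t) ⁻¹' B ↔ g ∈ B := by
      rw [mem_preimage, sampleFlow_neg hψ hN hΦ]
    by_cases hg : g ∈ B
    · rw [indicator_of_mem (hmem.mpr hg), indicator_of_mem hg, hf, hFdef]
      simp only [sampleFlow, randomTrig_combine, transported]
    · rw [indicator_of_notMem (fun h => hg (hmem.mp h)), indicator_of_notMem hg, mul_zero]
  rw [hchange, abs_sub_comm, ← integral_sub hfi.integrableOn hF.integrableOn, ← Real.norm_eq_abs]
  refine (norm_integral_le_integral_norm _).trans ((setIntegral_le_integral hsub.norm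
    (Filter.Eventually.of_forall fun g => norm_nonneg _)).trans ?_)
  rw [← ENNReal.ofReal_le_ofReal_iff (by positivity), ofReal_integral_eq_lintegral_ofReal hsub.norm
    (Filter.Eventually.of_forall fun g => norm_nonneg _)]
  exact hle

end SampleFlow

end BenjaminOno

namespace BenjaminOno

/-! ### Topology and measurability of the Sobolev spaces -/

section SobolevSpace

variable {s : ℝ}

theorem Sobolev.ext_coeff {u v : Sobolev s} (h : ∀ n, u.coeff n = v.coeff n) : u = v := by
  obtain ⟨c, hc⟩ := u
  obtain ⟨d, hd⟩ := v
  obtain rfl : c = d := funext h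
  rfl

theorem isInducing_toL2 (s : ℝ) : Topology.IsInducing (Sobolev.toL2 (s := s)) := ⟨rfl⟩

theorem toL2_apply (u : Sobolev s) (n : ℤ) :
    u.toL2 n = (((1 + (n : ℝ) ^ 2) ^ (s / 2) : ℝ) : ℂ) * u.coeff n := rfl

theorem continuous_coeff (n : ℤ) : Continuous fun u : Sobolev s => u.coeff n := by
  have h1 : Continuous fun f : lp (fun _ : ℤ => ℂ) 2 => f n :=
    (continuous_apply n).comp lp.uniformContinuous_coe.continuous
  have h2 := (h1.comp (isInducing_toL2 s).continuous).const_mul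
    ((((1 + (n : ℝ) ^ 2) ^ (s / 2) : ℝ) : ℂ)⁻¹)
  refine h2.congr fun u => ?_
  rw [Function.comp_apply, toL2_apply,
    inv_mul_cancel_left₀ (Complex.ofReal_ne_zero.mpr (weight_pos s n).ne')]

theorem measurable_coeff (n : ℤ) : Measurable fun u : Sobolev s => u.coeff n :=
  (continuous_coeff n).measurable

/-- An element of `ℓ²` is the limit of its finite truncations, which are finite sums of measurable
coordinates. -/
theorem measurable_of_coeff {Ω : Type*} [MeasurableSpace Ω] {f : Ω → Sobolev s}
    (hf : ∀ n, Measurable fun w => (f w).coeff n) : Measurable f := by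
  have h1 : StronglyMeasurable fun w => (f w).toL2 := by
    refine stronglyMeasurable_of_tendsto (Filter.atTop : Filter (Finset ℤ))
      (f := fun S w => ∑ n ∈ S, lp.single 2 n ((f w).toL2 n)) (fun S => ?_) ?_
    · refine Finset.stronglyMeasurable_fun_sum S fun n _ => ?_
      have hm : Measurable fun w => (f w).toL2 n := by
        simp only [toL2_apply]
        exact (hf n).const_mul _
      have hc : Continuous fun z : ℂ => (lp.single 2 n z : lp (fun _ : ℤ => ℂ) 2) :=
        (lp.singleContinuousLinearMap ℂ (fun _ : ℤ => ℂ) 2 n).continuous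
      exact hc.comp_stronglyMeasurable hm.stronglyMeasurable
    · rw [tendsto_pi_nhds]
      exact fun w => lp.hasSum_single (by norm_num) (f w).toL2
  refine measurable_of_isOpen fun A hA => ?_
  obtain ⟨V, hV, rfl⟩ := (isInducing_toL2 s).isOpen_iff.mp hA
  borelize ↥(lp (fun _ : ℤ => ℂ) 2)
  exact h1.measurable hV.measurableSet

/-- A curve with continuous coefficients is continuous in `H^s` if the moduli of all but finitely
many coefficients are constant. -/
theorem continuous_of_coeff {u : ℝ → Sobolev s} (hu : ∀ n, Continuous fun t => (u t).coeff n)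
    {S : Finset ℤ} (hS : ∀ n ∉ S, ∀ t t', ‖(u t).coeff n‖ = ‖(u t').coeff n‖) : Continuous u := by
  rw [(isInducing_toL2 s).continuous_iff, continuous_iff_continuousAt]
  intro t
  have hc : ∀ n, Continuous fun τ => (u τ).toL2 n := fun n => by
    simp only [toL2_apply]
    exact (hu n).const_mul _
  have hn : ∀ n ∉ S, ∀ τ, ‖(u τ).toL2 n‖ = ‖(u t).toL2 n‖ := fun n h τ => by
    rw [toL2_apply, toL2_apply, norm_mul, norm_mul, hS n h τ t]
  have hsum : Summable fun n => ‖(u t).toL2 n‖ ^ 2 := by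
    simpa using (lp.memℓp (u t).toL2).summable (by norm_num)
  have hd : ∀ τ, ‖(u τ).toL2 - (u t).toL2‖ ^ 2 = ∑' n, ‖(u τ).toL2 n - (u t).toL2 n‖ ^ 2 := fun τ => by
    have := lp.norm_rpow_eq_tsum (p := 2) (by norm_num) ((u τ).toL2 - (u t).toL2)
    simpa using this
  have hlim : Filter.Tendsto (fun τ => ∑' n, ‖(u τ).toL2 n - (u t).toL2 n‖ ^ 2) (nhds t)
      (nhds (∑' _n : ℤ, (0 : ℝ))) := by
    -- Outside `S` the two terms of the difference have the same modulus, so its square is at most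
    -- four times that of one of them; inside `S` continuity makes each square less than `1` near
    -- `t`.
    refine tendsto_tsum_of_dominated_convergence
      (bound := fun n => 4 * ‖(u t).toL2 n‖ ^ 2 + if n ∈ S then 1 else 0) ?_ (fun n => ?_) ?_
    · exact (hsum.mul_left 4).add (summable_of_ne_finset_zero (s := S) fun n hn => if_neg hn)
    · have := (((hc n).sub (continuous_const (y := (u t).toL2 n))).norm.pow 2).tendsto t
      simpa [Pi.pow_def] using this
    · have hev : ∀ᶠ τ in nhds t, ∀ n ∈ S, ‖(u τ).toL2 n - (u t).toL2 n‖ ^ 2 < 1 := by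
        rw [Filter.eventually_all_finset]
        intro n _
        have := (((hc n).sub (continuous_const (y := (u t).toL2 n))).norm.pow 2).tendsto t
        exact this.eventually_lt_const (by simp)
      filter_upwards [hev] with τ hτ n
      rw [Real.norm_of_nonneg (by positivity)]
      split_ifs with h
      · have := hτ n h
        have : 0 ≤ 4 * ‖(u t).toL2 n‖ ^ 2 := by positivity
        linarith
      · have h1 := norm_sub_le ((u τ).toL2 n) ((u t).toL2 n)
        rw [hn n h τ] at h1
        have h2 := pow_le_pow_left₀ (norm_nonneg _) h1 2
        linarith
  rw [tsum_zero] at hlim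
  rw [ContinuousAt, Function.comp_apply, tendsto_iff_norm_sub_tendsto_zero]
  have := (Real.continuous_sqrt.tendsto 0).comp hlim
  rw [Real.sqrt_zero] at this
  refine this.congr fun τ => ?_
  rw [Function.comp_apply, ← hd, Real.sqrt_sq (norm_nonneg _)]
  rfl

end SobolevSpace

/-! ### The random series in the Sobolev spaces -/

section RandomSeries

variable {s : ℝ}

theorem measurable_seriesCoeff (n : ℤ) : Measurable fun g => seriesCoeff g n := by
  simp only [seriesCoeff_eq]
  exact (measurable_gauss n).div_const _

/-- As finiteness of a sum of nonnegative extended reals, membership in `H^s` is a measurable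
condition, and Tonelli can be applied to it. -/
theorem isSobolev_seriesCoeff_iff (g : Sample) : IsSobolev s (seriesCoeff g)
    ↔ ∑' n : ℤ, ENNReal.ofReal ((1 + (n : ℝ) ^ 2) ^ s * ‖seriesCoeff g n‖ ^ 2) ≠ ⊤ := by
  have h0 : ∀ n : ℤ, 0 ≤ (1 + (n : ℝ) ^ 2) ^ s * ‖seriesCoeff g n‖ ^ 2 := fun n => by positivity
  constructor
  · intro h
    exact h.summable.tsum_ofReal_ne_top
  · intro h
    refine ⟨seriesCoeff_zero g, seriesCoeff_neg g, ?_⟩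
    have := ENNReal.summable_toReal h
    simpa only [ENNReal.toReal_ofReal (h0 _)] using this

theorem measurable_randomSeries (s : ℝ) : Measurable (randomSeries s) := by
  have hset : MeasurableSet {g : Sample | IsSobolev s (seriesCoeff g)} := by
    simp only [isSobolev_seriesCoeff_iff]
    refine (measurableSet_eq_fun (f := fun g : Sample => ∑' n : ℤ, ENNReal.ofReal
      ((1 + (n : ℝ) ^ 2) ^ s * ‖seriesCoeff g n‖ ^ 2)) (g := fun _ => ⊤)
      (Measurable.tsum fun n => ?_) measurable_const).compl
    exact (((measurable_seriesCoeff n).norm.pow_const 2).const_mul _).ennreal_ofReal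
  refine measurable_of_coeff fun n => ?_
  have : (fun g => (randomSeries s g).coeff n)
      = {g : Sample | IsSobolev s (seriesCoeff g)}.indicator fun g => seriesCoeff g n := by
    funext g
    by_cases h : IsSobolev s (seriesCoeff g)
    · rw [indicator_of_mem (show g ∈ {g : Sample | IsSobolev s (seriesCoeff g)} from h),
        randomSeries, dif_pos h]
    · rw [indicator_of_notMem (show g ∉ {g : Sample | IsSobolev s (seriesCoeff g)} from h),
        randomSeries, dif_neg h]
      rfl
  rw [this]
  exact (measurable_seriesCoeff n).indicator hset

theorem summable_weight_div_sq (hs : s < 1 / 2) :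
    Summable fun n : ℤ => (1 + (n : ℝ) ^ 2) ^ s / (n : ℝ) ^ 2 := by
  -- Monotonicity in the exponent reduces negative `s` to `s = 0`, so that `1 + n²` can be bounded
  -- by `2n²` under a nonnegative power.
  set r := max s 0 with hr
  have hr0 : 0 ≤ r := le_max_right _ _
  have hr1 : r < 1 / 2 := max_lt hs (by norm_num)
  have h := (Real.summable_abs_int_rpow (b := 2 - 2 * r) (by linarith)).mul_left (2 ^ r)
  refine Summable.of_nonneg_of_le (fun n => by positivity) (fun n => ?_) h
  rcases eq_or_ne n 0 with rfl | hn
  · simp only [Int.cast_zero, ne_eq, OfNat.ofNat_ne_zero, not_false_eq_true, zero_pow, div_zero]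
    positivity
  have hn1 : (1 : ℝ) ≤ |(n : ℝ)| := by exact_mod_cast Int.one_le_abs hn
  have hn2 : (1 : ℝ) ≤ (n : ℝ) ^ 2 := by rw [← sq_abs]; exact one_le_pow₀ hn1
  have hpos : 0 < |(n : ℝ)| := by linarith
  have h1 : (1 + (n : ℝ) ^ 2) ^ s ≤ 2 ^ r * (|(n : ℝ)| ^ (2 * r)) := by
    calc (1 + (n : ℝ) ^ 2) ^ s ≤ (1 + (n : ℝ) ^ 2) ^ r :=
          Real.rpow_le_rpow_of_exponent_le (by linarith) (le_max_left _ _)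
      _ ≤ (2 * |(n : ℝ)| ^ 2) ^ r :=
          Real.rpow_le_rpow (by positivity) (by rw [sq_abs]; linarith) hr0
      _ = 2 ^ r * (|(n : ℝ)| ^ (2 * r)) := by
          rw [Real.mul_rpow (by norm_num) (by positivity), Real.rpow_mul hpos.le, Real.rpow_two]
  rw [div_le_iff₀ (by positivity), mul_assoc]
  refine h1.trans (le_of_eq ?_)
  congr 1
  rw [← sq_abs, ← Real.rpow_two, ← Real.rpow_add hpos]
  congr 1
  ring

/-- The expected squared `H^s` norm is bounded by a multiple of the sum of `(1 + n²)^s / n²`, which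
converges for `s < 1/2`. -/
theorem ae_isSobolev (κ : ℝ) (hs : s < 1 / 2) : ∀ᵐ g ∂sampleLaw κ, IsSobolev s (seriesCoeff g) := by
  simp only [isSobolev_seriesCoeff_iff]
  obtain ⟨C, hC, h⟩ := integral_norm_gauss_pow_le κ 2
  have hm : ∀ n : ℤ, Measurable fun g => ENNReal.ofReal
      ((1 + (n : ℝ) ^ 2) ^ s * ‖seriesCoeff g n‖ ^ 2) := fun n =>
    (((measurable_seriesCoeff n).norm.pow_const 2).const_mul _).ennreal_ofReal
  have hfin : ∫⁻ g, ∑' n : ℤ, ENNReal.ofReal ((1 + (n : ℝ) ^ 2) ^ s * ‖seriesCoeff g n‖ ^ 2)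
      ∂sampleLaw κ ≠ ⊤ := by
    rw [lintegral_tsum fun n => (hm n).aemeasurable]
    refine ne_top_of_le_ne_top ((summable_weight_div_sq hs).mul_left C).tsum_ofReal_ne_top
      (ENNReal.tsum_le_tsum fun n => ?_)
    have hi : Integrable (fun g => (1 + (n : ℝ) ^ 2) ^ s * ‖seriesCoeff g n‖ ^ 2) (sampleLaw κ) := by
      simp only [seriesCoeff_eq, div_eq_mul_inv]
      exact ((((allLp_gauss κ n).mul (AllLp.const _)).norm.pow 2).integrable).const_mul _
    rw [← ofReal_integral_eq_lintegral_ofReal hi (Filter.Eventually.of_forall fun g => by positivity)]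
    refine ENNReal.ofReal_le_ofReal ?_
    have e : ∀ g, (1 + (n : ℝ) ^ 2) ^ s * ‖seriesCoeff g n‖ ^ 2
        = (1 + (n : ℝ) ^ 2) ^ s / (n : ℝ) ^ 2 * ‖gauss n g‖ ^ 2 := fun g => by
      rw [seriesCoeff_eq, norm_div, div_pow, Complex.norm_natCast, Nat.cast_natAbs, Int.cast_abs,
        sq_abs]
      ring
    simp only [e]
    rw [integral_const_mul, mul_comm C]
    exact mul_le_mul_of_nonneg_left (h n) (by positivity)
  filter_upwards [ae_lt_top (Measurable.tsum hm) hfin] with g hg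
  exact hg.ne

end RandomSeries

end BenjaminOno

namespace BenjaminOno

/-! ### The flow on the Sobolev spaces -/

/-- The low modes of a sequence of Fourier coefficients. -/
def lowOf (N : ℕ) (c : ℤ → ℂ) : Low N := fun k =>
  (k.1 : ℕ) * (if k.2 then (c (k.1 : ℕ)).im else (c (k.1 : ℕ)).re)

/-- The coefficients at time `t` of the solution with initial coefficients `c`, where `Φ` is the
flow of the low modes. -/
def flowCoeff {N : ℕ} (Φ : ℝ → Low N → Low N) (t : ℝ) (c : ℤ → ℂ) (n : ℤ) : ℂ :=
  if |n| ≤ (N : ℤ) then (lowTrig (Φ t (lowOf N c))).coeff n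
  else Complex.exp (-(Complex.I * n * ((|n| : ℤ) : ℂ) * t)) * c n

section Flow

variable {N : ℕ} {ε s : ℝ} {ψ : ℝ → ℝ} {c : ℤ → ℂ} {Φ : ℝ → Low N → Low N}

theorem lowOf_congr {d : ℤ → ℂ} (h : ∀ n : ℤ, |n| ≤ (N : ℤ) → c n = d n) : lowOf N c = lowOf N d := by
  funext k
  have hk := Finset.mem_Icc.mp k.1.2
  rw [lowOf, lowOf, h _ (by rw [abs_of_nonneg] <;> omega)]

theorem lowOf_lowTrig (x : Low N) : lowOf N (lowTrig x).coeff = x := by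
  funext ⟨n, b⟩
  have hn : ((n : ℕ) : ℝ) ≠ 0 := by
    have := (Finset.mem_Icc.mp n.2).1
    exact_mod_cast (show (n : ℕ) ≠ 0 by omega)
  cases b <;> simp [lowOf, coeff_lowTrig, lowGauss, mul_div_cancel₀ _ hn]

theorem lowTrig_lowOf (h0 : c 0 = 0) (hc : ∀ n, c (-n) = conj (c n)) :
    lowTrig (lowOf N c) = Trig.ofSeq N c := by
  ext k
  revert k
  refine mode_cases (N := N) ?_ (fun k hk => ?_) (fun k hk => ?_) fun n => ?_
  · rw [coeff_lowTrig_zero, Trig.coeff_ofSeq, h0, ite_self]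
  · rw [coeff_lowTrig_of_notMem _ hk, coeff_ofSeq_eq_zero hk]
  · rw [isReal_lowTrig, Trig.isReal_ofSeq hc, hk]
  · have h := Finset.mem_Icc.mp n.2
    have hn : ((n : ℕ) : ℂ) ≠ 0 := by exact_mod_cast (show (n : ℕ) ≠ 0 by omega)
    rw [coeff_lowTrig, Trig.coeff_ofSeq, if_pos (by rw [abs_of_nonneg] <;> omega), div_eq_iff hn]
    apply Complex.ext <;> simp [lowGauss, lowOf, mul_comm]

theorem ofSeq_flowCoeff (t : ℝ) (c : ℤ → ℂ) :
    Trig.ofSeq N (flowCoeff Φ t c) = lowTrig (Φ t (lowOf N c)) := by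
  ext n
  rw [Trig.coeff_ofSeq, flowCoeff]
  split_ifs with h
  · rfl
  · rw [coeff_lowTrig_of_notMem]
    rwa [Finset.mem_Icc, ← abs_le]

theorem lowOf_flowCoeff (t : ℝ) (c : ℤ → ℂ) : lowOf N (flowCoeff Φ t c) = Φ t (lowOf N c) := by
  rw [← lowOf_lowTrig (Φ t (lowOf N c))]
  exact lowOf_congr fun n hn => if_pos hn

theorem norm_flowCoeff {n : ℤ} (hn : ¬|n| ≤ (N : ℤ)) (t : ℝ) (c : ℤ → ℂ) :
    ‖flowCoeff Φ t c n‖ = ‖c n‖ := by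
  rw [flowCoeff, if_neg hn, norm_mul, Complex.norm_exp]
  simp

theorem IsSobolev.flowCoeff (hc : IsSobolev s c) (t : ℝ) : IsSobolev s (flowCoeff Φ t c) := by
  refine ⟨?_, fun n => ?_, ?_⟩
  · rw [BenjaminOno.flowCoeff, coeff_lowTrig_zero, hc.mean_zero, mul_zero, ite_self]
  · rw [BenjaminOno.flowCoeff, BenjaminOno.flowCoeff, abs_neg]
    split_ifs
    · exact isReal_lowTrig _ n
    · rw [map_mul, hc.real, ← Complex.exp_conj]
      simp
  · refine (summable_congr_cofinite ?_).mpr hc.summable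
    filter_upwards [(Finset.Icc (-(N : ℤ)) N).finite_toSet.compl_mem_cofinite] with n hn
    rw [norm_flowCoeff]
    rwa [mem_compl_iff, Finset.mem_coe, Finset.mem_Icc, ← abs_le] at hn

/-- The flow on `H^s`. -/
def sobolevFlow (Φ : ℝ → Low N → Low N) (t : ℝ) (u : Sobolev s) : Sobolev s :=
  ⟨flowCoeff Φ t u.coeff, u.isSobolev.flowCoeff t⟩

theorem coeff_sobolevFlow (t : ℝ) (u : Sobolev s) :
    (sobolevFlow Φ t u).coeff = flowCoeff Φ t u.coeff := rfl

theorem measurable_sobolevFlow {t : ℝ} (hΦ : Measurable (Φ t)) :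
    Measurable (sobolevFlow Φ t : Sobolev s → Sobolev s) := by
  have hlow : Measurable fun u : Sobolev s => lowOf N u.coeff := by
    refine measurable_pi_lambda _ fun k => Measurable.const_mul ?_ _
    split_ifs
    · exact Complex.measurable_im.comp (measurable_coeff _)
    · exact Complex.measurable_re.comp (measurable_coeff _)
  refine measurable_of_coeff fun n => ?_
  simp only [coeff_sobolevFlow, flowCoeff]
  split_ifs
  · exact (contDiff_coeff_lowTrig n).continuous.measurable.comp (hΦ.comp hlow)
  · exact (measurable_coeff n).const_mul _

theorem sobolevFlow_zero (hΦ : IsFlow (lowField ψ) Φ) (u : Sobolev s) : sobolevFlow Φ 0 u = u := by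
  refine Sobolev.ext_coeff fun n => ?_
  rw [coeff_sobolevFlow, flowCoeff, hΦ.zero, lowTrig_lowOf u.isSobolev.mean_zero u.isSobolev.real,
    Trig.coeff_ofSeq]
  split_ifs
  · rfl
  · simp

theorem sobolevFlow_neg (hψ : IsProfile ε ψ) (hN : 0 < N) (hΦ : IsFlow (lowField ψ) Φ) (t : ℝ)
    (u : Sobolev s) : sobolevFlow Φ (-t) (sobolevFlow Φ t u) = u := by
  refine Sobolev.ext_coeff fun n => ?_
  have h0 := congrArg (fun v : Sobolev s => v.coeff n) (sobolevFlow_zero hΦ u)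
  simp only [coeff_sobolevFlow] at h0 ⊢
  rw [← h0, flowCoeff, lowOf_flowCoeff, ← lowFlow_add hψ hN hΦ, neg_add_cancel, flowCoeff, flowCoeff]
  split_ifs with h
  · rfl
  · rw [← mul_assoc, ← Complex.exp_add]
    congr 2
    push_cast
    ring

theorem fourierCoef_evalAt {p : Trig} (hp : p.IsReal) (n : ℤ) :
    fourierCoef (fun x => (Trig.evalAt x p).re) n = p.coeff n := by
  have h : ∀ x : ℝ, (((Trig.evalAt x p).re : ℝ) : ℂ) * Complex.exp (-(Complex.I * n * x))
      = Trig.evalAt x (AddMonoidAlgebra.single (-n) 1 * p) := fun x => by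
    rw [map_mul, Trig.evalAt_single, Trig.ofReal_re_evalAt hp, one_mul, mul_comm]
    push_cast
    ring_nf
  have hπ : (2 * Real.pi : ℂ) ≠ 0 := by
    exact_mod_cast (mul_pos two_pos Real.pi_pos).ne'
  simp only [fourierCoef, h]
  rw [Trig.integral_evalAt, inv_mul_cancel_left₀ hπ, Trig.mean_apply,
    Trig.coeff_mul_eq_sum _ _ {-n} (fun k hk => ?_)]
  · rw [Finset.sum_singleton, Trig.coeff_single, if_pos rfl, one_mul, zero_sub, neg_neg]
  · rw [Trig.coeff_single, if_neg fun h => hk (by simp [h])]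

/-- The right-hand side of the equation: the field of the low modes, and the linear evolution of
the high modes. -/
theorem equation_eq (hψ : IsProfile ε ψ) (hN : 0 < N) (hc : ∀ n, c (-n) = conj (c n)) (n : ℤ) :
    -(hilbert (dx (dx c)) n) - smoothProj ψ N (fourierCoef fun x =>
        toFun (smoothProj ψ N c) x * toFun (dx (smoothProj ψ N c)) x) n
      = if |n| ≤ (N : ℤ) then (Trig.field ψ N (Trig.ofSeq N c)).coeff n
        else -(Complex.I * n * ((|n| : ℤ) : ℂ) * c n) := by
  have hp : (Trig.ofSeq N c).IsReal := Trig.isReal_ofSeq hc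
  have hv := isReal_proj (N := N) hψ.even hp
  have hz : ∀ n : ℤ, (N : ℤ) < |n| → smoothProj ψ N c n = 0 := fun n hn => by
    rw [smoothProj, hψ.symbol_eq_zero hN hn, Complex.ofReal_zero, zero_mul]
  have hd : Trig.ofSeq N (dx (smoothProj ψ N c)) = Trig.D (Trig.proj ψ N (Trig.ofSeq N c)) := by
    ext n
    rw [Trig.D, Trig.coeff_mult, proj_ofSeq, Trig.coeff_ofSeq, Trig.coeff_ofSeq, dx]
    split_ifs <;> simp
  have hprod : (fun x => toFun (smoothProj ψ N c) x * toFun (dx (smoothProj ψ N c)) x)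
      = fun x => (Trig.evalAt x (Trig.proj ψ N (Trig.ofSeq N c)
        * Trig.D (Trig.proj ψ N (Trig.ofSeq N c)))).re := by
    funext x
    rw [Trig.toFun_eq hz, Trig.toFun_eq (N := N) (fun n hn => by rw [dx, hz n hn, mul_zero]), hd,
      ← proj_ofSeq, Trig.evalAt_re_mul hv]
  have hl : hilbert (dx (dx c)) n = Complex.I * n * ((|n| : ℤ) : ℂ) * c n := by
    rw [hilbert, dx, dx, ← Int.sign_mul_self_eq_abs]
    push_cast
    linear_combination (-Complex.I * n.sign * n * n * c n) * Complex.I_sq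
  rw [hprod, smoothProj, fourierCoef_evalAt (hv.mul (isReal_D hv)), hl]
  split_ifs with h
  · rw [coeff_field, Trig.coeff_ofSeq, if_pos h]
  · rw [hψ.symbol_eq_zero hN (not_le.mp h)]
    simp

theorem isSolution_sobolevFlow (hψ : IsProfile ε ψ) (hN : 0 < N) (hΦ : IsFlow (lowField ψ) Φ)
    (u : Sobolev s) : IsSolution ψ N fun t => sobolevFlow Φ t u := by
  have heq : ∀ (n : ℤ) (t : ℝ), HasDerivAt (fun τ => (sobolevFlow Φ τ u).coeff n)
      (if |n| ≤ (N : ℤ) then (Trig.field ψ N (Trig.ofSeq N (sobolevFlow Φ t u).coeff)).coeff n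
        else -(Complex.I * n * ((|n| : ℤ) : ℂ) * (sobolevFlow Φ t u).coeff n)) t := by
    intro n t
    simp only [coeff_sobolevFlow, ofSeq_flowCoeff]
    by_cases h : |n| ≤ (N : ℤ)
    · simp only [flowCoeff, if_pos h]
      rw [← lowTrig_lowField hψ hN]
      exact (hasCoeffDeriv_lowTrig (hΦ.deriv _ t)).deriv n
    · simp only [flowCoeff, if_neg h]
      have h1 := (((Complex.ofRealCLM.hasDerivAt (x := t)).const_mul
        (Complex.I * n * ((|n| : ℤ) : ℂ))).neg.cexp).mul_const (u.coeff n)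
      refine h1.congr_deriv ?_
      simp only [Pi.neg_apply, Complex.ofRealCLM_apply, Complex.ofReal_one]
      ring
  refine ⟨continuous_of_coeff (S := Finset.Icc (-(N : ℤ)) N)
    (fun n => continuous_iff_continuousAt.mpr fun t => (heq n t).continuousAt)
    fun n hn t t' => ?_, fun n t => ?_⟩
  · rw [Finset.mem_Icc, ← abs_le] at hn
    rw [coeff_sobolevFlow, coeff_sobolevFlow, norm_flowCoeff hn, norm_flowCoeff hn]
  · rw [equation_eq hψ hN (sobolevFlow Φ t u).isSobolev.real]
    exact heq n t

/-- The system decouples: the low modes solve the finite-dimensional equation, whose integral curves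
are unique, and each high mode solves a scalar linear equation. -/
theorem IsSolution.eq_sobolevFlow (hψ : IsProfile ε ψ) (hN : 0 < N) (hΦ : IsFlow (lowField ψ) Φ)
    {u : ℝ → Sobolev s} (hu : IsSolution ψ N u) (t : ℝ) : u t = sobolevFlow Φ t (u 0) := by
  have heq := fun n t => (hu.equation n t).congr_deriv
    (equation_eq hψ hN (u t).isSobolev.real n)
  have hlow : ∀ t, lowTrig (lowOf N (u t).coeff) = Trig.ofSeq N (u t).coeff := fun t =>
    lowTrig_lowOf (u t).isSobolev.mean_zero (u t).isSobolev.real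
  have hd : ∀ t, HasDerivAt (fun τ => lowOf N (u τ).coeff) (lowField ψ (lowOf N (u t).coeff)) t := by
    intro t
    rw [hasDerivAt_pi]
    intro k
    have hk := Finset.mem_Icc.mp k.1.2
    have h := heq (k.1 : ℕ) t
    rw [if_pos (by rw [abs_of_nonneg] <;> omega), ← hlow] at h
    simp only [lowOf, lowField]
    refine HasDerivAt.const_mul _ ?_
    split_ifs
    · exact Complex.imCLM.hasFDerivAt.comp_hasDerivAt t h
    · exact Complex.reCLM.hasFDerivAt.comp_hasDerivAt t h
  have hflow := congrFun (lowCurve_unique hψ hN hd (hΦ.deriv (lowOf N (u 0).coeff)) (t₀ := 0)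
    (hΦ.zero _).symm) t
  refine Sobolev.ext_coeff fun n => ?_
  rw [coeff_sobolevFlow, flowCoeff]
  split_ifs with h
  · rw [← hflow, hlow, Trig.coeff_ofSeq, if_pos h]
  · set a : ℂ := Complex.I * n * ((|n| : ℤ) : ℂ) with ha
    -- The integrating factor removes the linear rotation of a high mode.
    have h1 : ∀ τ : ℝ, HasDerivAt (fun τ : ℝ => Complex.exp (a * τ) * (u τ).coeff n) 0 τ := by
      intro τ
      have h2 := heq n τ
      rw [if_neg h] at h2
      have h3 := ((Complex.ofRealCLM.hasDerivAt (x := τ)).const_mul a).cexp.mul h2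
      refine h3.congr_deriv ?_
      simp only [Complex.ofRealCLM_apply, Complex.ofReal_one]
      ring
    have h2 := is_const_of_deriv_eq_zero (fun τ => (h1 τ).differentiableAt)
      (fun τ => (h1 τ).deriv) t 0
    simp only [Complex.ofReal_zero, mul_zero, Complex.exp_zero, one_mul] at h2
    rw [← h2, ← mul_assoc, ← Complex.exp_add, neg_add_cancel, Complex.exp_zero, one_mul]

/-- As a preimage under the backward flow the image of a Borel set is measurable, and it can be
pulled back to the sample space. -/
theorem flowImage_eq (hψ : IsProfile ε ψ) (hN : 0 < N) (hΦ : IsFlow (lowField ψ) Φ) (t : ℝ)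
    (A : Set (Sobolev s)) : flowImage ψ N t A = sobolevFlow Φ (-t) ⁻¹' A := by
  ext v
  constructor
  · rintro ⟨u, hu, h0, rfl⟩
    rw [mem_preimage, hu.eq_sobolevFlow hψ hN hΦ t, sobolevFlow_neg hψ hN hΦ]
    exact h0
  · intro hv
    refine ⟨_, isSolution_sobolevFlow hψ hN hΦ (sobolevFlow Φ (-t) v), ?_, ?_⟩
    · rwa [sobolevFlow_zero hΦ]
    · simpa using sobolevFlow_neg hψ hN hΦ (-t) v

/-- Rotating `g_n` by the angle `-n² t` for `n > 0`, and its conjugate accordingly, reproduces the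
factor `exp(-i n |n| t)` of the linear evolution. The random series thus intertwines the flow on
samples with the flow on `H^s`. -/
theorem seriesCoeff_sampleFlow (t : ℝ) (g : Sample) :
    seriesCoeff (sampleFlow Φ t g) = flowCoeff Φ t (seriesCoeff g) := by
  funext n
  have hl : lowOf N (seriesCoeff g) = lowPart N g := by
    rw [← lowOf_lowTrig (lowPart N g), lowTrig_lowPart]
    exact lowOf_congr fun n hn => by rw [randomTrig, Trig.coeff_ofSeq, if_pos hn]
  rw [flowCoeff]
  split_ifs with h
  · rw [hl, ← randomTrig_combine _ (sampleRot (fun n => -(n ^ 2 * t)) g), randomTrig,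
      Trig.coeff_ofSeq, if_pos h, sampleFlow]
  · have hn : n.natAbs ∉ Finset.Icc 1 N := by rw [Finset.mem_Icc]; rw [Int.abs_eq_natAbs] at h; omega
    have hg : gauss n (sampleFlow Φ t g) = gauss n (sampleRot (fun n => -(n ^ 2 * t)) g) := by
      rw [gauss, gauss, sampleFlow, combine_apply_of_notMem _ _ hn]
    rw [seriesCoeff_eq, seriesCoeff_eq, hg, gauss_sampleRot, ← mul_div_assoc]
    congr 3
    have h1 : ((n.natAbs : ℝ) : ℂ) ^ 2 = ((n : ℤ) : ℂ) ^ 2 := by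
      rw [Complex.ofReal_natCast, ← Int.cast_natCast, ← Int.cast_pow, ← Int.cast_pow, Int.natAbs_sq]
    rw [← Int.sign_mul_self_eq_abs]
    push_cast at h1 ⊢
    rw [h1]
    ring

theorem randomSeries_sampleFlow {g : Sample} (hg : IsSobolev s (seriesCoeff g)) (t : ℝ) :
    randomSeries s (sampleFlow Φ t g) = sobolevFlow Φ t (randomSeries s g) := by
  have h : IsSobolev s (seriesCoeff (sampleFlow Φ t g)) := by
    rw [seriesCoeff_sampleFlow]
    exact hg.flowCoeff t
  refine Sobolev.ext_coeff fun n => ?_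
  rw [coeff_sobolevFlow, randomSeries, randomSeries, dif_pos h, dif_pos hg]
  exact congrFun (seriesCoeff_sampleFlow t g) n

/-! ### Almost invariance -/

variable {κ R : ℝ} {χ : ℝ → ℝ}

theorem measurable_density (hχ : Continuous χ) (hψ : IsProfile ε ψ) (hN : 0 < N) :
    Measurable fun u : Sobolev s => density κ χ ψ N R u.coeff := by
  have h : RandTrig (0 : Measure (Sobolev s)) fun u : Sobolev s => Trig.ofSeq N u.coeff := by
    refine ⟨⟨_, fun u _ hk => coeff_ofSeq_eq_zero hk⟩, fun n => ?_, fun n p => by simp⟩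
    simp only [Trig.coeff_ofSeq]
    split_ifs
    · exact measurable_coeff n
    · exact measurable_const
  have h2 := measurable_trigDensity (κ := κ) (R := R) hχ ψ N h
  simpa only [density_eq hψ hN (Sobolev.isSobolev _).real] using h2

theorem setIntegral_density (hs : s < 1 / 2) (hχ : Continuous χ) (hψ : IsProfile ε ψ) (hN : 0 < N)
    {A : Set (Sobolev s)} (hA : MeasurableSet A) :
    ∫ u in A, density κ χ ψ N R u.coeff ∂gaussianMeasure κ s
      = ∫ g in randomSeries s ⁻¹' A, trigDensity κ χ ψ N R (randomTrig N g) ∂sampleLaw κ := by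
  rw [gaussianMeasure, setIntegral_map hA (measurable_density hχ hψ hN).aestronglyMeasurable
    (measurable_randomSeries s).aemeasurable]
  refine setIntegral_congr_ae (measurable_randomSeries s hA) ?_
  filter_upwards [ae_isSobolev κ hs] with g hg _
  rw [randomSeries, dif_pos hg, density_eq hψ hN hg.real, randomTrig]

theorem integrable_of_pow_four {Ω : Type*} [MeasurableSpace Ω] {μ : Measure Ω} [IsFiniteMeasure μ]
    {f : Ω → ℝ} (hf : AEStronglyMeasurable f μ) (h : Integrable (fun w => f w ^ 4) μ) :
    Integrable f μ := by
  refine ((integrable_const (1 : ℝ)).add h).mono' hf (Filter.Eventually.of_forall fun w => ?_)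
  rw [Real.norm_eq_abs, Pi.add_apply, ← (show Even 4 by decide).pow_abs]
  nlinarith [sq_nonneg (|f w| ^ 2 - 1 / 2), sq_nonneg (|f w| - 1 / 2)]

end Flow

end BenjaminOno

end

/-! ### Proof of the almost invariance -/

open BenjaminOno in
theorem proposition6p1
    (κ : ℝ) (hκ : 0 < κ)
    (χ : ℝ → ℝ) (hχ : ContDiff ℝ ∞ χ) (hχ_supp : HasCompactSupport χ)
    (hχ_one : ∀ x : ℝ, |x| < 1 → χ x = 1)
    (ψ : ℝ → ℝ → ℝ) (hψ : ∀ ε ∈ Set.Ioo (0 : ℝ) 1, BenjaminOno.IsProfile ε (ψ ε))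
    (σ R : ℝ) (hσ : 0 < σ) (hR : 0 < R) (δ : ℝ) (hδ : 0 < δ) :
    ∃ ε ∈ Set.Ioo (0 : ℝ) 1, ∃ N₀ : ℕ, ∀ N : ℕ, N₀ < N →
      ∀ A : Set (BenjaminOno.Sobolev (1 / 2 - σ)), MeasurableSet A → ∀ t : ℝ,
        |(∫ u in A, BenjaminOno.density κ χ (ψ ε) N R u.coeff
              ∂(BenjaminOno.gaussianMeasure κ (1 / 2 - σ)))
          - ∫ u in BenjaminOno.flowImage (ψ ε) N t A,
              BenjaminOno.density κ χ (ψ ε) N R u.coeff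
              ∂(BenjaminOno.gaussianMeasure κ (1 / 2 - σ))| ≤ δ * |t| := by
  obtain ⟨C, hC, hmain⟩ := exists_integral_density_mul_defect_le hκ hχ.continuous hχ_supp hR
  obtain ⟨C', -, hmoment⟩ := exists_trigDensity_moment_le hκ hχ.continuous hχ_supp hR
  have hK : 0 ≤ 2 * Real.pi * κ * C := by positivity
  obtain ⟨ε, hε0, hε2, hεδ⟩ : ∃ ε : ℝ, 0 < ε ∧ ε ≤ 1 / 2 ∧ 2 * Real.pi * κ * C * √ε ≤ δ := by
    -- The square compensates the rate `√ε`; adding `1` to the denominator covers the case where the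
    -- constant vanishes.
    refine ⟨min (1 / 2) ((δ / (2 * Real.pi * κ * C + 1)) ^ 2), by positivity, min_le_left _ _, ?_⟩
    have h1 : √(min (1 / 2) ((δ / (2 * Real.pi * κ * C + 1)) ^ 2))
        ≤ δ / (2 * Real.pi * κ * C + 1) :=
      (Real.sqrt_le_sqrt (min_le_right _ _)).trans_eq (Real.sqrt_sq (by positivity))
    refine (mul_le_mul_of_nonneg_left h1 hK).trans ?_
    rw [← mul_div_assoc, div_le_iff₀ (by positivity)]
    nlinarith
  obtain ⟨N₀, hN₀⟩ := Filter.eventually_atTop.mp (eventually_renorm_le hε0)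
  have hε : ε ∈ Set.Ioo (0 : ℝ) 1 := ⟨hε0, by linarith⟩
  have hp := hψ ε hε
  refine ⟨ε, hε, N₀, fun N hNN A hA t => ?_⟩
  have hN : 0 < N := by omega
  obtain ⟨Φ, hΦ, hΦc, hΦv⟩ := exists_lowFlow hp hN
  obtain ⟨hH, hle⟩ := hmain ε (ψ ε) hε0 hε2 hp N hN (hN₀ N hNN.le)
  have hF : Integrable (fun g => trigDensity κ χ (ψ ε) N R (randomTrig N g)) (sampleLaw κ) :=
    integrable_of_pow_four
      (measurable_trigDensity hχ.continuous (ψ ε) N (randTrig_randomTrig κ N)).aestronglyMeasurable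
      (hmoment ε (ψ ε) hp N hN).1
  have hs : 1 / 2 - σ < 1 / 2 := by linarith
  -- The two preimages agree only almost everywhere, since off the event that the series converges
  -- in `H^s` the random element is set to zero.
  have hset : randomSeries (1 / 2 - σ) ⁻¹' (sobolevFlow Φ (-t) ⁻¹' A)
      =ᵐ[sampleLaw κ] sampleFlow Φ (-t) ⁻¹' (randomSeries (1 / 2 - σ) ⁻¹' A) := by
    rw [Filter.eventuallyEq_set]
    filter_upwards [ae_isSobolev κ hs] with g hg
    rw [mem_preimage, mem_preimage, mem_preimage, mem_preimage, randomSeries_sampleFlow hg]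
  rw [flowImage_eq hp hN hΦ, setIntegral_density hs hχ.continuous hp hN hA,
    setIntegral_density hs hχ.continuous hp hN
      (measurable_sobolevFlow (hΦv (-t)).measurable hA), setIntegral_congr_set hset]
  refine (abs_setIntegral_sub_le hκ hχ.continuous hp hN hΦ hΦc hΦv hF hH
    (measurable_randomSeries _ hA) t).trans ?_
  rw [mul_comm δ]
  refine mul_le_mul_of_nonneg_left (le_trans ?_ hεδ) (abs_nonneg t)
  rw [mul_assoc (2 * Real.pi * κ)]
  exact mul_le_mul_of_nonneg_left hle (by positivity)
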